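/- **Setting.** Let $(M,g)$ be an oriented Lorentzian manifold (smooth, Hausdorff, second countable) of dimension $d\ge 2$ with Hodge operator $\ast$, and let $\mathfrak g$ be a real Lie algebra with an invariant nondegenerate symmetric bilinear form $\mathrm{Tr}$. Let $\mathfrak k$ be a Lie algebra of Killing vector fields of $g$, acting on $\mathfrak g$-valued forms by the Lie derivative, and let $\mathcal F\in(U\mathfrak k\otimes U\mathfrak k)[[\hbar]]$ (complex coefficients) be a Drinfel'd twist: $\mathcal F$ is invertible, $\mathcal F=1\otimes1+O(\hbar)$ and $\mathcal F_{12}(\Delta\otimes\mathrm{id})\mathcal F=\mathcal F_{23}(\mathrm{id}\otimes\Delta)\mathcal F$. Let $\mathcal R=\mathcal F_{21}\mathcal F^{-1}=\mathsf R^k\otimes\mathsf R_k$ be its $\mathcal R$-matrix (summation over $k$ understood). For a $\mathfrak k$-equivariant bilinear operation $b$ put $b_\star=b\circ\mathcal F^{-1}$, extended to formal power series; this defines $[-,-]^\star$ and $\mathrm{Tr}(-\wedge_\star-)$ on $\Omega^\bullet(M,\mathfrak g)[[\hbar]]$. The classical brackets are $$\ell_1(A)=\mathrm d\ast\mathrm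 dA,\qquad \ell_2(A_1,A_2)=-\mathrm d\ast[A_1,A_2]-[A_1,\ast\mathrm dA_2]+(-1)^d[\ast\mathrm dA_1,A_2],$$ $$\ell_3(A_1,A_2,A_3)=-[A_1,\ast[A_2,A_3]]-[A_2,\ast[A_1,A_3]]+(-1)^d[\ast[A_1,A_2],A_3]$$ on $1$-forms; $\ell_2^\star=\ell_2\circ\mathcal F^{-1}$ and $\ell_3^\star(A_1,A_2,A_3)=\ell_3\big((A_1\otimes_\star A_2)\otimes_\star A_3\big)$ with $v\otimes_\star w=\mathcal F^{-1}(v\otimes w)$. For a field $A\in\Omega^1(M,\mathfrak g)[[\hbar]]$, every coefficient of which has compact support, put $\langle A,\mathcal A\rangle_\star=\int_M\mathrm{Tr}(A\wedge_\star\mathcal A)$, $F^{\mathcal R}=\mathrm dA+\tfrac12[A,A]^\star$, and let $$S_\star(A)=\tfrac12\langle A,\ell_1(A)\rangle_\star-\tfrac1{6}\langle A,\ell_2^\star(A,A)\rangle_\star-\tfrac1{24}\langle A,\ell_3^\star(A,A,A)\rangle_\star$$ be the braided Maurer–Cartan action. The braided gauge variation with parameter $\lambda\in\Omega^0(M,\mathfrak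 g)[[\hbar]]$ is $\delta_\lambda A=\mathrm d\lambda-[\lambda,A]^\star$, extended to expressions in $A$ so as to commute with equivariant linear maps and to satisfy the braided Leibniz rule $$\delta_\lambda\,\mu_\star(v_1\otimes v_2)=\mu_\star(\delta_\lambda v_1\otimes v_2)+\mu_\star\big(\mathsf R_k(v_1)\otimes\delta_{\mathsf R^k(\lambda)}v_2\big).$$ **Theorem.** (1) For an arbitrary twist, $$\begin{aligned}S_\star(A)=\int_M\Big\{&\tfrac12\mathrm{Tr}\big(F^{\mathcal R}\wedge_\star\ast F^{\mathcal R}\big)+\tfrac16\mathrm{Tr}\big([A,\mathsf R_k(A)]^\star\wedge_\star\ast\mathsf R^k(F^{\mathcal R})\big)\\&-\tfrac1{12}\Big(\mathrm{Tr}\big(F^{\mathcal R}\wedge_\star\ast[A,A]^\star\big)+\mathrm{Tr}\big(\ast[A,A]^\star\wedge_\star F^{\mathcal R}\big)\Big)\\&+\tfrac1{24}\Big(\mathrm{Tr}\big([A,\mathsf R_k(A)]^\star\wedge_\star\ast[\mathsf R^k(A),A]^\star\big)-\mathrm{Tr}\big([A,\mathsf R_k(A)]^\star\wedge_\star\ast\mathsf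 R^k([A,A]^\star)\big)\Big)\Big\}.\end{aligned}$$ (2) The action is braided gauge invariant: $\delta_\lambda S_\star(A)=0$ for all $\lambda\in\Omega^0(M,\mathfrak g)[[\hbar]]$, both when the variation is computed from the definition of $S_\star$ and when it is computed from the right-hand side of (1). (3) Place $\Omega^0,\Omega^1,\Omega^{d-1},\Omega^d$ (with values in $\mathfrak g$) in degrees $0,1,2,3$, paired by $\langle A,\mathcal A\rangle=\int_M\mathrm{Tr}(A\wedge\mathcal A)$ for degrees $1,2$ and by $\langle\lambda,\Lambda\rangle=\int_M\mathrm{Tr}(\lambda\wedge\Lambda)$ for degrees $0,3$, extended to a graded symmetric pairing. Suppose that $\mathcal F$ is compatible with it, i.e. $\langle v_1,v_2\rangle_\star=\langle\mathsf R_k(v_1),\mathsf R^k(v_2)\rangle_\star=(-1)^{|v_1||v_2|}\langle v_2,v_1\rangle_\star$ for all homogeneous compactly supported $v_1,v_2$. Then $$S_\star(A)=\tfrac12\int_M\mathrm{Tr}\big(F^{\mathcal R}\wedge_\star\ast F^{\mathcal R}\big)+\tfrac1{24}\int_M\mathrm{Tr}\big([A,\mathsf R_k(A)]^\star\wedge_\star\ast[\mathsf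 R^k(A),A]^\star\big)-\tfrac1{24}\int_M\mathrm{Tr}\big([A,A]^\star\wedge_\star\ast[A,A]^\star\big).$$ -/

import Mathlib

open scoped TensorProduct

set_option linter.unusedSectionVars false

section Cartan

variable {A L : Type*} [CommRing A] [LieRing L] [Module A L] [LieRingModule L A]
  [LieRinehartRing A L]

/-- The Lie derivative of a `k`-form. -/
def lieDer {k : ℕ} (ξ : L) (ω : L [⋀^Fin k]→ₗ[A] A) : L [⋀^Fin k]→ₗ[A] A where
  toFun X := ⁅ξ, ω X⁆ - ∑ i, ω (Function.update X i ⁅ξ, X i⁆)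
  map_update_add' := by
    intro _ X i x y
    have inst : ‹DecidableEq (Fin k)› = instDecidableEqFin k := Subsingleton.elim _ _
    subst inst
    have h : ∀ j, ω (Function.update (Function.update X i (x + y)) j
          ⁅ξ, Function.update X i (x + y) j⁆)
        = ω (Function.update (Function.update X i x) j ⁅ξ, Function.update X i x j⁆)
        + ω (Function.update (Function.update X i y) j ⁅ξ, Function.update X i y j⁆) := by
      intro j
      rcases eq_or_ne j i with rfl | hj
      · simp
      · simp [Function.update_comm hj.symm, hj]
    simp only [AlternatingMap.map_update_add, lie_add, h, Finset.sum_add_distrib]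
    abel
  map_update_smul' := by
    intro _ X i a x
    have inst : ‹DecidableEq (Fin k)› = instDecidableEqFin k := Subsingleton.elim _ _
    subst inst
    have h : ∀ j, ω (Function.update (Function.update X i (a • x)) j
          ⁅ξ, Function.update X i (a • x) j⁆)
        = a * ω (Function.update (Function.update X i x) j ⁅ξ, Function.update X i x j⁆)
        + if j = i then ⁅ξ, a⁆ * ω (Function.update X i x) else 0 := by
      intro j
      rcases eq_or_ne j i with rfl | hj
      · simp
      · simp [Function.update_comm hj.symm, hj]
    simp only [AlternatingMap.map_update_smul, smul_eq_mul, h, Finset.sum_add_distrib,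
      Finset.sum_ite_eq', Finset.mem_univ, if_true, ← Finset.mul_sum,
      LieRinehartRing.leibniz_mul_right]
    ring
  map_eq_zero_of_eq' := by
    intro X i j hij hne
    have h : ∀ l, l ≠ i → l ≠ j → ω (Function.update X l ⁅ξ, X l⁆) = 0 := fun l hi hj =>
      ω.map_eq_zero_of_eq _ (by simp [hi.symm, hj.symm, hij]) hne
    have hs : ω (Function.update X i ⁅ξ, X i⁆) + ω (Function.update X j ⁅ξ, X j⁆) = 0 := by
      have : Function.update X j ⁅ξ, X j⁆ = Function.update X i ⁅ξ, X i⁆ ∘ Equiv.swap i j := by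
        ext l
        simp only [Function.comp, Function.update_apply, Equiv.swap_apply_def]
        split_ifs <;> simp_all
      rw [this, ω.map_swap _ hne]
      simp
    have : ∑ l, ω (Function.update X l ⁅ξ, X l⁆) = 0 := by
      rw [← Finset.sum_subset (Finset.subset_univ {i, j}), Finset.sum_pair hne, hs]
      intro l _ hl
      simp only [Finset.mem_insert, Finset.mem_singleton, not_or] at hl
      exact h l hl.1 hl.2
    simp [ω.map_eq_zero_of_eq X hij hne, this]

theorem lieDer_apply {k : ℕ} (ξ : L) (ω : L [⋀^Fin k]→ₗ[A] A) (X : Fin k → L) :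
    lieDer ξ ω X = ⁅ξ, ω X⁆ - ∑ i, ω (Function.update X i ⁅ξ, X i⁆) := rfl

theorem lieDer_lieDer {k : ℕ} (ξ η : L) (ω : L [⋀^Fin k]→ₗ[A] A) :
    lieDer ξ (lieDer η ω) = lieDer ⁅ξ, η⁆ ω + lieDer η (lieDer ξ ω) := by
  ext X
  have hu : ∀ (ξ η : L) (i j : Fin k), ω (Function.update (Function.update X i ⁅ξ, X i⁆) j
        ⁅η, Function.update X i ⁅ξ, X i⁆ j⁆) =
      if i = j then ω (Function.update X i ⁅η, ⁅ξ, X i⁆⁆) else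
        ω (Function.update (Function.update X i ⁅ξ, X i⁆) j ⁅η, X j⁆) := by
    intro ξ η i j
    rcases eq_or_ne i j with rfl | h
    · simp
    · simp [h, h.symm]
  have hc : ∑ i, ∑ j, ω (Function.update (Function.update X i ⁅ξ, X i⁆) j
        ⁅η, Function.update X i ⁅ξ, X i⁆ j⁆)
      = ∑ i, ∑ j, ω (Function.update (Function.update X i ⁅η, X i⁆) j
        ⁅ξ, Function.update X i ⁅η, X i⁆ j⁆)
        - ∑ i, ω (Function.update X i ⁅⁅ξ, η⁆, X i⁆) := by
    rw [Finset.sum_comm (s := Finset.univ) (t := Finset.univ)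
      (f := fun i j => ω (Function.update (Function.update X i ⁅η, X i⁆) j
        ⁅ξ, Function.update X i ⁅η, X i⁆ j⁆)), ← Finset.sum_sub_distrib]
    refine Finset.sum_congr rfl fun i _ => ?_
    have : ω (Function.update X i ⁅⁅ξ, η⁆, X i⁆)
        = ∑ j, if i = j then ω (Function.update X i ⁅⁅ξ, η⁆, X i⁆) else 0 := by simp
    rw [this, ← Finset.sum_sub_distrib]
    refine Finset.sum_congr rfl fun j _ => ?_
    rw [hu, hu]
    rcases eq_or_ne i j with rfl | h
    · simp only [if_true, lie_lie, sub_eq_add_neg, AlternatingMap.map_update_add,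
        AlternatingMap.map_update_neg]
      abel
    · simp only [h, h.symm, if_false, sub_zero]
      rw [Function.update_comm h]
  simp only [lieDer_apply, AlternatingMap.add_apply, lie_sub, lie_sum, Finset.sum_sub_distrib,
    hc, lie_lie]
  abel

instance formLieRingModule {k : ℕ} : LieRingModule L (L [⋀^Fin k]→ₗ[A] A) where
  bracket := lieDer
  add_lie ξ η ω := by
    ext X
    change lieDer (ξ + η) ω X = (lieDer ξ ω + lieDer η ω) X
    simp only [AlternatingMap.add_apply, lieDer_apply, add_lie, AlternatingMap.map_update_add,
      Finset.sum_add_distrib]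
    abel
  lie_add ξ ω η := by
    ext X
    change lieDer ξ (ω + η) X = (lieDer ξ ω + lieDer ξ η) X
    simp only [AlternatingMap.add_apply, lieDer_apply, lie_add, Finset.sum_add_distrib]
    abel
  leibniz_lie := lieDer_lieDer

theorem form_lie_apply {k : ℕ} (ξ : L) (ω : L [⋀^Fin k]→ₗ[A] A) (X : Fin k → L) :
    ⁅ξ, ω⁆ X = ⁅ξ, ω X⁆ - ∑ i, ω (Function.update X i ⁅ξ, X i⁆) := rfl

theorem form_lie_smul {k : ℕ} (ξ : L) (a : A) (ω : L [⋀^Fin k]→ₗ[A] A) :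
    ⁅ξ, a • ω⁆ = ⁅ξ, a⁆ • ω + a • ⁅ξ, ω⁆ := by
  ext X
  simp only [form_lie_apply, AlternatingMap.add_apply, AlternatingMap.smul_apply, smul_eq_mul,
    LieRinehartRing.leibniz_mul_right, ← Finset.mul_sum]
  ring

theorem form_lie_cons {k : ℕ} (ξ : L) (ω : L [⋀^Fin (k + 1)]→ₗ[A] A) (Y : L) (v : Fin k → L) :
    ⁅ξ, ω⁆ (Fin.cons Y v) = ⁅ξ, ω.curryLeft Y⁆ v - ω (Fin.cons ⁅ξ, Y⁆ v) := by
  have h : ∀ u : Fin k → L, ω.curryLeft Y u = ω (Fin.cons Y u) := fun _ => rfl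
  simp only [form_lie_apply, Fin.sum_univ_succ, h, Fin.cons_zero, Fin.cons_succ,
    Fin.update_cons_zero, Fin.cons_update]
  abel

/-- The differential of a function, as a linear form on vector fields. -/
def dFun (a : A) : L →ₗ[A] A where
  toFun X := ⁅X, a⁆
  map_add' X Y := add_lie X Y a
  map_smul' b X := by simp

/-- The form `da ∧ ω`; used only to verify that the exterior derivative is well defined. -/
def dFunWedge {k : ℕ} (a : A) (ω : L [⋀^Fin k]→ₗ[A] A) : L [⋀^Fin (k + 1)]→ₗ[A] A :=
  AlternatingMap.alternatizeUncurryFin ((dFun a).smulRight ω)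

theorem dFunWedge_cons_zero (a : A) (ω : L [⋀^Fin 0]→ₗ[A] A) (X : L) (v : Fin 0 → L) :
    dFunWedge a ω (Fin.cons X v) = ⁅X, a⁆ * ω v := by
  have : Fin.removeNth 0 (Fin.cons X v : Fin 1 → L) = v := Subsingleton.elim _ _
  simp [dFunWedge, AlternatingMap.alternatizeUncurryFin_apply, this, dFun]

theorem dFunWedge_cons {k : ℕ} (a : A) (ω : L [⋀^Fin (k + 1)]→ₗ[A] A) (X : L)
    (v : Fin (k + 1) → L) :
    dFunWedge a ω (Fin.cons X v) = ⁅X, a⁆ * ω v - dFunWedge a (ω.curryLeft X) v := by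
  have h : ∀ i : Fin (k + 1), Fin.removeNth i.succ (Fin.cons X v : Fin (k + 2) → L)
      = Fin.cons X (Fin.removeNth i v) := by
    intro i
    ext j
    refine Fin.cases ?_ (fun j => ?_) j <;> simp [Fin.removeNth]
  have h0 : Fin.removeNth 0 (Fin.cons X v : Fin (k + 2) → L) = v := by
    ext j
    simp [Fin.removeNth]
  simp only [dFunWedge, AlternatingMap.alternatizeUncurryFin_apply]
  rw [Fin.sum_univ_succ]
  simp only [h, h0, Fin.cons_zero, Fin.cons_succ, LinearMap.smulRight_apply, Fin.val_succ,
    Fin.val_zero, pow_succ, pow_zero, one_smul, mul_neg, mul_one, neg_smul, Finset.sum_neg_distrib,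
    AlternatingMap.smul_apply, smul_eq_mul, dFun, LinearMap.coe_mk, AddHom.coe_mk,
    AlternatingMap.curryLeft_apply_apply, sub_eq_add_neg]
  rfl

theorem form_smul_lie_zero (a : A) (X : L) (ω : L [⋀^Fin 0]→ₗ[A] A) :
    ⁅a • X, ω⁆ = a • ⁅X, ω⁆ := by
  ext v
  simp [form_lie_apply]

theorem form_smul_lie {k : ℕ} (a : A) (X : L) (ω : L [⋀^Fin (k + 1)]→ₗ[A] A) :
    ⁅a • X, ω⁆ = a • ⁅X, ω⁆ + dFunWedge a (ω.curryLeft X) := by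
  ext v
  have h : ∀ i, ω (Function.update v i ⁅a • X, v i⁆)
      = a * ω (Function.update v i ⁅X, v i⁆) - ⁅v i, a⁆ * ω (Function.update v i X) := by
    intro i
    have : ⁅a • X, v i⁆ = a • ⁅X, v i⁆ - ⁅v i, a⁆ • X := by
      rw [← lie_skew, LieRinehartRing.leibniz_smul_right, ← lie_skew X (v i)]
      simp only [smul_neg]
      abel
    rw [this]
    simp [sub_eq_add_neg, AlternatingMap.map_update_add, ← neg_smul, AlternatingMap.map_update_smul]
  have h2 : ∀ i : Fin (k + 1), (-1) ^ i.val • ω (Fin.cons X (i.removeNth v))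
      = ω (Function.update v i X) := by
    intro i
    have := AlternatingMap.neg_one_pow_smul_map_insertNth ω i X (i.removeNth v)
    rw [Fin.insertNth_removeNth] at this
    rw [show (Fin.cons X (i.removeNth v) : Fin (k + 1) → L) = Matrix.vecCons X (i.removeNth v)
      from rfl, ← this, smul_smul, ← mul_pow]
    simp
  simp only [AlternatingMap.add_apply, form_lie_apply, h, AlternatingMap.smul_apply, smul_eq_mul,
    dFunWedge, AlternatingMap.alternatizeUncurryFin_apply, LinearMap.smulRight_apply,
    Finset.sum_sub_distrib, ← Finset.mul_sum, LieRinehartRing.lie_smul_eq_mul, mul_sub,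
    AlternatingMap.curryLeft_apply_apply, dFun, LinearMap.coe_mk, AddHom.coe_mk]
  have h3 : ∀ i : Fin (k + 1), (-1) ^ i.val • (⁅v i, a⁆ * ω (Matrix.vecCons X (i.removeNth v)))
      = ⁅v i, a⁆ * ω (Function.update v i X) := by
    intro i
    rw [← h2 i, mul_smul_comm]
    rfl
  simp only [h3]
  abel

/-- A linear map from vector fields to `k`-forms that is skew in its total argument is a
`(k+1)`-form. -/
def uncurryForm {k : ℕ} (f : L →ₗ[A] L [⋀^Fin k]→ₗ[A] A)
    (hf : ∀ X v, (∃ i, v i = X) → f X v = 0) : L [⋀^Fin (k + 1)]→ₗ[A] A where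
  __ := (AlternatingMap.toMultilinearMapLM ∘ₗ f).uncurryLeft
  map_eq_zero_of_eq' := by
    intro v i j hij hne
    change f (v 0) (Fin.tail v) = 0
    induction i using Fin.cases with
    | zero =>
      induction j using Fin.cases with
      | zero => exact absurd rfl hne
      | succ j => exact hf _ _ ⟨j, hij.symm⟩
    | succ i =>
      induction j using Fin.cases with
      | zero => exact hf _ _ ⟨i, hij⟩
      | succ j =>
        exact (f (v 0)).map_eq_zero_of_eq _ hij (fun h => hne (by rw [h]))

theorem uncurryForm_cons {k : ℕ} (f : L →ₗ[A] L [⋀^Fin k]→ₗ[A] A)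
    (hf : ∀ X v, (∃ i, v i = X) → f X v = 0) (X : L) (v : Fin k → L) :
    uncurryForm f hf (Fin.cons X v) = f X v := rfl

theorem form_eq_zero_of_cons {k : ℕ} (ω : L [⋀^Fin (k + 1)]→ₗ[A] A) (X : L)
    (h : ∀ w : Fin k → L, ω (Fin.cons X w) = 0) (v : Fin (k + 1) → L) (hv : ∃ i, v i = X) :
    ω v = 0 := by
  obtain ⟨i, rfl⟩ := hv
  have h0 : ω (v ∘ Equiv.swap 0 i) = 0 := by
    have := h (Fin.tail (v ∘ Equiv.swap 0 i))
    have h1 : v i = (v ∘ Equiv.swap 0 i) 0 := by simp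
    rwa [h1, Fin.cons_self_tail] at this
  rcases eq_or_ne 0 i with rfl | hi
  · simpa using h0
  · rwa [ω.map_swap _ hi, neg_eq_zero] at h0

variable [Algebra ℝ A] [LieAlgebra ℝ L] [LieRinehartAlgebra ℝ A L]

instance formLieModule {k : ℕ} : LieModule ℝ L (L [⋀^Fin k]→ₗ[A] A) where
  smul_lie t ξ ω := by
    ext X
    simp only [form_lie_apply, AlternatingMap.smul_apply, smul_lie, smul_sub, Finset.smul_sum]
    congr 1
    refine Finset.sum_congr rfl fun i _ => ?_
    rw [← algebraMap_smul A t, AlternatingMap.map_update_smul, algebraMap_smul]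
  lie_smul t ξ ω := by
    ext X
    simp only [form_lie_apply, AlternatingMap.smul_apply, lie_smul, smul_sub, Finset.smul_sum]

/-- The two properties of the exterior derivative that its recursive construction needs. -/
structure IsExtDer {k : ℕ} (D : (L [⋀^Fin k]→ₗ[A] A) →ₗ[ℝ] (L [⋀^Fin (k + 1)]→ₗ[A] A)) :
    Prop where
  smul : ∀ (a : A) (ω), D (a • ω) = a • D ω + dFunWedge a ω
  contr : ∀ (X : L) (η), (∀ v, (∃ i, v i = X) → η v = 0) → ∀ v, D η (Fin.cons X v) = ⁅X, η⁆ v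

/-- On functions, `(df)(X) = X f`. -/
def extDerZero : (L [⋀^Fin 0]→ₗ[A] A) →ₗ[ℝ] (L [⋀^Fin 1]→ₗ[A] A) where
  toFun ω := uncurryForm
    { toFun := fun X => ⁅X, ω⁆
      map_add' := fun X Y => add_lie X Y ω
      map_smul' := fun a X => form_smul_lie_zero a X ω } (fun _ _ ⟨i, _⟩ => i.elim0)
  map_add' ω η := by
    ext v
    exact congrArg (fun θ : L [⋀^Fin 0]→ₗ[A] A => θ (Fin.tail v)) (lie_add (v 0) ω η)
  map_smul' t ω := by
    ext v
    exact congrArg (fun θ : L [⋀^Fin 0]→ₗ[A] A => θ (Fin.tail v)) (lie_smul t (v 0) ω)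

theorem isExtDer_zero : IsExtDer (extDerZero (A := A) (L := L)) where
  smul a ω := by
    ext v
    rw [← Fin.cons_self_tail v, AlternatingMap.add_apply, dFunWedge_cons_zero]
    change ⁅v 0, a • ω⁆ (Fin.tail v) = a * ⁅v 0, ω⁆ (Fin.tail v) + _
    rw [form_lie_smul, AlternatingMap.add_apply, add_comm]
    rfl
  contr _ _ _ _ := rfl

/-- Cartan's formula `ι_X (dω) = L_X ω - d (ι_X ω)` as the recursion for `d`. -/
def extDerSucc {k : ℕ} (D : (L [⋀^Fin k]→ₗ[A] A) →ₗ[ℝ] (L [⋀^Fin (k + 1)]→ₗ[A] A))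
    (hD : IsExtDer D) :
    (L [⋀^Fin (k + 1)]→ₗ[A] A) →ₗ[ℝ] (L [⋀^Fin (k + 1 + 1)]→ₗ[A] A) where
  toFun ω := uncurryForm
    { toFun := fun X => ⁅X, ω⁆ - D (ω.curryLeft X)
      map_add' := fun X Y => by
        rw [map_add, map_add, add_lie]
        abel
      map_smul' := fun a X => by
        rw [map_smul, hD.smul, form_smul_lie, RingHom.id_apply, smul_sub]
        abel }
    (fun X v hv => by
      refine form_eq_zero_of_cons _ X (fun w => ?_) v hv
      change ⁅X, ω⁆ (Fin.cons X w) - D (ω.curryLeft X) (Fin.cons X w) = 0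
      rw [form_lie_cons, lie_self, hD.contr]
      · rw [ω.map_coord_zero 0 (by simp), sub_zero, sub_self]
      · rintro u ⟨i, hi⟩
        exact ω.map_eq_zero_of_eq (i := 0) (j := i.succ) (Fin.cons X u) (by simp [hi])
          (Fin.succ_ne_zero i).symm)
  map_add' ω η := by
    ext v
    change (⁅v 0, ω + η⁆ - D ((ω + η).curryLeft (v 0))) (Fin.tail v)
      = (⁅v 0, ω⁆ - D (ω.curryLeft (v 0))) (Fin.tail v)
        + (⁅v 0, η⁆ - D (η.curryLeft (v 0))) (Fin.tail v)
    rw [lie_add, AlternatingMap.curryLeft_add, LinearMap.add_apply, map_add,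
      ← AlternatingMap.add_apply]
    congr 1
    abel
  map_smul' t ω := by
    ext v
    have h : (t • ω).curryLeft (v 0) = t • ω.curryLeft (v 0) := rfl
    change (⁅v 0, t • ω⁆ - D ((t • ω).curryLeft (v 0))) (Fin.tail v)
      = t • (⁅v 0, ω⁆ - D (ω.curryLeft (v 0))) (Fin.tail v)
    rw [lie_smul t (v 0) ω, h, map_smul, ← smul_sub]
    rfl

theorem isExtDer_succ {k : ℕ}
    (D : (L [⋀^Fin k]→ₗ[A] A) →ₗ[ℝ] (L [⋀^Fin (k + 1)]→ₗ[A] A)) (hD : IsExtDer D) :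
    IsExtDer (extDerSucc D hD) where
  smul a ω := by
    ext v
    have h : (a • ω).curryLeft (v 0) = a • ω.curryLeft (v 0) := rfl
    rw [← Fin.cons_self_tail v, AlternatingMap.add_apply, dFunWedge_cons]
    change (⁅v 0, a • ω⁆ - D ((a • ω).curryLeft (v 0))) (Fin.tail v)
      = a * (⁅v 0, ω⁆ - D (ω.curryLeft (v 0))) (Fin.tail v) + _
    rw [form_lie_smul, h, hD.smul]
    simp only [AlternatingMap.sub_apply, AlternatingMap.add_apply, AlternatingMap.smul_apply,
      smul_eq_mul]
    ring
  contr X η h v := by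
    have h0 : η.curryLeft X = 0 := by
      ext w
      exact h _ ⟨0, rfl⟩
    change (⁅X, η⁆ - D (η.curryLeft X)) v = _
    rw [h0, map_zero, sub_zero]

/-- The exterior derivative in degree `k`, with the properties used in the recursion. -/
def extDerAux : (k : ℕ) →
    {D : (L [⋀^Fin k]→ₗ[A] A) →ₗ[ℝ] (L [⋀^Fin (k + 1)]→ₗ[A] A) // IsExtDer D}
  | 0 => ⟨extDerZero, isExtDer_zero⟩
  | k + 1 => ⟨extDerSucc (extDerAux k).1 (extDerAux k).2, isExtDer_succ _ _⟩

/-- The exterior derivative, determined by `(df)(X) = X f` on functions and by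
`ι_X (dω) = L_X ω - d (ι_X ω)` in positive degree (`extDer_zero_apply`, `extDer_succ_curryLeft`). -/
def extDer (k : ℕ) : (L [⋀^Fin k]→ₗ[A] A) →ₗ[ℝ] (L [⋀^Fin (k + 1)]→ₗ[A] A) :=
  (extDerAux k).1

theorem extDer_zero_apply (ω : L [⋀^Fin 0]→ₗ[A] A) (X : Fin 1 → L) :
    extDer 0 ω X = ⁅X 0, ω ![]⁆ := by
  change ⁅X 0, ω⁆ (Fin.tail X) = _
  rw [form_lie_apply, Subsingleton.elim (Fin.tail X) ![]]
  simp

theorem extDer_succ_curryLeft {k : ℕ} (ω : L [⋀^Fin (k + 1)]→ₗ[A] A) (X : L) :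
    (extDer (k + 1) ω).curryLeft X = ⁅X, ω⁆ - extDer k (ω.curryLeft X) := by
  ext v
  rfl

theorem form_smul_eq {k : ℕ} (t : ℝ) (ω : L [⋀^Fin k]→ₗ[A] A) : t • ω = algebraMap ℝ A t • ω := by
  ext X
  simp [Algebra.smul_def]

instance formIsScalarTower {k : ℕ} : IsScalarTower ℝ A (L [⋀^Fin k]→ₗ[A] A) where
  smul_assoc t a ω := by
    ext X
    simp

/-- The exterior product
`(α ∧ β)(X₁, …, Xₘ) = ∑ sign(σ) α(X_{σ 1}, …, X_{σ k}) β(X_{σ (k+1)}, …, X_{σ m})`,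
summed over the `(k, l)`-shuffles `σ`, where `m = k + l`. -/
noncomputable def wedge {k l m : ℕ} (h : k + l = m) :
    (L [⋀^Fin k]→ₗ[A] A) →ₗ[A] (L [⋀^Fin l]→ₗ[A] A) →ₗ[A] (L [⋀^Fin m]→ₗ[A] A) :=
  LinearMap.mk₂ A
    (fun α β => ((LinearMap.mul' A A).compAlternatingMap (α.domCoprod β)).domDomCongr
      (finSumFinEquiv.trans (finCongr h)))
    (fun α α' β => by
      rw [← AlternatingMap.domCoprod'_apply, TensorProduct.add_tmul, map_add]; ext; simp)
    (fun a α β => by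
      rw [← AlternatingMap.domCoprod'_apply, ← TensorProduct.smul_tmul', map_smul]; ext; simp)
    (fun α β β' => by
      rw [← AlternatingMap.domCoprod'_apply, TensorProduct.tmul_add, map_add]; ext; simp)
    (fun a α β => by
      rw [← AlternatingMap.domCoprod'_apply, TensorProduct.tmul_smul, map_smul]; ext; simp)

end Cartan

section LieValued

variable (A L 𝔤 : Type*) [CommRing A] [LieRing L] [Module A L] [LieRingModule L A]
  [LieRinehartRing A L] [Algebra ℝ A] [LieAlgebra ℝ L] [LieRinehartAlgebra ℝ A L]
  [LieRing 𝔤] [LieAlgebra ℝ 𝔤]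

/-- Lie algebra valued `k`-forms `Ω^k ⊗ 𝔤`. -/
def GForm (k : ℕ) : Type _ := (L [⋀^Fin k]→ₗ[A] A) ⊗[ℝ] 𝔤

noncomputable instance GForm.instAddCommGroup (k : ℕ) : AddCommGroup (GForm A L 𝔤 k) :=
  inferInstanceAs (AddCommGroup ((L [⋀^Fin k]→ₗ[A] A) ⊗[ℝ] 𝔤))

noncomputable instance GForm.instModule (k : ℕ) : Module ℝ (GForm A L 𝔤 k) :=
  inferInstanceAs (Module ℝ ((L [⋀^Fin k]→ₗ[A] A) ⊗[ℝ] 𝔤))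

/-- The action `ξ · (ω ⊗ x) = (L_ξ ω) ⊗ x` by Lie derivatives, trivial on `𝔤`. -/
noncomputable def gLie (k : ℕ) (ξ : L) :
    (L [⋀^Fin k]→ₗ[A] A) ⊗[ℝ] 𝔤 →ₗ[ℝ] (L [⋀^Fin k]→ₗ[A] A) ⊗[ℝ] 𝔤 :=
  (LieModule.toEnd ℝ L (L [⋀^Fin k]→ₗ[A] A) ξ).rTensor 𝔤

theorem gLie_add (k : ℕ) (ξ η : L) : gLie A L 𝔤 k (ξ + η) = gLie A L 𝔤 k ξ + gLie A L 𝔤 k η := by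
  rw [gLie, map_add, LinearMap.rTensor_add]
  rfl

theorem gLie_smul (k : ℕ) (t : ℝ) (ξ : L) : gLie A L 𝔤 k (t • ξ) = t • gLie A L 𝔤 k ξ := by
  rw [gLie, map_smul, LinearMap.rTensor_smul]
  rfl

theorem gLie_comp (k : ℕ) (ξ η : L) :
    gLie A L 𝔤 k ξ ∘ₗ gLie A L 𝔤 k η =
      gLie A L 𝔤 k ⁅ξ, η⁆ + gLie A L 𝔤 k η ∘ₗ gLie A L 𝔤 k ξ := by
  simp only [gLie, ← LinearMap.rTensor_comp, ← LinearMap.rTensor_add]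
  congr 1
  ext ω : 1
  exact leibniz_lie ξ η ω

noncomputable instance GForm.instLieRingModule (k : ℕ) : LieRingModule L (GForm A L 𝔤 k) where
  bracket ξ v := gLie A L 𝔤 k ξ v
  add_lie ξ η v := congrArg (fun f => f v) (gLie_add A L 𝔤 k ξ η)
  lie_add ξ v w := map_add (gLie A L 𝔤 k ξ) v w
  leibniz_lie ξ η v := congrArg (fun f => f v) (gLie_comp A L 𝔤 k ξ η)

instance GForm.instLieModule (k : ℕ) : LieModule ℝ L (GForm A L 𝔤 k) where
  smul_lie t ξ v := congrArg (fun f => f v) (gLie_smul A L 𝔤 k t ξ)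
  lie_smul t ξ v := map_smul (gLie A L 𝔤 k ξ) t v

variable {A L 𝔤}

/-- The exterior derivative of `𝔤`-valued forms. -/
noncomputable def gd {k m : ℕ} (h : k + 1 = m) : GForm A L 𝔤 k →ₗ[ℝ] GForm A L 𝔤 m := by
  subst h
  exact (extDer k).rTensor 𝔤

/-- The bracket `[α ⊗ x, β ⊗ y] = (α ∧ β) ⊗ [x, y]` of `𝔤`-valued forms. -/
noncomputable def gbr {k l m : ℕ} (h : k + l = m) :
    GForm A L 𝔤 k →ₗ[ℝ] GForm A L 𝔤 l →ₗ[ℝ] GForm A L 𝔤 m :=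
  TensorProduct.map₂ ((wedge h).restrictScalars₁₂ ℝ ℝ) (LieModule.toEnd ℝ 𝔤 𝔤 : 𝔤 →ₗ[ℝ] 𝔤 →ₗ[ℝ] 𝔤)

/-- `Tr(α ⊗ x ∧ β ⊗ y) = Tr(x, y) α ∧ β`. -/
noncomputable def gtr (Tr : 𝔤 →ₗ[ℝ] 𝔤 →ₗ[ℝ] ℝ) {k l m : ℕ} (h : k + l = m) :
    GForm A L 𝔤 k →ₗ[ℝ] GForm A L 𝔤 l →ₗ[ℝ] (L [⋀^Fin m]→ₗ[A] A) :=
  (TensorProduct.map₂ ((wedge h).restrictScalars₁₂ ℝ ℝ) Tr).compr₂ (TensorProduct.rid ℝ (L [⋀^Fin m]→ₗ[A] A)).toLinearMap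

/-- `X ↦ det (g (Y_i, X_j))` as a form. -/
def flatDet (g : L →ₗ[A] L →ₗ[A] A) {l : ℕ} (Y : Fin l → L) : L [⋀^Fin l]→ₗ[A] A :=
  Matrix.detRowAlternating.compLinearMap (LinearMap.pi fun i => g (Y i))

theorem flatDet_symm (g : L →ₗ[A] L →ₗ[A] A) {l : ℕ} (Y X : Fin l → L) :
    flatDet g Y X = flatDet g.flip X Y :=
  (Matrix.det_transpose (Matrix.of fun i j => g (Y j) (X i))).symm

/-- For vector fields `Y₁, …, Y_l`, the form `Y₁♭ ∧ … ∧ Y_l♭` with values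
`det (g (Y_i, X_j))`; alternating in the `Y_i`. -/
def flatWedge (g : L →ₗ[A] L →ₗ[A] A) (l : ℕ) : L [⋀^Fin l]→ₗ[A] (L [⋀^Fin l]→ₗ[A] A) where
  toFun Y := flatDet g Y
  map_update_add' Y i x y := by
    ext X
    simp only [flatDet_symm g, AlternatingMap.add_apply, AlternatingMap.map_update_add]
  map_update_smul' Y i a x := by
    ext X
    simp only [flatDet_symm g, AlternatingMap.smul_apply, AlternatingMap.map_update_smul]
  map_eq_zero_of_eq' Y i j hij hne := by
    ext X
    rw [flatDet_symm g, AlternatingMap.map_eq_zero_of_eq _ _ hij hne]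
    rfl

theorem flatWedge_apply (g : L →ₗ[A] L →ₗ[A] A) (l : ℕ) (Y X : Fin l → L) :
    flatWedge g l Y X = (Matrix.of fun i j => g (Y i) (X j)).det := by
  rw [← Matrix.det_transpose]
  rfl

/-- The Hodge operator of a Lorentzian metric `g`, given the coefficient map
`c : Ω^d → A`, `c (f vol) = f`, of its volume form:
`(∗β)(Y₁, …, Y_l) vol = - β ∧ Y₁♭ ∧ … ∧ Y_l♭`, where the sign is that of `det g`.
It is characterised by `α ∧ ∗β = ⟨α, β⟩ vol`. -/
noncomputable def hodge (g : L →ₗ[A] L →ₗ[A] A) {k l d : ℕ}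
    (c : (L [⋀^Fin d]→ₗ[A] A) →ₗ[A] A) (h : k + l = d) :
    (L [⋀^Fin k]→ₗ[A] A) →ₗ[ℝ] (L [⋀^Fin l]→ₗ[A] A) where
  toFun β := - (c ∘ₗ wedge h β).compAlternatingMap (flatWedge g l)
  map_add' α β := by
    ext Y
    simp only [map_add, AlternatingMap.neg_apply, AlternatingMap.add_apply,
      LinearMap.compAlternatingMap_apply, LinearMap.comp_apply, LinearMap.add_apply]
    abel
  map_smul' t β := by
    ext Y
    simp only [form_smul_eq, map_smul, AlternatingMap.neg_apply, AlternatingMap.smul_apply,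
      LinearMap.compAlternatingMap_apply, LinearMap.comp_apply, LinearMap.smul_apply,
      RingHom.id_apply, smul_neg]

/-- The Hodge operator on `𝔤`-valued forms. -/
noncomputable def ghodge (g : L →ₗ[A] L →ₗ[A] A) {k l d : ℕ}
    (c : (L [⋀^Fin d]→ₗ[A] A) →ₗ[A] A) (h : k + l = d) :
    GForm A L 𝔤 k →ₗ[ℝ] GForm A L 𝔤 l :=
  (hodge g c h).rTensor 𝔤

end LieValued

section Series

/-- `V[[ħ]]`: formal power series in `ħ` with coefficients in the complexification of the real
vector space `V`. -/
abbrev FPS (V : Type*) [AddCommGroup V] [Module ℝ V] : Type _ := ℕ → ℂ ⊗[ℝ] V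

variable {V W X : Type*} [AddCommGroup V] [Module ℝ V] [AddCommGroup W] [Module ℝ W]
  [AddCommGroup X] [Module ℝ X]

/-- The `ħ`-linear extension of a linear map. -/
noncomputable def mapS (f : V →ₗ[ℝ] W) : FPS V →ₗ[ℂ] FPS W :=
  (f.baseChange ℂ).compLeft ℕ

/-- The complex bilinear extension of a bilinear map. -/
noncomputable def bilC (b : V →ₗ[ℝ] W →ₗ[ℝ] X) :
    ℂ ⊗[ℝ] V →ₗ[ℂ] ℂ ⊗[ℝ] W →ₗ[ℂ] ℂ ⊗[ℝ] X :=
  (LinearMap.baseChangeHom ℝ ℂ W X ∘ₗ b).liftBaseChange ℂ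

/-- The `ħ`-bilinear extension of a bilinear map. -/
noncomputable def cauchy (b : V →ₗ[ℝ] W →ₗ[ℝ] X) : FPS V →ₗ[ℂ] FPS W →ₗ[ℂ] FPS X :=
  LinearMap.mk₂ ℂ (fun v w m => ∑ p ∈ Finset.HasAntidiagonal.antidiagonal m, bilC b (v p.1) (w p.2))
    (fun v v' w => by ext m; simp [Finset.sum_add_distrib])
    (fun t v w => by ext m; simp [Finset.smul_sum])
    (fun v w w' => by ext m; simp [Finset.sum_add_distrib])
    (fun t v w => by ext m; simp [Finset.smul_sum])

end Series

section Twist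

variable (𝔨 : Type*) [LieRing 𝔨] [LieAlgebra ℝ 𝔨]

/-- The universal enveloping algebra of the complexification of `𝔨`. -/
abbrev UEnv : Type _ := UniversalEnvelopingAlgebra ℂ (ℂ ⊗[ℝ] 𝔨)

attribute [local instance] LieRing.ofAssociativeRing

/-- The coproduct, with `Δ ξ = ξ ⊗ 1 + 1 ⊗ ξ` on Lie algebra elements. -/
noncomputable def comul : UEnv 𝔨 →ₐ[ℂ] UEnv 𝔨 ⊗[ℂ] UEnv 𝔨 :=
  UniversalEnvelopingAlgebra.lift ℂ
    { toFun := fun ξ => UniversalEnvelopingAlgebra.ι ℂ ξ ⊗ₜ[ℂ] 1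
        + 1 ⊗ₜ[ℂ] UniversalEnvelopingAlgebra.ι ℂ ξ
      map_add' := fun ξ η => by
        simp only [map_add, TensorProduct.add_tmul, TensorProduct.tmul_add]
        abel
      map_smul' := fun t ξ => by
        simp [TensorProduct.smul_tmul', TensorProduct.tmul_smul]
      map_lie' := fun {ξ η} => by
        simp only [LieHom.map_lie, LieRing.of_associative_ring_bracket, mul_add, add_mul,
          Algebra.TensorProduct.tmul_mul_tmul, mul_one, one_mul, TensorProduct.sub_tmul,
          TensorProduct.tmul_sub]
        abel }

/-- `F ↦ F₁₂ = F ⊗ 1`. -/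
noncomputable def twist12 : UEnv 𝔨 ⊗[ℂ] UEnv 𝔨 →ₐ[ℂ] UEnv 𝔨 ⊗[ℂ] (UEnv 𝔨 ⊗[ℂ] UEnv 𝔨) :=
  (Algebra.TensorProduct.assoc ℂ ℂ ℂ (UEnv 𝔨) (UEnv 𝔨) (UEnv 𝔨)).toAlgHom.comp
    Algebra.TensorProduct.includeLeft

/-- `F ↦ F₂₃ = 1 ⊗ F`. -/
noncomputable def twist23 : UEnv 𝔨 ⊗[ℂ] UEnv 𝔨 →ₐ[ℂ] UEnv 𝔨 ⊗[ℂ] (UEnv 𝔨 ⊗[ℂ] UEnv 𝔨) :=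
  Algebra.TensorProduct.includeRight

/-- `F ↦ (Δ ⊗ 1) F`. -/
noncomputable def twistΔ1 : UEnv 𝔨 ⊗[ℂ] UEnv 𝔨 →ₐ[ℂ] UEnv 𝔨 ⊗[ℂ] (UEnv 𝔨 ⊗[ℂ] UEnv 𝔨) :=
  (Algebra.TensorProduct.assoc ℂ ℂ ℂ (UEnv 𝔨) (UEnv 𝔨) (UEnv 𝔨)).toAlgHom.comp
    (Algebra.TensorProduct.map (comul 𝔨) (AlgHom.id ℂ (UEnv 𝔨)))

/-- `F ↦ (1 ⊗ Δ) F`. -/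
noncomputable def twist1Δ : UEnv 𝔨 ⊗[ℂ] UEnv 𝔨 →ₐ[ℂ] UEnv 𝔨 ⊗[ℂ] (UEnv 𝔨 ⊗[ℂ] UEnv 𝔨) :=
  Algebra.TensorProduct.map (AlgHom.id ℂ (UEnv 𝔨)) (comul 𝔨)

/-- A Drinfel'd twist `F = 1 ⊗ 1 + O(ħ)`, an invertible element of `(U𝔨 ⊗ U𝔨)[[ħ]]` with
`F₁₂ (Δ ⊗ 1) F = F₂₃ (1 ⊗ Δ) F` in `(U𝔨 ⊗ U𝔨 ⊗ U𝔨)[[ħ]]`. -/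
structure DrinfeldTwist where
  F : (PowerSeries (UEnv 𝔨 ⊗[ℂ] UEnv 𝔨))ˣ
  normalized : PowerSeries.coeff 0 (F : PowerSeries (UEnv 𝔨 ⊗[ℂ] UEnv 𝔨)) = 1
  cocycle :
    PowerSeries.map (twist12 𝔨).toRingHom F.1 * PowerSeries.map (twistΔ1 𝔨).toRingHom F.1 =
      PowerSeries.map (twist23 𝔨).toRingHom F.1 * PowerSeries.map (twist1Δ 𝔨).toRingHom F.1

variable {𝔨}

/-- The flip `F ↦ F₂₁`. -/
noncomputable def flip21 :
    PowerSeries (UEnv 𝔨 ⊗[ℂ] UEnv 𝔨) →+* PowerSeries (UEnv 𝔨 ⊗[ℂ] UEnv 𝔨) :=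
  PowerSeries.map (Algebra.TensorProduct.comm ℂ (UEnv 𝔨) (UEnv 𝔨)).toAlgHom.toRingHom

/-- The inverse twist `F⁻¹`. -/
noncomputable def DrinfeldTwist.Finv (F : DrinfeldTwist 𝔨) :
    PowerSeries (UEnv 𝔨 ⊗[ℂ] UEnv 𝔨) := (F.F⁻¹).1

/-- The R-matrix `R = F₂₁ F⁻¹ = R^k ⊗ R_k`. -/
noncomputable def DrinfeldTwist.R (F : DrinfeldTwist 𝔨) :
    PowerSeries (UEnv 𝔨 ⊗[ℂ] UEnv 𝔨) := flip21 F.F.1 * F.Finv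

/-- `R₂₁ = R_k ⊗ R^k`. -/
noncomputable def DrinfeldTwist.R21 (F : DrinfeldTwist 𝔨) :
    PowerSeries (UEnv 𝔨 ⊗[ℂ] UEnv 𝔨) := flip21 F.R

section Action

variable {V W X : Type*}
  [AddCommGroup V] [Module ℝ V] [LieRingModule 𝔨 V] [LieModule ℝ 𝔨 V]
  [AddCommGroup W] [Module ℝ W] [LieRingModule 𝔨 W] [LieModule ℝ 𝔨 W]
  [AddCommGroup X] [Module ℝ X]

/-- The action of `U𝔨` on `V[[ħ]]`. -/
noncomputable def actS (V : Type*) [AddCommGroup V] [Module ℝ V] [LieRingModule 𝔨 V]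
    [LieModule ℝ 𝔨 V] : UEnv 𝔨 →ₗ[ℂ] Module.End ℂ (FPS V) where
  toFun x := (UniversalEnvelopingAlgebra.lift ℂ
    (LieModule.toEnd ℂ (ℂ ⊗[ℝ] 𝔨) (ℂ ⊗[ℝ] V)) x).compLeft ℕ
  map_add' x y := by ext v m; simp
  map_smul' t x := by ext v m; simp

/-- `(x ⊗ y, B) ↦ B(x v, y w)` for `x ⊗ y ∈ U𝔨 ⊗ U𝔨`. -/
noncomputable def legs (B : FPS V →ₗ[ℂ] FPS W →ₗ[ℂ] FPS X) :
    UEnv 𝔨 ⊗[ℂ] UEnv 𝔨 →ₗ[ℂ] FPS V →ₗ[ℂ] FPS W →ₗ[ℂ] FPS X :=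
  TensorProduct.lift (LinearMap.mk₂ ℂ (fun x y => B.compl₁₂ (actS V x) (actS W y))
    (fun x x' y => by ext; simp) (fun t x y => by ext; simp)
    (fun x y y' => by ext; simp) (fun t x y => by ext; simp))

theorem legs_add (B B' : FPS V →ₗ[ℂ] FPS W →ₗ[ℂ] FPS X) :
    legs (𝔨 := 𝔨) (B + B') = legs B + legs B' := by
  ext x y v w m
  simp [legs]

theorem legs_smul (t : ℂ) (B : FPS V →ₗ[ℂ] FPS W →ₗ[ℂ] FPS X) :
    legs (𝔨 := 𝔨) (t • B) = t • legs B := by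
  ext x y v w m
  simp [legs]

/-- For `T = ∑ₙ ħⁿ Tₙ` in `(U𝔨 ⊗ U𝔨)[[ħ]]` and `B` an `ħ`-bilinear map, the map `B ∘ T`, that is
`(v, w) ↦ ∑ₙ ħⁿ B(Tₙ · (v ⊗ w))`. -/
noncomputable def sw (T : PowerSeries (UEnv 𝔨 ⊗[ℂ] UEnv 𝔨)) :
    (FPS V →ₗ[ℂ] FPS W →ₗ[ℂ] FPS X) →ₗ[ℂ] (FPS V →ₗ[ℂ] FPS W →ₗ[ℂ] FPS X) where
  toFun B := LinearMap.mk₂ ℂ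
    (fun v w m => ∑ p ∈ Finset.HasAntidiagonal.antidiagonal m, legs B (PowerSeries.coeff p.1 T) v w p.2)
    (fun v v' w => by ext m; simp [Finset.sum_add_distrib])
    (fun t v w => by ext m; simp [Finset.smul_sum])
    (fun v w w' => by ext m; simp [Finset.sum_add_distrib])
    (fun t v w => by ext m; simp [Finset.smul_sum])
  map_add' B B' := by
    refine LinearMap.ext₂ fun v w => ?_
    ext m
    simp [legs_add, Finset.sum_add_distrib]
  map_smul' t B := by
    refine LinearMap.ext₂ fun v w => ?_
    ext m
    simp [legs_smul, Finset.smul_sum]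

/-- The star product `b_⋆ = b ∘ F⁻¹` of a bilinear map `b`. -/
noncomputable def starProd (F : DrinfeldTwist 𝔨) (b : V →ₗ[ℝ] W →ₗ[ℝ] X) :
    FPS V →ₗ[ℂ] FPS W →ₗ[ℂ] FPS X :=
  sw F.Finv (cauchy b)

end Action

end Twist

section Variation

variable {𝔨 : Type*} [LieRing 𝔨] [LieAlgebra ℝ 𝔨]

/-- A `V[[ħ]]`-valued expression in a field, recorded as its value together with its braided gauge
variation `λ ↦ δ_λ`, for gauge parameters `λ` in `Λ[[ħ]]`. -/
structure Obs (Λ V : Type*) [AddCommGroup Λ] [Module ℝ Λ] [AddCommGroup V] [Module ℝ V] where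
  val : FPS V
  var : FPS Λ →ₗ[ℂ] FPS V

variable {Λ : Type*} [AddCommGroup Λ] [Module ℝ Λ] [LieRingModule 𝔨 Λ] [LieModule ℝ 𝔨 Λ]
  {V W X : Type*}
  [AddCommGroup V] [Module ℝ V] [LieRingModule 𝔨 V] [LieModule ℝ 𝔨 V]
  [AddCommGroup W] [Module ℝ W] [LieRingModule 𝔨 W] [LieModule ℝ 𝔨 W]
  [AddCommGroup X] [Module ℝ X]

noncomputable instance : Add (Obs Λ V) := ⟨fun a b => ⟨a.val + b.val, a.var + b.var⟩⟩

noncomputable instance : SMul ℂ (Obs Λ V) := ⟨fun t a => ⟨t • a.val, t • a.var⟩⟩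

/-- Braided variations commute with linear maps. -/
noncomputable def Obs.map (f : V →ₗ[ℝ] W) (a : Obs Λ V) : Obs Λ W :=
  ⟨mapS f a.val, mapS f ∘ₗ a.var⟩

/-- A string of expressions `a₁, …, aᵣ`, given by the evaluation
`Φ ↦ Φ(a₁, …, aᵣ)` and the variation `Φ ↦ (λ ↦ δ_λ (Φ(a₁, …, aᵣ)))`, where `Φ` ranges over the
multilinear maps with values in `X[[ħ]]`, seen as elements of the iterated space of linear
maps `D`. -/
structure ArgString (Λ D X : Type*) [AddCommGroup Λ] [Module ℝ Λ] [AddCommMonoid D] [Module ℂ D]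
    [AddCommGroup X] [Module ℝ X] where
  ev : D →ₗ[ℂ] FPS X
  var : D →ₗ[ℂ] FPS Λ →ₗ[ℂ] FPS X

/-- The empty string. -/
noncomputable def ArgString.nil : ArgString Λ (FPS X) X := ⟨LinearMap.id, 0⟩

/-- Prepending `a` to a string `s`, with the braided Leibniz rule
`δ_λ (Φ(a, s)) = Φ(δ_λ a, s) + δ_{R^k λ} (Φ(R_k a, s))`, where the variation in the second
term acts on `s` only. -/
noncomputable def ArgString.cons (F : DrinfeldTwist 𝔨) (a : Obs Λ V) {D : Type*}
    [AddCommMonoid D] [Module ℂ D] (s : ArgString Λ D X) : ArgString Λ (FPS V →ₗ[ℂ] D) X where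
  ev := s.ev ∘ₗ LinearMap.applyₗ a.val
  var :=
    { toFun := fun Φ => (s.ev ∘ₗ Φ) ∘ₗ a.var + sw F.R21 (s.var ∘ₗ Φ) a.val
      map_add' := fun Φ Ψ => by
        rw [LinearMap.comp_add, LinearMap.comp_add, map_add, LinearMap.add_comp,
          LinearMap.add_apply]
        abel
      map_smul' := fun t Φ => by
        rw [LinearMap.comp_smul, LinearMap.comp_smul, map_smul, LinearMap.smul_comp,
          LinearMap.smul_apply, RingHom.id_apply, smul_add] }

/-- The expression `Φ(a₁, …, aᵣ)`. -/
noncomputable def ArgString.apply {D : Type*} [AddCommMonoid D] [Module ℂ D]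
    (s : ArgString Λ D X) (Φ : D) : Obs Λ X := ⟨s.ev Φ, s.var Φ⟩

/-- The expression `μ(a, b)`, with `δ_λ μ(a, b) = μ(δ_λ a, b) + μ(R_k a, δ_{R^k λ} b)`. -/
noncomputable def Obs.mul (F : DrinfeldTwist 𝔨) (μ : FPS V →ₗ[ℂ] FPS W →ₗ[ℂ] FPS X)
    (a : Obs Λ V) (b : Obs Λ W) : Obs Λ X :=
  (ArgString.cons F a (ArgString.cons F b ArgString.nil)).apply μ

theorem Obs.mul_val (F : DrinfeldTwist 𝔨) (μ : FPS V →ₗ[ℂ] FPS W →ₗ[ℂ] FPS X)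
    (a : Obs Λ V) (b : Obs Λ W) : (Obs.mul F μ a b).val = μ a.val b.val := rfl

theorem Obs.mul_var (F : DrinfeldTwist 𝔨) (μ : FPS V →ₗ[ℂ] FPS W →ₗ[ℂ] FPS X)
    (a : Obs Λ V) (b : Obs Λ W) (l : FPS Λ) :
    (Obs.mul F μ a b).var l = μ (a.var l) b.val + sw F.R21 (μ.compl₂ b.var) a.val l := by
  have h : (ArgString.cons F b (ArgString.nil (Λ := Λ) (X := X))).var ∘ₗ μ = μ.compl₂ b.var := by
    ext v w : 2
    simp [ArgString.cons, ArgString.nil]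
  rw [← h]
  rfl

end Variation

section YangMills

variable (A L 𝔤 : Type*) [CommRing A] [LieRing L] [Module A L] [LieRingModule L A]
  [LieRinehartRing A L] [Algebra ℝ A] [LieAlgebra ℝ L] [LieRinehartAlgebra ℝ A L]
  [LieRing 𝔤] [LieAlgebra ℝ 𝔤]

/-- The data entering the Lagrangian densities in dimension `d = n + 2`: a metric on vector fields,
the coefficient map of top degree forms relative to its volume form, an inner product on `𝔤`, a
Lie algebra of vector fields, and a Drinfel'd twist. -/
structure YMData (n : ℕ) where
  metric : L →ₗ[A] L →ₗ[A] A
  coeff : (L [⋀^Fin (n + 2)]→ₗ[A] A) →ₗ[A] A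
  Tr : 𝔤 →ₗ[ℝ] 𝔤 →ₗ[ℝ] ℝ
  𝔨 : LieSubalgebra ℝ L
  F : DrinfeldTwist 𝔨

variable {A L 𝔤} {n : ℕ} (Y : YMData A L 𝔤 n)

namespace YMData

/-- The Hodge operator on `𝔤`-valued forms. -/
noncomputable def hod {k l : ℕ} (h : k + l = n + 2) : GForm A L 𝔤 k →ₗ[ℝ] GForm A L 𝔤 l :=
  ghodge Y.metric Y.coeff h

/-- `[α, β]_⋆`. -/
noncomputable def brS {k l m : ℕ} (h : k + l = m) :
    FPS (GForm A L 𝔤 k) →ₗ[ℂ] FPS (GForm A L 𝔤 l) →ₗ[ℂ] FPS (GForm A L 𝔤 m) :=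
  starProd Y.F (gbr h)

/-- `Tr(α ∧_⋆ β)`. -/
noncomputable def trS {k l m : ℕ} (h : k + l = m) :
    FPS (GForm A L 𝔤 k) →ₗ[ℂ] FPS (GForm A L 𝔤 l) →ₗ[ℂ] FPS (L [⋀^Fin m]→ₗ[A] A) :=
  starProd Y.F (gtr Y.Tr h)

/-- The Hodge operator on `𝔤[[ħ]]`-valued forms. -/
noncomputable def hodS {k l : ℕ} (h : k + l = n + 2) :
    FPS (GForm A L 𝔤 k) →ₗ[ℂ] FPS (GForm A L 𝔤 l) := mapS (Y.hod h)

/-- `ℓ₁(A) = d ∗ d A`. -/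
noncomputable def ell1 : GForm A L 𝔤 1 →ₗ[ℝ] GForm A L 𝔤 (n + 1) :=
  gd rfl ∘ₗ Y.hod (k := 2) (l := n) (by omega) ∘ₗ gd rfl

/-- `ℓ₂(A₁, A₂) = - d ∗ [A₁, A₂] - [A₁, ∗ d A₂] + (-1)^d [∗ d A₁, A₂]`. -/
noncomputable def ell2 : GForm A L 𝔤 1 →ₗ[ℝ] GForm A L 𝔤 1 →ₗ[ℝ] GForm A L 𝔤 (n + 1) :=
  - (gbr (m := 2) rfl).compr₂ (gd rfl ∘ₗ Y.hod (k := 2) (l := n) (by omega))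
    - (gbr (by omega)).compl₂ (Y.hod (k := 2) (l := n) (by omega) ∘ₗ gd rfl)
    + (-1 : ℝ) ^ (n + 2) • (gbr rfl) ∘ₗ (Y.hod (k := 2) (l := n) (by omega) ∘ₗ gd rfl)

/-- `(A₁, A₂, A₃) ↦ [A₁, ∗ [A₂, A₃]]`. -/
noncomputable def nested :
    GForm A L 𝔤 1 →ₗ[ℝ] GForm A L 𝔤 1 →ₗ[ℝ] GForm A L 𝔤 1 →ₗ[ℝ] GForm A L 𝔤 (n + 1) where
  toFun A₁ := ((gbr (m := 2) rfl).compr₂ (Y.hod (k := 2) (l := n) (by omega))).compr₂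
    (gbr (by omega) A₁)
  map_add' A₁ A₁' := by
    ext A₂ A₃ : 2
    simp
  map_smul' t A₁ := by
    ext A₂ A₃ : 2
    simp

/-- `ℓ₃(A₁, A₂, A₃) = - [A₁, ∗ [A₂, A₃]] - [A₂, ∗ [A₁, A₃]] + (-1)^d [∗ [A₁, A₂], A₃]`. -/
noncomputable def ell3 :
    GForm A L 𝔤 1 →ₗ[ℝ] GForm A L 𝔤 1 →ₗ[ℝ] GForm A L 𝔤 1 →ₗ[ℝ] GForm A L 𝔤 (n + 1) :=
  - Y.nested - Y.nested.flip
    + (-1 : ℝ) ^ (n + 2) •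
      ((gbr (m := 2) rfl).compr₂ (Y.hod (k := 2) (l := n) (by omega))).compr₂ (gbr rfl)

/-- `ℓ₂⋆`. -/
noncomputable def ell2S : FPS (GForm A L 𝔤 1) →ₗ[ℂ] FPS (GForm A L 𝔤 1) →ₗ[ℂ]
    FPS (GForm A L 𝔤 (n + 1)) := starProd Y.F Y.ell2

/-- `A₁ ⊗_⋆ A₂`. -/
noncomputable def tensorS : FPS (GForm A L 𝔤 1) →ₗ[ℂ] FPS (GForm A L 𝔤 1) →ₗ[ℂ]
    FPS (GForm A L 𝔤 1 ⊗[ℝ] GForm A L 𝔤 1) :=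
  starProd Y.F (TensorProduct.mk ℝ (GForm A L 𝔤 1) (GForm A L 𝔤 1))

/-- `ℓ₃⋆` as a function of `A₁ ⊗_⋆ A₂` and `A₃`, so that
`ℓ₃⋆(A₁, A₂, A₃) = ℓ₃((A₁ ⊗_⋆ A₂) ⊗_⋆ A₃)`. -/
noncomputable def ell3S : FPS (GForm A L 𝔤 1 ⊗[ℝ] GForm A L 𝔤 1) →ₗ[ℂ] FPS (GForm A L 𝔤 1) →ₗ[ℂ]
    FPS (GForm A L 𝔤 (n + 1)) := starProd Y.F (TensorProduct.lift Y.ell3)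

/-- The gauge field `a`, with `δ_λ a = dλ - [λ, a]_⋆`. -/
noncomputable def field (a : FPS (GForm A L 𝔤 1)) : Obs (GForm A L 𝔤 0) (GForm A L 𝔤 1) where
  val := a
  var := mapS (gd rfl) - (Y.brS (k := 0) (l := 1) rfl).flip a

/-- `[a, a]_⋆`. -/
noncomputable def fieldSq (a : FPS (GForm A L 𝔤 1)) : Obs (GForm A L 𝔤 0) (GForm A L 𝔤 2) :=
  Obs.mul Y.F (Y.brS rfl) (Y.field a) (Y.field a)

/-- The braided curvature `da + ½ [a, a]_⋆`. -/
noncomputable def curv (a : FPS (GForm A L 𝔤 1)) : Obs (GForm A L 𝔤 0) (GForm A L 𝔤 2) :=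
  (Y.field a).map (gd rfl) + (1 / 2 : ℂ) • Y.fieldSq a

/-- `Tr(a ∧_⋆ ℓ₁(a))`. -/
noncomputable def mc1 (a : FPS (GForm A L 𝔤 1)) :
    Obs (GForm A L 𝔤 0) (L [⋀^Fin (n + 2)]→ₗ[A] A) :=
  Obs.mul Y.F (Y.trS (by omega)) (Y.field a) ((Y.field a).map Y.ell1)

/-- `Tr(a ∧_⋆ ℓ₂⋆(a, a))`. -/
noncomputable def mc2 (a : FPS (GForm A L 𝔤 1)) :
    Obs (GForm A L 𝔤 0) (L [⋀^Fin (n + 2)]→ₗ[A] A) :=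
  Obs.mul Y.F (Y.trS (by omega)) (Y.field a) (Obs.mul Y.F Y.ell2S (Y.field a) (Y.field a))

/-- `Tr(a ∧_⋆ ℓ₃⋆(a, a, a))`. -/
noncomputable def mc3 (a : FPS (GForm A L 𝔤 1)) :
    Obs (GForm A L 𝔤 0) (L [⋀^Fin (n + 2)]→ₗ[A] A) :=
  Obs.mul Y.F (Y.trS (by omega)) (Y.field a)
    (Obs.mul Y.F Y.ell3S (Obs.mul Y.F Y.tensorS (Y.field a) (Y.field a)) (Y.field a))

/-- `(α, β, γ) ↦ Tr([α, R_k γ]_⋆ ∧_⋆ ∗ R^k β)`. -/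
noncomputable def word3 : FPS (GForm A L 𝔤 1) →ₗ[ℂ] FPS (GForm A L 𝔤 2) →ₗ[ℂ]
    FPS (GForm A L 𝔤 1) →ₗ[ℂ] FPS (L [⋀^Fin (n + 2)]→ₗ[A] A) where
  toFun α := (sw Y.F.R21
    (((Y.trS (by omega)).compl₂ (Y.hodS (k := 2) (l := n) (by omega))) ∘ₗ
      Y.brS (m := 2) rfl α)).flip
  map_add' α α' := by
    rw [map_add, LinearMap.comp_add, map_add]
    rfl
  map_smul' t α := by
    rw [map_smul, LinearMap.comp_smul, map_smul]
    rfl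

/-- `(γ, β) ↦ Tr([α, R_k γ]_⋆ ∧_⋆ ∗ [R^k β, δ]_⋆)`. -/
noncomputable def word4Aux (α δ : FPS (GForm A L 𝔤 1)) : FPS (GForm A L 𝔤 1) →ₗ[ℂ]
    FPS (GForm A L 𝔤 1) →ₗ[ℂ] FPS (L [⋀^Fin (n + 2)]→ₗ[A] A) :=
  sw Y.F.R21 ((Y.trS (by omega)).compl₁₂ (Y.brS (m := 2) rfl α)
    (Y.hodS (k := 2) (l := n) (by omega) ∘ₗ (Y.brS (m := 2) rfl).flip δ))

theorem word4Aux_add_left (α α' δ : FPS (GForm A L 𝔤 1)) :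
    Y.word4Aux (α + α') δ = Y.word4Aux α δ + Y.word4Aux α' δ := by
  rw [word4Aux, word4Aux, word4Aux, ← map_add]
  congr 1
  exact LinearMap.ext₂ fun v w => by simp

theorem word4Aux_smul_left (t : ℂ) (α δ : FPS (GForm A L 𝔤 1)) :
    Y.word4Aux (t • α) δ = t • Y.word4Aux α δ := by
  rw [word4Aux, word4Aux, ← map_smul]
  congr 1
  exact LinearMap.ext₂ fun v w => by simp

theorem word4Aux_add_right (α δ δ' : FPS (GForm A L 𝔤 1)) :
    Y.word4Aux α (δ + δ') = Y.word4Aux α δ + Y.word4Aux α δ' := by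
  rw [word4Aux, word4Aux, word4Aux, ← map_add]
  congr 1
  exact LinearMap.ext₂ fun v w => by simp

theorem word4Aux_smul_right (t : ℂ) (α δ : FPS (GForm A L 𝔤 1)) :
    Y.word4Aux α (t • δ) = t • Y.word4Aux α δ := by
  rw [word4Aux, word4Aux, ← map_smul]
  congr 1
  exact LinearMap.ext₂ fun v w => by simp

/-- `(γ, δ) ↦ Tr([α, R_k γ]_⋆ ∧_⋆ ∗ [R^k β, δ]_⋆)`. -/
noncomputable def word4Right (α β : FPS (GForm A L 𝔤 1)) : FPS (GForm A L 𝔤 1) →ₗ[ℂ]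
    FPS (GForm A L 𝔤 1) →ₗ[ℂ] FPS (L [⋀^Fin (n + 2)]→ₗ[A] A) :=
  LinearMap.mk₂ ℂ (fun γ δ => Y.word4Aux α δ γ β)
    (fun γ γ' δ => by rw [map_add, LinearMap.add_apply])
    (fun t γ δ => by rw [map_smul, LinearMap.smul_apply])
    (fun γ δ δ' => by rw [word4Aux_add_right, LinearMap.add_apply, LinearMap.add_apply])
    (fun t γ δ => by rw [word4Aux_smul_right, LinearMap.smul_apply, LinearMap.smul_apply])

theorem word4Right_apply (α β γ δ : FPS (GForm A L 𝔤 1)) :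
    Y.word4Right α β γ δ = Y.word4Aux α δ γ β := rfl

/-- `(α, β, γ, δ) ↦ Tr([α, R_k γ]_⋆ ∧_⋆ ∗ [R^k β, δ]_⋆)`. -/
noncomputable def word4 : FPS (GForm A L 𝔤 1) →ₗ[ℂ] FPS (GForm A L 𝔤 1) →ₗ[ℂ]
    FPS (GForm A L 𝔤 1) →ₗ[ℂ] FPS (GForm A L 𝔤 1) →ₗ[ℂ] FPS (L [⋀^Fin (n + 2)]→ₗ[A] A) :=
  LinearMap.mk₂ ℂ (fun α β => Y.word4Right α β)
    (fun α α' β => LinearMap.ext₂ fun γ δ => by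
      simp only [LinearMap.add_apply, word4Right_apply, word4Aux_add_left])
    (fun t α β => LinearMap.ext₂ fun γ δ => by
      simp only [LinearMap.smul_apply, word4Right_apply, word4Aux_smul_left])
    (fun α β β' => LinearMap.ext₂ fun γ δ => by
      simp only [LinearMap.add_apply, word4Right_apply, map_add])
    (fun t α β => LinearMap.ext₂ fun γ δ => by
      simp only [LinearMap.smul_apply, word4Right_apply, map_smul])

/-- `Tr(F ∧_⋆ ∗ F)` for the braided curvature `F` of `a`. -/
noncomputable def ymTerm (a : FPS (GForm A L 𝔤 1)) :
    Obs (GForm A L 𝔤 0) (L [⋀^Fin (n + 2)]→ₗ[A] A) :=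
  Obs.mul Y.F (Y.trS (by omega)) (Y.curv a) ((Y.curv a).map (Y.hod (l := n) (by omega)))

/-- `Tr([a, R_k a]_⋆ ∧_⋆ ∗ R^k b)` for a `2`-form expression `b`, as the image of the string
`a, b, a`. -/
noncomputable def braidTerm (a : FPS (GForm A L 𝔤 1))
    (b : Obs (GForm A L 𝔤 0) (GForm A L 𝔤 2)) :
    Obs (GForm A L 𝔤 0) (L [⋀^Fin (n + 2)]→ₗ[A] A) :=
  (ArgString.cons Y.F (Y.field a) (ArgString.cons Y.F b
    (ArgString.cons Y.F (Y.field a) ArgString.nil))).apply Y.word3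

/-- `Tr([a, R_k a]_⋆ ∧_⋆ ∗ [R^k a, a]_⋆)`, as the image of the string `a, a, a, a`. -/
noncomputable def quarticTerm (a : FPS (GForm A L 𝔤 1)) :
    Obs (GForm A L 𝔤 0) (L [⋀^Fin (n + 2)]→ₗ[A] A) :=
  (ArgString.cons Y.F (Y.field a) (ArgString.cons Y.F (Y.field a)
    (ArgString.cons Y.F (Y.field a) (ArgString.cons Y.F (Y.field a) ArgString.nil)))).apply
    Y.word4

/-- The integrand of the explicit form of the action for a general twist:
`½ Tr(F ∧_⋆ ∗F) + (1/6) Tr([a, R_k a]_⋆ ∧_⋆ ∗ R^k F)`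
`- (1/12) (Tr(F ∧_⋆ ∗[a, a]_⋆) + Tr(∗[a, a]_⋆ ∧_⋆ F))`
`+ (1/24) (Tr([a, R_k a]_⋆ ∧_⋆ ∗[R^k a, a]_⋆) - Tr([a, R_k a]_⋆ ∧_⋆ ∗ R^k [a, a]_⋆))`. -/
noncomputable def ymDensity (a : FPS (GForm A L 𝔤 1)) :
    Obs (GForm A L 𝔤 0) (L [⋀^Fin (n + 2)]→ₗ[A] A) :=
  (1 / 2 : ℂ) • Y.ymTerm a + (1 / 6 : ℂ) • Y.braidTerm a (Y.curv a)
  + (-1 / 12 : ℂ) •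
    (Obs.mul Y.F (Y.trS (by omega)) (Y.curv a) ((Y.fieldSq a).map (Y.hod (l := n) (by omega)))
      + Obs.mul Y.F (Y.trS (by omega)) ((Y.fieldSq a).map (Y.hod (l := n) (by omega))) (Y.curv a))
  + (1 / 24 : ℂ) • (Y.quarticTerm a + (-1 : ℂ) • Y.braidTerm a (Y.fieldSq a))

end YMData

end YangMills

section VectorFields

open scoped Manifold ContDiff Topology

/-- Smooth real functions. -/
abbrev Fn (E M : Type*) [NormedAddCommGroup E] [NormedSpace ℝ E] [TopologicalSpace M]
    [ChartedSpace E M] : Type _ := C^∞⟮𝓘(ℝ, E), M; 𝓘(ℝ, ℝ), ℝ⟯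

/-- Smooth vector fields. -/
abbrev VF (E M : Type*) [NormedAddCommGroup E] [NormedSpace ℝ E] [TopologicalSpace M]
    [ChartedSpace E M] [IsManifold 𝓘(ℝ, E) ∞ M] : Type _ :=
  Cₛ^∞⟮𝓘(ℝ, E); E, (TangentSpace 𝓘(ℝ, E) : M → Type _)⟯

variable {E M : Type*} [NormedAddCommGroup E] [NormedSpace ℝ E] [TopologicalSpace M]
  [ChartedSpace E M] [IsManifold 𝓘(ℝ, E) ∞ M]

noncomputable instance : SMul (Fn E M) (VF E M) :=
  ⟨fun f X => ⟨fun x => f x • X x, f.contMDiff.smul_section X.contMDiff⟩⟩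

theorem VF.smul_apply (f : Fn E M) (X : VF E M) (x : M) : (f • X) x = f x • X x := rfl

theorem VF.coe_smul (f : Fn E M) (X : VF E M) : ⇑(f • X) = (f : M → ℝ) • ⇑X := rfl

noncomputable instance : Module (Fn E M) (VF E M) where
  one_smul X := by ext x; exact one_smul ℝ (X x)
  mul_smul f g X := by ext x; exact mul_smul (f x) (g x) (X x)
  smul_zero f := by ext x; exact smul_zero (f x)
  smul_add f X Y := by ext x; exact smul_add (f x) (X x) (Y x)
  add_smul f g X := by ext x; exact add_smul (f x) (g x) (X x)
  zero_smul X := by ext x; exact zero_smul ℝ (X x)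

instance : IsScalarTower ℝ (Fn E M) (VF E M) where
  smul_assoc t f X := by ext x; exact smul_assoc t (f x) (X x)

theorem VF.contMDiffAt' (X : VF E M) (k : ℕ∞) (x : M) :
    CMDiffAt k (T% (X : ∀ x : M, TangentSpace 𝓘(ℝ, E) x)) x :=
  (X.contMDiff x).of_le (by exact_mod_cast le_top)

theorem VF.mdifferentiableAt' (X : VF E M) (x : M) :
    MDiffAt (T% (X : ∀ x : M, TangentSpace 𝓘(ℝ, E) x)) x :=
  X.mdifferentiableAt

theorem Fn.mdifferentiableAt' (f : Fn E M) (x : M) : MDiffAt (f : M → ℝ) x :=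
  f.contMDiff.mdifferentiable (by simp) x

/-- The derivative of a function along a vector field. -/
noncomputable instance : Bracket (VF E M) (Fn E M) :=
  ⟨fun X f => ⟨fun x => mvfderiv 𝓘(ℝ, E) f x (X x), by
    have h := (f.contMDiff.contMDiff_tangentMap (m := ∞) (by simp)).comp X.contMDiff
    exact (contMDiff_snd_tangentBundle_modelSpace ℝ 𝓘(ℝ, ℝ)).comp h⟩⟩

theorem VF.lie_fn_apply (X : VF E M) (f : Fn E M) (x : M) :
    ⁅X, f⁆ x = mvfderiv 𝓘(ℝ, E) f x (X x) := rfl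

variable (E M) in
theorem isManifold_minSmoothness (k : ℕ) : IsManifold 𝓘(ℝ, E) (minSmoothness ℝ k) M := by
  rw [minSmoothness_of_isRCLikeNormedField]
  exact IsManifold.of_le (n := ∞) (by exact_mod_cast (le_top : (k : ℕ∞) ≤ ⊤))

variable [CompleteSpace E]

/-- The Lie bracket of vector fields. -/
noncomputable instance : Bracket (VF E M) (VF E M) :=
  ⟨fun X Y => ⟨VectorField.mlieBracket 𝓘(ℝ, E) X Y, fun x => by
    have : IsManifold 𝓘(ℝ, E) (((⊤ : ℕ∞) : WithTop ℕ∞) + 1) M := by simpa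
    have := isManifold_minSmoothness E M 2
    exact (ContMDiffAt.mlieBracket_vectorField (m := ⊤) (n := ⊤) (X.contMDiff x)
      (Y.contMDiff x) (by simp [minSmoothness_of_isRCLikeNormedField]))⟩⟩

theorem VF.lie_apply (X Y : VF E M) (x : M) :
    ⁅X, Y⁆ x = VectorField.mlieBracket 𝓘(ℝ, E) X Y x := rfl

theorem mlieBracket_leibniz {U V W : ∀ x : M, TangentSpace 𝓘(ℝ, E) x} {x : M}
    (hU : CMDiffAt 2 (T% U) x) (hV : CMDiffAt 2 (T% V) x) (hW : CMDiffAt 2 (T% W) x) :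
    VectorField.mlieBracket 𝓘(ℝ, E) U (VectorField.mlieBracket 𝓘(ℝ, E) V W) x =
      VectorField.mlieBracket 𝓘(ℝ, E) (VectorField.mlieBracket 𝓘(ℝ, E) U V) W x +
      VectorField.mlieBracket 𝓘(ℝ, E) V (VectorField.mlieBracket 𝓘(ℝ, E) U W) x := by
  have := isManifold_minSmoothness E M 3
  have h2 : minSmoothness ℝ 2 = 2 := minSmoothness_of_isRCLikeNormedField
  exact VectorField.leibniz_identity_mlieBracket_apply (by rwa [h2]) (by rwa [h2]) (by rwa [h2])

noncomputable instance : LieRing (VF E M) where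
  add_lie X Y Z := by
    ext x
    exact VectorField.mlieBracket_add_left (X.mdifferentiableAt' x) (Y.mdifferentiableAt' x)
  lie_add X Y Z := by
    ext x
    exact VectorField.mlieBracket_add_right (Y.mdifferentiableAt' x) (Z.mdifferentiableAt' x)
  lie_self X := by
    ext x
    rw [VF.lie_apply, VectorField.mlieBracket_self]
    rfl
  leibniz_lie X Y Z := by
    ext x
    exact mlieBracket_leibniz (X.contMDiffAt' 2 x) (Y.contMDiffAt' 2 x) (Z.contMDiffAt' 2 x)

noncomputable instance : LieAlgebra ℝ (VF E M) where
  lie_smul t X Y := by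
    ext x
    exact VectorField.mlieBracket_const_smul_right (Y.mdifferentiableAt' x)

variable [Nontrivial E]

theorem VF.lie_lie_fn (X Y : VF E M) (f : Fn E M) (x : M) :
    ⁅X, ⁅Y, f⁆⁆ x = ⁅⁅X, Y⁆, f⁆ x + ⁅Y, ⁅X, f⁆⁆ x := by
  obtain ⟨v, hv⟩ : ∃ v : TangentSpace 𝓘(ℝ, E) x, v ≠ 0 := exists_ne (0 : E)
  set Z : ∀ y : M, TangentSpace 𝓘(ℝ, E) y := FiberBundle.extend E v with hZ
  have hZx : Z x = v := FiberBundle.extend_apply_self E v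
  have hZs : CMDiffAt 2 (T% Z) x := FiberBundle.contMDiffAt_extend 𝓘(ℝ, E) E v
  have hZe : ∀ᶠ y in 𝓝 x, MDiffAt (T% Z) y := by
    obtain ⟨s, hs, h⟩ := FiberBundle.exists_mdifferentiableOn_extend 𝓘(ℝ, E) E v
    filter_upwards [eventually_mem_nhds_iff.mpr hs] with y hy
    exact (h y (mem_of_mem_nhds hy)).mdifferentiableAt hy
  have hbr : ∀ U : VF E M, CMDiffAt 1 (T% (VectorField.mlieBracket 𝓘(ℝ, E) U Z)) x := by
    intro U
    have := isManifold_minSmoothness E M 2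
    have : IsManifold 𝓘(ℝ, E) (((2 : ℕ∞) : WithTop ℕ∞) + 1) M :=
      IsManifold.of_le (n := ∞) (by exact_mod_cast (le_top : (3 : ℕ∞) ≤ ⊤))
    exact ContMDiffAt.mlieBracket_vectorField (m := 1) (n := 2) (U.contMDiffAt' 2 x) hZs
      (by rw [minSmoothness_of_isRCLikeNormedField]; rfl)
  have hder : ∀ (U : VF E M) (g : Fn E M),
      VectorField.mlieBracket 𝓘(ℝ, E) U ((g : M → ℝ) • Z) =ᶠ[𝓝 x]
        (⇑⁅U, g⁆ : M → ℝ) • Z + (g : M → ℝ) • VectorField.mlieBracket 𝓘(ℝ, E) U Z := by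
    intro U g
    filter_upwards [hZe] with y hy
    exact VectorField.mlieBracket_smul_right (g.mdifferentiableAt' y) hy
  have hsm : ∀ (g : Fn E M) {k : ℕ∞} (W : ∀ y : M, TangentSpace 𝓘(ℝ, E) y),
      CMDiffAt k (T% W) x → CMDiffAt k (T% ((g : M → ℝ) • W)) x := by
    intro g k W hW
    exact ((g.contMDiff x).of_le (by exact_mod_cast le_top)).smul_section hW
  have hcomp : ∀ (U V : VF E M), VectorField.mlieBracket 𝓘(ℝ, E) U
      (VectorField.mlieBracket 𝓘(ℝ, E) V ((f : M → ℝ) • Z)) x =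
      ⁅U, ⁅V, f⁆⁆ x • Z x + ⁅V, f⁆ x • VectorField.mlieBracket 𝓘(ℝ, E) U Z x +
      (⁅U, f⁆ x • VectorField.mlieBracket 𝓘(ℝ, E) V Z x +
        f x • VectorField.mlieBracket 𝓘(ℝ, E) U (VectorField.mlieBracket 𝓘(ℝ, E) V Z) x) := by
    intro U V
    rw [(Filter.EventuallyEq.refl (𝓝 x) (U : ∀ y : M, TangentSpace 𝓘(ℝ, E) y)).mlieBracket_vectorField_eq
      (hder V f), VectorField.mlieBracket_add_right, VectorField.mlieBracket_smul_right,
      VectorField.mlieBracket_smul_right]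
    · rfl
    · exact f.mdifferentiableAt' x
    · exact (hbr V).mdifferentiableAt one_ne_zero
    · exact ⁅V, f⁆.mdifferentiableAt' x
    · exact hZs.mdifferentiableAt two_ne_zero
    · exact (hsm ⁅V, f⁆ _ (hZs.of_le one_le_two)).mdifferentiableAt one_ne_zero
    · exact (hsm f _ (hbr V)).mdifferentiableAt one_ne_zero
  have hJ := mlieBracket_leibniz (X.contMDiffAt' 2 x) (Y.contMDiffAt' 2 x)
    (hsm f (k := 2) Z hZs)
  have hJ' := mlieBracket_leibniz (X.contMDiffAt' 2 x) (Y.contMDiffAt' 2 x) hZs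
  rw [hcomp, hcomp] at hJ
  have hb : VectorField.mlieBracket 𝓘(ℝ, E) (VectorField.mlieBracket 𝓘(ℝ, E) X Y)
      ((f : M → ℝ) • Z) x = _ := (hder ⁅X, Y⁆ f).self_of_nhds
  rw [hb, hJ'] at hJ
  have : (⁅X, ⁅Y, f⁆⁆ x - (⁅⁅X, Y⁆, f⁆ x + ⁅Y, ⁅X, f⁆⁆ x)) • v = 0 := by
    rw [← hZx]
    simp only [Pi.add_apply, Pi.smul_apply', smul_add] at hJ
    have hc : (⇑⁅X, Y⁆ : ∀ y : M, TangentSpace 𝓘(ℝ, E) y) =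
      VectorField.mlieBracket 𝓘(ℝ, E) X Y := rfl
    rw [hc] at hJ
    rw [sub_smul, add_smul, sub_eq_zero]
    have hJ2 := sub_eq_zero.mpr hJ
    rw [← sub_eq_zero, ← hJ2]
    abel
  rcases smul_eq_zero.mp this with h | h
  · exact sub_eq_zero.mp h
  · exact absurd h hv

noncomputable instance : LieRingModule (VF E M) (Fn E M) where
  add_lie X Y f := by
    ext x
    exact map_add (mvfderiv 𝓘(ℝ, E) f x) (X x) (Y x)
  lie_add X f g := by
    ext x
    have h := mvfderiv_add (f.mdifferentiableAt' x) (g.mdifferentiableAt' x)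
    exact congrArg (fun φ => φ (X x)) h
  leibniz_lie X Y f := by
    ext x
    exact VF.lie_lie_fn X Y f x

instance : LieRinehartRing (Fn E M) (VF E M) where
  lie_smul_eq_mul' f g X := by
    ext x
    exact map_smul (mvfderiv 𝓘(ℝ, E) g x) (f x) (X x)
  leibniz_mul_right' X f g := by
    ext x
    have h := mvfderiv_mul (f.mdifferentiableAt' x) (g.mdifferentiableAt' x)
    refine (congrArg (fun φ => φ (X x)) h).trans ?_
    change f x * _ + g x * _ = f x * ⁅X, g⁆ x + ⁅X, f⁆ x * g x
    rw [mul_comm (g x)]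
    rfl
  leibniz_smul_right' X Y f := by
    ext x
    have h := VectorField.mlieBracket_smul_right (V := X) (f.mdifferentiableAt' x)
      (Y.mdifferentiableAt' x)
    exact h.trans (add_comm _ _)

instance : LieRinehartAlgebra ℝ (Fn E M) (VF E M) where
  smul_lie t X f := by
    ext x
    exact map_smul (mvfderiv 𝓘(ℝ, E) f x) t (X x)
  lie_smul t X f := by
    ext x
    have h := mvfderiv_smul (mdifferentiableAt_const (c := t)) (f.mdifferentiableAt' x)
    refine (congrArg (fun φ => φ (X x)) h).trans ?_
    simp [mvfderiv_const, VF.lie_fn_apply]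

end VectorFields

section Geometry

open scoped Manifold ContDiff
open MeasureTheory

/-- The model space of dimension `d = n + 2`. -/
abbrev Mdl (n : ℕ) : Type := EuclideanSpace ℝ (Fin (n + 2))

/-- A Lorentzian metric, of signature `(-, +, …, +)`. -/
structure LorentzMetric (n : ℕ) (M : Type*) [TopologicalSpace M] [ChartedSpace (Mdl n) M]
    [IsManifold 𝓘(ℝ, Mdl n) ∞ M] where
  g : ∀ x : M, TangentSpace 𝓘(ℝ, Mdl n) x →ₗ[ℝ] TangentSpace 𝓘(ℝ, Mdl n) x →ₗ[ℝ] ℝ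
  smooth : ∀ X Y : VF (Mdl n) M,
    ContMDiff 𝓘(ℝ, Mdl n) 𝓘(ℝ, ℝ) ∞ fun x => g x (X x) (Y x)
  symm : ∀ x v w, g x v w = g x w v
  lorentzian : ∀ x, ∃ t, g x t t < 0 ∧ ∀ v, g x t v = 0 → v ≠ 0 → 0 < g x v v

variable {n : ℕ} {M : Type*} [TopologicalSpace M] [ChartedSpace (Mdl n) M]
  [IsManifold 𝓘(ℝ, Mdl n) ∞ M]

/-- The metric as a `C^∞(M)`-bilinear form on vector fields. -/
noncomputable def LorentzMetric.onFields (g : LorentzMetric n M) :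
    VF (Mdl n) M →ₗ[Fn (Mdl n) M] VF (Mdl n) M →ₗ[Fn (Mdl n) M] Fn (Mdl n) M :=
  LinearMap.mk₂ _ (fun X Y => ⟨fun x => g.g x (X x) (Y x), g.smooth X Y⟩)
    (fun X X' Y => by ext x; exact LinearMap.map_add₂ (g.g x) (X x) (X' x) (Y x))
    (fun f X Y => by ext x; exact LinearMap.map_smul₂ (g.g x) (f x) (X x) (Y x))
    (fun X Y Y' => by ext x; exact map_add (g.g x (X x)) (Y x) (Y' x))
    (fun f X Y => by ext x; exact map_smul (g.g x (X x)) (f x) (Y x))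

/-- A Killing vector field: `L_ξ g = 0`. -/
def LorentzMetric.IsKilling (g : LorentzMetric n M) (ξ : VF (Mdl n) M) : Prop :=
  ∀ X Y : VF (Mdl n) M,
    ⁅ξ, g.onFields X Y⁆ = g.onFields ⁅ξ, X⁆ Y + g.onFields X ⁅ξ, Y⁆

/-- The volume form of `g` for a choice of orientation: a top degree form `vol` that generates the
`C^∞(M)`-module of top degree forms (it vanishes nowhere), normalised by
`vol(X₁, …, X_d)² = |det (g(X_i, X_j))| = - det (g(X_i, X_j))`. -/
structure LorentzMetric.VolumeForm (g : LorentzMetric n M) where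
  vol : VF (Mdl n) M [⋀^Fin (n + 2)]→ₗ[Fn (Mdl n) M] Fn (Mdl n) M
  generates : Function.Bijective fun f : Fn (Mdl n) M => f • vol
  normalized : ∀ X : Fin (n + 2) → VF (Mdl n) M,
    vol X ^ 2 = - (Matrix.of fun i j => g.onFields (X i) (X j)).det

/-- The coefficient map `f vol ↦ f` of top degree forms. -/
noncomputable def LorentzMetric.VolumeForm.coeff {g : LorentzMetric n M} (v : g.VolumeForm) :
    (VF (Mdl n) M [⋀^Fin (n + 2)]→ₗ[Fn (Mdl n) M] Fn (Mdl n) M) →ₗ[Fn (Mdl n) M] Fn (Mdl n) M :=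
  (LinearEquiv.ofBijective (LinearMap.toSpanSingleton (Fn (Mdl n) M) _ v.vol)
    v.generates).symm.toLinearMap

/-- The density `√|det (g_ij)|` in a chart. -/
noncomputable def LorentzMetric.chartDensity (g : LorentzMetric n M)
    (e : OpenPartialHomeomorph M (Mdl n)) (y : Mdl n) : ℝ :=
  Real.sqrt |(Matrix.of fun i j : Fin (n + 2) => g.g (e.symm y)
    (mfderiv 𝓘(ℝ, Mdl n) 𝓘(ℝ, Mdl n) e.symm y (EuclideanSpace.single i 1 : Mdl n))
    (mfderiv 𝓘(ℝ, Mdl n) 𝓘(ℝ, Mdl n) e.symm y (EuclideanSpace.single j 1 : Mdl n))).det|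

/-- The volume measure of `g`, given by `√|det (g_ij)| dx` in every chart of the atlas. The chart
expressions agree on overlaps, so the measure is their supremum. -/
noncomputable def LorentzMetric.measure [MeasurableSpace M] (g : LorentzMetric n M) : Measure M :=
  ⨆ e ∈ atlas (Mdl n) M, Measure.map e.symm
    ((volume.restrict e.target).withDensity fun y => ENNReal.ofReal (g.chartDensity e y))

variable {g : LorentzMetric n M}

/-- `∫_M α` in `ℂ[[ħ]]` for `α` in `Ω^d(M)[[ħ]]`. -/
noncomputable def LorentzMetric.VolumeForm.integral [MeasurableSpace M] (v : g.VolumeForm)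
    (α : FPS (VF (Mdl n) M [⋀^Fin (n + 2)]→ₗ[Fn (Mdl n) M] Fn (Mdl n) M)) : ℕ → ℂ := fun m =>
  ∫ x, (LinearMap.liftBaseChange ℂ (N := ℂ)
    { toFun := fun β => ((v.coeff β x : ℝ) : ℂ)
      map_add' := fun β γ => by rw [map_add]; exact Complex.ofReal_add _ _
      map_smul' := fun t β => by
        rw [LinearMap.map_smul_of_tower]
        exact Complex.ofReal_mul t _ }) (α m) ∂g.measure

variable {𝔤 : Type*} [LieRing 𝔤] [LieAlgebra ℝ 𝔤]

variable (n M) in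
/-- Compactly supported forms. -/
def cptForms (k : ℕ) : Submodule ℝ (VF (Mdl n) M [⋀^Fin k]→ₗ[Fn (Mdl n) M] Fn (Mdl n) M) where
  carrier := {α | ∃ K : Set M, IsCompact K ∧ ∀ X, ∀ x ∉ K, α X x = 0}
  add_mem' := by
    rintro α β ⟨K, hK, h⟩ ⟨K', hK', h'⟩
    refine ⟨K ∪ K', hK.union hK', fun X x hx => ?_⟩
    rw [Set.mem_union, not_or] at hx
    change α X x + β X x = 0
    rw [h X x hx.1, h' X x hx.2, add_zero]
  zero_mem' := ⟨∅, isCompact_empty, fun _ _ _ => rfl⟩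
  smul_mem' := by
    rintro t α ⟨K, hK, h⟩
    refine ⟨K, hK, fun X x hx => ?_⟩
    change t * α X x = 0
    rw [h X x hx, mul_zero]

variable (n M 𝔤) in
/-- Compactly supported `𝔤`-valued forms. -/
noncomputable def cptGForms (k : ℕ) :
    Submodule ℝ (GForm (Fn (Mdl n) M) (VF (Mdl n) M) 𝔤 k) :=
  LinearMap.range ((cptForms n M k).subtype.rTensor 𝔤)

/-- Elements of `Ω^k(M, 𝔤)[[ħ]]` with compactly supported coefficients. -/
def IsCpt {k : ℕ} (a : FPS (GForm (Fn (Mdl n) M) (VF (Mdl n) M) 𝔤 k)) : Prop :=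
  ∀ m, a m ∈ (cptGForms n M 𝔤 k).baseChange ℂ

end Geometry

section BraidedYangMills

open scoped Manifold ContDiff

/-- Braided Yang-Mills theory on an oriented Lorentzian manifold of dimension `n + 2`: an
inner product on the Lie algebra `𝔤`, a Lie algebra `𝔨` of vector fields, and a twist. -/
structure BraidedYM {n : ℕ} {M : Type*} [TopologicalSpace M] [ChartedSpace (Mdl n) M]
    [IsManifold 𝓘(ℝ, Mdl n) ∞ M] {g : LorentzMetric n M} (v : g.VolumeForm)
    (𝔤 : Type*) [LieRing 𝔤] [LieAlgebra ℝ 𝔤] where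
  Tr : 𝔤 →ₗ[ℝ] 𝔤 →ₗ[ℝ] ℝ
  𝔨 : LieSubalgebra ℝ (VF (Mdl n) M)
  F : DrinfeldTwist 𝔨

variable {n : ℕ} {M : Type*} [TopologicalSpace M] [ChartedSpace (Mdl n) M]
  [IsManifold 𝓘(ℝ, Mdl n) ∞ M] [MeasurableSpace M] {g : LorentzMetric n M} {v : g.VolumeForm}
  {𝔤 : Type*} [LieRing 𝔤] [LieAlgebra ℝ 𝔤]

namespace BraidedYM

/-- The data defining the Lagrangian densities. -/
noncomputable def data (T : BraidedYM v 𝔤) :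
    YMData (Fn (Mdl n) M) (VF (Mdl n) M) 𝔤 n where
  metric := g.onFields
  coeff := v.coeff
  Tr := T.Tr
  𝔨 := T.𝔨
  F := T.F

/-- The braided Maurer-Cartan functional
`S_⋆(a) = ½⟨a, ℓ₁(a)⟩_⋆ - (1/6)⟨a, ℓ₂⋆(a, a)⟩_⋆ - (1/24)⟨a, ℓ₃⋆(a, a, a)⟩_⋆`. -/
noncomputable def action (T : BraidedYM v 𝔤)
    (a : FPS (GForm (Fn (Mdl n) M) (VF (Mdl n) M) 𝔤 1)) : ℕ → ℂ :=
  (1 / 2 : ℂ) • v.integral (T.data.mc1 a).val - (1 / 6 : ℂ) • v.integral (T.data.mc2 a).val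
    - (1 / 24 : ℂ) • v.integral (T.data.mc3 a).val

/-- The braided gauge variation `δ_λ S_⋆(a)`. -/
noncomputable def actionVar (T : BraidedYM v 𝔤)
    (a : FPS (GForm (Fn (Mdl n) M) (VF (Mdl n) M) 𝔤 1))
    (l : FPS (GForm (Fn (Mdl n) M) (VF (Mdl n) M) 𝔤 0)) : ℕ → ℂ :=
  (1 / 2 : ℂ) • v.integral ((T.data.mc1 a).var l) - (1 / 6 : ℂ) • v.integral ((T.data.mc2 a).var l)
    - (1 / 24 : ℂ) • v.integral ((T.data.mc3 a).var l)

/-- For a pairing `⟨x, y⟩ = ∫ b(x, y)` of `𝔤`-valued forms,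
`⟨x, y⟩_⋆ = ⟨R_k x, R^k y⟩_⋆ = ⟨y, x⟩_⋆`, where `⟨y, x⟩ := ⟨x, y⟩` classically. -/
def CompatiblePairing (T : BraidedYM v 𝔤) {k l : ℕ}
    (b : GForm (Fn (Mdl n) M) (VF (Mdl n) M) 𝔤 k →ₗ[ℝ]
      GForm (Fn (Mdl n) M) (VF (Mdl n) M) 𝔤 l →ₗ[ℝ]
      (VF (Mdl n) M [⋀^Fin (n + 2)]→ₗ[Fn (Mdl n) M] Fn (Mdl n) M)) : Prop :=
  ∀ x y, IsCpt x → IsCpt y →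
    v.integral (starProd T.F b x y) = v.integral (sw T.F.R21 (starProd T.F b) x y) ∧
    v.integral (sw T.F.R21 (starProd T.F b) x y) = v.integral (starProd T.F b.flip y x)

/-- Compatibility of the twist with the cyclic structure, for the pairings between `V¹` and `V²` and
between `V⁰` and `V³`, in both orders (the other pairings vanish; the sign
`(-1)^{|x||y|}` is `1` in all these cases). -/
def IsCompatible (T : BraidedYM v 𝔤) : Prop :=
  T.CompatiblePairing (gtr T.Tr (show 1 + (n + 1) = n + 2 by omega)) ∧
  T.CompatiblePairing (gtr T.Tr (show 1 + (n + 1) = n + 2 by omega)).flip ∧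
  T.CompatiblePairing (gtr T.Tr (show 0 + (n + 2) = n + 2 by omega)) ∧
  T.CompatiblePairing (gtr T.Tr (show 0 + (n + 2) = n + 2 by omega)).flip

end BraidedYM

end BraidedYangMills

open scoped Manifold ContDiff

/-! ### The exterior product: permutation sums and contraction -/

section WedgeContraction

variable {A L : Type*} [CommRing A] [LieRing L] [Module A L] [LieRingModule L A]
  [LieRinehartRing A L] [Algebra ℝ A] [LieAlgebra ℝ L] [LieRinehartAlgebra ℝ A L]

/-! The twist enters only through v ⊗⋆ w = F⁻¹(v ⊗ w), and the proof confines it there. Every star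
product is a classical linear map applied after ⊗⋆ (`starProd_eq`), and ⊗⋆ has three properties. It
is natural under invariant maps (`starTensor_mapS`), because F⁻¹ acts through U𝔨. It is associative
(`starTensor_assoc`), by the cocycle condition. It is braided commutative (`sw_R21_starTensor`),
because F⁻¹R₂₁ = F₂₁⁻¹; an inserted R-matrix therefore amounts to a classical permutation of
factors. The maps d, ∗ and the brackets are 𝔨-invariant (for ∗ this is where the Killing condition
is used). Hence every term of either form of the action is the image of one of the ordered powers a
⊗⋆ a, a ⊗⋆ (a ⊗⋆ a), a ⊗⋆ (a ⊗⋆ (a ⊗⋆ a)) under a classical linear map.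

For (1), let `ym2`, `ym3`, `ym4` be the symmetric multilinear maps polarising the homogeneous parts
of ½Tr(F ∧ ∗F). The explicit density is their sum on the ordered powers of a, with no integration
needed (`IsRegular.ymDensity_eq`). The Maurer-Cartan density is the same sum up to exact forms
(`IsRegular.mc1_eq`, `IsRegular.mc2_eq`, `IsRegular.mc3_eq`), by Leibniz and the invariance of Tr.
Stokes' theorem (`integral_extDer`) removes the exact forms, since the coefficients of a have
compact support.

For (2), an `Obs` carries a value together with its braided variation, and all the factorisations
above are proved for both. Associativity of products of such expressions needs a hexagon identity
for the variation (`Obs.mul_assoc`). The variation of a power of a is then a classical map on λ ⊗⋆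
(one power lower), which inserts dλ, minus a classical map on λ ⊗⋆ (the same power), which rotates
each factor by [λ, -] (`field2_var`, `field3_var`, `field4_var`). Invariance reduces to four
classical identities, one for each power of a: `ym2_shift`, `IsRegular.ym3_shift`,
`IsRegular.ym4_shift`, `IsRegular.ym4_rot`. They express d² = 0, Leibniz, Jacobi and the invariance
of Tr. The variation of the explicit density vanishes even before integration; for the Maurer-Cartan
form the exact terms are removed by Stokes, as each of them keeps a compactly supported factor.

For (3), compatibility makes the integrated star pairing symmetric. Carrying one factor a around the
pairing turns the braided terms into unbraided ones (`IsRegular.integral_innerMid`) and, with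
Stokes, identifies the two mixed cubic terms (`IsRegular.integral_cubic_symm`). The cubic
corrections then cancel and the quartic ones leave the coefficient -1/24 (`integral_combination`).

The geometric input is the invariance and symmetry of ∗ on 2-forms, checked pointwise in frames
(`IsVolume.lie_hodge`, `IsVolume.wedge_hodge_symm`), and Stokes' theorem. The latter uses that the
supremum of the chart measures restricts to each of them (`LorentzMetric.measure_restrict_source`)
and that dψ is a divergence in coordinates. -/

/-- The exterior product as a sum over all permutations. -/
theorem factorial_smul_wedge_apply {k l m : ℕ} (h : k + l = m) (α : L [⋀^Fin k]→ₗ[A] A)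
    (β : L [⋀^Fin l]→ₗ[A] A) (X : Fin m → L) :
    (k.factorial * l.factorial) • wedge h α β X =
      ∑ σ : Equiv.Perm (Fin m), Equiv.Perm.sign σ •
        (α (fun i => X (σ (Fin.cast h (Fin.castAdd l i)))) *
          β (fun j => X (σ (Fin.cast h (Fin.natAdd k j))))) := by
  have h1 := congrArg (fun ψ => LinearMap.mul' A A (ψ (X ∘ finSumFinEquiv.trans (finCongr h))))
    (MultilinearMap.domCoprod_alternization_eq α β)
  simp only [Fintype.card_fin] at h1
  have h2 : (k.factorial * l.factorial) • wedge h α β X =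
      LinearMap.mul' A A (((k.factorial * l.factorial) • α.domCoprod β)
        (X ∘ finSumFinEquiv.trans (finCongr h))) := by
    rw [AlternatingMap.smul_apply, map_nsmul]
    rfl
  rw [h2, ← h1, MultilinearMap.alternatization_apply, map_sum]
  refine Fintype.sum_equiv (finSumFinEquiv.trans (finCongr h)).permCongr _ _ fun σ => ?_
  rw [Equiv.Perm.sign_permCongr]
  simp only [MultilinearMap.domDomCongr_apply, Units.smul_def,
    map_zsmul, MultilinearMap.domCoprod_apply, LinearMap.mul'_apply, Function.comp_def]
  congr 1
  congr 1
  · change α _ = α _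
    congr 1
    ext i
    simp [Equiv.permCongr_apply]
  · change β _ = β _
    congr 1
    ext i
    simp [Equiv.permCongr_apply]

/-- The permutation of `Fin (m + 1)` that maps `p` to `0` and acts as `τ` on the rest. -/
def Equiv.Perm.insertZero {m : ℕ} (x : Fin (m + 1) × Equiv.Perm (Fin m)) :
    Equiv.Perm (Fin (m + 1)) :=
  x.1.cycleRange.trans (Equiv.Perm.decomposeFin.symm (0, x.2))

theorem Equiv.Perm.insertZero_self {m : ℕ} (x : Fin (m + 1) × Equiv.Perm (Fin m)) :
    Equiv.Perm.insertZero x x.1 = 0 := by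
  simp [Equiv.Perm.insertZero]

theorem Equiv.Perm.insertZero_succAbove {m : ℕ} (x : Fin (m + 1) × Equiv.Perm (Fin m))
    (j : Fin m) : Equiv.Perm.insertZero x (x.1.succAbove j) = (x.2 j).succ := by
  simp [Equiv.Perm.insertZero]

theorem Equiv.Perm.sign_insertZero {m : ℕ} (x : Fin (m + 1) × Equiv.Perm (Fin m)) :
    Equiv.Perm.sign (Equiv.Perm.insertZero x) = (-1) ^ (x.1 : ℕ) * Equiv.Perm.sign x.2 := by
  rw [Equiv.Perm.insertZero, Equiv.Perm.sign_trans, Fin.sign_cycleRange,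
    Equiv.Perm.decomposeFin.symm_sign]
  simp [mul_comm]

theorem Equiv.Perm.insertZero_bijective (m : ℕ) :
    Function.Bijective (Equiv.Perm.insertZero (m := m)) := by
  rw [Fintype.bijective_iff_injective_and_card]
  refine ⟨fun x y h => ?_, ?_⟩
  · obtain ⟨p, τ⟩ := x
    obtain ⟨q, ρ⟩ := y
    have hp : p = q := by
      have h1 := Equiv.Perm.insertZero_self (p, τ)
      have h2 := Equiv.Perm.insertZero_self (q, ρ)
      rw [h] at h1
      exact (Equiv.Perm.insertZero (q, ρ)).injective (h1.trans h2.symm)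
    subst hp
    congr 1
    ext j
    have h1 := Equiv.Perm.insertZero_succAbove (p, τ) j
    rw [h, Equiv.Perm.insertZero_succAbove (p, ρ) j] at h1
    rw [Fin.succ_injective _ h1]
  · simp [Fintype.card_perm, Nat.factorial_succ]

/-- Sorting permutations by the slot p that receives the first argument isolates that argument,
which is what a contraction needs. -/
theorem sum_perm_fin_succ {m : ℕ} {B : Type*} [AddCommMonoid B] (f : Equiv.Perm (Fin (m + 1)) → B) :
    ∑ σ, f σ = ∑ p, ∑ τ, f (Equiv.Perm.insertZero (p, τ)) := by
  rw [← Fintype.sum_prod_type']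
  exact (Function.Bijective.sum_comp (Equiv.Perm.insertZero_bijective m) f).symm

/-- Factorials act invertibly on a real algebra, so the overcounting in `factorial_smul_wedge_apply`
can be divided out. -/
theorem factorial_smul_injective (k l : ℕ) :
    Function.Injective fun a : A => (k.factorial * l.factorial) • a := by
  intro a b h
  have h1 : ((k.factorial * l.factorial : ℕ) : ℝ) ≠ 0 := by positivity
  simp only [← Nat.cast_smul_eq_nsmul ℝ] at h
  have h2 := congrArg (fun x => ((k.factorial * l.factorial : ℕ) : ℝ)⁻¹ • x) h
  simpa only [inv_smul_smul₀ h1] using h2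

theorem wedge_zero_left_apply {l : ℕ} (h : 0 + l = l) (α : L [⋀^Fin 0]→ₗ[A] A)
    (β : L [⋀^Fin l]→ₗ[A] A) : wedge h α β = α ![] • β := by
  ext X
  apply factorial_smul_injective 0 l
  dsimp only
  rw [factorial_smul_wedge_apply]
  have : ∀ σ : Equiv.Perm (Fin l), Equiv.Perm.sign σ •
        (α (fun i => X (σ (Fin.cast h (Fin.castAdd l i)))) *
          β (fun j => X (σ (Fin.cast h (Fin.natAdd 0 j))))) = α ![] * β X := by
    intro σ
    have h1 : (fun j : Fin l => X (σ (Fin.cast h (Fin.natAdd 0 j)))) = X ∘ σ := by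
      ext j
      congr 2
      ext
      simp
    rw [h1, β.map_perm, mul_smul_comm, smul_smul, Int.units_mul_self, one_smul]
    congr 2
    exact Subsingleton.elim _ _
  rw [Finset.sum_congr rfl fun σ _ => this σ]
  simp [Fintype.card_perm]

theorem wedge_zero_right_apply {k : ℕ} (h : k + 0 = k) (α : L [⋀^Fin k]→ₗ[A] A)
    (β : L [⋀^Fin 0]→ₗ[A] A) : wedge h α β = β ![] • α := by
  ext X
  apply factorial_smul_injective k 0
  dsimp only
  rw [factorial_smul_wedge_apply]
  have : ∀ σ : Equiv.Perm (Fin k), Equiv.Perm.sign σ •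
        (α (fun i => X (σ (Fin.cast h (Fin.castAdd 0 i)))) *
          β (fun j => X (σ (Fin.cast h (Fin.natAdd k j))))) = α X * β ![] := by
    intro σ
    have h1 : (fun j : Fin k => X (σ (Fin.cast h (Fin.castAdd 0 j)))) = X ∘ σ := by
      ext j
      congr 2
    rw [h1, α.map_perm, smul_mul_assoc, smul_smul, Int.units_mul_self, one_smul]
    congr 2
    exact Subsingleton.elim _ _
  rw [Finset.sum_congr rfl fun σ _ => this σ]
  simp [Fintype.card_perm, mul_comm]

/-- The interior product is an antiderivation. -/
theorem wedge_curryLeft {k l m : ℕ} (h : (k + 1) + (l + 1) = m + 1) (h1 : k + (l + 1) = m)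
    (h2 : (k + 1) + l = m) (α : L [⋀^Fin (k + 1)]→ₗ[A] A)
    (β : L [⋀^Fin (l + 1)]→ₗ[A] A) (Y : L) :
    (wedge h α β).curryLeft Y =
      wedge h1 (α.curryLeft Y) β + (-1 : ℤ) ^ (k + 1) • wedge h2 α (β.curryLeft Y) := by
  subst h2
  ext v
  apply factorial_smul_injective (k + 1) (l + 1)
  -- Here Y lands in slot i of α. Moving it to the front costs (-1)^i, which cancels the sign
  -- contributed by `insertZero`.
  have hL : ∀ (i : Fin (k + 1)) (τ : Equiv.Perm (Fin (k + 1 + l))),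
      Equiv.Perm.sign (Equiv.Perm.insertZero (Fin.cast h (Fin.castAdd (l + 1) i), τ)) •
        (α (fun j => (Fin.cons Y v : Fin (k + 1 + l + 1) → L)
          (Equiv.Perm.insertZero (Fin.cast h (Fin.castAdd (l + 1) i), τ)
            (Fin.cast h (Fin.castAdd (l + 1) j)))) *
          β (fun j => (Fin.cons Y v : Fin (k + 1 + l + 1) → L)
          (Equiv.Perm.insertZero (Fin.cast h (Fin.castAdd (l + 1) i), τ)
            (Fin.cast h (Fin.natAdd (k + 1) j))))) =
      Equiv.Perm.sign τ • (α.curryLeft Y (fun j => v (τ (Fin.cast h1 (Fin.castAdd (l + 1) j)))) *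
        β (fun j => v (τ (Fin.cast h1 (Fin.natAdd k j))))) := by
    intro i τ
    set p : Fin (k + 1 + l + 1) := Fin.cast h (Fin.castAdd (l + 1) i) with hp
    have ha : (fun j => (Fin.cons Y v : Fin (k + 1 + l + 1) → L)
          (Equiv.Perm.insertZero (p, τ) (Fin.cast h (Fin.castAdd (l + 1) j)))) =
        i.insertNth Y (fun j => v (τ (Fin.cast h1 (Fin.castAdd (l + 1) j)))) := by
      rw [Fin.eq_insertNth_iff]
      refine ⟨?_, ?_⟩
      · have := Equiv.Perm.insertZero_self (p, τ)
        dsimp only at this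
        rw [← hp, this]
        rfl
      · ext j
        have h3 : Fin.cast h (Fin.castAdd (l + 1) (i.succAbove j)) =
            p.succAbove (Fin.cast h1 (Fin.castAdd (l + 1) j)) := by
          ext
          simp only [Fin.succAbove, hp, Fin.lt_def, Fin.val_cast, Fin.val_castAdd, Fin.val_castSucc]
          split_ifs <;> simp
        have := Equiv.Perm.insertZero_succAbove (p, τ) (Fin.cast h1 (Fin.castAdd (l + 1) j))
        dsimp only at this
        simp only [Fin.removeNth, h3, this, Fin.cons_succ]
    have hb : (fun j => (Fin.cons Y v : Fin (k + 1 + l + 1) → L)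
          (Equiv.Perm.insertZero (p, τ) (Fin.cast h (Fin.natAdd (k + 1) j)))) =
        fun j => v (τ (Fin.cast h1 (Fin.natAdd k j))) := by
      ext j
      have h3 : Fin.cast h (Fin.natAdd (k + 1) j) =
            p.succAbove (Fin.cast h1 (Fin.natAdd k j)) := by
          ext
          have := i.isLt
          simp only [Fin.succAbove, hp, Fin.lt_def, Fin.val_cast, Fin.val_castAdd, Fin.val_castSucc,
            Fin.val_natAdd]
          split_ifs <;> simp <;> omega
      have := Equiv.Perm.insertZero_succAbove (p, τ) (Fin.cast h1 (Fin.natAdd k j))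
      dsimp only at this
      simp only [h3, this, Fin.cons_succ]
    rw [ha, hb, Equiv.Perm.sign_insertZero, AlternatingMap.map_insertNth]
    have h4 : (p : ℕ) = i := rfl
    simp only [h4, AlternatingMap.curryLeft_apply_apply, mul_smul, Units.smul_def, smul_mul_assoc]
    rw [smul_comm, smul_smul, smul_smul]
    have h5 : (((-1 : ℤˣ) ^ (i : ℕ) : ℤˣ) : ℤ) * (-1) ^ (i : ℕ) = 1 := by
      push_cast
      rw [← mul_pow]
      simp
    congr 1
    linear_combination ((Equiv.Perm.sign τ : ℤˣ) : ℤ) * h5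
  -- Here Y lands in slot i of β, so p = k + 1 + i. The sign (-1)^i cancels as before and (-1)^(k+1)
  -- is left over.
  have hR : ∀ (i : Fin (l + 1)) (τ : Equiv.Perm (Fin (k + 1 + l))),
      Equiv.Perm.sign (Equiv.Perm.insertZero (Fin.cast h (Fin.natAdd (k + 1) i), τ)) •
        (α (fun j => (Fin.cons Y v : Fin (k + 1 + l + 1) → L)
          (Equiv.Perm.insertZero (Fin.cast h (Fin.natAdd (k + 1) i), τ)
            (Fin.cast h (Fin.castAdd (l + 1) j)))) *
          β (fun j => (Fin.cons Y v : Fin (k + 1 + l + 1) → L)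
          (Equiv.Perm.insertZero (Fin.cast h (Fin.natAdd (k + 1) i), τ)
            (Fin.cast h (Fin.natAdd (k + 1) j))))) =
      (-1 : ℤ) ^ (k + 1) • Equiv.Perm.sign τ • (α (fun j => v (τ (Fin.cast rfl (Fin.castAdd l j)))) *
        β.curryLeft Y (fun j => v (τ (Fin.cast rfl (Fin.natAdd (k + 1) j))))) := by
    intro i τ
    set p : Fin (k + 1 + l + 1) := Fin.cast h (Fin.natAdd (k + 1) i) with hp
    have hb : (fun j => (Fin.cons Y v : Fin (k + 1 + l + 1) → L)
          (Equiv.Perm.insertZero (p, τ) (Fin.cast h (Fin.natAdd (k + 1) j)))) =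
        i.insertNth Y (fun j => v (τ (Fin.cast rfl (Fin.natAdd (k + 1) j)))) := by
      rw [Fin.eq_insertNth_iff]
      refine ⟨?_, ?_⟩
      · have := Equiv.Perm.insertZero_self (p, τ)
        dsimp only at this
        rw [← hp, this]
        rfl
      · ext j
        have h3 : Fin.cast h (Fin.natAdd (k + 1) (i.succAbove j)) =
            p.succAbove (Fin.cast rfl (Fin.natAdd (k + 1) j)) := by
          ext
          simp only [Fin.succAbove, hp, Fin.lt_def, Fin.val_cast, Fin.val_natAdd, Fin.val_castSucc]
          split_ifs <;> simp <;> omega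
        have := Equiv.Perm.insertZero_succAbove (p, τ) (Fin.cast rfl (Fin.natAdd (k + 1) j))
        dsimp only at this
        simp only [Fin.removeNth, h3, this, Fin.cons_succ]
    have ha : (fun j => (Fin.cons Y v : Fin (k + 1 + l + 1) → L)
          (Equiv.Perm.insertZero (p, τ) (Fin.cast h (Fin.castAdd (l + 1) j)))) =
        fun j => v (τ (Fin.cast rfl (Fin.castAdd l j))) := by
      ext j
      have h3 : Fin.cast h (Fin.castAdd (l + 1) j) =
            p.succAbove (Fin.cast rfl (Fin.castAdd l j)) := by
          ext
          have := j.isLt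
          simp only [Fin.succAbove, hp, Fin.lt_def, Fin.val_cast, Fin.val_castAdd, Fin.val_castSucc,
            Fin.val_natAdd]
          split_ifs <;> simp <;> omega
      have := Equiv.Perm.insertZero_succAbove (p, τ) (Fin.cast rfl (Fin.castAdd l j))
      dsimp only at this
      simp only [h3, this, Fin.cons_succ]
    rw [ha, hb, Equiv.Perm.sign_insertZero, AlternatingMap.map_insertNth]
    have h4 : (p : ℕ) = k + 1 + i := rfl
    simp only [h4, AlternatingMap.curryLeft_apply_apply, mul_smul, Units.smul_def, mul_smul_comm]
    rw [smul_comm ((Equiv.Perm.sign τ : ℤˣ) : ℤ), smul_smul]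
    have h5 : (((-1 : ℤˣ) ^ (k + 1 + i : ℕ) : ℤˣ) : ℤ) * (-1) ^ (i : ℕ) = (-1) ^ (k + 1) := by
      push_cast
      rw [pow_add (-1 : ℤ) (k + 1) i, mul_assoc, ← mul_pow]
      simp
    rw [h5]
  have e : ∀ f : Fin (k + 1 + l + 1) → A, ∑ p, f p =
      ∑ i : Fin (k + 1), f (Fin.cast h (Fin.castAdd (l + 1) i)) +
        ∑ i : Fin (l + 1), f (Fin.cast h (Fin.natAdd (k + 1) i)) := by
    intro f
    rw [← Fin.sum_univ_add fun i => f (Fin.cast h i)]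
    exact (Fintype.sum_equiv (finCongr h) _ _ fun _ => rfl).symm
  dsimp only
  rw [AlternatingMap.curryLeft_apply_apply,
    show (Matrix.vecCons Y v : Fin (k + 1 + l + 1) → L) = Fin.cons Y v from rfl,
    factorial_smul_wedge_apply, sum_perm_fin_succ, e]
  simp only [hL, hR, ← Finset.smul_sum, ← factorial_smul_wedge_apply]
  -- The summands no longer depend on i; the k + 1, respectively l + 1, equal copies complete the
  -- factorials.
  simp only [Finset.sum_const, Finset.card_univ, Fintype.card_fin, AlternatingMap.add_apply,
    AlternatingMap.smul_apply, smul_add]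
  congr 1
  · rw [smul_smul, Nat.factorial_succ k]
    congr 1
    ring
  · rw [smul_smul (_ * _) (l + 1), smul_comm ((-1 : ℤ) ^ (k + 1)), Nat.factorial_succ l]
    congr 1
    ring

end WedgeContraction

/-! ### Cartan calculus: product rules for d and the Lie derivative -/

section FormCalculus

variable {A L : Type*} [CommRing A] [LieRing L] [Module A L] [LieRingModule L A]
  [LieRinehartRing A L] [Algebra ℝ A] [LieAlgebra ℝ L] [LieRinehartAlgebra ℝ A L]

/-- Contractions lower the degree, so this turns the identities of the calculus into inductions on
degree. -/
theorem form_ext_curryLeft {k : ℕ} {ψ η : L [⋀^Fin (k + 1)]→ₗ[A] A}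
    (h : ∀ Y, ψ.curryLeft Y = η.curryLeft Y) : ψ = η := by
  ext X
  have := congrArg (fun θ : L [⋀^Fin k]→ₗ[A] A => θ (Fin.tail X)) (h (X 0))
  simpa only [AlternatingMap.curryLeft_apply_apply, Matrix.vecCons, Fin.cons_self_tail] using this

theorem form_zero_ext {ψ η : L [⋀^Fin 0]→ₗ[A] A} (h : ψ ![] = η ![]) : ψ = η := by
  ext X
  rwa [Subsingleton.elim X ![]]

theorem curryLeft_smul {k : ℕ} (a : A) (ψ : L [⋀^Fin (k + 1)]→ₗ[A] A) (Y : L) :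
    (a • ψ).curryLeft Y = a • ψ.curryLeft Y := rfl

theorem curryLeft_zsmul {k : ℕ} (a : ℤ) (ψ : L [⋀^Fin (k + 1)]→ₗ[A] A) (Y : L) :
    (a • ψ).curryLeft Y = a • ψ.curryLeft Y := rfl

theorem curryLeft_add' {k : ℕ} (ψ η : L [⋀^Fin (k + 1)]→ₗ[A] A) (Y : L) :
    (ψ + η).curryLeft Y = ψ.curryLeft Y + η.curryLeft Y := rfl

theorem curryLeft_sub' {k : ℕ} (ψ η : L [⋀^Fin (k + 1)]→ₗ[A] A) (Y : L) :
    (ψ - η).curryLeft Y = ψ.curryLeft Y - η.curryLeft Y := by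
  ext
  simp

theorem form_lie_curryLeft {k : ℕ} (ξ : L) (ψ : L [⋀^Fin (k + 1)]→ₗ[A] A) (Y : L) :
    ⁅ξ, ψ⁆.curryLeft Y = ⁅ξ, ψ.curryLeft Y⁆ - ψ.curryLeft ⁅ξ, Y⁆ := by
  ext v
  exact form_lie_cons ξ ψ Y v

theorem form_lie_zero_apply (ξ : L) (ψ : L [⋀^Fin 0]→ₗ[A] A) : ⁅ξ, ψ⁆ ![] = ⁅ξ, ψ ![]⁆ := by
  rw [form_lie_apply]
  simp

/-- The exterior product is graded commutative. -/
theorem wedge_comm {m : ℕ} : ∀ {k l : ℕ} (h : k + l = m) (h' : l + k = m)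
    (α : L [⋀^Fin k]→ₗ[A] A) (β : L [⋀^Fin l]→ₗ[A] A),
    wedge h α β = (-1 : ℤ) ^ (k * l) • wedge h' β α := by
  induction m with
  | zero =>
    intro k l h h' α β
    obtain rfl : k = 0 := by omega
    obtain rfl : l = 0 := by omega
    rw [wedge_zero_left_apply, wedge_zero_right_apply]
    simp
  | succ m ih =>
    intro k l h h' α β
    rcases k with _ | k
    · obtain rfl : l = m + 1 := by omega
      rw [wedge_zero_left_apply, wedge_zero_right_apply]
      simp
    rcases l with _ | l
    · obtain rfl : k = m := by omega
      rw [wedge_zero_left_apply, wedge_zero_right_apply]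
      simp
    refine form_ext_curryLeft fun Y => ?_
    rw [curryLeft_zsmul, wedge_curryLeft h (by omega) (by omega),
      wedge_curryLeft h' (by omega) (by omega), ih (l := l + 1) _ (by omega) (α.curryLeft Y) β,
      ih (l := l) _ (by omega) α (β.curryLeft Y), smul_add, smul_smul, smul_smul, add_comm]
    congr 2
    · ring
    · rw [← pow_add, show (k + 1) * (l + 1) + (l + 1) = k * (l + 1) + 2 * (l + 1) by ring, pow_add,
        pow_mul (-1 : ℤ) 2]
      simp

/-- The wedge product of a `1`-form with an `l`-form, contracted. -/
theorem wedge_one_curryLeft {l m : ℕ} (h : 1 + (l + 1) = m + 1) (h1 : l + 1 = m) (h2 : 1 + l = m)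
    (α : L [⋀^Fin 1]→ₗ[A] A) (β : L [⋀^Fin (l + 1)]→ₗ[A] A) (Y : L) :
    (wedge h α β).curryLeft Y = α ![Y] • (h1 ▸ β) - wedge h2 α (β.curryLeft Y) := by
  subst h1
  have := wedge_curryLeft (k := 0) h (by omega) h2 α β Y
  rw [this, wedge_zero_left_apply]
  simp [sub_eq_add_neg]

theorem wedge_one_one_curryLeft (h : 1 + 1 = 2) (α β : L [⋀^Fin 1]→ₗ[A] A) (Y : L) :
    (wedge h α β).curryLeft Y = α ![Y] • β - β ![Y] • α := by
  have := wedge_one_curryLeft (l := 0) h rfl rfl α β Y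
  rw [this, wedge_zero_right_apply]
  simp

/-- The exterior product is associative when the first two factors are `1`-forms. -/
theorem wedge_one_assoc {l : ℕ} : ∀ {p m : ℕ} (h1 : 1 + l = p) (h2 : 1 + p = m) (h3 : 2 + l = m)
    (α β : L [⋀^Fin 1]→ₗ[A] A) (γ : L [⋀^Fin l]→ₗ[A] A),
    wedge h2 α (wedge h1 β γ) = wedge h3 (wedge (m := 2) rfl α β) γ := by
  induction l with
  | zero =>
    intro p m h1 h2 h3 α β γ
    subst h1 h3
    rw [wedge_zero_right_apply, wedge_zero_right_apply, map_smul]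
  | succ l ih =>
    intro p m h1 h2 h3 α β γ
    obtain rfl : p = l + 1 + 1 := by omega
    obtain rfl : m = l + 1 + 1 + 1 := by omega
    refine form_ext_curryLeft fun Y => ?_
    rw [wedge_one_curryLeft h2 rfl (by omega),
      wedge_one_curryLeft h1 rfl (by omega), wedge_curryLeft (k := 1) h3 (by omega) (by omega),
      wedge_one_one_curryLeft]
    simp only [map_sub, map_smul, LinearMap.sub_apply, LinearMap.smul_apply]
    rw [ih (by omega) (by omega) (by omega)]
    simp only [pow_two, Int.reduceNeg, mul_neg, mul_one, neg_neg, one_smul, Nat.reduceAdd]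
    abel

/-- The Lie derivative is a derivation of the exterior product. -/
theorem form_lie_wedge {m : ℕ} (ξ : L) : ∀ {k l : ℕ} (h : k + l = m)
    (α : L [⋀^Fin k]→ₗ[A] A) (β : L [⋀^Fin l]→ₗ[A] A),
    ⁅ξ, wedge h α β⁆ = wedge h ⁅ξ, α⁆ β + wedge h α ⁅ξ, β⁆ := by
  induction m with
  | zero =>
    intro k l h α β
    obtain rfl : k = 0 := by omega
    obtain rfl : l = 0 := by omega
    rw [wedge_zero_left_apply, wedge_zero_left_apply, wedge_zero_left_apply, form_lie_smul,
      form_lie_zero_apply]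
  | succ m ih =>
    intro k l h α β
    rcases k with _ | k
    · obtain rfl : l = m + 1 := by omega
      rw [wedge_zero_left_apply, wedge_zero_left_apply, wedge_zero_left_apply, form_lie_smul,
        form_lie_zero_apply]
    rcases l with _ | l
    · obtain rfl : k = m := by omega
      rw [wedge_zero_right_apply, wedge_zero_right_apply, wedge_zero_right_apply, form_lie_smul,
        form_lie_zero_apply]
      exact add_comm _ _
    refine form_ext_curryLeft fun Y => ?_
    have hw := fun α β => wedge_curryLeft (A := A) (L := L) h (by omega) (by omega) α β
    simp only [curryLeft_add', form_lie_curryLeft, hw, lie_add, lie_zsmul, ih, map_sub,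
      LinearMap.sub_apply, smul_add, smul_sub]
    abel

theorem extDer_smul {k : ℕ} (a : A) (ψ : L [⋀^Fin k]→ₗ[A] A) :
    extDer k (a • ψ) = a • extDer k ψ + dFunWedge a ψ :=
  (extDerAux k).2.smul a ψ

/-- Links the auxiliary product used in the construction of d with the exterior product, so that
`extDer_smul` becomes a Leibniz rule. -/
theorem dFunWedge_eq_wedge {k : ℕ} : ∀ (h : 1 + k = k + 1) (f : L [⋀^Fin 0]→ₗ[A] A)
    (ψ : L [⋀^Fin k]→ₗ[A] A),
    dFunWedge (f ![]) ψ = wedge h (extDer 0 f) ψ := by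
  induction k with
  | zero =>
    intro h f ψ
    rw [wedge_zero_right_apply]
    ext X
    rw [← Fin.cons_self_tail X, dFunWedge_cons_zero, AlternatingMap.smul_apply, extDer_zero_apply,
      smul_eq_mul, mul_comm, Subsingleton.elim (Fin.tail X) ![]]
    rfl
  | succ k ih =>
    intro h f ψ
    refine form_ext_curryLeft fun Y => ?_
    rw [wedge_one_curryLeft h rfl (by omega), extDer_zero_apply, ← ih]
    ext v
    exact dFunWedge_cons _ _ _ _

/-- The exterior derivative commutes with Lie derivatives. -/
theorem extDer_lie {k : ℕ} (ξ : L) : ∀ ψ : L [⋀^Fin k]→ₗ[A] A,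
    extDer k ⁅ξ, ψ⁆ = ⁅ξ, extDer k ψ⁆ := by
  induction k with
  | zero =>
    intro ψ
    ext X
    rw [extDer_zero_apply, form_lie_zero_apply, form_lie_apply, extDer_zero_apply, Fin.sum_univ_one,
      extDer_zero_apply]
    simp
  | succ k ih =>
    intro ψ
    refine form_ext_curryLeft fun Y => ?_
    rw [extDer_succ_curryLeft, form_lie_curryLeft, form_lie_curryLeft, extDer_succ_curryLeft,
      extDer_succ_curryLeft, map_sub, ih, lie_sub, leibniz_lie ξ Y ψ]
    abel

/-- By Cartan's formula ι_Y d(df) = L_Y(df) - d(Yf), which vanishes because d commutes with L_Y.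
This serves to annihilate d(dλ). -/
theorem extDer_extDer_zero (f : L [⋀^Fin 0]→ₗ[A] A) : extDer 1 (extDer 0 f) = 0 := by
  refine form_ext_curryLeft fun Y => ?_
  have h : (extDer 0 f).curryLeft Y = ⁅Y, f⁆ := by
    apply form_zero_ext
    rw [form_lie_zero_apply]
    exact extDer_zero_apply f _
  rw [extDer_succ_curryLeft, h, ← extDer_lie, sub_self]
  ext
  simp

theorem extDer_wedge_zero {k : ℕ} (h : 0 + k = k) (h1 : 1 + k = k + 1) (h2 : 0 + (k + 1) = k + 1)
    (f : L [⋀^Fin 0]→ₗ[A] A) (ψ : L [⋀^Fin k]→ₗ[A] A) :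
    extDer k (wedge h f ψ) = wedge h1 (extDer 0 f) ψ + wedge h2 f (extDer k ψ) := by
  rw [wedge_zero_left_apply, wedge_zero_left_apply, extDer_smul, dFunWedge_eq_wedge h1]
  exact add_comm _ _

/-- The graded Leibniz rule for the product of a `1`-form with a form. -/
theorem extDer_wedge_one {l : ℕ} : ∀ {m : ℕ} (h : 1 + l = m) (h1 : 2 + l = m + 1)
    (h2 : 1 + (l + 1) = m + 1) (α : L [⋀^Fin 1]→ₗ[A] A) (ν : L [⋀^Fin l]→ₗ[A] A),
    extDer m (wedge h α ν) = wedge h1 (extDer 1 α) ν - wedge h2 α (extDer l ν) := by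
  induction l with
  | zero =>
    intro m h h1 h2 α ν
    subst h
    rw [wedge_zero_right_apply, wedge_zero_right_apply, extDer_smul, dFunWedge_eq_wedge (by omega),
      wedge_comm h2 h2 α]
    simp
  | succ l ih =>
    intro m h h1 h2 α ν
    obtain rfl : m = l + 1 + 1 := by omega
    refine form_ext_curryLeft fun Y => ?_
    have hα : (extDer 1 α).curryLeft Y = ⁅Y, α⁆ - extDer 0 (α.curryLeft Y) :=
      extDer_succ_curryLeft α Y
    have hY : α ![Y] = (α.curryLeft Y) ![] := rfl
    rw [curryLeft_sub', extDer_succ_curryLeft, wedge_one_curryLeft h rfl (by omega),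
      wedge_one_curryLeft h2 rfl (by omega), wedge_curryLeft (k := 1) h1 (by omega) (by omega), hα,
      extDer_succ_curryLeft, form_lie_wedge, map_sub, ih (by omega) (by omega) (by omega),
      map_sub, LinearMap.sub_apply, map_sub, extDer_smul, hY, dFunWedge_eq_wedge (by omega)]
    have e : (-1 : ℤ) ^ (1 + 1) = 1 := by norm_num
    rw [e, one_smul]
    abel

end FormCalculus

/-! ### The Hodge operator in terms of frames -/

section HodgeCalculus

variable {A L : Type*} [CommRing A] [LieRing L] [Module A L] [LieRingModule L A]
  [LieRinehartRing A L] [Algebra ℝ A] [LieAlgebra ℝ L] [LieRinehartAlgebra ℝ A L]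

/-- This has the shape of a Laplace expansion along the first row, which is how determinants of g
are matched with products of lowered vector fields. -/
theorem wedge_one_apply {l : ℕ} : ∀ (h : 1 + l = l + 1) (γ : L [⋀^Fin 1]→ₗ[A] A)
    (ψ : L [⋀^Fin l]→ₗ[A] A) (X : Fin (l + 1) → L),
    wedge h γ ψ X = ∑ i : Fin (l + 1), (-1 : A) ^ (i : ℕ) * γ ![X i] * ψ (i.removeNth X) := by
  induction l with
  | zero =>
    intro h γ ψ X
    have e : X = ![X 0] := by
      ext i
      fin_cases i
      rfl
    rw [wedge_zero_right_apply, Fin.sum_univ_one, AlternatingMap.smul_apply, smul_eq_mul,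
      Subsingleton.elim (Fin.removeNth 0 X) ![]]
    conv_lhs => rw [e]
    simp [mul_comm]
  | succ l ih =>
    intro h γ ψ X
    obtain ⟨Y, v, rfl⟩ : ∃ Y v, X = Fin.cons Y v := ⟨X 0, Fin.tail X, (Fin.cons_self_tail X).symm⟩
    have h1 := congrArg (fun θ : L [⋀^Fin (l + 1)]→ₗ[A] A => θ v)
      (wedge_one_curryLeft h rfl (by omega) γ ψ Y)
    have h2 : ∀ i : Fin (l + 1), Fin.removeNth i.succ (Fin.cons Y v : Fin (l + 2) → L)
        = Fin.cons Y (Fin.removeNth i v) := by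
      intro i
      ext j
      refine Fin.cases ?_ (fun j => ?_) j <;> simp [Fin.removeNth]
    have h3 : Fin.removeNth 0 (Fin.cons Y v : Fin (l + 2) → L) = v := by
      ext j
      simp [Fin.removeNth]
    refine h1.trans ?_
    rw [Fin.sum_univ_succ]
    simp only [AlternatingMap.sub_apply, AlternatingMap.smul_apply, ih, h2, h3, Fin.cons_zero,
      Fin.cons_succ, Fin.val_succ, Fin.val_zero, pow_succ, smul_eq_mul]
    simp [sub_eq_add_neg]
    rfl

variable (g : L →ₗ[A] L →ₗ[A] A)

theorem flatWedge_one_apply (Z X : L) : flatWedge g 1 ![Z] ![X] = g Z X := by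
  rw [flatWedge_apply]
  simp

theorem flatWedge_cons {l : ℕ} (h : 1 + l = l + 1) (Z : L) (Y : Fin l → L) :
    flatWedge g (l + 1) (Fin.cons Z Y) = wedge h (flatWedge g 1 ![Z]) (flatWedge g l Y) := by
  ext X
  rw [wedge_one_apply, flatWedge_apply, Matrix.det_succ_row_zero]
  refine Finset.sum_congr rfl fun i _ => ?_
  rw [flatWedge_one_apply, flatWedge_apply]
  rfl

theorem flatWedge_two (Z W : L) :
    flatWedge g 2 ![Z, W] = wedge rfl (flatWedge g 1 ![Z]) (flatWedge g 1 ![W]) :=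
  flatWedge_cons g rfl Z ![W]

/-- Lowering an index with g commutes with L_ξ when ξ is Killing; the product rule for the exterior
product does the rest. -/
theorem flatWedge_lie {ξ : L} (hξ : ∀ X Y, ⁅ξ, g X Y⁆ = g ⁅ξ, X⁆ Y + g X ⁅ξ, Y⁆) {l : ℕ} :
    ∀ Y : Fin l → L, ⁅ξ, flatWedge g l Y⁆ =
      ∑ i, flatWedge g l (Function.update Y i ⁅ξ, Y i⁆) := by
  induction l with
  | zero =>
    intro Y
    ext X
    -- In degree 0 the form is the constant 1, and ξ(1) = 0 follows from Leibniz applied to 1 · 1.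
    have h1 := LieRinehartRing.leibniz_mul_right ξ (1 : A) 1
    simp only [mul_one] at h1
    rw [form_lie_apply, flatWedge_apply]
    simpa using h1
  | succ l ih =>
    intro Y
    obtain ⟨Z, v, rfl⟩ : ∃ Z v, Y = Fin.cons Z v := ⟨Y 0, Fin.tail Y, (Fin.cons_self_tail Y).symm⟩
    have h1 : ⁅ξ, flatWedge g 1 ![Z]⁆ = flatWedge g 1 ![⁅ξ, Z⁆] := by
      ext X
      obtain ⟨X, rfl⟩ : ∃ x, X = ![x] := ⟨X 0, by ext i; fin_cases i; rfl⟩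
      rw [form_lie_apply, flatWedge_one_apply, hξ, Fin.sum_univ_one]
      have : Function.update ![X] 0 ⁅ξ, ![X] 0⁆ = ![⁅ξ, X⁆] := by
        ext i; fin_cases i; rfl
      rw [this, flatWedge_one_apply, flatWedge_one_apply]
      abel
    rw [flatWedge_cons g (by omega), form_lie_wedge, h1, ih, map_sum, Fin.sum_univ_succ]
    simp only [Fin.cons_zero, Fin.cons_succ, Fin.update_cons_zero, ← Fin.cons_update,
      flatWedge_cons g (show 1 + l = l + 1 by omega)]

/-- `vol` is a volume form of the metric `g`, with coefficient map `c`. -/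
structure IsVolume {d : ℕ} (c : (L [⋀^Fin d]→ₗ[A] A) →ₗ[A] A) (vol : L [⋀^Fin d]→ₗ[A] A) :
    Prop where
  symm : ∀ X Y, g X Y = g Y X
  coeff_smul : ∀ f : A, c (f • vol) = f
  smul_coeff : ∀ ψ, c ψ • vol = ψ
  normalized : ∀ X : Fin d → L, vol X ^ 2 = - (Matrix.of fun i j => g (X i) (X j)).det

/-- The vector fields `E` restrict to a basis at the point `ev`, in which the metric has
nonvanishing determinant. -/
structure IsFrameAt (ev : A →ₐ[ℝ] ℝ) {d : ℕ} (E : Fin d → L) : Prop where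
  span : ∀ X : L, ∃ c : Fin d → ℝ, X - ∑ i, c i • E i ∈ RingHom.ker ev • (⊤ : Submodule A L)
  det_ne : ev (Matrix.of fun i j => g (E i) (E j)).det ≠ 0

/-- There is a frame at enough points to separate the functions. -/
def HasFrames (d : ℕ) : Prop :=
  ∀ a : A, (∀ (ev : A →ₐ[ℝ] ℝ) (E : Fin d → L), IsFrameAt g ev E → ev a = 0) → a = 0

variable {g}

theorem ev_form_eq_zero_of_mem {k : ℕ} (ev : A →ₐ[ℝ] ℝ) (ψ : L [⋀^Fin k]→ₗ[A] A) (X : Fin k → L)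
    (i : Fin k) (hi : X i ∈ RingHom.ker ev • (⊤ : Submodule A L)) : ev (ψ X) = 0 := by
  have : ∀ x ∈ RingHom.ker ev • (⊤ : Submodule A L), ev (ψ (Function.update X i x)) = 0 := by
    intro x hx
    induction hx using Submodule.smul_induction_on' with
    | smul r hr n _ =>
      rw [AlternatingMap.map_update_smul, smul_eq_mul, map_mul, RingHom.mem_ker.mp hr, zero_mul]
    | add x _ y _ hx hy => rw [AlternatingMap.map_update_add, map_add, hx, hy, add_zero]
  simpa using this _ hi

/-- Tensoriality: a form sees its arguments at a point only modulo fields whose coefficients vanish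
there. The arguments are exchanged one at a time. -/
theorem ev_form_congr {k : ℕ} (ev : A →ₐ[ℝ] ℝ) (ψ : L [⋀^Fin k]→ₗ[A] A) (X X' : Fin k → L)
    (h : ∀ i, X i - X' i ∈ RingHom.ker ev • (⊤ : Submodule A L)) : ev (ψ X) = ev (ψ X') := by
  have : ∀ s : Finset (Fin k), ev (ψ (s.piecewise X X')) = ev (ψ X') := by
    intro s
    induction s using Finset.induction_on with
    | empty => simp
    | insert i s hi ih =>
      rw [Finset.piecewise_insert, ← ih, ← sub_eq_zero, ← map_sub]
      have h1 : s.piecewise X X' = Function.update (s.piecewise X X') i (X' i) := by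
        ext j
        rcases eq_or_ne j i with rfl | hj
        · simp [hi]
        · simp [hj]
      conv_lhs => enter [2, 2]; rw [h1]
      rw [← AlternatingMap.map_update_sub]
      exact ev_form_eq_zero_of_mem ev ψ _ i (by simpa using h i)
  simpa using this Finset.univ

/-- The restriction of a form to a frame at a point, with constant coefficients. -/
noncomputable def frameForm {d k : ℕ} (ev : A →ₐ[ℝ] ℝ) (E : Fin d → L)
    (ψ : L [⋀^Fin k]→ₗ[A] A) : (Fin d → ℝ) [⋀^Fin k]→ₗ[ℝ] ℝ :=
  ev.toLinearMap.compAlternatingMap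
    ((⟨ψ.toMultilinearMap.restrictScalars ℝ, ψ.map_eq_zero_of_eq'⟩ :
      L [⋀^Fin k]→ₗ[ℝ] A).compLinearMap (Fintype.linearCombination ℝ E))

theorem frameForm_apply {d k : ℕ} (ev : A →ₐ[ℝ] ℝ) (E : Fin d → L)
    (ψ : L [⋀^Fin k]→ₗ[A] A) (v : Fin k → Fin d → ℝ) :
    frameForm ev E ψ v = ev (ψ fun j => ∑ i, v j i • E i) := rfl

theorem IsFrameAt.ev_form_eq_zero {d k : ℕ} {ev : A →ₐ[ℝ] ℝ} {E : Fin d → L}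
    (hE : IsFrameAt g ev E) (ψ : L [⋀^Fin k]→ₗ[A] A) (h : frameForm ev E ψ = 0) (X : Fin k → L) :
    ev (ψ X) = 0 := by
  choose c hc using fun j => hE.span (X j)
  rw [ev_form_congr ev ψ X (fun j => ∑ i, c j i • E i) hc, ← frameForm_apply, h]
  rfl

theorem form_eq_zero_of_ev {d k : ℕ} (hF : HasFrames g d) (ψ : L [⋀^Fin k]→ₗ[A] A)
    (h : ∀ (ev : A →ₐ[ℝ] ℝ) (E : Fin d → L), IsFrameAt g ev E → frameForm ev E ψ = 0) :
    ψ = 0 := by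
  ext X
  exact hF _ fun ev E hE => hE.ev_form_eq_zero ψ (h ev E hE) X

/-- More than d vectors of ℝᵈ are dependent, so the restriction of ψ to each frame vanishes. -/
theorem form_eq_zero_of_lt {d k : ℕ} (hF : HasFrames g d) (hk : d < k) (ψ : L [⋀^Fin k]→ₗ[A] A) :
    ψ = 0 := by
  refine form_eq_zero_of_ev hF ψ fun ev E _ => ?_
  ext v
  refine AlternatingMap.map_linearDependent _ v fun hv => ?_
  have := hv.fintype_card_le_finrank
  simp at this
  omega

theorem ev_wedge_eq_zero_left {k l m : ℕ} (h : k + l = m) (ev : A →ₐ[ℝ] ℝ)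
    (α : L [⋀^Fin k]→ₗ[A] A) (β : L [⋀^Fin l]→ₗ[A] A) (hα : ∀ X, ev (α X) = 0) (X : Fin m → L) :
    ev (wedge h α β X) = 0 := by
  have h1 := congrArg ev (factorial_smul_wedge_apply h α β X)
  simp only [map_sum, map_nsmul, Units.smul_def, map_zsmul, map_mul, hα, zero_mul, smul_zero,
    Finset.sum_const_zero] at h1
  have h2 : k.factorial * l.factorial ≠ 0 := by positivity
  exact (smul_eq_zero.mp h1).resolve_left h2

theorem ev_wedge_eq_zero_right {k l m : ℕ} (h : k + l = m) (ev : A →ₐ[ℝ] ℝ)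
    (α : L [⋀^Fin k]→ₗ[A] A) (β : L [⋀^Fin l]→ₗ[A] A) (hβ : ∀ X, ev (β X) = 0) (X : Fin m → L) :
    ev (wedge h α β X) = 0 := by
  rw [wedge_comm h (by omega), AlternatingMap.smul_apply, map_zsmul,
    ev_wedge_eq_zero_left _ ev β α hβ, smul_zero]

section Volume

variable {n : ℕ} {c : (L [⋀^Fin (n + 2)]→ₗ[A] A) →ₗ[A] A} {vol : L [⋀^Fin (n + 2)]→ₗ[A] A}

theorem IsVolume.ext (hv : IsVolume g c vol) {a b : A} (h : a • vol = b • vol) : a = b := by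
  rw [← hv.coeff_smul a, h, hv.coeff_smul]

theorem IsVolume.ev_vol_ne {d : ℕ} {c : (L [⋀^Fin d]→ₗ[A] A) →ₗ[A] A} {vol : L [⋀^Fin d]→ₗ[A] A}
    (hv : IsVolume g c vol) {ev : A →ₐ[ℝ] ℝ} {E : Fin d → L}
    (hE : IsFrameAt g ev E) : ev (vol E) ≠ 0 := by
  intro h
  apply hE.det_ne
  have := congrArg ev (hv.normalized E)
  rw [map_pow, h, map_neg] at this
  simpa using this.symm

theorem IsVolume.ev_coeff_eq_zero (hv : IsVolume g c vol) {ev : A →ₐ[ℝ] ℝ} {E : Fin (n + 2) → L}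
    (hE : IsFrameAt g ev E) (ψ : L [⋀^Fin (n + 2)]→ₗ[A] A) (h : ev (ψ E) = 0) : ev (c ψ) = 0 := by
  rw [← hv.smul_coeff ψ, AlternatingMap.smul_apply, smul_eq_mul, map_mul] at h
  exact (mul_eq_zero.mp h).resolve_right (hv.ev_vol_ne hE)

/-- As a function of X the left-hand side is a top form, hence a multiple of vol. Evaluating on a
frame and comparing with vol(E)² = -det g fixes the factor as -1; the sign is the Lorentzian one. -/
theorem IsVolume.coeff_flatWedge (hv : IsVolume g c vol) (hF : HasFrames g (n + 2))
    (X : Fin (n + 2) → L) : c (flatWedge g (n + 2) X) = - vol X := by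
  set η : L [⋀^Fin (n + 2)]→ₗ[A] A := c.compAlternatingMap (flatWedge g (n + 2)) with hη
  have h1 : ∀ X, c (flatWedge g (n + 2) X) = c η * vol X := by
    intro X
    have := congrArg (fun θ : L [⋀^Fin (n + 2)]→ₗ[A] A => θ X) (hv.smul_coeff η)
    exact this.symm
  have h2 : c η + 1 = 0 := by
    refine hF _ fun ev E hE => ?_
    have h3 : flatWedge g (n + 2) E E = c η * vol E * vol E := by
      conv_lhs => rw [← hv.smul_coeff (flatWedge g (n + 2) E)]
      rw [AlternatingMap.smul_apply, h1, smul_eq_mul]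
    rw [flatWedge_apply] at h3
    have h4 : (c η + 1) * (vol E) ^ 2 = 0 := by
      have := hv.normalized E
      linear_combination (-1 : A) * h3 + this
    have h5 := congrArg ev h4
    rw [map_mul, map_zero, map_pow] at h5
    exact (mul_eq_zero.mp h5).resolve_right (pow_ne_zero _ (hv.ev_vol_ne hE))
  rw [h1]
  linear_combination vol X * h2

theorem IsVolume.flatWedge_eq (hv : IsVolume g c vol) (hF : HasFrames g (n + 2))
    (X : Fin (n + 2) → L) : flatWedge g (n + 2) X = - vol X • vol := by
  rw [← hv.smul_coeff (flatWedge g (n + 2) X), hv.coeff_flatWedge hF]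

/-- Killing vector fields preserve the volume form. -/
theorem IsVolume.lie_vol (hv : IsVolume g c vol) (hF : HasFrames g (n + 2)) {ξ : L}
    (hξ : ∀ X Y, ⁅ξ, g X Y⁆ = g ⁅ξ, X⁆ Y + g X ⁅ξ, Y⁆) : ⁅ξ, vol⁆ = 0 := by
  set h := c ⁅ξ, vol⁆ with hh
  have h0 : ⁅ξ, vol⁆ = h • vol := (hv.smul_coeff _).symm
  -- Differentiating X₁♭ ∧ … ∧ X_d♭ = -vol(X) vol along ξ and comparing with L_ξ vol = h vol, the
  -- factor h appears once from each occurrence of vol.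
  have h1 : ∀ Y, (2 : A) * (h * vol Y) = 0 := by
    intro Y
    have e1 := flatWedge_lie g hξ Y
    simp only [hv.flatWedge_eq hF, form_lie_smul, h0, ← Finset.sum_smul, smul_smul,
      ← add_smul] at e1
    have e2 := hv.ext e1
    have e3 := congrArg (fun θ : L [⋀^Fin (n + 2)]→ₗ[A] A => θ Y) h0
    simp only [form_lie_apply, AlternatingMap.smul_apply, smul_eq_mul] at e3
    rw [lie_neg, Finset.sum_neg_distrib] at e2
    linear_combination (-1 : A) * e2 - e3
  rw [h0]
  ext Y
  have h2 := congrArg (fun a => (1 / 2 : ℝ) • a) (h1 Y)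
  rw [smul_zero, two_mul, ← two_smul ℝ, smul_smul] at h2
  norm_num at h2
  exact h2

theorem IsVolume.lie_coeff (hv : IsVolume g c vol) (hF : HasFrames g (n + 2)) {ξ : L}
    (hξ : ∀ X Y, ⁅ξ, g X Y⁆ = g ⁅ξ, X⁆ Y + g X ⁅ξ, Y⁆) (ψ : L [⋀^Fin (n + 2)]→ₗ[A] A) :
    c ⁅ξ, ψ⁆ = ⁅ξ, c ψ⁆ := by
  conv_lhs => rw [← hv.smul_coeff ψ]
  rw [form_lie_smul, hv.lie_vol hF hξ, smul_zero, add_zero, hv.coeff_smul]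

theorem hodge_apply {k l d : ℕ} (c : (L [⋀^Fin d]→ₗ[A] A) →ₗ[A] A) (h : k + l = d)
    (β : L [⋀^Fin k]→ₗ[A] A) (Y : Fin l → L) :
    hodge g c h β Y = - c (wedge h β (flatWedge g l Y)) := rfl

/-- The Hodge operator commutes with Lie derivatives along Killing vector fields. -/
theorem IsVolume.lie_hodge (hv : IsVolume g c vol) (hF : HasFrames g (n + 2)) {ξ : L}
    (hξ : ∀ X Y, ⁅ξ, g X Y⁆ = g ⁅ξ, X⁆ Y + g X ⁅ξ, Y⁆) {k l : ℕ} (h : k + l = n + 2)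
    (β : L [⋀^Fin k]→ₗ[A] A) : hodge g c h ⁅ξ, β⁆ = ⁅ξ, hodge g c h β⁆ := by
  ext Y
  simp only [form_lie_apply, hodge_apply, lie_neg, ← hv.lie_coeff hF hξ, form_lie_wedge,
    flatWedge_lie g hξ, map_add, map_sum, Finset.sum_neg_distrib]
  abel

theorem hodge_smul {k l d : ℕ} (c : (L [⋀^Fin d]→ₗ[A] A) →ₗ[A] A) (h : k + l = d) (a : A)
    (β : L [⋀^Fin k]→ₗ[A] A) : hodge g c h (a • β) = a • hodge g c h β := by
  ext Y
  simp [hodge_apply]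

/-- The form γ ∧ vol has degree d + 1 and is zero; contracting it with Z gives the identity. -/
theorem IsVolume.wedge_one_curryLeft_vol (hF : HasFrames g (n + 2))
    (h : 1 + (n + 1) = n + 2) (γ : L [⋀^Fin 1]→ₗ[A] A) (Z : L) :
    wedge h γ (vol.curryLeft Z) = γ ![Z] • vol := by
  have h1 := wedge_one_curryLeft (show 1 + (n + 2) = n + 2 + 1 by omega) rfl h γ vol Z
  rw [form_eq_zero_of_lt hF (by omega) (wedge _ γ vol)] at h1
  exact (sub_eq_zero.mp h1.symm).symm

/-- The definition of ∗ evaluates on Y to minus the coefficient of Z₀♭ ∧ Z₁♭ ∧ Y₁♭ ∧ …, which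
`IsVolume.coeff_flatWedge` identifies with -vol(Z₀, Z₁, Y). -/
theorem IsVolume.hodge_flatWedge (hv : IsVolume g c vol) (hF : HasFrames g (n + 2))
    (h : 2 + n = n + 2) (Z : Fin 2 → L) :
    hodge g c h (flatWedge g 2 Z) = (vol.curryLeft (Z 0)).curryLeft (Z 1) := by
  have hZ : Z = ![Z 0, Z 1] := by
    ext i; fin_cases i <;> rfl
  ext Y
  rw [hodge_apply]
  conv_lhs => rw [hZ]
  rw [flatWedge_two, ← wedge_one_assoc (p := n + 1) (by omega) (by omega) h,
    ← flatWedge_cons g (by omega), ← flatWedge_cons g (by omega), hv.coeff_flatWedge hF, neg_neg]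
  rfl

/-- Multiplying ι_{Z₁} ι_{Z₀} vol first by W₁♭ and then by W₀♭ undoes the two contractions; the
antiderivation rule produces the two terms of the determinant. -/
theorem IsVolume.flatWedge_wedge_hodge (hv : IsVolume g c vol) (hF : HasFrames g (n + 2))
    (h : 2 + n = n + 2) (W Z : Fin 2 → L) :
    wedge h (flatWedge g 2 W) (hodge g c h (flatWedge g 2 Z)) =
      (Matrix.of fun i j => g (W i) (Z j)).det • vol := by
  have hW : W = ![W 0, W 1] := by
    ext i; fin_cases i <;> rfl
  have h1 := wedge_one_curryLeft (show 1 + (n + 1) = n + 1 + 1 by omega) rfl (by omega)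
    (flatWedge g 1 ![W 1]) (vol.curryLeft (Z 0)) (Z 1)
  rw [IsVolume.wedge_one_curryLeft_vol hF, curryLeft_smul] at h1
  have h2 : wedge (show 1 + n = n + 1 by omega) (flatWedge g 1 ![W 1])
      ((vol.curryLeft (Z 0)).curryLeft (Z 1)) =
      flatWedge g 1 ![W 1] ![Z 1] • vol.curryLeft (Z 0)
        - flatWedge g 1 ![W 1] ![Z 0] • vol.curryLeft (Z 1) := by
    rw [h1]
    exact (sub_sub_cancel _ _).symm
  rw [hv.hodge_flatWedge hF]
  conv_lhs => rw [hW]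
  rw [flatWedge_two, ← wedge_one_assoc (p := n + 1) (by omega) (by omega) h, h2]
  simp only [map_sub, map_smul, IsVolume.wedge_one_curryLeft_vol hF,
    flatWedge_one_apply, Matrix.det_fin_two, Matrix.of_apply, smul_smul, ← sub_smul]
  congr 1
  ring

/-- A 2-form expands at a point in products of dual frame covectors, and these are lowered vector
fields because g is nondegenerate there. Agreement at the single point is all that is needed. -/
theorem IsFrameAt.exists_span_flatWedge {ev : A →ₐ[ℝ] ℝ} {d : ℕ}
    {E : Fin d → L} (hE : IsFrameAt g ev E) (α : L [⋀^Fin 2]→ₗ[A] A) :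
    ∃ α₀ ∈ Submodule.span ℝ (Set.range fun Z : Fin 2 → L => flatWedge g 2 Z),
      ∀ X, ev ((α - α₀) X) = 0 := by
  set G : Matrix (Fin d) (Fin d) ℝ := Matrix.of fun i j => ev (g (E i) (E j)) with hG
  have hdet : IsUnit G.det := by
    rw [isUnit_iff_ne_zero]
    have := hE.det_ne
    rwa [AlgHom.map_det] at this
  -- The metric dual frame at the point; the inverse Gram matrix is frozen to constants.
  set D : Fin d → L := fun i => ∑ j, algebraMap ℝ A (G⁻¹ i j) • E j with hD
  have hDE : ∀ i k, ev (g (D i) (E k)) = if i = k then 1 else 0 := by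
    intro i k
    have := congrFun (congrFun (Matrix.nonsing_inv_mul G hdet) i) k
    rw [Matrix.mul_apply, Matrix.one_apply] at this
    rw [← this]
    simp only [hD, map_sum, LinearMap.sum_apply, map_smul, LinearMap.smul_apply, smul_eq_mul,
      map_mul, AlgHom.commutes, Algebra.algebraMap_self, RingHom.id_apply]
    rfl
  -- The factor 1/2 compensates for each unordered pair of indices being summed twice.
  refine ⟨∑ i, ∑ j, ((1 / 2 : ℝ) * ev (α ![E i, E j])) • flatWedge g 2 ![D i, D j], ?_, ?_⟩
  · exact Submodule.sum_mem _ fun i _ => Submodule.sum_mem _ fun j _ =>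
      Submodule.smul_mem _ _ (Submodule.subset_span ⟨_, rfl⟩)
  refine fun X => hE.ev_form_eq_zero _ ?_ X
  refine Module.Basis.ext_alternating (Pi.basisFun ℝ (Fin d)) fun v _ => ?_
  rw [frameForm_apply]
  have e : (fun j : Fin 2 => ∑ i, ((Pi.basisFun ℝ (Fin d)) (v j)) i • E i) =
      ![E (v 0), E (v 1)] := by
    ext j
    fin_cases j <;> simp [Pi.single_apply]
  have hsum : ∀ a b : Fin d, ev ((∑ i, ∑ j, ((1 / 2 : ℝ) * ev (α ![E i, E j])) •
      flatWedge g 2 ![D i, D j]) ![E a, E b]) = ev (α ![E a, E b]) := by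
    intro a b
    have hab : ev (α ![E b, E a]) = - ev (α ![E a, E b]) := by
      rw [← map_neg, ← α.map_swap _ (show (0 : Fin 2) ≠ 1 by decide)]
      congr 2
      ext j
      fin_cases j <;> rfl
    let φ : (L [⋀^Fin 2]→ₗ[A] A) →ₗ[ℝ] ℝ :=
      { toFun := fun ψ => ev (ψ ![E a, E b])
        map_add' := fun ψ η => by rw [AlternatingMap.add_apply, map_add]
        map_smul' := fun t ψ => by rw [AlternatingMap.smul_apply, map_smul]; rfl }
    have hφ : ∀ i j, φ (flatWedge g 2 ![D i, D j]) = (if i = a then 1 else 0) *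
        (if j = b then 1 else 0) - (if i = b then 1 else 0) * (if j = a then 1 else 0) := by
      intro i j
      change ev (flatWedge g 2 ![D i, D j] ![E a, E b]) = _
      simp only [flatWedge_apply, Matrix.det_fin_two, Matrix.of_apply, map_sub, map_mul,
        Matrix.cons_val_zero, Matrix.cons_val_one, hDE]
    change φ _ = _
    simp only [map_sum, map_smul, hφ, smul_eq_mul, mul_sub, Finset.sum_sub_distrib]
    simp
    rw [hab]
    ring
  rw [e, AlternatingMap.sub_apply, map_sub, hsum]
  simp

/-- The pairing of `2`-forms by the Hodge operator is symmetric. -/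
theorem IsVolume.wedge_hodge_symm (hv : IsVolume g c vol) (hF : HasFrames g (n + 2))
    (h : 2 + n = n + 2) (α β : L [⋀^Fin 2]→ₗ[A] A) :
    wedge h α (hodge g c h β) = wedge h β (hodge g c h α) := by
  refine sub_eq_zero.mp ?_
  rw [← hv.smul_coeff (_ - _)]
  convert zero_smul A vol
  rw [map_sub]
  refine hF _ fun ev E hE => ?_
  set S := Submodule.span ℝ (Set.range fun Z : Fin 2 → L => flatWedge g 2 Z) with hS
  -- On products of lowered fields both sides are 2 × 2 determinants of g, equal by symmetry of g;
  -- bilinearity extends this to the span.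
  have hsymm : ∀ α ∈ S, ∀ β ∈ S, ev (c (wedge h α (hodge g c h β))) =
      ev (c (wedge h β (hodge g c h α))) := by
    intro α hα
    induction hα using Submodule.span_induction with
    | zero => intro β _; simp
    | add x y _ _ hx hy =>
      intro β hβ
      simp only [map_add, LinearMap.add_apply, hx β hβ, hy β hβ]
    | smul t x _ hx =>
      intro β hβ
      simp only [map_smul, form_smul_eq, LinearMap.smul_apply, hx β hβ, hodge_smul, smul_eq_mul,
        map_mul]
    | mem x hx =>
      obtain ⟨W, rfl⟩ := hx
      intro β hβ
      induction hβ using Submodule.span_induction with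
      | zero => simp
      | add x y _ _ hx hy => simp only [map_add, LinearMap.add_apply, hx, hy]
      | smul t x _ hx =>
        simp only [map_smul, form_smul_eq, LinearMap.smul_apply, hx, hodge_smul, smul_eq_mul,
          map_mul]
      | mem x hx =>
        obtain ⟨Z, rfl⟩ := hx
        rw [hv.flatWedge_wedge_hodge hF, hv.flatWedge_wedge_hodge hF, Matrix.det_fin_two,
          Matrix.det_fin_two]
        simp only [Matrix.of_apply, hv.symm (Z _)]
        congr 3
        ring
  have hl : ∀ α β, (∀ X, ev (α X) = 0) → ev (c (wedge h α (hodge g c h β))) = 0 := fun α β hα =>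
    hv.ev_coeff_eq_zero hE _ (ev_wedge_eq_zero_left h ev _ _ hα _)
  have hr : ∀ α β, (∀ X, ev (β X) = 0) → ev (c (wedge h α (hodge g c h β))) = 0 := fun α β hβ => by
    refine hv.ev_coeff_eq_zero hE _ (ev_wedge_eq_zero_right h ev _ _ (fun Y => ?_) _)
    rw [hodge_apply, map_neg, hv.ev_coeff_eq_zero hE _ (ev_wedge_eq_zero_left h ev _ _ hβ _),
      neg_zero]
  -- Both sides depend only on the forms at the point, so α and β may be replaced by elements of the
  -- span.
  have hred : ∀ α α₀ β β₀, (∀ X, ev ((α - α₀) X) = 0) → (∀ X, ev ((β - β₀) X) = 0) →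
      ev (c (wedge h α (hodge g c h β))) = ev (c (wedge h α₀ (hodge g c h β₀))) := by
    intro α α₀ β β₀ hα hβ
    have h1 := hl _ β hα
    have h2 := hr α₀ _ hβ
    simp only [map_sub, LinearMap.sub_apply] at h1 h2
    linarith
  obtain ⟨α₀, hα₀, hα⟩ := hE.exists_span_flatWedge α
  obtain ⟨β₀, hβ₀, hβ⟩ := hE.exists_span_flatWedge β
  rw [map_sub, hred α α₀ β β₀ hα hβ, hred β β₀ α α₀ hβ hα, hsymm α₀ hα₀ β₀ hβ₀, sub_self]

end Volume

end HodgeCalculus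

/-! ### Series with coefficients in an algebra acting on V[[ħ]] -/

section PowerSeriesAction

theorem sum_antidiagonal_triple {B : Type*} [AddCommMonoid B] (f : ℕ → ℕ → ℕ → B) (m : ℕ) :
    ∑ p ∈ Finset.HasAntidiagonal.antidiagonal m, ∑ q ∈ Finset.HasAntidiagonal.antidiagonal p.2, f p.1 q.1 q.2 =
      ∑ p ∈ Finset.HasAntidiagonal.antidiagonal m, ∑ q ∈ Finset.HasAntidiagonal.antidiagonal p.1, f q.1 q.2 p.2 := by
  rw [Finset.sum_sigma', Finset.sum_sigma']
  refine Finset.sum_nbij' (fun x => ⟨(x.1.1 + x.2.1, x.2.2), (x.1.1, x.2.1)⟩)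
    (fun x => ⟨(x.2.1, x.2.2 + x.1.2), (x.2.2, x.1.2)⟩) ?_ ?_ ?_ ?_ ?_
  · rintro ⟨⟨a, b⟩, ⟨c, d⟩⟩ h
    simp only [Finset.mem_sigma, Finset.HasAntidiagonal.mem_antidiagonal, and_true] at h ⊢
    omega
  · rintro ⟨⟨a, b⟩, ⟨c, d⟩⟩ h
    simp only [Finset.mem_sigma, Finset.HasAntidiagonal.mem_antidiagonal, and_true] at h ⊢
    omega
  · rintro ⟨⟨a, b⟩, ⟨c, d⟩⟩ h
    simp only [Finset.mem_sigma, Finset.HasAntidiagonal.mem_antidiagonal] at h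
    obtain ⟨_, rfl⟩ := h
    rfl
  · rintro ⟨⟨a, b⟩, ⟨c, d⟩⟩ h
    simp only [Finset.mem_sigma, Finset.HasAntidiagonal.mem_antidiagonal] at h
    obtain ⟨_, rfl⟩ := h
    rfl
  · intros
    rfl

theorem sum_antidiagonal_triple_left_comm {B : Type*} [AddCommMonoid B] (f : ℕ → ℕ → ℕ → B)
    (m : ℕ) :
    ∑ p ∈ Finset.HasAntidiagonal.antidiagonal m, ∑ q ∈ Finset.HasAntidiagonal.antidiagonal p.2, f p.1 q.1 q.2 =
      ∑ p ∈ Finset.HasAntidiagonal.antidiagonal m, ∑ q ∈ Finset.HasAntidiagonal.antidiagonal p.2, f q.1 p.1 q.2 := by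
  rw [sum_antidiagonal_triple, sum_antidiagonal_triple (fun a b c => f b a c)]
  refine Finset.sum_congr rfl fun p _ => ?_
  exact (Finset.Nat.sum_antidiagonal_swap (f := fun q => f q.2 q.1 p.2))

variable {R S : Type*} [Ring R] [Algebra ℂ R] [Ring S] [Algebra ℂ S]
  {V W Z : Type*} [AddCommGroup V] [Module ℝ V] [AddCommGroup W] [Module ℝ W]
  [AddCommGroup Z] [Module ℝ Z]

/-- The action of `R[[ħ]]` on `V[[ħ]]` induced by an action of `R` on the complexification
of `V`. -/
noncomputable def psAct (ρ : R →ₐ[ℂ] Module.End ℂ (ℂ ⊗[ℝ] V)) (T : PowerSeries R) (u : FPS V) :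
    FPS V := fun m => ∑ p ∈ Finset.HasAntidiagonal.antidiagonal m, ρ (PowerSeries.coeff p.1 T) (u p.2)

theorem psAct_mul (ρ : R →ₐ[ℂ] Module.End ℂ (ℂ ⊗[ℝ] V)) (T U : PowerSeries R) (u : FPS V) :
    psAct ρ (T * U) u = psAct ρ T (psAct ρ U u) := by
  ext m
  simp only [psAct, PowerSeries.coeff_mul, map_sum, LinearMap.sum_apply, map_mul,
    Module.End.mul_apply]
  exact (sum_antidiagonal_triple (fun a b c => ρ (PowerSeries.coeff a T)
    (ρ (PowerSeries.coeff b U) (u c))) m).symm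

/-- Lets the algebra change along φ while the module changes along f; it transports the twist to U𝔨
⊗ U𝔨 ⊗ U𝔨 through coproducts and the associator. -/
theorem psAct_intertwine (ρ : R →ₐ[ℂ] Module.End ℂ (ℂ ⊗[ℝ] V)) (σ : S →ₐ[ℂ] Module.End ℂ (ℂ ⊗[ℝ] W))
    (φ : R →+* S) (f : V →ₗ[ℝ] W) (h : ∀ r u, f.baseChange ℂ (ρ r u) = σ (φ r) (f.baseChange ℂ u))
    (T : PowerSeries R) (u : FPS V) :
    mapS f (psAct ρ T u) = psAct σ (PowerSeries.map φ T) (mapS f u) := by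
  ext m
  change f.baseChange ℂ (∑ p ∈ Finset.HasAntidiagonal.antidiagonal m, _) = ∑ p ∈ Finset.HasAntidiagonal.antidiagonal m, _
  rw [map_sum]
  refine Finset.sum_congr rfl fun p _ => ?_
  rw [h, PowerSeries.coeff_map]
  rfl

theorem bilC_tmul_tmul (b : V →ₗ[ℝ] W →ₗ[ℝ] Z) (s t : ℂ) (v : V) (w : W) :
    bilC b (s ⊗ₜ v) (t ⊗ₜ w) = (s * t) ⊗ₜ b v w := by
  simp [bilC, TensorProduct.smul_tmul']

/-- The complexification of `V ⊗ W` as a tensor product of complexifications. -/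
noncomputable def mkC (V W : Type*) [AddCommGroup V] [Module ℝ V] [AddCommGroup W] [Module ℝ W] :
    (ℂ ⊗[ℝ] V) ⊗[ℂ] (ℂ ⊗[ℝ] W) ≃ₗ[ℂ] ℂ ⊗[ℝ] (V ⊗[ℝ] W) :=
  (TensorProduct.AlgebraTensorModule.distribBaseChange ℝ ℂ V W).symm

theorem mkC_tmul (x : ℂ ⊗[ℝ] V) (y : ℂ ⊗[ℝ] W) :
    mkC V W (x ⊗ₜ y) = bilC (TensorProduct.mk ℝ V W) x y := by
  induction x with
  | zero => simp
  | add x x' hx hx' => rw [TensorProduct.add_tmul, map_add, hx, hx', map_add, LinearMap.add_apply]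
  | tmul s v =>
    induction y with
    | zero => simp
    | add y y' hy hy' => rw [TensorProduct.tmul_add, map_add, hy, hy', map_add]
    | tmul t w =>
      rw [bilC_tmul_tmul]
      simp [mkC, TensorProduct.AlgebraTensorModule.distribBaseChange_symm_tmul]

/-- The action of a tensor product of algebras on a tensor product. -/
noncomputable def tensAct (ρ : R →ₐ[ℂ] Module.End ℂ (ℂ ⊗[ℝ] V))
    (σ : S →ₐ[ℂ] Module.End ℂ (ℂ ⊗[ℝ] W)) :
    R ⊗[ℂ] S →ₐ[ℂ] Module.End ℂ (ℂ ⊗[ℝ] (V ⊗[ℝ] W)) :=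
  (((mkC V W).conjAlgEquiv ℂ).toAlgHom.comp Module.endTensorEndAlgHom).comp
    (Algebra.TensorProduct.map ρ σ)

theorem tensAct_tmul (ρ : R →ₐ[ℂ] Module.End ℂ (ℂ ⊗[ℝ] V))
    (σ : S →ₐ[ℂ] Module.End ℂ (ℂ ⊗[ℝ] W)) (r : R) (s : S) (x : ℂ ⊗[ℝ] V) (y : ℂ ⊗[ℝ] W) :
    tensAct ρ σ (r ⊗ₜ s) (bilC (TensorProduct.mk ℝ V W) x y) =
      bilC (TensorProduct.mk ℝ V W) (ρ r x) (σ s y) := by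
  rw [← mkC_tmul, ← mkC_tmul]
  simp [tensAct, Module.endTensorEndAlgHom_apply]

theorem complexified_tensor_ext {f g : ℂ ⊗[ℝ] (V ⊗[ℝ] W) →ₗ[ℂ] ℂ ⊗[ℝ] Z}
    (h : ∀ x y, f (bilC (TensorProduct.mk ℝ V W) x y) = g (bilC (TensorProduct.mk ℝ V W) x y)) :
    f = g := by
  ext v w
  have := h (1 ⊗ₜ v) (1 ⊗ₜ w)
  simpa [bilC_tmul_tmul] using this

theorem cauchy_apply (b : V →ₗ[ℝ] W →ₗ[ℝ] Z) (v : FPS V) (w : FPS W) (m : ℕ) :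
    cauchy b v w m = ∑ p ∈ Finset.HasAntidiagonal.antidiagonal m, bilC b (v p.1) (w p.2) := rfl

/-- Acting on one factor is acting by 1 ⊗ T on the product. With its left-hand companion this
collects the two twists in an iterated ⊗⋆ into one series acting on an untwisted product. -/
theorem cauchy_psAct_right (ρ : R →ₐ[ℂ] Module.End ℂ (ℂ ⊗[ℝ] V))
    (σ : S →ₐ[ℂ] Module.End ℂ (ℂ ⊗[ℝ] W)) (T : PowerSeries S) (v : FPS V) (w : FPS W) :
    cauchy (TensorProduct.mk ℝ V W) v (psAct σ T w) =
      psAct (tensAct ρ σ) (PowerSeries.map (Algebra.TensorProduct.includeRight :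
        S →ₐ[ℂ] R ⊗[ℂ] S).toRingHom T) (cauchy (TensorProduct.mk ℝ V W) v w) := by
  ext m
  simp only [psAct, cauchy_apply, map_sum, PowerSeries.coeff_map]
  rw [sum_antidiagonal_triple_left_comm (fun a b c => bilC (TensorProduct.mk ℝ V W) (v a)
    (σ (PowerSeries.coeff b T) (w c)))]
  refine Finset.sum_congr rfl fun p _ => Finset.sum_congr rfl fun q _ => ?_
  change _ = tensAct ρ σ (1 ⊗ₜ _) _
  rw [tensAct_tmul, map_one]
  rfl

theorem cauchy_psAct_left (ρ : R →ₐ[ℂ] Module.End ℂ (ℂ ⊗[ℝ] V))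
    (σ : S →ₐ[ℂ] Module.End ℂ (ℂ ⊗[ℝ] W)) (T : PowerSeries R) (v : FPS V) (w : FPS W) :
    cauchy (TensorProduct.mk ℝ V W) (psAct ρ T v) w =
      psAct (tensAct ρ σ) (PowerSeries.map (Algebra.TensorProduct.includeLeft :
        R →ₐ[ℂ] R ⊗[ℂ] S).toRingHom T) (cauchy (TensorProduct.mk ℝ V W) v w) := by
  ext m
  simp only [psAct, cauchy_apply, map_sum, PowerSeries.coeff_map, LinearMap.sum_apply]
  rw [← sum_antidiagonal_triple (fun a b c => bilC (TensorProduct.mk ℝ V W)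
    (ρ (PowerSeries.coeff a T) (v b)) (w c))]
  refine Finset.sum_congr rfl fun p _ => Finset.sum_congr rfl fun q _ => ?_
  change _ = tensAct ρ σ (_ ⊗ₜ 1) _
  rw [tensAct_tmul, map_one]
  rfl

end PowerSeriesAction

/-! ### Actions of the enveloping algebra and invariant maps -/

section StarTensor

attribute [local instance] LieRing.ofAssociativeRing

variable {𝔨 : Type*} [LieRing 𝔨] [LieAlgebra ℝ 𝔨]
  {V W Z V' W' X : Type*}
  [AddCommGroup V] [Module ℝ V] [LieRingModule 𝔨 V] [LieModule ℝ 𝔨 V]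
  [AddCommGroup W] [Module ℝ W] [LieRingModule 𝔨 W] [LieModule ℝ 𝔨 W]
  [AddCommGroup Z] [Module ℝ Z] [LieRingModule 𝔨 Z] [LieModule ℝ 𝔨 Z]
  [AddCommGroup V'] [Module ℝ V'] [LieRingModule 𝔨 V'] [LieModule ℝ 𝔨 V']
  [AddCommGroup W'] [Module ℝ W'] [LieRingModule 𝔨 W'] [LieModule ℝ 𝔨 W']
  [AddCommGroup X] [Module ℝ X]

variable (𝔨 V) in
/-- The action of the enveloping algebra on the complexification of a module. -/
noncomputable def actC : UEnv 𝔨 →ₐ[ℂ] Module.End ℂ (ℂ ⊗[ℝ] V) :=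
  UniversalEnvelopingAlgebra.lift ℂ (LieModule.toEnd ℂ (ℂ ⊗[ℝ] 𝔨) (ℂ ⊗[ℝ] V))

theorem actS_apply (x : UEnv 𝔨) (v : FPS V) (m : ℕ) : actS V x v m = actC 𝔨 V x (v m) := rfl

theorem actC_ι (c s : ℂ) (ξ : 𝔨) (v : V) :
    actC 𝔨 V (UniversalEnvelopingAlgebra.ι ℂ (c ⊗ₜ ξ)) (s ⊗ₜ v) = (c * s) ⊗ₜ ⁅ξ, v⁆ := by
  rw [actC, UniversalEnvelopingAlgebra.lift_ι_apply]
  rfl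

/-- Invariance of a linear map under a Lie algebra. -/
def IsInv (𝔨 : Type*) [LieRing 𝔨] {V W : Type*} [AddCommGroup V] [Module ℝ V]
    [LieRingModule 𝔨 V] [AddCommGroup W] [Module ℝ W] [LieRingModule 𝔨 W] (f : V →ₗ[ℝ] W) : Prop :=
  ∀ (ξ : 𝔨) (v : V), f ⁅ξ, v⁆ = ⁅ξ, f v⁆

/-- The elements with property p form a subalgebra containing the generators; the universal property
maps U𝔨 into it, and the composite with the inclusion is the identity. Real generators suffice,
since complex multiples are products with scalars. -/
theorem uenv_induction {p : UEnv 𝔨 → Prop} (h1 : ∀ t : ℂ, p (algebraMap ℂ _ t))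
    (hι : ∀ ξ : 𝔨, p (UniversalEnvelopingAlgebra.ι ℂ (1 ⊗ₜ ξ))) (hadd : ∀ x y, p x → p y → p (x + y))
    (hmul : ∀ x y, p x → p y → p (x * y)) (x : UEnv 𝔨) : p x := by
  have hι' : ∀ ξ : ℂ ⊗[ℝ] 𝔨, p (UniversalEnvelopingAlgebra.ι ℂ ξ) := by
    intro ξ
    induction ξ with
    | zero => simpa using h1 0
    | add ξ η hξ hη => rw [map_add]; exact hadd _ _ hξ hη
    | tmul c ξ =>
      have : c ⊗ₜ[ℝ] ξ = c • ((1 : ℂ) ⊗ₜ[ℝ] ξ) := by simp [TensorProduct.smul_tmul']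
      rw [this, map_smul, Algebra.smul_def]
      exact hmul _ _ (h1 c) (hι ξ)
  let s : Subalgebra ℂ (UEnv 𝔨) :=
    { carrier := {x | p x}
      mul_mem' := fun hx hy => hmul _ _ hx hy
      add_mem' := fun hx hy => hadd _ _ hx hy
      algebraMap_mem' := h1 }
  let φ : ℂ ⊗[ℝ] 𝔨 →ₗ⁅ℂ⁆ s :=
    { toFun := fun ξ => ⟨UniversalEnvelopingAlgebra.ι ℂ ξ, hι' ξ⟩
      map_add' := fun ξ η => Subtype.ext (map_add _ ξ η)
      map_smul' := fun t ξ => Subtype.ext (map_smul _ t ξ)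
      map_lie' := fun {ξ η} => Subtype.ext (LieHom.map_lie _ ξ η) }
  have h : s.val.comp (UniversalEnvelopingAlgebra.lift ℂ φ) = AlgHom.id ℂ (UEnv 𝔨) := by
    ext ξ
    change ((UniversalEnvelopingAlgebra.lift ℂ φ (UniversalEnvelopingAlgebra.ι ℂ ξ) : s) :
      UEnv 𝔨) = _
    rw [UniversalEnvelopingAlgebra.lift_ι_apply]
    rfl
  have hx := congrArg (fun f : UEnv 𝔨 →ₐ[ℂ] UEnv 𝔨 => f x) h
  dsimp only [AlgHom.comp_apply, AlgHom.id_apply] at hx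
  rw [← hx]
  exact (UniversalEnvelopingAlgebra.lift ℂ φ x).2

/-- Commuting with 𝔨 propagates to U𝔨, hence to the coefficients of F. This is the source of all
naturality statements for ⊗⋆. -/
theorem IsInv.actC {f : V →ₗ[ℝ] W} (hf : IsInv 𝔨 f) (x : UEnv 𝔨) (u : ℂ ⊗[ℝ] V) :
    f.baseChange ℂ (actC 𝔨 V x u) = _root_.actC 𝔨 W x (f.baseChange ℂ u) := by
  induction x using uenv_induction generalizing u with
  | h1 t => simp
  | hι ξ =>
    induction u with
    | zero => simp
    | add u u' h h' => simp only [map_add, h, h']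
    | tmul s v => rw [actC_ι, LinearMap.baseChange_tmul, LinearMap.baseChange_tmul, actC_ι, hf]
  | hadd x y hx hy => simp only [map_add, LinearMap.add_apply, hx, hy]
  | hmul x y hx hy => simp only [map_mul, Module.End.mul_apply, hx, hy]

end StarTensor

/-! ### Calculus of invariant maps, ħ-linear maps and twisted bilinear maps -/

section StarTensorCoherence

attribute [local instance] LieRing.ofAssociativeRing

variable {𝔨 : Type*} [LieRing 𝔨] [LieAlgebra ℝ 𝔨]
  {V W Z V' W' X Y : Type*}
  [AddCommGroup V] [Module ℝ V] [LieRingModule 𝔨 V] [LieModule ℝ 𝔨 V]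
  [AddCommGroup W] [Module ℝ W] [LieRingModule 𝔨 W] [LieModule ℝ 𝔨 W]
  [AddCommGroup Z] [Module ℝ Z] [LieRingModule 𝔨 Z] [LieModule ℝ 𝔨 Z]
  [AddCommGroup V'] [Module ℝ V'] [LieRingModule 𝔨 V'] [LieModule ℝ 𝔨 V']
  [AddCommGroup W'] [Module ℝ W'] [LieRingModule 𝔨 W'] [LieModule ℝ 𝔨 W']
  [AddCommGroup X] [Module ℝ X] [AddCommGroup Y] [Module ℝ Y]

/-! ### Invariant maps -/

theorem IsInv.map {f : V →ₗ[ℝ] V'} {g : W →ₗ[ℝ] W'} (hf : IsInv 𝔨 f) (hg : IsInv 𝔨 g) :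
    IsInv 𝔨 (TensorProduct.map f g) := by
  intro ξ u
  induction u with
  | zero => simp
  | add u u' h h' => simp only [lie_add, map_add, h, h']
  | tmul v w =>
    simp only [TensorProduct.LieModule.lie_tmul_right, map_add, TensorProduct.map_tmul, hf ξ, hg ξ]

theorem IsInv.id : IsInv 𝔨 (LinearMap.id : V →ₗ[ℝ] V) := fun _ _ => rfl

theorem IsInv.comp {g : W →ₗ[ℝ] Z} {f : V →ₗ[ℝ] W} (hg : IsInv 𝔨 g) (hf : IsInv 𝔨 f) :
    IsInv 𝔨 (g ∘ₗ f) := fun ξ v => by rw [LinearMap.comp_apply, hf, hg]; rfl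

theorem IsInv.add {f g : V →ₗ[ℝ] W} (hf : IsInv 𝔨 f) (hg : IsInv 𝔨 g) : IsInv 𝔨 (f + g) :=
  fun ξ v => by rw [LinearMap.add_apply, hf, hg, LinearMap.add_apply, lie_add]

theorem IsInv.sub {f g : V →ₗ[ℝ] W} (hf : IsInv 𝔨 f) (hg : IsInv 𝔨 g) : IsInv 𝔨 (f - g) :=
  fun ξ v => by rw [LinearMap.sub_apply, hf, hg, LinearMap.sub_apply, lie_sub]

theorem IsInv.smul {f : V →ₗ[ℝ] W} (t : ℝ) (hf : IsInv 𝔨 f) : IsInv 𝔨 (t • f) :=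
  fun ξ v => by rw [LinearMap.smul_apply, hf, LinearMap.smul_apply, lie_smul]

theorem IsInv.neg {f : V →ₗ[ℝ] W} (hf : IsInv 𝔨 f) : IsInv 𝔨 (-f) :=
  fun ξ v => by rw [LinearMap.neg_apply, hf, LinearMap.neg_apply, lie_neg]

variable (V W Z) in
theorem IsInv.comm : IsInv 𝔨 (TensorProduct.comm ℝ V W).toLinearMap := by
  intro ξ u
  induction u with
  | zero => simp
  | add u u' h h' => simp only [lie_add, map_add, h, h']
  | tmul v w =>
    simp [TensorProduct.LieModule.lie_tmul_right, add_comm]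

variable (V W Z) in
theorem IsInv.assoc : IsInv 𝔨 (TensorProduct.assoc ℝ V W Z).toLinearMap := by
  intro ξ u
  induction u with
  | zero => simp
  | add u u' h h' => simp only [lie_add, map_add, h, h']
  | tmul v w =>
    induction v with
    | zero => simp
    | add u u' h h' => simp only [TensorProduct.add_tmul, lie_add, map_add, h, h']
    | tmul v v' =>
      simp [TensorProduct.LieModule.lie_tmul_right, TensorProduct.add_tmul,
        TensorProduct.tmul_add, add_assoc]

variable (V W Z) in
theorem IsInv.leftComm : IsInv 𝔨 (TensorProduct.leftComm ℝ V W Z).toLinearMap := by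
  intro ξ u
  induction u with
  | zero => simp
  | add u u' h h' => simp only [lie_add, map_add, h, h']
  | tmul v w =>
    induction w with
    | zero => simp
    | add u u' h h' => simp only [TensorProduct.tmul_add, lie_add, map_add, h, h']
    | tmul v v' =>
      simp [TensorProduct.LieModule.lie_tmul_right,
        TensorProduct.tmul_add]
      abel

/-- Invariance of a bilinear map under a Lie algebra. -/
def IsInv₂ (𝔨 : Type*) [LieRing 𝔨] {V W Z : Type*} [AddCommGroup V] [Module ℝ V]
    [LieRingModule 𝔨 V] [AddCommGroup W] [Module ℝ W] [LieRingModule 𝔨 W] [AddCommGroup Z]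
    [Module ℝ Z] [LieRingModule 𝔨 Z] (b : V →ₗ[ℝ] W →ₗ[ℝ] Z) : Prop :=
  ∀ (ξ : 𝔨) (v : V) (w : W), ⁅ξ, b v w⁆ = b ⁅ξ, v⁆ w + b v ⁅ξ, w⁆

theorem IsInv₂.lift {b : V →ₗ[ℝ] W →ₗ[ℝ] Z} (hb : IsInv₂ 𝔨 b) : IsInv 𝔨 (TensorProduct.lift b) := by
  intro ξ u
  induction u with
  | zero => simp
  | add u u' h h' => simp only [lie_add, map_add, h, h']
  | tmul v w => simp [TensorProduct.LieModule.lie_tmul_right, hb ξ v w]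

/-! ### Linear maps of power series -/

theorem mapS_apply (f : V →ₗ[ℝ] W) (u : FPS V) (m : ℕ) : mapS f u m = f.baseChange ℂ (u m) := rfl

theorem mapS_comp (g : W →ₗ[ℝ] Z) (f : V →ₗ[ℝ] W) (u : FPS V) :
    mapS (g ∘ₗ f) u = mapS g (mapS f u) := by
  ext m
  simp [mapS_apply, LinearMap.baseChange_comp]

theorem mapS_id (u : FPS V) : mapS LinearMap.id u = u := by
  ext m
  simp [mapS_apply]

theorem mapS_add (f g : V →ₗ[ℝ] W) (u : FPS V) : mapS (f + g) u = mapS f u + mapS g u := by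
  ext m
  simp [mapS_apply]

theorem mapS_sub (f g : V →ₗ[ℝ] W) (u : FPS V) : mapS (f - g) u = mapS f u - mapS g u := by
  ext m
  simp [mapS_apply]

theorem mapS_smul (t : ℝ) (f : V →ₗ[ℝ] W) (u : FPS V) : mapS (t • f) u = (t : ℂ) • mapS f u := by
  ext m
  simp [mapS_apply]
  rfl

theorem mapS_neg (f : V →ₗ[ℝ] W) (u : FPS V) : mapS (-f) u = - mapS f u := by
  ext m
  simp [mapS_apply]

theorem actS_mapS {f : V →ₗ[ℝ] W} (hf : IsInv 𝔨 f) (x : UEnv 𝔨) (u : FPS V) :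
    actS W x (mapS f u) = mapS f (actS V x u) := by
  ext m
  exact (hf.actC x (u m)).symm

theorem actS_mul (a b : UEnv 𝔨) (u : FPS V) : actS V (a * b) u = actS V a (actS V b u) := by
  ext m
  simp [actS_apply]

/-- Multiplication by `ħ`. -/
noncomputable def shiftS (u : FPS V) : FPS V := fun m => m.casesOn 0 u

/-- `ħ`-linearity of a linear map. -/
def IsShift (Φ : FPS V →ₗ[ℂ] FPS W) : Prop := ∀ u, Φ (shiftS u) = shiftS (Φ u)

theorem IsShift.comp {Ψ : FPS W →ₗ[ℂ] FPS Z} {Φ : FPS V →ₗ[ℂ] FPS W} (hΨ : IsShift Ψ)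
    (hΦ : IsShift Φ) : IsShift (Ψ ∘ₗ Φ) := fun u => by
  rw [LinearMap.comp_apply, hΦ, hΨ]
  rfl

theorem isShift_mapS (f : V →ₗ[ℝ] W) : IsShift (mapS f) := by
  intro u
  ext m
  rcases m with _ | m
  · simp [mapS_apply, shiftS]
  · rfl

theorem shiftS_iterate_apply (u : FPS V) (k m : ℕ) :
    (shiftS^[k] u) m = if k ≤ m then u (m - k) else 0 := by
  induction k generalizing m with
  | zero => simp
  | succ k ih =>
    rw [Function.iterate_succ_apply']
    rcases m with _ | m
    · simp [shiftS]
    · change (shiftS^[k] u) m = _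
      rw [ih]
      simp

theorem IsShift.iterate {Φ : FPS V →ₗ[ℂ] FPS W} (hΦ : IsShift Φ) (k : ℕ) (u : FPS V) :
    Φ (shiftS^[k] u) = shiftS^[k] (Φ u) := by
  induction k generalizing u with
  | zero => rfl
  | succ k ih => rw [Function.iterate_succ_apply', Function.iterate_succ_apply', hΦ, ih]

/-- Series agreeing up to order m differ by a multiple of ħ^(m+1), and Φ preserves such multiples.
-/
theorem IsShift.congr {Φ : FPS V →ₗ[ℂ] FPS W} (hΦ : IsShift Φ) {m : ℕ} {u u' : FPS V}
    (h : ∀ j ≤ m, u j = u' j) : Φ u m = Φ u' m := by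
  have h1 : u - u' = shiftS^[m + 1] fun j => u (j + (m + 1)) - u' (j + (m + 1)) := by
    ext j
    rw [shiftS_iterate_apply, Pi.sub_apply]
    split_ifs with hj
    · rw [Nat.sub_add_cancel hj]
    · rw [h j (by omega), sub_self]
  have h2 : Φ u - Φ u' = shiftS^[m + 1] (Φ fun j => u (j + (m + 1)) - u' (j + (m + 1))) := by
    rw [← map_sub, h1, hΦ.iterate]
  have h3 := congrFun h2 m
  rw [shiftS_iterate_apply, if_neg (by omega), Pi.sub_apply] at h3
  exact sub_eq_zero.mp h3

/-! ### Twisting bilinear maps -/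

theorem legs_tmul (B : FPS V →ₗ[ℂ] FPS W →ₗ[ℂ] FPS X) (x y : UEnv 𝔨) (v : FPS V) (w : FPS W) :
    legs B (x ⊗ₜ y) v w = B (actS V x v) (actS W y w) := rfl

theorem sw_apply (T : PowerSeries (UEnv 𝔨 ⊗[ℂ] UEnv 𝔨)) (B : FPS V →ₗ[ℂ] FPS W →ₗ[ℂ] FPS X)
    (v : FPS V) (w : FPS W) (m : ℕ) :
    sw T B v w m = ∑ p ∈ Finset.HasAntidiagonal.antidiagonal m,
      legs B (PowerSeries.coeff p.1 T) v w p.2 := rfl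

theorem legs_compr₂ (B : FPS V →ₗ[ℂ] FPS W →ₗ[ℂ] FPS X) (Φ : FPS X →ₗ[ℂ] FPS Y)
    (t : UEnv 𝔨 ⊗[ℂ] UEnv 𝔨) (v : FPS V) (w : FPS W) :
    legs (B.compr₂ Φ) t v w = Φ (legs B t v w) := by
  induction t with
  | zero => simp
  | add s t hs ht => simp only [map_add, LinearMap.add_apply, hs, ht]
  | tmul x y => rfl

/-- Up to a fixed order only finitely many coefficients of T act, which replaces the ħ-adic sum by a
finite one that linear maps can be applied to. -/
theorem sw_eq_of_le (T : PowerSeries (UEnv 𝔨 ⊗[ℂ] UEnv 𝔨)) (B : FPS V →ₗ[ℂ] FPS W →ₗ[ℂ] FPS X)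
    (v : FPS V) (w : FPS W) {j m : ℕ} (h : j ≤ m) :
    sw T B v w j = (∑ k ∈ Finset.range (m + 1),
      shiftS^[k] (legs B (PowerSeries.coeff k T) v w)) j := by
  rw [sw_apply, Finset.sum_apply]
  simp only [shiftS_iterate_apply]
  rw [Finset.Nat.sum_antidiagonal_eq_sum_range_succ
    (fun a b => legs B (PowerSeries.coeff a T) v w b), ← Finset.sum_filter]
  refine Finset.sum_congr ?_ fun _ _ => rfl
  ext k
  simp only [Finset.mem_range, Finset.mem_filter]
  omega

/-- Without ħ-linearity Φ could not be moved past the sum over orders of T; with it, truncation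
reduces the claim to finite sums. -/
theorem sw_compr₂ (T : PowerSeries (UEnv 𝔨 ⊗[ℂ] UEnv 𝔨)) (B : FPS V →ₗ[ℂ] FPS W →ₗ[ℂ] FPS X)
    {Φ : FPS X →ₗ[ℂ] FPS Y} (hΦ : IsShift Φ) (v : FPS V) (w : FPS W) :
    sw T (B.compr₂ Φ) v w = Φ (sw T B v w) := by
  ext m
  rw [sw_eq_of_le T _ v w le_rfl, hΦ.congr (u := sw T B v w) (u' := ∑ k ∈ Finset.range (m + 1),
    shiftS^[k] (legs B (PowerSeries.coeff k T) v w)) fun j hj => sw_eq_of_le T B v w hj]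
  simp only [map_sum, hΦ.iterate, legs_compr₂]

theorem legs_compl₁₂ (B : FPS V' →ₗ[ℂ] FPS W' →ₗ[ℂ] FPS X) {f : V →ₗ[ℝ] V'} {g : W →ₗ[ℝ] W'}
    (hf : IsInv 𝔨 f) (hg : IsInv 𝔨 g) (t : UEnv 𝔨 ⊗[ℂ] UEnv 𝔨) (v : FPS V) (w : FPS W) :
    legs B t (mapS f v) (mapS g w) = legs (B.compl₁₂ (mapS f) (mapS g)) t v w := by
  induction t with
  | zero => simp
  | add s t hs ht => simp only [map_add, LinearMap.add_apply, hs, ht]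
  | tmul x y =>
    rw [legs_tmul, legs_tmul, actS_mapS hf, actS_mapS hg]
    rfl

theorem sw_mapS_mapS (T : PowerSeries (UEnv 𝔨 ⊗[ℂ] UEnv 𝔨))
    (B : FPS V' →ₗ[ℂ] FPS W' →ₗ[ℂ] FPS X) {f : V →ₗ[ℝ] V'} {g : W →ₗ[ℝ] W'}
    (hf : IsInv 𝔨 f) (hg : IsInv 𝔨 g) (v : FPS V) (w : FPS W) :
    sw T B (mapS f v) (mapS g w) = sw T (B.compl₁₂ (mapS f) (mapS g)) v w := by
  ext m
  rw [sw_apply, sw_apply]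
  exact Finset.sum_congr rfl fun p _ => congrFun (legs_compl₁₂ B hf hg _ v w) _

theorem sw_mapS (T : PowerSeries (UEnv 𝔨 ⊗[ℂ] UEnv 𝔨))
    (B : FPS V' →ₗ[ℂ] FPS W →ₗ[ℂ] FPS X) {f : V →ₗ[ℝ] V'} (hf : IsInv 𝔨 f) (v : FPS V)
    (w : FPS W) : sw T B (mapS f v) w = sw T (B ∘ₗ mapS f) v w := by
  have h := sw_mapS_mapS T B hf (IsInv.id (V := W)) v w
  rw [mapS_id] at h
  have hB : B.compl₁₂ (mapS f) (mapS LinearMap.id) = B ∘ₗ mapS f :=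
    LinearMap.ext₂ fun x y => by rw [LinearMap.compl₁₂_apply, mapS_id]; rfl
  rw [h, hB]

theorem legs_sw (T : PowerSeries (UEnv 𝔨 ⊗[ℂ] UEnv 𝔨)) (B : FPS V →ₗ[ℂ] FPS W →ₗ[ℂ] FPS X)
    (t : UEnv 𝔨 ⊗[ℂ] UEnv 𝔨) (v : FPS V) (w : FPS W) (m : ℕ) :
    legs (sw T B) t v w m = ∑ p ∈ Finset.HasAntidiagonal.antidiagonal m,
      legs B (PowerSeries.coeff p.1 T * t) v w p.2 := by
  induction t with
  | zero => simp
  | add s t hs ht =>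
    simp only [map_add, LinearMap.add_apply, Pi.add_apply, hs, ht, mul_add, Finset.sum_add_distrib]
  | tmul x y =>
    rw [legs_tmul, sw_apply]
    refine Finset.sum_congr rfl fun p _ => ?_
    generalize PowerSeries.coeff p.1 T = s
    induction s with
    | zero => simp
    | add s t hs ht => simp only [map_add, LinearMap.add_apply, Pi.add_apply, hs, ht, add_mul]
    | tmul x' y' =>
      rw [Algebra.TensorProduct.tmul_mul_tmul, legs_tmul, legs_tmul, actS_mul, actS_mul]

/-- The order reverses because `sw` acts by precomposition: (B ∘ S) ∘ T = B ∘ (S T). -/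
theorem sw_mul (T S : PowerSeries (UEnv 𝔨 ⊗[ℂ] UEnv 𝔨)) (B : FPS V →ₗ[ℂ] FPS W →ₗ[ℂ] FPS X) :
    sw T (sw S B) = sw (S * T) B := by
  refine LinearMap.ext₂ fun v w => ?_
  ext m
  simp only [sw_apply, legs_sw, PowerSeries.coeff_mul, map_sum, LinearMap.sum_apply,
    Finset.sum_apply]
  rw [← sum_antidiagonal_triple (fun a b c => legs B (PowerSeries.coeff a S * PowerSeries.coeff b T)
    v w c), sum_antidiagonal_triple_left_comm (fun a b c => legs B
    (PowerSeries.coeff a S * PowerSeries.coeff b T) v w c)]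

theorem sw_flip (T : PowerSeries (UEnv 𝔨 ⊗[ℂ] UEnv 𝔨)) (B : FPS V →ₗ[ℂ] FPS W →ₗ[ℂ] FPS X)
    (v : FPS V) (w : FPS W) : sw (flip21 T) B.flip w v = sw T B v w := by
  ext m
  simp only [sw_apply]
  refine Finset.sum_congr rfl fun p _ => congrFun ?_ _
  rw [flip21, PowerSeries.coeff_map]
  generalize PowerSeries.coeff p.1 T = s
  induction s with
  | zero => simp
  | add s t hs ht => simp only [map_add, LinearMap.add_apply, hs, ht]
  | tmul x y => rfl

end StarTensorCoherence

/-! ### The star tensor product: naturality, braiding, associativity -/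

section StarTensorProduct

attribute [local instance] LieRing.ofAssociativeRing

variable {𝔨 : Type*} [LieRing 𝔨] [LieAlgebra ℝ 𝔨]
  {V W Z V' W' X Y : Type*}
  [AddCommGroup V] [Module ℝ V] [LieRingModule 𝔨 V] [LieModule ℝ 𝔨 V]
  [AddCommGroup W] [Module ℝ W] [LieRingModule 𝔨 W] [LieModule ℝ 𝔨 W]
  [AddCommGroup Z] [Module ℝ Z] [LieRingModule 𝔨 Z] [LieModule ℝ 𝔨 Z]
  [AddCommGroup V'] [Module ℝ V'] [LieRingModule 𝔨 V'] [LieModule ℝ 𝔨 V']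
  [AddCommGroup W'] [Module ℝ W'] [LieRingModule 𝔨 W'] [LieModule ℝ 𝔨 W']
  [AddCommGroup X] [Module ℝ X] [AddCommGroup Y] [Module ℝ Y]
  (F : DrinfeldTwist 𝔨)

/-- The twisted tensor product `v ⊗⋆ w = F⁻¹ (v ⊗ w)`. -/
noncomputable def starTensor : FPS V →ₗ[ℂ] FPS W →ₗ[ℂ] FPS (V ⊗[ℝ] W) :=
  starProd F (TensorProduct.mk ℝ V W)

theorem bilC_compr₂ (b : V →ₗ[ℝ] W →ₗ[ℝ] X) (f : X →ₗ[ℝ] Y) (x : ℂ ⊗[ℝ] V) (y : ℂ ⊗[ℝ] W) :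
    bilC (b.compr₂ f) x y = f.baseChange ℂ (bilC b x y) := by
  induction x with
  | zero => simp
  | add x x' hx hx' => simp only [map_add, LinearMap.add_apply, hx, hx']
  | tmul s v =>
    induction y with
    | zero => simp
    | add y y' hy hy' => simp only [map_add, hy, hy']
    | tmul t w => simp [bilC_tmul_tmul]

theorem bilC_compl₁₂ (b : V' →ₗ[ℝ] W' →ₗ[ℝ] X) (f : V →ₗ[ℝ] V') (g : W →ₗ[ℝ] W')
    (x : ℂ ⊗[ℝ] V) (y : ℂ ⊗[ℝ] W) :
    bilC (b.compl₁₂ f g) x y = bilC b (f.baseChange ℂ x) (g.baseChange ℂ y) := by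
  induction x with
  | zero => simp
  | add x x' hx hx' => simp only [map_add, LinearMap.add_apply, hx, hx']
  | tmul s v =>
    induction y with
    | zero => simp
    | add y y' hy hy' => simp only [map_add, hy, hy']
    | tmul t w => simp [bilC_tmul_tmul]

theorem bilC_flip (b : V →ₗ[ℝ] W →ₗ[ℝ] X) (x : ℂ ⊗[ℝ] V) (y : ℂ ⊗[ℝ] W) :
    bilC b.flip y x = bilC b x y := by
  induction x with
  | zero => simp
  | add x x' hx hx' => simp only [map_add, LinearMap.add_apply, hx, hx']
  | tmul s v =>
    induction y with
    | zero => simp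
    | add y y' hy hy' => simp only [map_add, LinearMap.add_apply, hy, hy']
    | tmul t w => simp [bilC_tmul_tmul, mul_comm]

theorem cauchy_compr₂ (b : V →ₗ[ℝ] W →ₗ[ℝ] X) (f : X →ₗ[ℝ] Y) :
    cauchy (b.compr₂ f) = (cauchy b).compr₂ (mapS f) := by
  refine LinearMap.ext₂ fun v w => ?_
  ext m
  simp only [cauchy_apply, LinearMap.compr₂_apply, mapS_apply, map_sum, bilC_compr₂]

theorem cauchy_compl₁₂ (b : V' →ₗ[ℝ] W' →ₗ[ℝ] X) (f : V →ₗ[ℝ] V') (g : W →ₗ[ℝ] W') :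
    cauchy (b.compl₁₂ f g) = (cauchy b).compl₁₂ (mapS f) (mapS g) := by
  refine LinearMap.ext₂ fun v w => ?_
  ext m
  simp only [cauchy_apply, LinearMap.compl₁₂_apply, mapS_apply, bilC_compl₁₂]

theorem cauchy_flip (b : V →ₗ[ℝ] W →ₗ[ℝ] X) : cauchy b.flip = (cauchy b).flip := by
  refine LinearMap.ext₂ fun v w => ?_
  ext m
  rw [LinearMap.flip_apply, cauchy_apply, cauchy_apply, ← Finset.Nat.sum_antidiagonal_swap]
  exact Finset.sum_congr rfl fun p _ => bilC_flip b _ _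

theorem starProd_compr₂ (b : V →ₗ[ℝ] W →ₗ[ℝ] X) (f : X →ₗ[ℝ] Y) (v : FPS V) (w : FPS W) :
    starProd F (b.compr₂ f) v w = mapS f (starProd F b v w) := by
  rw [starProd, cauchy_compr₂, sw_compr₂ _ _ (isShift_mapS f)]
  rfl

/-- All dependence on the twist is pushed into ⊗⋆, leaving a classical linear map outside. -/
theorem starProd_eq (b : V →ₗ[ℝ] W →ₗ[ℝ] X) (v : FPS V) (w : FPS W) :
    starProd F b v w = mapS (TensorProduct.lift b) (starTensor F v w) := by
  rw [starTensor, ← starProd_compr₂]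
  rfl

/-- F⁻¹ acts through U𝔨 on each factor and so commutes with invariant maps. -/
theorem starTensor_mapS {f : V →ₗ[ℝ] V'} {g : W →ₗ[ℝ] W'} (hf : IsInv 𝔨 f) (hg : IsInv 𝔨 g)
    (v : FPS V) (w : FPS W) :
    starTensor F (mapS f v) (mapS g w) = mapS (TensorProduct.map f g) (starTensor F v w) := by
  rw [starTensor, starProd, sw_mapS_mapS _ _ hf hg, ← cauchy_compl₁₂]
  exact starProd_compr₂ F (TensorProduct.mk ℝ V W) (TensorProduct.map f g) v w

theorem starTensor_mapS_left {f : V →ₗ[ℝ] V'} (hf : IsInv 𝔨 f) (v : FPS V) (w : FPS W) :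
    starTensor F (mapS f v) w = mapS (f.rTensor W) (starTensor F v w) := by
  have h := starTensor_mapS F hf (IsInv.id (V := W)) v w
  rwa [mapS_id] at h

theorem starTensor_mapS_right {g : W →ₗ[ℝ] W'} (hg : IsInv 𝔨 g) (v : FPS V) (w : FPS W) :
    starTensor F v (mapS g w) = mapS (g.lTensor V) (starTensor F v w) := by
  have h := starTensor_mapS F (IsInv.id (V := V)) hg v w
  rwa [mapS_id] at h

/-! ### Braided commutativity -/

theorem flip21_flip21 (T : PowerSeries (UEnv 𝔨 ⊗[ℂ] UEnv 𝔨)) : flip21 (flip21 T) = T := by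
  ext m
  rw [flip21, PowerSeries.coeff_map, PowerSeries.coeff_map]
  exact (Algebra.TensorProduct.comm ℂ (UEnv 𝔨) (UEnv 𝔨)).symm_apply_apply _

/-- R₂₁ is the flip of F₂₁ F⁻¹, that is F F₂₁⁻¹, so the leading F cancels. -/
theorem DrinfeldTwist.Finv_mul_R21 : F.Finv * F.R21 = flip21 F.Finv := by
  have h : F.Finv * F.F.1 = 1 := F.F.inv_mul
  rw [R21, R, map_mul, flip21_flip21, ← mul_assoc, h, one_mul]

/-- Braided commutativity: F⁻¹R₂₁ = F₂₁⁻¹ is the twist with its legs exchanged. This is what turns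
each R_k, R^k of the theorem into a classical transposition. -/
theorem sw_R21_starProd (b : V →ₗ[ℝ] W →ₗ[ℝ] X) (v : FPS V) (w : FPS W) :
    sw F.R21 (starProd F b) v w = starProd F b.flip w v := by
  rw [starProd, sw_mul, F.Finv_mul_R21]
  have h := sw_flip F.Finv (cauchy b).flip w v
  rw [LinearMap.flip_flip] at h
  rw [h, ← cauchy_flip]
  rfl

theorem sw_R21_starTensor (v : FPS V) (w : FPS W) :
    sw F.R21 (starTensor F) v w = mapS (TensorProduct.comm ℝ W V).toLinearMap (starTensor F w v) := by
  rw [starTensor, sw_R21_starProd, starTensor, ← starProd_compr₂]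
  rfl

/-! ### Power series linearity -/

theorem sum_antidiagonal_shiftS (u : ℕ → FPS X) (m : ℕ) :
    ∑ p ∈ Finset.HasAntidiagonal.antidiagonal m, shiftS (u p.1) p.2 =
      shiftS (fun m => ∑ p ∈ Finset.HasAntidiagonal.antidiagonal m, u p.1 p.2) m := by
  rcases m with _ | m
  · simp [shiftS]
  · rw [Finset.Nat.sum_antidiagonal_succ']
    simp [shiftS]

theorem sum_antidiagonal_shiftS_left (u : ℕ → FPS X) (m : ℕ) :
    ∑ p ∈ Finset.HasAntidiagonal.antidiagonal m, shiftS (u p.2) p.1 =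
      shiftS (fun m => ∑ p ∈ Finset.HasAntidiagonal.antidiagonal m, u p.2 p.1) m := by
  rcases m with _ | m
  · simp [shiftS]
  · rw [Finset.Nat.sum_antidiagonal_succ]
    simp [shiftS]

theorem isShift_actS (x : UEnv 𝔨) : IsShift (actS V x) := by
  intro u
  ext m
  rcases m with _ | m
  · simp [actS_apply, shiftS]
  · rfl

theorem isShift_cauchy_right (b : V →ₗ[ℝ] W →ₗ[ℝ] X) (v : FPS V) : IsShift (cauchy b v) := by
  intro w
  ext m
  rw [cauchy_apply]
  refine Eq.trans ?_ (sum_antidiagonal_shiftS (fun a c => bilC b (v a) (w c)) m)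
  refine Finset.sum_congr rfl fun p _ => ?_
  rcases p with ⟨a, _ | c⟩
  · simp [shiftS]
  · rfl

theorem isShift_cauchy_left (b : V →ₗ[ℝ] W →ₗ[ℝ] X) (w : FPS W) : IsShift ((cauchy b).flip w) := by
  intro v
  ext m
  rw [LinearMap.flip_apply, cauchy_apply]
  refine Eq.trans ?_ (sum_antidiagonal_shiftS_left (fun c a => bilC b (v a) (w c)) m)
  refine Finset.sum_congr rfl fun p _ => ?_
  rcases p with ⟨_ | a, c⟩
  · simp [shiftS]
  · rfl

theorem isShift_sw_right (T : PowerSeries (UEnv 𝔨 ⊗[ℂ] UEnv 𝔨))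
    {B : FPS V →ₗ[ℂ] FPS W →ₗ[ℂ] FPS X} (hB : ∀ v, IsShift (B v)) (v : FPS V) :
    IsShift (sw T B v) := by
  have h : ∀ t w, legs B t v (shiftS w) = shiftS (legs (𝔨 := 𝔨) B t v w) := by
    intro t w
    have h0 : ∀ u u' : FPS X, shiftS (u + u') = shiftS u + shiftS u' := by
      intro u u'
      ext m
      rcases m with _ | m <;> simp [shiftS]
    induction t with
    | zero => ext m; rcases m with _ | m <;> simp [shiftS]
    | add s t hs ht => simp only [map_add, LinearMap.add_apply, hs, ht, h0]
    | tmul x y => rw [legs_tmul, legs_tmul, isShift_actS, hB]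
  intro w
  ext m
  simp only [sw_apply, h]
  exact sum_antidiagonal_shiftS (fun a => legs B (PowerSeries.coeff a T) v w) m

theorem isShift_sw_left (T : PowerSeries (UEnv 𝔨 ⊗[ℂ] UEnv 𝔨))
    {B : FPS V →ₗ[ℂ] FPS W →ₗ[ℂ] FPS X} (hB : ∀ w, IsShift (B.flip w)) (w : FPS W) :
    IsShift ((sw T B).flip w) := by
  have h : (sw T B).flip w = sw (flip21 T) B.flip w := by
    ext1 v
    rw [sw_flip]
    rfl
  rw [h]
  exact isShift_sw_right _ hB w

theorem isShift_starTensor_right (v : FPS V) : IsShift (starTensor F (W := W) v) :=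
  isShift_sw_right _ (isShift_cauchy_right _) v

theorem isShift_starTensor_left (w : FPS W) : IsShift ((starTensor F (V := V)).flip w) :=
  isShift_sw_left _ (isShift_cauchy_left _) w

/-! ### Associativity -/

/-- On Lie algebra elements this is the Leibniz rule for the action on a tensor product, and both
sides are multiplicative in x. -/
theorem actC_tensor (x : UEnv 𝔨) :
    actC 𝔨 (V ⊗[ℝ] W) x = tensAct (actC 𝔨 V) (actC 𝔨 W) (comul 𝔨 x) := by
  induction x using uenv_induction with
  | h1 t => rw [AlgHom.commutes, AlgHom.commutes, AlgHom.commutes]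
  | hι ξ =>
    ext v w
    have h : comul 𝔨 (UniversalEnvelopingAlgebra.ι ℂ ((1 : ℂ) ⊗ₜ[ℝ] ξ)) =
        UniversalEnvelopingAlgebra.ι ℂ (1 ⊗ₜ ξ) ⊗ₜ[ℂ] 1 +
        1 ⊗ₜ[ℂ] UniversalEnvelopingAlgebra.ι ℂ (1 ⊗ₜ ξ) := by
      rw [comul, UniversalEnvelopingAlgebra.lift_ι_apply]
      rfl
    have hb : ∀ (v : V) (w : W), (1 : ℂ) ⊗ₜ[ℝ] (v ⊗ₜ[ℝ] w) =
        bilC (TensorProduct.mk ℝ V W) (1 ⊗ₜ v) (1 ⊗ₜ w) := fun v w => by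
      rw [bilC_tmul_tmul, one_mul]
      rfl
    simp only [TensorProduct.AlgebraTensorModule.curry_apply, LinearMap.restrictScalars_self,
      TensorProduct.curry_apply, LinearMap.coe_restrictScalars]
    rw [actC_ι, h, map_add, LinearMap.add_apply, hb v w, tensAct_tmul, tensAct_tmul, map_one,
      map_one, Module.End.one_apply, Module.End.one_apply, actC_ι, actC_ι,
      TensorProduct.LieModule.lie_tmul_right]
    simp only [mul_one, TensorProduct.tmul_add, hb]
  | hadd x y hx hy => simp only [map_add, hx, hy]
  | hmul x y hx hy => simp only [map_mul, hx, hy]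

theorem starTensor_eq_psAct (v : FPS V) (w : FPS W) :
    starTensor F v w = psAct (tensAct (actC 𝔨 V) (actC 𝔨 W)) F.Finv
      (cauchy (TensorProduct.mk ℝ V W) v w) := by
  ext m
  rw [starTensor, starProd, sw_apply, psAct]
  refine Finset.sum_congr rfl fun p _ => ?_
  generalize PowerSeries.coeff p.1 F.Finv = t
  induction t with
  | zero => simp
  | add s t hs ht => simp only [map_add, LinearMap.add_apply, Pi.add_apply, hs, ht]
  | tmul x y =>
    rw [legs_tmul, cauchy_apply, cauchy_apply, map_sum]
    refine Finset.sum_congr rfl fun q _ => ?_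
    rw [tensAct_tmul]
    rfl

theorem DrinfeldTwist.cocycle_inv :
    PowerSeries.map (twistΔ1 𝔨).toRingHom F.Finv * PowerSeries.map (twist12 𝔨).toRingHom F.Finv =
      PowerSeries.map (twist1Δ 𝔨).toRingHom F.Finv *
        PowerSeries.map (twist23 𝔨).toRingHom F.Finv := by
  have h := F.cocycle
  have hu : Units.map (PowerSeries.map (twist12 𝔨).toRingHom).toMonoidHom F.F *
      Units.map (PowerSeries.map (twistΔ1 𝔨).toRingHom).toMonoidHom F.F =
      Units.map (PowerSeries.map (twist23 𝔨).toRingHom).toMonoidHom F.F *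
      Units.map (PowerSeries.map (twist1Δ 𝔨).toRingHom).toMonoidHom F.F := Units.ext h
  have := congrArg (fun u => ((u⁻¹ : (PowerSeries (UEnv 𝔨 ⊗[ℂ] (UEnv 𝔨 ⊗[ℂ] UEnv 𝔨)))ˣ) :
    PowerSeries (UEnv 𝔨 ⊗[ℂ] (UEnv 𝔨 ⊗[ℂ] UEnv 𝔨)))) hu
  simp only [mul_inv_rev, ← map_inv, Units.val_mul] at this
  exact this

theorem assoc_bilC (x : ℂ ⊗[ℝ] V) (y : ℂ ⊗[ℝ] W) (z : ℂ ⊗[ℝ] Z) :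
    (TensorProduct.assoc ℝ V W Z).toLinearMap.baseChange ℂ
      (bilC (TensorProduct.mk ℝ (V ⊗[ℝ] W) Z) (bilC (TensorProduct.mk ℝ V W) x y) z) =
      bilC (TensorProduct.mk ℝ V (W ⊗[ℝ] Z)) x (bilC (TensorProduct.mk ℝ W Z) y z) := by
  induction x with
  | zero => simp
  | add x x' hx hx' => simp only [map_add, LinearMap.add_apply, hx, hx']
  | tmul s v =>
    induction y with
    | zero => simp
    | add y y' hy hy' => simp only [map_add, LinearMap.add_apply, hy, hy']
    | tmul t w =>
      induction z with
      | zero => simp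
      | add y y' hy hy' => simp only [map_add, hy, hy']
      | tmul t z => simp [bilC_tmul_tmul, mul_assoc]

theorem assoc_tensAct {R S Q : Type*} [Ring R] [Algebra ℂ R] [Ring S] [Algebra ℂ S] [Ring Q]
    [Algebra ℂ Q] (ρ : R →ₐ[ℂ] Module.End ℂ (ℂ ⊗[ℝ] V)) (σ : S →ₐ[ℂ] Module.End ℂ (ℂ ⊗[ℝ] W))
    (τ : Q →ₐ[ℂ] Module.End ℂ (ℂ ⊗[ℝ] Z)) (t : (R ⊗[ℂ] S) ⊗[ℂ] Q)
    (u : ℂ ⊗[ℝ] ((V ⊗[ℝ] W) ⊗[ℝ] Z)) :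
    (TensorProduct.assoc ℝ V W Z).toLinearMap.baseChange ℂ (tensAct (tensAct ρ σ) τ t u) =
      tensAct ρ (tensAct σ τ) (Algebra.TensorProduct.assoc ℂ ℂ ℂ R S Q t)
        ((TensorProduct.assoc ℝ V W Z).toLinearMap.baseChange ℂ u) := by
  induction t with
  | zero => simp
  | add r s hr hs => simp only [map_add, LinearMap.add_apply, hr, hs]
  | tmul t q =>
    induction t with
    | zero => simp
    | add r s hr hs => simp only [TensorProduct.add_tmul, map_add, LinearMap.add_apply, hr, hs]
    | tmul r s =>
      refine congrArg (fun f : ℂ ⊗[ℝ] ((V ⊗[ℝ] W) ⊗[ℝ] Z) →ₗ[ℂ] ℂ ⊗[ℝ] (V ⊗[ℝ] (W ⊗[ℝ] Z)) => f u)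
        (?_ : ((TensorProduct.assoc ℝ V W Z).toLinearMap.baseChange ℂ) ∘ₗ
          (tensAct (tensAct ρ σ) τ ((r ⊗ₜ s) ⊗ₜ q)) = (tensAct ρ (tensAct σ τ) (r ⊗ₜ (s ⊗ₜ q))) ∘ₗ
          ((TensorProduct.assoc ℝ V W Z).toLinearMap.baseChange ℂ))
      refine complexified_tensor_ext fun x z => ?_
      refine congrArg (fun f : ℂ ⊗[ℝ] (V ⊗[ℝ] W) →ₗ[ℂ] ℂ ⊗[ℝ] (V ⊗[ℝ] (W ⊗[ℝ] Z)) => f x)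
        (?_ : (((TensorProduct.assoc ℝ V W Z).toLinearMap.baseChange ℂ) ∘ₗ
          (tensAct (tensAct ρ σ) τ ((r ⊗ₜ s) ⊗ₜ q))) ∘ₗ
            (bilC (TensorProduct.mk ℝ (V ⊗[ℝ] W) Z)).flip z =
          ((tensAct ρ (tensAct σ τ) (r ⊗ₜ (s ⊗ₜ q))) ∘ₗ
          ((TensorProduct.assoc ℝ V W Z).toLinearMap.baseChange ℂ)) ∘ₗ
            (bilC (TensorProduct.mk ℝ (V ⊗[ℝ] W) Z)).flip z)
      refine complexified_tensor_ext fun x y => ?_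
      simp only [LinearMap.comp_apply, LinearMap.flip_apply, tensAct_tmul, assoc_bilC]

/-- The two bracketings apply (Δ ⊗ 1)F⁻¹ · F₁₂⁻¹ and (1 ⊗ Δ)F⁻¹ · F₂₃⁻¹ to the same untwisted triple
product; these series agree by the inverted cocycle condition. -/
theorem starTensor_assoc (v : FPS V) (w : FPS W) (z : FPS Z) :
    mapS (TensorProduct.assoc ℝ V W Z).toLinearMap (starTensor F (starTensor F v w) z) =
      starTensor F v (starTensor F w z) := by
  -- The outer twist treats W ⊗ Z as one module, on which U𝔨 acts through the coproduct.
  have hR : ∀ (T : PowerSeries (UEnv 𝔨 ⊗[ℂ] UEnv 𝔨)) (u : FPS (V ⊗[ℝ] (W ⊗[ℝ] Z))),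
      psAct (tensAct (actC 𝔨 V) (actC 𝔨 (W ⊗[ℝ] Z))) T u =
      psAct (tensAct (actC 𝔨 V) (tensAct (actC 𝔨 W) (actC 𝔨 Z)))
        (PowerSeries.map (twist1Δ 𝔨).toRingHom T) u := by
    intro T u
    have := psAct_intertwine (tensAct (actC 𝔨 V) (actC 𝔨 (W ⊗[ℝ] Z)))
      (tensAct (actC 𝔨 V) (tensAct (actC 𝔨 W) (actC 𝔨 Z))) (twist1Δ 𝔨).toRingHom LinearMap.id
      (fun r x => by
        simp only [LinearMap.baseChange_id, LinearMap.id_apply]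
        refine congrArg (fun f : Module.End ℂ (ℂ ⊗[ℝ] (V ⊗[ℝ] (W ⊗[ℝ] Z))) => f x) ?_
        induction r with
        | zero => simp
        | add r s hr hs => simp only [map_add, hr, hs]
        | tmul r s =>
          refine complexified_tensor_ext fun y z => ?_
          change _ = tensAct _ _ (r ⊗ₜ comul 𝔨 s) _
          rw [tensAct_tmul, tensAct_tmul, actC_tensor]) T u
    rwa [mapS_id, mapS_id] at this
  have hL : ∀ (T : PowerSeries (UEnv 𝔨 ⊗[ℂ] UEnv 𝔨)) (u : FPS ((V ⊗[ℝ] W) ⊗[ℝ] Z)),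
      mapS (TensorProduct.assoc ℝ V W Z).toLinearMap
        (psAct (tensAct (actC 𝔨 (V ⊗[ℝ] W)) (actC 𝔨 Z)) T u) =
      psAct (tensAct (actC 𝔨 V) (tensAct (actC 𝔨 W) (actC 𝔨 Z)))
        (PowerSeries.map (twistΔ1 𝔨).toRingHom T)
        (mapS (TensorProduct.assoc ℝ V W Z).toLinearMap u) := by
    intro T u
    refine psAct_intertwine _ _ (twistΔ1 𝔨).toRingHom _ (fun r x => ?_) T u
    change _ = tensAct _ _ (Algebra.TensorProduct.assoc ℂ ℂ ℂ _ _ _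
      (Algebra.TensorProduct.map (comul 𝔨) (AlgHom.id ℂ (UEnv 𝔨)) r)) _
    rw [← assoc_tensAct]
    refine congrArg (fun f : Module.End ℂ (ℂ ⊗[ℝ] ((V ⊗[ℝ] W) ⊗[ℝ] Z)) =>
      (TensorProduct.assoc ℝ V W Z).toLinearMap.baseChange ℂ (f x)) ?_
    induction r with
    | zero => simp
    | add r s hr hs => simp only [map_add, hr, hs]
    | tmul r s =>
      refine complexified_tensor_ext fun y z => ?_
      change _ = tensAct _ _ (comul 𝔨 r ⊗ₜ s) _
      rw [tensAct_tmul, tensAct_tmul, actC_tensor]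
  -- The inner twist acts on the first two factors; after rebracketing it is the series with legs
  -- 12.
  have hA : ∀ (T : PowerSeries (UEnv 𝔨 ⊗[ℂ] UEnv 𝔨)) (u : FPS ((V ⊗[ℝ] W) ⊗[ℝ] Z)),
      mapS (TensorProduct.assoc ℝ V W Z).toLinearMap
        (psAct (tensAct (tensAct (actC 𝔨 V) (actC 𝔨 W)) (actC 𝔨 Z))
          (PowerSeries.map (Algebra.TensorProduct.includeLeft : UEnv 𝔨 ⊗[ℂ] UEnv 𝔨 →ₐ[ℂ] (UEnv 𝔨 ⊗[ℂ] UEnv 𝔨) ⊗[ℂ] UEnv 𝔨).toRingHom T) u) =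
      psAct (tensAct (actC 𝔨 V) (tensAct (actC 𝔨 W) (actC 𝔨 Z)))
        (PowerSeries.map (twist12 𝔨).toRingHom T)
        (mapS (TensorProduct.assoc ℝ V W Z).toLinearMap u) := by
    intro T u
    rw [psAct_intertwine _ (tensAct (actC 𝔨 V) (tensAct (actC 𝔨 W) (actC 𝔨 Z)))
      (Algebra.TensorProduct.assoc ℂ ℂ ℂ (UEnv 𝔨) (UEnv 𝔨) (UEnv 𝔨)).toAlgHom.toRingHom _
      (fun r x => assoc_tensAct _ _ _ r x)]
    congr 1
  rw [starTensor_eq_psAct, starTensor_eq_psAct, cauchy_psAct_left _ (actC 𝔨 Z), hL, hA,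
    starTensor_eq_psAct, starTensor_eq_psAct, cauchy_psAct_right (actC 𝔨 V), hR, ← psAct_mul,
    ← psAct_mul, F.cocycle_inv]
  congr 1
  ext m
  simp only [mapS_apply, cauchy_apply, map_sum, LinearMap.sum_apply]
  rw [sum_antidiagonal_triple (fun a b c => bilC (TensorProduct.mk ℝ V (W ⊗[ℝ] Z)) (v a)
    (bilC (TensorProduct.mk ℝ W Z) (w b) (z c)))]
  exact Finset.sum_congr rfl fun p _ => Finset.sum_congr rfl fun q _ => assoc_bilC _ _ _

end StarTensorProduct

/-! ### Expressions with braided variations -/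

section BraidedVariation

variable {𝔨 : Type*} [LieRing 𝔨] [LieAlgebra ℝ 𝔨]
  {Λ V W Z V' W' X S : Type*}
  [AddCommGroup Λ] [Module ℝ Λ] [LieRingModule 𝔨 Λ] [LieModule ℝ 𝔨 Λ]
  [AddCommGroup V] [Module ℝ V] [LieRingModule 𝔨 V] [LieModule ℝ 𝔨 V]
  [AddCommGroup W] [Module ℝ W] [LieRingModule 𝔨 W] [LieModule ℝ 𝔨 W]
  [AddCommGroup Z] [Module ℝ Z] [LieRingModule 𝔨 Z] [LieModule ℝ 𝔨 Z]
  [AddCommGroup V'] [Module ℝ V'] [LieRingModule 𝔨 V'] [LieModule ℝ 𝔨 V']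
  [AddCommGroup W'] [Module ℝ W'] [LieRingModule 𝔨 W'] [LieModule ℝ 𝔨 W']
  [AddCommGroup S] [Module ℝ S] [LieRingModule 𝔨 S] [LieModule ℝ 𝔨 S]
  [AddCommGroup X] [Module ℝ X]
  (F : DrinfeldTwist 𝔨)

theorem Obs.ext' {a b : Obs Λ X} (h : a.val = b.val) (h' : ∀ l, a.var l = b.var l) : a = b := by
  cases a
  cases b
  rw [Obs.mk.injEq]
  exact ⟨h, LinearMap.ext h'⟩

theorem Obs.add_val (a b : Obs Λ X) : (a + b).val = a.val + b.val := rfl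

theorem Obs.add_var (a b : Obs Λ X) (l : FPS Λ) : (a + b).var l = a.var l + b.var l := rfl

theorem Obs.smul_val (t : ℂ) (a : Obs Λ X) : (t • a).val = t • a.val := rfl

theorem Obs.smul_var (t : ℂ) (a : Obs Λ X) (l : FPS Λ) : (t • a).var l = t • a.var l := rfl

theorem Obs.map_val (f : V →ₗ[ℝ] W) (a : Obs Λ V) : (a.map f).val = mapS f a.val := rfl

theorem Obs.map_var (f : V →ₗ[ℝ] W) (a : Obs Λ V) (l : FPS Λ) :
    (a.map f).var l = mapS f (a.var l) := rfl

theorem Obs.map_comp (g : W →ₗ[ℝ] Z) (f : V →ₗ[ℝ] W) (a : Obs Λ V) :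
    a.map (g ∘ₗ f) = (a.map f).map g :=
  Obs.ext' (mapS_comp _ _ _) fun _ => mapS_comp _ _ _

theorem Obs.map_id (a : Obs Λ V) : a.map LinearMap.id = a :=
  Obs.ext' (mapS_id _) fun _ => mapS_id _

theorem Obs.map_add (f : V →ₗ[ℝ] W) (a b : Obs Λ V) : (a + b).map f = a.map f + b.map f :=
  Obs.ext' (_root_.map_add (mapS f) _ _) fun l => _root_.map_add (mapS f) (a.var l) (b.var l)

theorem Obs.map_smul (f : V →ₗ[ℝ] W) (t : ℂ) (a : Obs Λ V) : (t • a).map f = t • a.map f :=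
  Obs.ext' (_root_.map_smul (mapS f) _ _) fun l => _root_.map_smul (mapS f) t (a.var l)

theorem Obs.mul_compr₂ (μ : FPS V →ₗ[ℂ] FPS W →ₗ[ℂ] FPS Z) (f : Z →ₗ[ℝ] X)
    (a : Obs Λ V) (b : Obs Λ W) :
    Obs.mul F (μ.compr₂ (mapS f)) a b = (Obs.mul F μ a b).map f := by
  refine Obs.ext' rfl fun l => ?_
  rw [Obs.map_var, Obs.mul_var, Obs.mul_var, _root_.map_add, ← sw_compr₂ _ _ (isShift_mapS f)]
  rfl

theorem Obs.mul_starProd (μ : V →ₗ[ℝ] W →ₗ[ℝ] X) (a : Obs Λ V) (b : Obs Λ W) :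
    Obs.mul F (starProd F μ) a b = (Obs.mul F (starTensor F) a b).map (TensorProduct.lift μ) := by
  rw [← Obs.mul_compr₂]
  congr 1
  exact LinearMap.ext₂ fun v w => starProd_eq F μ v w

theorem Obs.mul_add (μ : FPS V →ₗ[ℂ] FPS W →ₗ[ℂ] FPS X) (a : Obs Λ V) (b b' : Obs Λ W) :
    Obs.mul F μ a (b + b') = Obs.mul F μ a b + Obs.mul F μ a b' := by
  refine Obs.ext' (_root_.map_add (μ a.val) _ _) fun l => ?_
  have h : μ.compl₂ (b + b').var = μ.compl₂ b.var + μ.compl₂ b'.var :=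
    LinearMap.ext₂ fun x y => _root_.map_add (μ x) _ _
  rw [Obs.add_var, Obs.mul_var, Obs.mul_var, Obs.mul_var, h, Obs.add_val, _root_.map_add,
    _root_.map_add, LinearMap.add_apply, LinearMap.add_apply]
  abel

theorem Obs.mul_smul (μ : FPS V →ₗ[ℂ] FPS W →ₗ[ℂ] FPS X) (t : ℂ) (a : Obs Λ V) (b : Obs Λ W) :
    Obs.mul F μ a (t • b) = t • Obs.mul F μ a b := by
  refine Obs.ext' (_root_.map_smul (μ a.val) _ _) fun l => ?_
  have h : μ.compl₂ (t • b).var = t • μ.compl₂ b.var :=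
    LinearMap.ext₂ fun x y => _root_.map_smul (μ x) _ _
  rw [Obs.smul_var, Obs.mul_var, Obs.mul_var, h, Obs.smul_val, _root_.map_smul,
    _root_.map_smul, LinearMap.smul_apply, LinearMap.smul_apply, smul_add]

theorem Obs.add_mul (μ : FPS V →ₗ[ℂ] FPS W →ₗ[ℂ] FPS X) (a a' : Obs Λ V) (b : Obs Λ W) :
    Obs.mul F μ (a + a') b = Obs.mul F μ a b + Obs.mul F μ a' b := by
  refine Obs.ext' (LinearMap.map_add₂ _ _ _ _) fun l => ?_
  rw [Obs.add_var, Obs.mul_var, Obs.mul_var, Obs.mul_var, Obs.add_var, Obs.add_val,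
    _root_.map_add, _root_.map_add, LinearMap.add_apply, LinearMap.add_apply]
  abel

theorem Obs.smul_mul (μ : FPS V →ₗ[ℂ] FPS W →ₗ[ℂ] FPS X) (t : ℂ) (a : Obs Λ V) (b : Obs Λ W) :
    Obs.mul F μ (t • a) b = t • Obs.mul F μ a b := by
  refine Obs.ext' (LinearMap.map_smul₂ _ _ _ _) fun l => ?_
  rw [Obs.smul_var, Obs.mul_var, Obs.mul_var, Obs.smul_var, Obs.smul_val,
    _root_.map_smul, _root_.map_smul, LinearMap.smul_apply, LinearMap.smul_apply, smul_add]

/-- Naturality of ⊗⋆ for values and variations at once: the R-matrix in the Leibniz rule also acts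
through U𝔨, so it too commutes with f. -/
theorem Obs.mul_map_map {f : V →ₗ[ℝ] V'} {g : W →ₗ[ℝ] W'} (hf : IsInv 𝔨 f) (hg : IsInv 𝔨 g)
    (a : Obs Λ V) (b : Obs Λ W) :
    Obs.mul F (starTensor F) (a.map f) (b.map g) =
      (Obs.mul F (starTensor F) a b).map (TensorProduct.map f g) := by
  refine Obs.ext' (starTensor_mapS F hf hg _ _) fun l => ?_
  have h : (starTensor F).compl₂ (b.map g).var ∘ₗ mapS f =
      ((starTensor F).compl₂ b.var).compr₂ (mapS (TensorProduct.map f g)) :=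
    LinearMap.ext₂ fun x y => starTensor_mapS F hf hg x (b.var y)
  rw [Obs.map_var, Obs.mul_var, Obs.mul_var, Obs.map_var, Obs.map_val, Obs.map_val,
    starTensor_mapS F hf hg, sw_mapS _ _ hf, h, sw_compr₂ _ _ (isShift_mapS _), _root_.map_add]

theorem Obs.mul_map {g : W →ₗ[ℝ] W'} (hg : IsInv 𝔨 g) (a : Obs Λ V) (b : Obs Λ W) :
    Obs.mul F (starTensor F) a (b.map g) =
      (Obs.mul F (starTensor F) a b).map (TensorProduct.map LinearMap.id g) := by
  rw [← Obs.mul_map_map F IsInv.id hg, Obs.map_id]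

theorem Obs.map_mul {f : V →ₗ[ℝ] V'} (hf : IsInv 𝔨 f) (a : Obs Λ V) (b : Obs Λ W) :
    Obs.mul F (starTensor F) (a.map f) b =
      (Obs.mul F (starTensor F) a b).map (TensorProduct.map f LinearMap.id) := by
  rw [← Obs.mul_map_map F hf IsInv.id, Obs.map_id]

/-! ### Braiding of the gauge parameter -/

/-- The braiding in the Leibniz rule is absorbed by writing λ leftmost: the result is a classical
permutation of λ ⊗⋆ x, free of R. -/
theorem sw_R21_starTensor_mapS {p : Λ →ₗ[ℝ] W} (hp : IsInv 𝔨 p) (x : FPS V) (l : FPS Λ) :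
    sw F.R21 ((starTensor F (V := V)).compl₂ (mapS p)) x l =
      mapS (TensorProduct.map LinearMap.id p ∘ₗ (TensorProduct.comm ℝ Λ V).toLinearMap)
        (starTensor F l x) := by
  have h : (starTensor F (V := V)).compl₂ (mapS p) =
      (starTensor F).compr₂ (mapS (TensorProduct.map LinearMap.id p)) :=
    LinearMap.ext₂ fun x y => starTensor_mapS_right F hp x y
  rw [h, sw_compr₂ _ _ (isShift_mapS _), sw_R21_starTensor, mapS_comp]

/-- Rebracketing isolates λ and x, braided commutativity exchanges these two, and a second
rebracketing brings everything to the normal form λ ⊗⋆ (x ⊗⋆ s). -/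
theorem sw_R21_starTensor_starTensor {q : Λ ⊗[ℝ] S →ₗ[ℝ] W} (hq : IsInv 𝔨 q) (s : FPS S)
    (x : FPS V) (l : FPS Λ) :
    sw F.R21 ((starTensor F (V := V)).compl₂ (mapS q ∘ₗ (starTensor F).flip s)) x l =
      mapS (TensorProduct.map LinearMap.id q ∘ₗ (TensorProduct.leftComm ℝ Λ V S).toLinearMap)
        (starTensor F l (starTensor F x s)) := by
  have h : (starTensor F (V := V)).compl₂ (mapS q ∘ₗ (starTensor F).flip s) =
      (starTensor F).compr₂ (mapS (TensorProduct.map LinearMap.id q ∘ₗ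
        (TensorProduct.assoc ℝ V Λ S).toLinearMap) ∘ₗ (starTensor F).flip s) := by
    refine LinearMap.ext₂ fun x y => ?_
    rw [LinearMap.compl₂_apply, LinearMap.comp_apply, starTensor_mapS_right F hq,
      LinearMap.flip_apply, ← starTensor_assoc, ← mapS_comp]
    rfl
  rw [h, sw_compr₂ _ _ ((isShift_mapS _).comp (isShift_starTensor_left F s)), sw_R21_starTensor,
    LinearMap.comp_apply, LinearMap.flip_apply, starTensor_mapS_left F (IsInv.comm Λ V), ← mapS_comp,
    ← starTensor_assoc, ← mapS_comp]
  congr 2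
  refine TensorProduct.ext_threefold fun l x s => ?_
  simp

theorem starTensor_compl₂_add (v w : FPS Λ →ₗ[ℂ] FPS W) : (starTensor F (V := V)).compl₂ (v + w) =
    (starTensor F).compl₂ v + (starTensor F).compl₂ w :=
  LinearMap.ext₂ fun x _ => _root_.map_add (starTensor F x) _ _

variable (V) in
/-- The hexagon identity for the braiding of a linear map `v` past a star product. -/
def IsHexagonal (v : FPS Λ →ₗ[ℂ] FPS W) : Prop := ∀ (x y : FPS V) (l : FPS Λ),
  mapS (TensorProduct.assoc ℝ V V W).toLinearMap
      (sw F.R21 ((starTensor F).compl₂ v) (starTensor F x y) l) =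
    sw F.R21 ((starTensor F).compl₂ (sw F.R21 ((starTensor F).compl₂ v) y)) x l

variable {F}

theorem IsHexagonal.add {v w : FPS Λ →ₗ[ℂ] FPS W} (hv : IsHexagonal V F v)
    (hw : IsHexagonal V F w) : IsHexagonal V F (v + w) := by
  intro x y l
  simp only [starTensor_compl₂_add, _root_.map_add, LinearMap.add_apply, hv x y l, hw x y l]

theorem isHexagonal_mapS {p : Λ →ₗ[ℝ] W} (hp : IsInv 𝔨 p) : IsHexagonal V F (mapS p) := by
  intro x y l
  have h : sw F.R21 ((starTensor F).compl₂ (mapS p)) y = 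
      mapS (TensorProduct.map LinearMap.id p ∘ₗ (TensorProduct.comm ℝ Λ V).toLinearMap) ∘ₗ
        (starTensor F).flip y := LinearMap.ext fun l => sw_R21_starTensor_mapS F hp y l
  rw [sw_R21_starTensor_mapS F hp, h,
    sw_R21_starTensor_starTensor F ((IsInv.id.map hp).comp (IsInv.comm Λ V)), ← mapS_comp]
  congr 2
  refine TensorProduct.ext_threefold' fun l x s => ?_
  simp

/-- Passing x ⊗⋆ y in one step or in two gives the same normal form with λ leftmost; what remains is
a coherence identity between classical permutations. -/
theorem isHexagonal_starTensor {q : Λ ⊗[ℝ] S →ₗ[ℝ] W} (hq : IsInv 𝔨 q) (s : FPS S) :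
    IsHexagonal V F (mapS q ∘ₗ (starTensor F).flip s) := by
  intro x y l
  have h : sw F.R21 ((starTensor F).compl₂ (mapS q ∘ₗ (starTensor F).flip s)) y = 
      mapS (TensorProduct.map LinearMap.id q ∘ₗ (TensorProduct.leftComm ℝ Λ V S).toLinearMap) ∘ₗ
        (starTensor F).flip (starTensor F y s) :=
    LinearMap.ext fun l => sw_R21_starTensor_starTensor F hq s y l
  rw [sw_R21_starTensor_starTensor F hq, h,
    sw_R21_starTensor_starTensor F ((IsInv.id.map hq).comp (IsInv.leftComm Λ V S)), ← mapS_comp,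
    ← starTensor_assoc F x y s, starTensor_mapS_right F (IsInv.assoc V V S), ← mapS_comp]
  congr 2
  ext l x y s
  simp

variable (F)

/-- The Leibniz rule yields one term per factor. The terms varying a or b agree by associativity of
⊗⋆; the term varying c passes the parameter across both a and b, which is the hexagon condition. -/
theorem Obs.mul_assoc (a b : Obs Λ V) {c : Obs Λ W} (hc : IsHexagonal V F c.var) :
    (Obs.mul F (starTensor F) (Obs.mul F (starTensor F) a b) c).map
        (TensorProduct.assoc ℝ V V W).toLinearMap =
      Obs.mul F (starTensor F) a (Obs.mul F (starTensor F) b c) := by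
  refine Obs.ext' (starTensor_assoc F _ _ _) fun l => ?_
  have h : (starTensor F (V := V)).compl₂ (Obs.mul F (starTensor F) b c).var =
      ((starTensor F).compl₂ b.var).compr₂ (mapS (TensorProduct.assoc ℝ V V W).toLinearMap ∘ₗ
        (starTensor F).flip c.val) +
      (starTensor F).compl₂ (sw F.R21 ((starTensor F).compl₂ c.var) b.val) := by
    refine LinearMap.ext₂ fun x l => ?_
    rw [LinearMap.compl₂_apply, Obs.mul_var, _root_.map_add, ← starTensor_assoc]
    rfl
  rw [Obs.map_var, Obs.mul_var, Obs.mul_var, Obs.mul_var, Obs.mul_val, Obs.mul_val, h,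
    _root_.map_add, hc, LinearMap.map_add₂, _root_.map_add, starTensor_assoc, _root_.map_add,
    LinearMap.add_apply, LinearMap.add_apply,
    sw_compr₂ _ _ ((isShift_mapS _).comp (isShift_starTensor_left F _)), add_assoc]
  rfl

/-! ### Strings -/

/-- A string `s` evaluated at `Φ` is the expression `Ψ(y)`. -/
def ArgString.Represents {D : Type*} [AddCommMonoid D] [Module ℂ D] (s : ArgString Λ D X)
    (Φ : D) (Ψ : FPS W →ₗ[ℂ] FPS X) (y : Obs Λ W) : Prop :=
  s.ev Φ = Ψ y.val ∧ ∀ l, s.var Φ l = Ψ (y.var l)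

theorem ArgString.represents_single (y : Obs Λ W) (Ψ : FPS W →ₗ[ℂ] FPS X) :
    (ArgString.cons F y (ArgString.nil (Λ := Λ) (X := X))).Represents Ψ Ψ y := by
  refine ⟨rfl, fun l => ?_⟩
  have h : (ArgString.nil (Λ := Λ) (X := X)).var ∘ₗ Ψ = 0 := rfl
  change Ψ (y.var l) + sw F.R21 ((ArgString.nil (Λ := Λ) (X := X)).var ∘ₗ Ψ) y.val l = _
  rw [h, _root_.map_zero]
  exact add_zero _

/-- The Leibniz rule of a string is that of a product whose second factor is the rest of the string,
and ħ-linearity of Ψ carries it outside the braiding. Iterating, a string is its right-nested star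
product. -/
theorem ArgString.Represents.cons {D : Type*} [AddCommMonoid D] [Module ℂ D]
    {s : ArgString Λ D X} {y : Obs Λ W} (a : Obs Λ V) {Φ : FPS V →ₗ[ℂ] D}
    {Ψ : FPS (V ⊗[ℝ] W) →ₗ[ℂ] FPS X} (hΨ : IsShift Ψ)
    (h : ∀ x, s.Represents (Φ x) (Ψ ∘ₗ starTensor F x) y) :
    (ArgString.cons F a s).Represents Φ Ψ (Obs.mul F (starTensor F) a y) := by
  refine ⟨(h _).1, fun l => ?_⟩
  have hs : s.var ∘ₗ Φ = ((starTensor F).compl₂ y.var).compr₂ Ψ :=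
    LinearMap.ext₂ fun x l => (h x).2 l
  change s.ev (Φ (a.var l)) + sw F.R21 (s.var ∘ₗ Φ) a.val l = _
  rw [hs, sw_compr₂ _ _ hΨ, (h _).1, Obs.mul_var, _root_.map_add]
  rfl

theorem ArgString.Represents.apply_eq {D : Type*} [AddCommMonoid D] [Module ℂ D]
    {s : ArgString Λ D X} {y : Obs Λ W} {Φ : D} {f : W →ₗ[ℝ] X}
    (h : s.Represents Φ (mapS f) y) : s.apply Φ = y.map f := Obs.ext' h.1 h.2

end BraidedVariation

/-! ### Identities for Lie algebra valued forms -/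

section LieValuedForms

variable {A L 𝔤 : Type*} [CommRing A] [LieRing L] [Module A L] [LieRingModule L A]
  [LieRinehartRing A L] [Algebra ℝ A] [LieAlgebra ℝ L] [LieRinehartAlgebra ℝ A L]
  [LieRing 𝔤] [LieAlgebra ℝ 𝔤]

/-- The `𝔤`-valued form `ψ ⊗ x`. -/
def GForm.of {k : ℕ} (ψ : L [⋀^Fin k]→ₗ[A] A) (x : 𝔤) : GForm A L 𝔤 k := ψ ⊗ₜ[ℝ] x

theorem GForm.induction {k : ℕ} {p : GForm A L 𝔤 k → Prop} (h0 : p 0)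
    (h1 : ∀ ψ x, p (GForm.of ψ x)) (h2 : ∀ α β, p α → p β → p (α + β)) (α : GForm A L 𝔤 k) : p α :=
  TensorProduct.induction_on α h0 h1 h2

theorem GForm.lie_of {k : ℕ} (ξ : L) (ψ : L [⋀^Fin k]→ₗ[A] A) (x : 𝔤) :
    ⁅ξ, GForm.of ψ x⁆ = GForm.of ⁅ξ, ψ⁆ x := rfl

theorem gd_of {k : ℕ} (ψ : L [⋀^Fin k]→ₗ[A] A) (x : 𝔤) :
    gd rfl (GForm.of ψ x) = GForm.of (extDer k ψ) x := rfl

theorem gbr_of {k l m : ℕ} (h : k + l = m) (α : L [⋀^Fin k]→ₗ[A] A) (β : L [⋀^Fin l]→ₗ[A] A)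
    (x y : 𝔤) : gbr h (GForm.of α x) (GForm.of β y) = GForm.of (wedge h α β) ⁅x, y⁆ := rfl

theorem gtr_of (Tr : 𝔤 →ₗ[ℝ] 𝔤 →ₗ[ℝ] ℝ) {k l m : ℕ} (h : k + l = m) (α : L [⋀^Fin k]→ₗ[A] A)
    (β : L [⋀^Fin l]→ₗ[A] A) (x y : 𝔤) :
    gtr Tr h (GForm.of α x) (GForm.of β y) = Tr x y • wedge h α β := rfl

theorem ghodge_of (g : L →ₗ[A] L →ₗ[A] A) {k l d : ℕ} (c : (L [⋀^Fin d]→ₗ[A] A) →ₗ[A] A)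
    (h : k + l = d) (β : L [⋀^Fin k]→ₗ[A] A) (y : 𝔤) :
    ghodge g c h (GForm.of β y) = GForm.of (hodge g c h β) y := rfl

theorem GForm.of_add {k : ℕ} (α β : L [⋀^Fin k]→ₗ[A] A) (x : 𝔤) :
    GForm.of (α + β) x = GForm.of α x + GForm.of β x := TensorProduct.add_tmul _ _ _

theorem GForm.of_add_right {k : ℕ} (α : L [⋀^Fin k]→ₗ[A] A) (x y : 𝔤) :
    GForm.of α (x + y) = GForm.of α x + GForm.of α y := TensorProduct.tmul_add _ _ _

theorem GForm.of_neg_right {k : ℕ} (α : L [⋀^Fin k]→ₗ[A] A) (x : 𝔤) :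
    GForm.of α (-x) = -GForm.of α x := TensorProduct.tmul_neg _ _

theorem GForm.of_zsmul {k : ℕ} (t : ℤ) (α : L [⋀^Fin k]→ₗ[A] A) (x : 𝔤) :
    GForm.of (t • α) x = t • GForm.of α x :=
  map_zsmul ((TensorProduct.mk ℝ (L [⋀^Fin k]→ₗ[A] A) 𝔤).flip x) t α

/-! ### Invariance -/

theorem gd_lie {k : ℕ} (ξ : L) (α : GForm A L 𝔤 k) : gd rfl ⁅ξ, α⁆ = ⁅ξ, gd rfl α⁆ := by
  induction α using GForm.induction with
  | h0 => simp
  | h1 ψ x => rw [GForm.lie_of, gd_of, gd_of, GForm.lie_of, extDer_lie]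
  | h2 α β hα hβ => simp only [lie_add, map_add, hα, hβ]

theorem gbr_lie {k l m : ℕ} (h : k + l = m) (ξ : L) (α : GForm A L 𝔤 k) (β : GForm A L 𝔤 l) :
    ⁅ξ, gbr h α β⁆ = gbr h ⁅ξ, α⁆ β + gbr h α ⁅ξ, β⁆ := by
  induction α using GForm.induction with
  | h0 => simp
  | h1 ψ x =>
    induction β using GForm.induction with
    | h0 => simp
    | h1 ν y => simp only [GForm.lie_of, gbr_of, form_lie_wedge, GForm.of_add]
    | h2 α β hα hβ => simp only [lie_add, map_add, hα, hβ]; abel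
  | h2 α β hα hβ => simp only [lie_add, map_add, LinearMap.add_apply, hα, hβ]; abel

theorem ghodge_lie {g : L →ₗ[A] L →ₗ[A] A} {k l d : ℕ} {c : (L [⋀^Fin d]→ₗ[A] A) →ₗ[A] A}
    (h : k + l = d) {ξ : L} (hξ : ∀ β, hodge g c h ⁅ξ, β⁆ = ⁅ξ, hodge g c h β⁆)
    (α : GForm A L 𝔤 k) : ghodge g c h ⁅ξ, α⁆ = ⁅ξ, ghodge g c h α⁆ := by
  induction α using GForm.induction with
  | h0 => simp
  | h1 ψ x => rw [GForm.lie_of, ghodge_of, ghodge_of, GForm.lie_of, hξ]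
  | h2 α β hα hβ => simp only [lie_add, map_add, hα, hβ]

/-! ### Differential identities -/

theorem gd_gd_zero (α : GForm A L 𝔤 0) : gd rfl (gd (m := 1) rfl α) = 0 := by
  induction α using GForm.induction with
  | h0 => simp
  | h1 ψ x => rw [gd_of, gd_of, extDer_extDer_zero]; exact TensorProduct.zero_tmul _ _
  | h2 α β hα hβ => simp only [map_add, hα, hβ, add_zero]

theorem gd_gbr_zero (α : GForm A L 𝔤 0) (β : GForm A L 𝔤 1) :
    gd rfl (gbr (show 0 + 1 = 1 from rfl) α β) =
      gbr (show 1 + 1 = 2 from rfl) (gd rfl α) β + gbr (show 0 + 2 = 2 from rfl) α (gd rfl β) := by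
  induction α using GForm.induction with
  | h0 => simp
  | h1 ψ x =>
    induction β using GForm.induction with
    | h0 => simp
    | h1 ν y =>
      rw [gbr_of, gd_of, gd_of, gd_of, gbr_of, gbr_of, ← GForm.of_add]
      exact congrArg (fun θ => GForm.of θ ⁅x, y⁆) (extDer_wedge_zero rfl rfl rfl ψ ν)
    | h2 α β hα hβ => simp only [map_add, hα, hβ]; abel
  | h2 α β hα hβ => simp only [map_add, LinearMap.add_apply, hα, hβ]; abel

theorem extDer_gtr_one (Tr : 𝔤 →ₗ[ℝ] 𝔤 →ₗ[ℝ] ℝ) {l m : ℕ} (h : 1 + l = m) (h1 : 2 + l = m + 1)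
    (h2 : 1 + (l + 1) = m + 1) (α : GForm A L 𝔤 1) (β : GForm A L 𝔤 l) :
    extDer m (gtr Tr h α β) = gtr Tr h1 (gd rfl α) β - gtr Tr h2 α (gd rfl β) := by
  induction α using GForm.induction with
  | h0 => simp
  | h1 ψ x =>
    induction β using GForm.induction with
    | h0 => simp
    | h1 ν y => simp only [gd_of, gtr_of, map_smul, extDer_wedge_one h h1 h2, smul_sub]
    | h2 α β hα hβ => simp only [map_add, hα, hβ]; abel
  | h2 α β hα hβ => simp only [map_add, LinearMap.add_apply, hα, hβ]; abel

/-! ### Algebraic identities -/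

theorem gbr_comm {k l m : ℕ} (h : k + l = m) (h' : l + k = m) (α : GForm A L 𝔤 k)
    (β : GForm A L 𝔤 l) : gbr h α β = -((-1 : ℤ) ^ (k * l) • gbr h' β α) := by
  induction α using GForm.induction with
  | h0 => simp
  | h1 ψ x =>
    induction β using GForm.induction with
    | h0 => simp
    | h1 ν y =>
      rw [gbr_of, gbr_of, wedge_comm h h', ← lie_skew, GForm.of_neg_right, GForm.of_zsmul]
    | h2 α β hα hβ => simp only [map_add, LinearMap.add_apply, smul_add, hα, hβ]; abel
  | h2 α β hα hβ => simp only [map_add, LinearMap.add_apply, smul_add, hα, hβ]; abel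

theorem gbr_one_one_comm (α β : GForm A L 𝔤 1) :
    gbr (show 1 + 1 = 2 from rfl) α β = gbr rfl β α := by
  rw [gbr_comm _ rfl]
  simp

theorem gtr_comm {Tr : 𝔤 →ₗ[ℝ] 𝔤 →ₗ[ℝ] ℝ} (hsymm : ∀ x y, Tr x y = Tr y x) {k l m : ℕ}
    (h : k + l = m) (h' : l + k = m) (α : GForm A L 𝔤 k) (β : GForm A L 𝔤 l) :
    gtr Tr h α β = (-1 : ℤ) ^ (k * l) • gtr Tr h' β α := by
  induction α using GForm.induction with
  | h0 => simp
  | h1 ψ x =>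
    induction β using GForm.induction with
    | h0 => simp
    | h1 ν y => rw [gtr_of, gtr_of, wedge_comm h h', hsymm x y, smul_comm]
    | h2 α β hα hβ => simp only [map_add, LinearMap.add_apply, smul_add, hα, hβ]
  | h2 α β hα hβ => simp only [map_add, LinearMap.add_apply, smul_add, hα, hβ]

theorem Tr_lie_right {Tr : 𝔤 →ₗ[ℝ] 𝔤 →ₗ[ℝ] ℝ} (hinv : ∀ x y z : 𝔤, Tr ⁅x, z⁆ y + Tr z ⁅x, y⁆ = 0)
    (x y z : 𝔤) : Tr x ⁅y, z⁆ = Tr ⁅x, y⁆ z := by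
  have := hinv y z x
  rw [← lie_skew, map_neg, LinearMap.neg_apply] at this
  linarith

/-- Combines associativity of the exterior product for two 1-forms with Tr(x, [y, z]) = Tr([x, y],
z). -/
theorem gtr_gbr_one {Tr : 𝔤 →ₗ[ℝ] 𝔤 →ₗ[ℝ] ℝ} (hinv : ∀ x y z : 𝔤, Tr ⁅x, z⁆ y + Tr z ⁅x, y⁆ = 0)
    {l p m : ℕ} (h1 : 1 + l = p) (h2 : 1 + p = m) (h3 : 2 + l = m) (α β : GForm A L 𝔤 1)
    (γ : GForm A L 𝔤 l) : gtr Tr h2 α (gbr h1 β γ) = gtr Tr h3 (gbr rfl α β) γ := by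
  induction α using GForm.induction with
  | h0 => simp
  | h1 ψ x =>
    induction β using GForm.induction with
    | h0 => simp
    | h1 ν y =>
      induction γ using GForm.induction with
      | h0 => simp
      | h1 ρ z =>
        simp only [gbr_of, gtr_of, wedge_one_assoc h1 h2 h3, Tr_lie_right hinv]
      | h2 α β hα hβ => simp only [map_add, hα, hβ]
    | h2 α β hα hβ => simp only [map_add, LinearMap.add_apply, hα, hβ]
  | h2 α β hα hβ => simp only [map_add, LinearMap.add_apply, hα, hβ]

/-- The Jacobi identity of 𝔤; no sign arises because α has degree 0. -/
theorem gbr_zero_gbr (α : GForm A L 𝔤 0) (β γ : GForm A L 𝔤 1) :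
    gbr (show 0 + 2 = 2 from rfl) α (gbr rfl β γ) =
      gbr rfl (gbr (show 0 + 1 = 1 from rfl) α β) γ +
        gbr rfl β (gbr (show 0 + 1 = 1 from rfl) α γ) := by
  induction α using GForm.induction with
  | h0 => simp
  | h1 ψ x =>
    induction β using GForm.induction with
    | h0 => simp
    | h1 ν y =>
      induction γ using GForm.induction with
      | h0 => simp
      | h1 ρ z =>
        simp only [gbr_of, wedge_zero_left_apply, map_smul, LinearMap.smul_apply]
        rw [← GForm.of_add_right, ← leibniz_lie]
      | h2 α β hα hβ => simp only [map_add, hα, hβ]; abel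
    | h2 α β hα hβ => simp only [map_add, LinearMap.add_apply, hα, hβ]; abel
  | h2 α β hα hβ => simp only [map_add, LinearMap.add_apply, hα, hβ]; abel

theorem gtr_ghodge_symm {Tr : 𝔤 →ₗ[ℝ] 𝔤 →ₗ[ℝ] ℝ} (hsymm : ∀ x y, Tr x y = Tr y x)
    {g : L →ₗ[A] L →ₗ[A] A} {l d : ℕ} {c : (L [⋀^Fin d]→ₗ[A] A) →ₗ[A] A} (h : 2 + l = d)
    (hg : ∀ α β : L [⋀^Fin 2]→ₗ[A] A, wedge h α (hodge g c h β) = wedge h β (hodge g c h α))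
    (α β : GForm A L 𝔤 2) : gtr Tr h α (ghodge g c h β) = gtr Tr h β (ghodge g c h α) := by
  induction α using GForm.induction with
  | h0 => simp
  | h1 ψ x =>
    induction β using GForm.induction with
    | h0 => simp
    | h1 ν y => rw [ghodge_of, ghodge_of, gtr_of, gtr_of, hg, hsymm]
    | h2 α β hα hβ => simp only [map_add, LinearMap.add_apply, hα, hβ]
  | h2 α β hα hβ => simp only [map_add, LinearMap.add_apply, hα, hβ]

/-- The Hodge operator is linear over functions and acts trivially on 𝔤, so this is the invariance
of Tr pointwise. -/
theorem gtr_gbr_zero_ghodge {Tr : 𝔤 →ₗ[ℝ] 𝔤 →ₗ[ℝ] ℝ}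
    (hinv : ∀ x y z : 𝔤, Tr ⁅x, z⁆ y + Tr z ⁅x, y⁆ = 0)
    {g : L →ₗ[A] L →ₗ[A] A} {l d : ℕ} {c : (L [⋀^Fin d]→ₗ[A] A) →ₗ[A] A} (h : 2 + l = d)
    (α : GForm A L 𝔤 0) (β γ : GForm A L 𝔤 2) :
    gtr Tr h (gbr (show 0 + 2 = 2 from rfl) α β) (ghodge g c h γ) +
      gtr Tr h β (ghodge g c h (gbr (show 0 + 2 = 2 from rfl) α γ)) = 0 := by
  induction α using GForm.induction with
  | h0 => simp
  | h1 ψ x =>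
    induction β using GForm.induction with
    | h0 => simp
    | h1 ν y =>
      induction γ using GForm.induction with
      | h0 => simp
      | h1 ρ z =>
        simp only [gbr_of, ghodge_of, gtr_of, wedge_zero_left_apply, map_smul, hodge_smul,
          LinearMap.smul_apply]
        rw [← add_smul, hinv, zero_smul]
      | h2 α β hα hβ =>
        simp only [map_add]
        rw [add_add_add_comm, hα, hβ, add_zero]
    | h2 α β hα hβ =>
      simp only [map_add, LinearMap.add_apply]
      rw [add_add_add_comm, hα, hβ, add_zero]
  | h2 α β hα hβ =>
    simp only [map_add, LinearMap.add_apply]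
    rw [add_add_add_comm, hα, hβ, add_zero]

end LieValuedForms

/-! ### Variations of powers of the gauge field -/

section GaugeVariation

variable {𝔨 : Type*} [LieRing 𝔨] [LieAlgebra ℝ 𝔨] {Λ V S W : Type*}
  [AddCommGroup Λ] [Module ℝ Λ] [LieRingModule 𝔨 Λ] [LieModule ℝ 𝔨 Λ]
  [AddCommGroup V] [Module ℝ V] [LieRingModule 𝔨 V] [LieModule ℝ 𝔨 V]
  [AddCommGroup W] [Module ℝ W] [LieRingModule 𝔨 W] [LieModule ℝ 𝔨 W]
  [AddCommGroup S] [Module ℝ S] [LieRingModule 𝔨 S] [LieModule ℝ 𝔨 S]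
  (F : DrinfeldTwist 𝔨)

/-- `l ⊗ (v ⊗ s) ↦ d l ⊗ (v ⊗ s) + v ⊗ D(l ⊗ s)`. -/
noncomputable def shiftVar (d : Λ →ₗ[ℝ] V) (D : Λ ⊗[ℝ] S →ₗ[ℝ] V ⊗[ℝ] S) :
    Λ ⊗[ℝ] (V ⊗[ℝ] S) →ₗ[ℝ] V ⊗[ℝ] (V ⊗[ℝ] S) :=
  TensorProduct.map d LinearMap.id +
    TensorProduct.map LinearMap.id D ∘ₗ (TensorProduct.leftComm ℝ Λ V S).toLinearMap

/-- `l ⊗ v ↦ d l ⊗ v + v ⊗ d l`. -/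
noncomputable def shiftVarOne (d : Λ →ₗ[ℝ] V) : Λ ⊗[ℝ] V →ₗ[ℝ] V ⊗[ℝ] V :=
  TensorProduct.map d LinearMap.id +
    TensorProduct.map LinearMap.id d ∘ₗ (TensorProduct.comm ℝ Λ V).toLinearMap

/-- The action `l ⊗ (v ⊗ w) ↦ β(l ⊗ v) ⊗ w + v ⊗ B(l ⊗ w)` on a tensor product. -/
noncomputable def rotVar (β : Λ ⊗[ℝ] V →ₗ[ℝ] V) (B : Λ ⊗[ℝ] W →ₗ[ℝ] W) :
    Λ ⊗[ℝ] (V ⊗[ℝ] W) →ₗ[ℝ] V ⊗[ℝ] W :=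
  TensorProduct.map β LinearMap.id ∘ₗ (TensorProduct.assoc ℝ Λ V W).symm.toLinearMap +
    TensorProduct.map LinearMap.id B ∘ₗ (TensorProduct.leftComm ℝ Λ V W).toLinearMap

variable {d : Λ →ₗ[ℝ] V} {β : Λ ⊗[ℝ] V →ₗ[ℝ] V}

theorem mapS_assoc_symm (l : FPS Λ) (x : FPS V) (y : FPS W) :
    mapS (TensorProduct.assoc ℝ Λ V W).symm.toLinearMap (starTensor F l (starTensor F x y)) =
      starTensor F (starTensor F l x) y := by
  rw [← starTensor_assoc, ← mapS_comp]
  simp [mapS_id]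

theorem IsInv.assoc_symm : IsInv 𝔨 (TensorProduct.assoc ℝ Λ V W).symm.toLinearMap := by
  intro ξ u
  apply (TensorProduct.assoc ℝ Λ V W).injective
  have h := IsInv.assoc (𝔨 := 𝔨) Λ V W ξ ((TensorProduct.assoc ℝ Λ V W).symm u)
  simp only [LinearEquiv.coe_coe, LinearEquiv.apply_symm_apply] at h ⊢
  exact h.symm

theorem IsInv.shiftVarOne (hd : IsInv 𝔨 d) : IsInv 𝔨 (shiftVarOne d) :=
  (hd.map IsInv.id).add ((IsInv.id.map hd).comp (IsInv.comm Λ V))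

theorem IsInv.shiftVar (hd : IsInv 𝔨 d) {D : Λ ⊗[ℝ] S →ₗ[ℝ] V ⊗[ℝ] S} (hD : IsInv 𝔨 D) :
    IsInv 𝔨 (shiftVar d D) :=
  (hd.map IsInv.id).add ((IsInv.id.map hD).comp (IsInv.leftComm Λ V S))

theorem IsInv.rotVar (hβ : IsInv 𝔨 β) {B : Λ ⊗[ℝ] W →ₗ[ℝ] W} (hB : IsInv 𝔨 B) :
    IsInv 𝔨 (rotVar β B) :=
  ((hβ.map IsInv.id).comp IsInv.assoc_symm).add ((IsInv.id.map hB).comp (IsInv.leftComm Λ V W))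

section

variable {a : Obs Λ V} (ha : ∀ l, a.var l = mapS d l - mapS β (starTensor F l a.val))
  (hd : IsInv 𝔨 d) (hβ : IsInv 𝔨 β)
include ha hd hβ

/-- With λ written leftmost the braided variation is given by classical maps: dλ is inserted in each
slot, minus each slot is rotated by λ. No R-matrix survives. -/
theorem var_mul_self (l : FPS Λ) : (Obs.mul F (starTensor F) a a).var l =
    mapS (shiftVarOne d) (starTensor F l a.val) -
      mapS (rotVar β β) (starTensor F l (starTensor F a.val a.val)) := by
  have h : (starTensor F (V := V)).compl₂ (mapS d) = (starTensor F).compl₂ a.var +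
      (starTensor F).compl₂ (mapS β ∘ₗ (starTensor F).flip a.val) := by
    rw [← starTensor_compl₂_add]
    congr 1
    exact LinearMap.ext fun l => eq_add_of_sub_eq (ha l).symm
  have h' := congrArg (fun B => sw F.R21 B a.val l) h
  simp only [map_add, LinearMap.add_apply] at h'
  rw [Obs.mul_var, eq_sub_of_add_eq h'.symm, ha, map_sub, LinearMap.sub_apply,
    sw_R21_starTensor_mapS F hd, sw_R21_starTensor_starTensor F hβ,
    starTensor_mapS_left F hd, starTensor_mapS_left F hβ, ← mapS_assoc_symm, shiftVarOne, rotVar,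
    mapS_add, mapS_add, ← mapS_comp]
  simp only [LinearMap.rTensor]
  abel

/-- The inductive step: the normal form of a variation is inherited by the next power. The shift
term uses the lower power s with y = a ⊗⋆ s, since inserting dλ replaces one factor a. -/
theorem var_mul {y : Obs Λ (V ⊗[ℝ] S)} {D : Λ ⊗[ℝ] S →ₗ[ℝ] V ⊗[ℝ] S}
    {B : Λ ⊗[ℝ] (V ⊗[ℝ] S) →ₗ[ℝ] V ⊗[ℝ] S} {s : FPS S} (hy : y.val = starTensor F a.val s)
    (hD : IsInv 𝔨 D) (hB : IsInv 𝔨 B)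
    (hvar : ∀ l, y.var l = mapS D (starTensor F l s) - mapS B (starTensor F l y.val))
    (l : FPS Λ) : (Obs.mul F (starTensor F) a y).var l =
      mapS (shiftVar d D) (starTensor F l y.val) -
        mapS (rotVar β B) (starTensor F l (starTensor F a.val y.val)) := by
  have h : (starTensor F (V := V)).compl₂ (mapS D ∘ₗ (starTensor F).flip s) =
      (starTensor F).compl₂ y.var +
      (starTensor F).compl₂ (mapS B ∘ₗ (starTensor F).flip y.val) := by
    rw [← starTensor_compl₂_add]
    congr 1
    exact LinearMap.ext fun l => eq_add_of_sub_eq (hvar l).symm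
  have h' := congrArg (fun B => sw F.R21 B a.val l) h
  simp only [map_add, LinearMap.add_apply] at h'
  rw [Obs.mul_var, eq_sub_of_add_eq h'.symm, ha, map_sub, LinearMap.sub_apply,
    sw_R21_starTensor_starTensor F hD, sw_R21_starTensor_starTensor F hB,
    starTensor_mapS_left F hd, starTensor_mapS_left F hβ, ← mapS_assoc_symm, shiftVar, rotVar,
    mapS_add, mapS_add, ← mapS_comp, ← hy]
  simp only [LinearMap.rTensor]
  abel

theorem isHexagonal_var : IsHexagonal V F a.var := by
  have h : a.var = mapS d + mapS (-β) ∘ₗ (starTensor F).flip a.val :=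
    LinearMap.ext fun l => by
      rw [ha, sub_eq_add_neg, ← mapS_neg]
      rfl
  rw [h]
  exact (isHexagonal_mapS hd).add (isHexagonal_starTensor hβ.neg _)

theorem isHexagonal_var_mul_self : IsHexagonal V F (Obs.mul F (starTensor F) a a).var := by
  have h : (Obs.mul F (starTensor F) a a).var =
      mapS (shiftVarOne d) ∘ₗ (starTensor F).flip a.val +
      mapS (-rotVar β β) ∘ₗ (starTensor F).flip (starTensor F a.val a.val) :=
    LinearMap.ext fun l => by
      rw [var_mul_self F ha hd hβ, sub_eq_add_neg, ← mapS_neg]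
      rfl
  rw [h]
  exact (isHexagonal_starTensor hd.shiftVarOne _).add (isHexagonal_starTensor (hβ.rotVar hβ).neg _)

end

end GaugeVariation

theorem starProd_compl₁₂ {𝔨 V W V' W' X : Type*} [LieRing 𝔨] [LieAlgebra ℝ 𝔨]
    [AddCommGroup V] [Module ℝ V] [LieRingModule 𝔨 V] [LieModule ℝ 𝔨 V]
    [AddCommGroup W] [Module ℝ W] [LieRingModule 𝔨 W] [LieModule ℝ 𝔨 W]
    [AddCommGroup V'] [Module ℝ V'] [LieRingModule 𝔨 V'] [LieModule ℝ 𝔨 V']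
    [AddCommGroup W'] [Module ℝ W'] [LieRingModule 𝔨 W'] [LieModule ℝ 𝔨 W']
    [AddCommGroup X] [Module ℝ X] (F : DrinfeldTwist 𝔨) (b : V' →ₗ[ℝ] W' →ₗ[ℝ] X)
    {f : V →ₗ[ℝ] V'} {g : W →ₗ[ℝ] W'} (hf : IsInv 𝔨 f) (hg : IsInv 𝔨 g) (v : FPS V) (w : FPS W) :
    starProd F (b.compl₁₂ f g) v w = starProd F b (mapS f v) (mapS g w) := by
  rw [starProd, starProd, sw_mapS_mapS _ _ hf hg, ← cauchy_compl₁₂]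

theorem tensor_ext_four {M N P Q X : Type*} [AddCommGroup M] [Module ℝ M] [AddCommGroup N]
    [Module ℝ N] [AddCommGroup P] [Module ℝ P] [AddCommGroup Q] [Module ℝ Q] [AddCommGroup X]
    [Module ℝ X] {g h : M ⊗[ℝ] (N ⊗[ℝ] (P ⊗[ℝ] Q)) →ₗ[ℝ] X}
    (H : ∀ w x y z, g (w ⊗ₜ (x ⊗ₜ (y ⊗ₜ z))) = h (w ⊗ₜ (x ⊗ₜ (y ⊗ₜ z)))) : g = h := by
  ext w x y z
  exact H w x y z

theorem tensor_ext_five {M N P Q S X : Type*} [AddCommGroup M] [Module ℝ M] [AddCommGroup N]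
    [Module ℝ N] [AddCommGroup P] [Module ℝ P] [AddCommGroup Q] [Module ℝ Q] [AddCommGroup S]
    [Module ℝ S] [AddCommGroup X] [Module ℝ X] {g h : M ⊗[ℝ] (N ⊗[ℝ] (P ⊗[ℝ] (Q ⊗[ℝ] S))) →ₗ[ℝ] X}
    (H : ∀ w x y z u, g (w ⊗ₜ (x ⊗ₜ (y ⊗ₜ (z ⊗ₜ u)))) = h (w ⊗ₜ (x ⊗ₜ (y ⊗ₜ (z ⊗ₜ u))))) :
    g = h := by
  ext w x y z u
  exact H w x y z u

/-! ### Classical gauge identities of the polarised Yang-Mills density -/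

section YangMillsDensities

variable {A L 𝔤 : Type*} [CommRing A] [LieRing L] [Module A L] [LieRingModule L A]
  [LieRinehartRing A L] [Algebra ℝ A] [LieAlgebra ℝ L] [LieRinehartAlgebra ℝ A L]
  [LieRing 𝔤] [LieAlgebra ℝ 𝔤] {n : ℕ} (Y : YMData A L 𝔤 n)

namespace YMData

/-- The properties of the data on which gauge invariance rests. -/
structure IsRegular : Prop where
  symm : ∀ x y : 𝔤, Y.Tr x y = Y.Tr y x
  inv : ∀ x y z : 𝔤, Y.Tr ⁅x, z⁆ y + Y.Tr z ⁅x, y⁆ = 0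
  hodge_lie : ∀ ξ ∈ Y.𝔨, ∀ β : L [⋀^Fin 2]→ₗ[A] A,
    hodge Y.metric Y.coeff (show 2 + n = n + 2 by omega) ⁅ξ, β⁆ =
      ⁅ξ, hodge Y.metric Y.coeff (show 2 + n = n + 2 by omega) β⁆
  hodge_symm : ∀ α β : L [⋀^Fin 2]→ₗ[A] A,
    wedge (show 2 + n = n + 2 by omega) α (hodge Y.metric Y.coeff (by omega) β) =
      wedge (show 2 + n = n + 2 by omega) β (hodge Y.metric Y.coeff (by omega) α)

/-- The inner product density `Tr(α ∧ ∗β)` of `2`-forms. -/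
noncomputable def inner2 : GForm A L 𝔤 2 →ₗ[ℝ] GForm A L 𝔤 2 →ₗ[ℝ] (L [⋀^Fin (n + 2)]→ₗ[A] A) :=
  (gtr Y.Tr (by omega)).compl₂ (Y.hod (k := 2) (l := n) (by omega))

theorem inner2_apply (α β : GForm A L 𝔤 2) :
    Y.inner2 α β = gtr Y.Tr (by omega) α (Y.hod (k := 2) (l := n) (by omega) β) := rfl

variable (A L 𝔤) in
/-- The bracket of `1`-forms. -/
noncomputable def br : GForm A L 𝔤 1 ⊗[ℝ] GForm A L 𝔤 1 →ₗ[ℝ] GForm A L 𝔤 2 :=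
  TensorProduct.lift (gbr rfl)

variable (A L 𝔤) in
/-- The exterior derivative of `1`-forms. -/
noncomputable def d1 : GForm A L 𝔤 1 →ₗ[ℝ] GForm A L 𝔤 2 := gd rfl

variable (A L 𝔤) in
/-- The exterior derivative of functions. -/
noncomputable def d0 : GForm A L 𝔤 0 →ₗ[ℝ] GForm A L 𝔤 1 := gd rfl

variable (A L 𝔤) in
/-- The bracket of a function and a `1`-form. -/
noncomputable def br0 : GForm A L 𝔤 0 ⊗[ℝ] GForm A L 𝔤 1 →ₗ[ℝ] GForm A L 𝔤 1 :=
  TensorProduct.lift (gbr rfl)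

theorem br_comm (α β : GForm A L 𝔤 1) : br A L 𝔤 (α ⊗ₜ β) = br A L 𝔤 (β ⊗ₜ α) :=
  gbr_one_one_comm α β

theorem d1_d0 (α : GForm A L 𝔤 0) : d1 A L 𝔤 (d0 A L 𝔤 α) = 0 := gd_gd_zero α

/-- `(α, (β, γ)) ↦ Tr([α, γ] ∧ ∗β)`. -/
noncomputable def innerMid :
    GForm A L 𝔤 1 ⊗[ℝ] (GForm A L 𝔤 2 ⊗[ℝ] GForm A L 𝔤 1) →ₗ[ℝ] (L [⋀^Fin (n + 2)]→ₗ[A] A) :=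
  TensorProduct.lift Y.inner2 ∘ₗ TensorProduct.map (br A L 𝔤) LinearMap.id ∘ₗ
    (TensorProduct.assoc ℝ _ _ _).symm.toLinearMap ∘ₗ
    TensorProduct.map LinearMap.id (TensorProduct.comm ℝ _ _).toLinearMap

/-- `(α, (β, (γ, δ))) ↦ Tr([α, γ] ∧ ∗[β, δ])`. -/
noncomputable def innerCross :
    GForm A L 𝔤 1 ⊗[ℝ] (GForm A L 𝔤 1 ⊗[ℝ] (GForm A L 𝔤 1 ⊗[ℝ] GForm A L 𝔤 1)) →ₗ[ℝ]
      (L [⋀^Fin (n + 2)]→ₗ[A] A) :=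
  TensorProduct.lift Y.inner2 ∘ₗ TensorProduct.map (br A L 𝔤) (br A L 𝔤) ∘ₗ
    (TensorProduct.assoc ℝ _ _ _).symm.toLinearMap ∘ₗ
    TensorProduct.map LinearMap.id (TensorProduct.leftComm ℝ _ _ _).toLinearMap

theorem innerCross_tmul (α β γ δ : GForm A L 𝔤 1) :
    Y.innerCross (α ⊗ₜ (β ⊗ₜ (γ ⊗ₜ δ))) = Y.inner2 (br A L 𝔤 (α ⊗ₜ γ)) (br A L 𝔤 (β ⊗ₜ δ)) := rfl

/-- The quadratic part of the Yang-Mills density. -/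
noncomputable def ym2 : GForm A L 𝔤 1 ⊗[ℝ] GForm A L 𝔤 1 →ₗ[ℝ] (L [⋀^Fin (n + 2)]→ₗ[A] A) :=
  (1 / 2 : ℝ) • (TensorProduct.lift Y.inner2 ∘ₗ TensorProduct.map (d1 A L 𝔤) (d1 A L 𝔤))

/-- The cubic part of the Yang-Mills density. -/
noncomputable def ym3 : GForm A L 𝔤 1 ⊗[ℝ] (GForm A L 𝔤 1 ⊗[ℝ] GForm A L 𝔤 1) →ₗ[ℝ]
    (L [⋀^Fin (n + 2)]→ₗ[A] A) :=
  (1 / 6 : ℝ) • (TensorProduct.lift Y.inner2 ∘ₗ TensorProduct.map (d1 A L 𝔤) (br A L 𝔤) +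
    TensorProduct.lift Y.inner2 ∘ₗ TensorProduct.map (br A L 𝔤) (d1 A L 𝔤) ∘ₗ
      (TensorProduct.assoc ℝ _ _ _).symm.toLinearMap +
    Y.innerMid ∘ₗ TensorProduct.map LinearMap.id (TensorProduct.map (d1 A L 𝔤) LinearMap.id))

/-- The quartic part of the Yang-Mills density. -/
noncomputable def ym4 :
    GForm A L 𝔤 1 ⊗[ℝ] (GForm A L 𝔤 1 ⊗[ℝ] (GForm A L 𝔤 1 ⊗[ℝ] GForm A L 𝔤 1)) →ₗ[ℝ]
      (L [⋀^Fin (n + 2)]→ₗ[A] A) :=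
  (1 / 24 : ℝ) • (TensorProduct.lift Y.inner2 ∘ₗ TensorProduct.map (br A L 𝔤) (br A L 𝔤) ∘ₗ
      (TensorProduct.assoc ℝ _ _ _).symm.toLinearMap +
    Y.innerCross +
    Y.innerMid ∘ₗ TensorProduct.map LinearMap.id (TensorProduct.map (br A L 𝔤) LinearMap.id ∘ₗ
      (TensorProduct.assoc ℝ _ _ _).symm.toLinearMap))

theorem ym2_tmul (α β : GForm A L 𝔤 1) :
    Y.ym2 (α ⊗ₜ β) = (1 / 2 : ℝ) • Y.inner2 (d1 A L 𝔤 α) (d1 A L 𝔤 β) := rfl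

theorem ym3_tmul (α β γ : GForm A L 𝔤 1) :
    Y.ym3 (α ⊗ₜ (β ⊗ₜ γ)) = (1 / 6 : ℝ) • (Y.inner2 (d1 A L 𝔤 α) (br A L 𝔤 (β ⊗ₜ γ)) +
      Y.inner2 (br A L 𝔤 (α ⊗ₜ β)) (d1 A L 𝔤 γ) + Y.inner2 (br A L 𝔤 (α ⊗ₜ γ)) (d1 A L 𝔤 β)) := rfl

theorem ym4_tmul (α β γ δ : GForm A L 𝔤 1) :
    Y.ym4 (α ⊗ₜ (β ⊗ₜ (γ ⊗ₜ δ))) = (1 / 24 : ℝ) •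
      (Y.inner2 (br A L 𝔤 (α ⊗ₜ β)) (br A L 𝔤 (γ ⊗ₜ δ)) +
      Y.inner2 (br A L 𝔤 (α ⊗ₜ γ)) (br A L 𝔤 (β ⊗ₜ δ)) +
      Y.inner2 (br A L 𝔤 (α ⊗ₜ δ)) (br A L 𝔤 (β ⊗ₜ γ))) := by
  rw [ym4, LinearMap.smul_apply, LinearMap.add_apply, LinearMap.add_apply, innerCross_tmul]
  rfl

/-! ### Infinitesimal gauge invariance of the densities -/

variable {Y}

theorem IsRegular.inner2_comm (hY : Y.IsRegular) (α β : GForm A L 𝔤 2) :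
    Y.inner2 α β = Y.inner2 β α := gtr_ghodge_symm hY.symm _ hY.hodge_symm α β

theorem IsRegular.inner2_ad (hY : Y.IsRegular) (l : GForm A L 𝔤 0) (α β : GForm A L 𝔤 2) :
    Y.inner2 (gbr rfl l α) β + Y.inner2 α (gbr rfl l β) = 0 := by
  rw [inner2_apply, inner2_apply]
  exact gtr_gbr_zero_ghodge hY.inv (g := Y.metric) (c := Y.coeff) (by omega) l α β

theorem d1_br0 (l : GForm A L 𝔤 0) (α : GForm A L 𝔤 1) :
    d1 A L 𝔤 (br0 A L 𝔤 (l ⊗ₜ α)) =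
      br A L 𝔤 (d0 A L 𝔤 l ⊗ₜ α) + gbr rfl l (d1 A L 𝔤 α) := gd_gbr_zero l α

theorem ad_br (l : GForm A L 𝔤 0) (α β : GForm A L 𝔤 1) :
    gbr rfl l (br A L 𝔤 (α ⊗ₜ β)) =
      br A L 𝔤 (br0 A L 𝔤 (l ⊗ₜ α) ⊗ₜ β) + br A L 𝔤 (α ⊗ₜ br0 A L 𝔤 (l ⊗ₜ β)) :=
  gbr_zero_gbr l α β

/-- The linear order of gauge invariance: only d(dλ) occurs. -/
theorem ym2_shift : Y.ym2 ∘ₗ shiftVarOne (d0 A L 𝔤) = 0 := by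
  refine TensorProduct.ext' fun l α => ?_
  simp [shiftVarOne, ym2_tmul, d1_d0]

/-- At quadratic order, inserting dλ in the cubic density must match rotating the quadratic one.
Since d[λ, α] = [dλ, α] + [λ, dα], the [λ, -] terms cancel by invariance of the inner product and
the [dλ, α] terms remain. -/
theorem IsRegular.ym3_shift (hY : Y.IsRegular) :
    Y.ym3 ∘ₗ shiftVar (d0 A L 𝔤) (shiftVarOne (d0 A L 𝔤)) =
      Y.ym2 ∘ₗ rotVar (br0 A L 𝔤) (br0 A L 𝔤) := by
  refine TensorProduct.ext_threefold' fun l α β => ?_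
  have h1 := hY.inner2_ad l (d1 A L 𝔤 α) (d1 A L 𝔤 β)
  simp only [shiftVarOne, shiftVar, rotVar, LinearMap.comp_apply, LinearMap.add_apply, map_add,
    TensorProduct.map_tmul, LinearMap.id_apply, LinearEquiv.coe_coe, TensorProduct.comm_tmul,
    TensorProduct.leftComm_tmul, TensorProduct.assoc_symm_tmul, TensorProduct.tmul_add,
    ym2_tmul, ym3_tmul, d1_d0, map_zero, LinearMap.zero_apply, d1_br0]
  rw [eq_neg_of_add_eq_zero_left h1, br_comm α (d0 A L 𝔤 l), br_comm β (d0 A L 𝔤 l), hY.inner2_comm (d1 A L 𝔤 α) (br A L 𝔤 (_ ⊗ₜ β))]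
  module

theorem IsRegular.ym4_shift (hY : Y.IsRegular) :
    Y.ym4 ∘ₗ shiftVar (d0 A L 𝔤) (shiftVar (d0 A L 𝔤) (shiftVarOne (d0 A L 𝔤))) =
      Y.ym3 ∘ₗ rotVar (br0 A L 𝔤) (rotVar (br0 A L 𝔤) (br0 A L 𝔤)) := by
  refine tensor_ext_four fun l α β γ => ?_
  have h1 := hY.inner2_ad l (d1 A L 𝔤 α) (br A L 𝔤 (β ⊗ₜ γ))
  have h2 := hY.inner2_ad l (br A L 𝔤 (α ⊗ₜ β)) (d1 A L 𝔤 γ)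
  have h3 := hY.inner2_ad l (br A L 𝔤 (α ⊗ₜ γ)) (d1 A L 𝔤 β)
  simp only [ad_br, map_add, LinearMap.add_apply] at h1 h2 h3
  simp only [shiftVarOne, shiftVar, rotVar, LinearMap.comp_apply, LinearMap.add_apply, map_add,
    TensorProduct.map_tmul, LinearMap.id_apply, LinearEquiv.coe_coe, TensorProduct.comm_tmul,
    TensorProduct.leftComm_tmul, TensorProduct.assoc_symm_tmul, TensorProduct.tmul_add,
    ym3_tmul, ym4_tmul, d1_br0]
  rw [br_comm α (d0 A L 𝔤 l), br_comm β (d0 A L 𝔤 l), br_comm γ (d0 A L 𝔤 l),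
    hY.inner2_comm (br A L 𝔤 (d0 A L 𝔤 l ⊗ₜ β)), hY.inner2_comm (br A L 𝔤 (d0 A L 𝔤 l ⊗ₜ γ))]
  -- One invariance relation for each of the three pairings in the cubic density, with its weight
  -- 1/6.
  linear_combination (norm := module) (-1 / 6 : ℝ) • h1 + (-1 / 6 : ℝ) • h2 + (-1 / 6 : ℝ) • h3

/-- The quartic density contains no derivatives, so each of its three pairings is invariant by
Jacobi and the invariance of the inner product. -/
theorem IsRegular.ym4_rot (hY : Y.IsRegular) :
    Y.ym4 ∘ₗ rotVar (br0 A L 𝔤) (rotVar (br0 A L 𝔤) (rotVar (br0 A L 𝔤) (br0 A L 𝔤))) = 0 := by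
  refine tensor_ext_five fun l α β γ δ => ?_
  have h1 := hY.inner2_ad l (br A L 𝔤 (α ⊗ₜ β)) (br A L 𝔤 (γ ⊗ₜ δ))
  have h2 := hY.inner2_ad l (br A L 𝔤 (α ⊗ₜ γ)) (br A L 𝔤 (β ⊗ₜ δ))
  have h3 := hY.inner2_ad l (br A L 𝔤 (α ⊗ₜ δ)) (br A L 𝔤 (β ⊗ₜ γ))
  simp only [ad_br, map_add, LinearMap.add_apply] at h1 h2 h3
  simp only [rotVar, LinearMap.comp_apply, LinearMap.add_apply, map_add,
    TensorProduct.map_tmul, LinearMap.id_apply, LinearEquiv.coe_coe, LinearMap.zero_apply,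
    TensorProduct.leftComm_tmul, TensorProduct.assoc_symm_tmul, TensorProduct.tmul_add,
    ym4_tmul]
  linear_combination (norm := module) (1 / 24 : ℝ) • h1 + (1 / 24 : ℝ) • h2 + (1 / 24 : ℝ) • h3

end YMData

end YangMillsDensities

/-! ### The gauge field and its ordered powers -/

section YangMillsObservables

section TensorActions

variable {L : Type*} [LieRing L] [LieAlgebra ℝ L] (𝔥 : LieSubalgebra ℝ L) (V W : Type*)
  [AddCommGroup V] [Module ℝ V] [LieRingModule 𝔥 V] [LieModule ℝ 𝔥 V]
  [AddCommGroup W] [Module ℝ W] [LieRingModule 𝔥 W] [LieModule ℝ 𝔥 W]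

/-- The tensor product action of a subalgebra; it takes precedence over the restriction of the
tensor product action of the ambient Lie algebra. -/
noncomputable instance subalgebraTensorLieRingModule : LieRingModule 𝔥 (V ⊗[ℝ] W) :=
  TensorProduct.LieModule.lieRingModule

instance subalgebraTensorLieModule : LieModule ℝ 𝔥 (V ⊗[ℝ] W) :=
  TensorProduct.LieModule.lieModule

end TensorActions

variable {A L 𝔤 : Type*} [CommRing A] [LieRing L] [Module A L] [LieRingModule L A]
  [LieRinehartRing A L] [Algebra ℝ A] [LieAlgebra ℝ L] [LieRinehartAlgebra ℝ A L]
  [LieRing 𝔤] [LieAlgebra ℝ 𝔤] {n : ℕ} {Y : YMData A L 𝔤 n}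

namespace YMData

theorem isInv_gd {k : ℕ} : IsInv Y.𝔨 (gd rfl : GForm A L 𝔤 k →ₗ[ℝ] GForm A L 𝔤 (k + 1)) :=
  fun ξ α => gd_lie (ξ : L) α

theorem isInv_d0 : IsInv Y.𝔨 (d0 A L 𝔤) := isInv_gd

theorem isInv_d1 : IsInv Y.𝔨 (d1 A L 𝔤) := isInv_gd

theorem isInv_gbr {k l m : ℕ} (h : k + l = m) :
    IsInv Y.𝔨 (TensorProduct.lift (gbr h : GForm A L 𝔤 k →ₗ[ℝ] GForm A L 𝔤 l →ₗ[ℝ] _)) :=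
  IsInv₂.lift fun ξ α β => gbr_lie h (ξ : L) α β

theorem isInv_br : IsInv Y.𝔨 (br A L 𝔤) := isInv_gbr rfl

theorem isInv_br0 : IsInv Y.𝔨 (br0 A L 𝔤) := isInv_gbr rfl

theorem IsRegular.isInv_hod (hY : Y.IsRegular) :
    IsInv Y.𝔨 (Y.hod (k := 2) (l := n) (by omega)) :=
  fun ξ α => ghodge_lie (g := Y.metric) (c := Y.coeff) _ (hY.hodge_lie ξ ξ.2) α

variable (Y)

/-- The product `a ⊗⋆ a`. -/
noncomputable def field2 (a : FPS (GForm A L 𝔤 1)) :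
    Obs (GForm A L 𝔤 0) (GForm A L 𝔤 1 ⊗[ℝ] GForm A L 𝔤 1) :=
  Obs.mul Y.F (starTensor Y.F) (Y.field a) (Y.field a)

/-- The product `a ⊗⋆ (a ⊗⋆ a)`. -/
noncomputable def field3 (a : FPS (GForm A L 𝔤 1)) :
    Obs (GForm A L 𝔤 0) (GForm A L 𝔤 1 ⊗[ℝ] (GForm A L 𝔤 1 ⊗[ℝ] GForm A L 𝔤 1)) :=
  Obs.mul Y.F (starTensor Y.F) (Y.field a) (Y.field2 a)

/-- The product `a ⊗⋆ (a ⊗⋆ (a ⊗⋆ a))`. -/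
noncomputable def field4 (a : FPS (GForm A L 𝔤 1)) :
    Obs (GForm A L 𝔤 0)
      (GForm A L 𝔤 1 ⊗[ℝ] (GForm A L 𝔤 1 ⊗[ℝ] (GForm A L 𝔤 1 ⊗[ℝ] GForm A L 𝔤 1))) :=
  Obs.mul Y.F (starTensor Y.F) (Y.field a) (Y.field3 a)

variable {Y} (a : FPS (GForm A L 𝔤 1))

theorem field_var (l : FPS (GForm A L 𝔤 0)) : (Y.field a).var l =
    mapS (d0 A L 𝔤) l - mapS (br0 A L 𝔤) (starTensor Y.F l (Y.field a).val) := by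
  rw [br0, ← starProd_eq]
  rfl

theorem field2_var (l : FPS (GForm A L 𝔤 0)) : (Y.field2 a).var l =
    mapS (shiftVarOne (d0 A L 𝔤)) (starTensor Y.F l a) -
      mapS (rotVar (br0 A L 𝔤) (br0 A L 𝔤)) (starTensor Y.F l (Y.field2 a).val) :=
  var_mul_self Y.F (field_var a) isInv_d0 isInv_br0 l

theorem field3_var (l : FPS (GForm A L 𝔤 0)) : (Y.field3 a).var l =
    mapS (shiftVar (d0 A L 𝔤) (shiftVarOne (d0 A L 𝔤))) (starTensor Y.F l (Y.field2 a).val) -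
      mapS (rotVar (br0 A L 𝔤) (rotVar (br0 A L 𝔤) (br0 A L 𝔤)))
        (starTensor Y.F l (Y.field3 a).val) :=
  var_mul Y.F (field_var a) isInv_d0 isInv_br0 rfl isInv_d0.shiftVarOne
    (isInv_br0.rotVar isInv_br0) (field2_var a) l

theorem field4_var (l : FPS (GForm A L 𝔤 0)) : (Y.field4 a).var l =
    mapS (shiftVar (d0 A L 𝔤) (shiftVar (d0 A L 𝔤) (shiftVarOne (d0 A L 𝔤))))
        (starTensor Y.F l (Y.field3 a).val) -
      mapS (rotVar (br0 A L 𝔤) (rotVar (br0 A L 𝔤) (rotVar (br0 A L 𝔤) (br0 A L 𝔤))))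
        (starTensor Y.F l (Y.field4 a).val) :=
  var_mul Y.F (field_var a) isInv_d0 isInv_br0 rfl (isInv_d0.shiftVar isInv_d0.shiftVarOne)
    (isInv_br0.rotVar (isInv_br0.rotVar isInv_br0)) (field3_var a) l

/-- Gauge invariance of the Yang-Mills density. -/
theorem IsRegular.ym_var (hY : Y.IsRegular) (l : FPS (GForm A L 𝔤 0)) :
    mapS Y.ym2 ((Y.field2 a).var l) + mapS Y.ym3 ((Y.field3 a).var l) +
      mapS Y.ym4 ((Y.field4 a).var l) = 0 := by
  rw [field2_var, field3_var, field4_var, map_sub, map_sub, map_sub]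
  -- The sum telescopes: the shift term of each power cancels the rotation term of the previous one,
  -- and both ends vanish.
  simp only [← mapS_comp, ym2_shift, hY.ym3_shift, hY.ym4_shift, hY.ym4_rot]
  have h0 : ∀ {U V : Type _} [AddCommGroup U] [Module ℝ U] [AddCommGroup V] [Module ℝ V] (u : FPS U),
      mapS (0 : U →ₗ[ℝ] V) u = 0 := fun u => by ext m; simp [mapS_apply]
  rw [h0, h0]
  abel

theorem field2_mul_field :
    Obs.mul Y.F (starTensor Y.F) (Y.field2 a) (Y.field a) =
      (Y.field3 a).map (TensorProduct.assoc ℝ _ _ _).symm.toLinearMap := by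
  have h := Obs.mul_assoc Y.F (Y.field a) (Y.field a)
    (isHexagonal_var Y.F (field_var a) isInv_d0 isInv_br0)
  rw [field3, field2, ← h, ← Obs.map_comp]
  simp [Obs.map_id]

theorem field2_mul_field2 :
    Obs.mul Y.F (starTensor Y.F) (Y.field2 a) (Y.field2 a) =
      (Y.field4 a).map (TensorProduct.assoc ℝ _ _ _).symm.toLinearMap := by
  have h := Obs.mul_assoc Y.F (Y.field a) (Y.field a) (c := Y.field2 a)
    (isHexagonal_var_mul_self Y.F (field_var a) isInv_d0 isInv_br0)
  rw [field4, field3, ← h, ← Obs.map_comp]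
  simp [Obs.map_id, field2]

theorem fieldSq_eq : Y.fieldSq a = (Y.field2 a).map (br A L 𝔤) :=
  Obs.mul_starProd Y.F _ _ _

theorem curv_eq :
    Y.curv a = (Y.field a).map (d1 A L 𝔤) + (1 / 2 : ℂ) • (Y.field2 a).map (br A L 𝔤) := by
  rw [curv, fieldSq_eq]
  rfl

theorem IsRegular.mul_trS_hod (hY : Y.IsRegular) (x y : Obs (GForm A L 𝔤 0) (GForm A L 𝔤 2)) :
    Obs.mul Y.F (Y.trS (show 2 + n = n + 2 by omega)) x (y.map (Y.hod (l := n) (by omega))) =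
      (Obs.mul Y.F (starTensor Y.F) x y).map (TensorProduct.lift Y.inner2) := by
  rw [trS, Obs.mul_starProd, Obs.mul_map _ hY.isInv_hod, ← Obs.map_comp]
  congr 1
  exact TensorProduct.ext' fun α β => rfl

/-- Exchanging degrees n and 2 costs the sign (-1)^(2n) = 1, and symmetry of the inner product then
restores the order of the factors. -/
theorem IsRegular.mul_trS_hod_left (hY : Y.IsRegular)
    (x y : Obs (GForm A L 𝔤 0) (GForm A L 𝔤 2)) :
    Obs.mul Y.F (Y.trS (show n + 2 = n + 2 by omega)) (x.map (Y.hod (l := n) (by omega))) y =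
      (Obs.mul Y.F (starTensor Y.F) x y).map (TensorProduct.lift Y.inner2) := by
  rw [trS, Obs.mul_starProd, Obs.map_mul _ hY.isInv_hod, ← Obs.map_comp]
  congr 1
  refine TensorProduct.ext' fun α β => ?_
  refine Eq.trans ?_ (hY.inner2_comm β α)
  refine (gtr_comm hY.symm _ (by omega) _ _).trans ?_
  rw [pow_mul', (by norm_num : (-1 : ℤ) ^ 2 = 1), one_pow, one_smul]
  rfl

theorem mul_d_d : Obs.mul Y.F (starTensor Y.F) ((Y.field a).map (d1 A L 𝔤))
    ((Y.field a).map (d1 A L 𝔤)) =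
      (Y.field2 a).map (TensorProduct.map (d1 A L 𝔤) (d1 A L 𝔤)) :=
  Obs.mul_map_map _ isInv_d1 isInv_d1 _ _

theorem mul_d_br : Obs.mul Y.F (starTensor Y.F) ((Y.field a).map (d1 A L 𝔤))
    ((Y.field2 a).map (br A L 𝔤)) =
      (Y.field3 a).map (TensorProduct.map (d1 A L 𝔤) (br A L 𝔤)) :=
  Obs.mul_map_map _ isInv_d1 isInv_br _ _

theorem mul_br_d : Obs.mul Y.F (starTensor Y.F) ((Y.field2 a).map (br A L 𝔤))
    ((Y.field a).map (d1 A L 𝔤)) = (Y.field3 a).map (TensorProduct.map (br A L 𝔤) (d1 A L 𝔤) ∘ₗ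
      (TensorProduct.assoc ℝ _ _ _).symm.toLinearMap) := by
  rw [Obs.mul_map_map _ isInv_br isInv_d1, field2_mul_field, ← Obs.map_comp]

theorem mul_br_br : Obs.mul Y.F (starTensor Y.F) ((Y.field2 a).map (br A L 𝔤))
    ((Y.field2 a).map (br A L 𝔤)) = (Y.field4 a).map (TensorProduct.map (br A L 𝔤) (br A L 𝔤) ∘ₗ
      (TensorProduct.assoc ℝ _ _ _).symm.toLinearMap) := by
  rw [Obs.mul_map_map _ isInv_br isInv_br, field2_mul_field2, ← Obs.map_comp]

theorem IsRegular.trS_brS_hodS (hY : Y.IsRegular) (α γ : FPS (GForm A L 𝔤 1))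
    (β : FPS (GForm A L 𝔤 2)) :
    Y.trS (show 2 + n = n + 2 by omega) (Y.brS rfl α γ) (Y.hodS (by omega) β) =
      mapS (TensorProduct.lift Y.inner2 ∘ₗ TensorProduct.map (br A L 𝔤) LinearMap.id ∘ₗ
        (TensorProduct.assoc ℝ _ _ _).symm.toLinearMap)
        (starTensor Y.F α (starTensor Y.F γ β)) := by
  have hG : Y.inner2 = (gtr Y.Tr (show 2 + n = n + 2 by omega)).compl₁₂ LinearMap.id
    (Y.hod (k := 2) (l := n) (by omega)) := rfl
  rw [trS, brS, hodS, starProd_eq Y.F (gbr rfl), mapS_comp, mapS_comp, mapS_assoc_symm]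
  have h := starProd_compl₁₂ Y.F (gtr Y.Tr (show 2 + n = n + 2 by omega)) IsInv.id hY.isInv_hod
    (mapS (br A L 𝔤) (starTensor Y.F α γ)) β
  rw [mapS_id] at h
  refine h.symm.trans ?_
  rw [← hG, starProd_eq, starTensor_mapS_left _ isInv_br]
  rfl

/-- Read with γ before β, the word is a plain star product; the R-matrix is exactly what reorders it
to α, β, γ, the transposition being absorbed in `innerMid`. -/
theorem IsRegular.word3_eq (hY : Y.IsRegular) (α γ : FPS (GForm A L 𝔤 1))
    (β : FPS (GForm A L 𝔤 2)) :
    Y.word3 α β γ = mapS Y.innerMid (starTensor Y.F α (starTensor Y.F β γ)) := by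
  have h : ((Y.trS (show 2 + n = n + 2 by omega)).compl₂ (Y.hodS (k := 2) (l := n) (by omega))) ∘ₗ
      Y.brS (m := 2) rfl α = (starTensor Y.F).compr₂ (mapS (TensorProduct.lift Y.inner2 ∘ₗ
        TensorProduct.map (br A L 𝔤) LinearMap.id ∘ₗ
        (TensorProduct.assoc ℝ _ _ _).symm.toLinearMap) ∘ₗ starTensor Y.F α) :=
    LinearMap.ext₂ fun γ β => hY.trS_brS_hodS α γ β
  change sw Y.F.R21 (((Y.trS _).compl₂ (Y.hodS _)) ∘ₗ Y.brS _ α) γ β = _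
  rw [h, sw_compr₂ _ _ ((isShift_mapS _).comp (isShift_starTensor_right _ _)), sw_R21_starTensor,
    LinearMap.comp_apply, starTensor_mapS_right _ (IsInv.comm _ _), ← mapS_comp]
  rfl

end YMData

end YangMillsObservables

theorem IsInv.lTensor {𝔨 V W : Type*} [LieRing 𝔨] [LieAlgebra ℝ 𝔨]
    [AddCommGroup V] [Module ℝ V] [LieRingModule 𝔨 V] [LieModule ℝ 𝔨 V]
    [AddCommGroup W] [Module ℝ W] [LieRingModule 𝔨 W] [LieModule ℝ 𝔨 W]
    {f : V →ₗ[ℝ] W} (hf : IsInv 𝔨 f) (U : Type*) [AddCommGroup U] [Module ℝ U]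
    [LieRingModule 𝔨 U] [LieModule ℝ 𝔨 U] : IsInv 𝔨 (f.lTensor U) :=
  IsInv.id.map hf

theorem IsInv.rTensor {𝔨 V W : Type*} [LieRing 𝔨] [LieAlgebra ℝ 𝔨]
    [AddCommGroup V] [Module ℝ V] [LieRingModule 𝔨 V] [LieModule ℝ 𝔨 V]
    [AddCommGroup W] [Module ℝ W] [LieRingModule 𝔨 W] [LieModule ℝ 𝔨 W]
    {f : V →ₗ[ℝ] W} (hf : IsInv 𝔨 f) (U : Type*) [AddCommGroup U] [Module ℝ U]
    [LieRingModule 𝔨 U] [LieModule ℝ 𝔨 U] : IsInv 𝔨 (f.rTensor U) :=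
  hf.map IsInv.id

theorem tensor_ext_four' {M N P Q X : Type*} [AddCommGroup M] [Module ℝ M] [AddCommGroup N]
    [Module ℝ N] [AddCommGroup P] [Module ℝ P] [AddCommGroup Q] [Module ℝ Q] [AddCommGroup X]
    [Module ℝ X] {g h : M ⊗[ℝ] ((N ⊗[ℝ] P) ⊗[ℝ] Q) →ₗ[ℝ] X}
    (H : ∀ w x y z, g (w ⊗ₜ ((x ⊗ₜ y) ⊗ₜ z)) = h (w ⊗ₜ ((x ⊗ₜ y) ⊗ₜ z))) : g = h := by
  ext w x y z
  exact H w x y z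

/-! ### Expansion of the explicit density -/

section YangMillsExpansion

variable {A L 𝔤 : Type*} [CommRing A] [LieRing L] [Module A L] [LieRingModule L A]
  [LieRinehartRing A L] [Algebra ℝ A] [LieAlgebra ℝ L] [LieRinehartAlgebra ℝ A L]
  [LieRing 𝔤] [LieAlgebra ℝ 𝔤] {n : ℕ} {Y : YMData A L 𝔤 n}

namespace YMData

theorem IsRegular.trS_brS_hodS_brS (hY : Y.IsRegular) (α γ β δ : FPS (GForm A L 𝔤 1)) :
    Y.trS (show 2 + n = n + 2 by omega) (Y.brS rfl α γ) (Y.hodS (by omega) (Y.brS (m := 2) rfl β δ)) =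
      mapS (TensorProduct.lift Y.inner2 ∘ₗ TensorProduct.map (br A L 𝔤) (br A L 𝔤) ∘ₗ
        (TensorProduct.assoc ℝ _ _ _).symm.toLinearMap ∘ₗ
        TensorProduct.map LinearMap.id (TensorProduct.assoc ℝ _ _ _).toLinearMap)
        (starTensor Y.F α (starTensor Y.F (starTensor Y.F γ β) δ)) := by
  have h1 : Y.brS (m := 2) rfl β δ = mapS (br A L 𝔤) (starTensor Y.F β δ) :=
    starProd_eq Y.F (gbr rfl) β δ
  rw [hY.trS_brS_hodS, h1, starTensor_mapS_right Y.F isInv_br,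
    starTensor_mapS_right Y.F (isInv_br.lTensor _), ← starTensor_assoc Y.F γ β δ,
    starTensor_mapS_right Y.F (IsInv.assoc _ _ _)]
  simp only [← mapS_comp]
  congr 2
  exact tensor_ext_four' fun α γ β δ => rfl

/-- As for three factors, but the braided pair sits in the middle: the product is bracketed as α ⊗⋆
((γ ⊗⋆ β) ⊗⋆ δ) so that the two become adjacent. -/
theorem IsRegular.word4_eq (hY : Y.IsRegular) (α β γ δ : FPS (GForm A L 𝔤 1)) :
    Y.word4 α β γ δ =
      mapS Y.innerCross (starTensor Y.F α (starTensor Y.F β (starTensor Y.F γ δ))) := by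
  have h : (Y.trS (show 2 + n = n + 2 by omega)).compl₁₂ (Y.brS (m := 2) rfl α)
    (Y.hodS (k := 2) (l := n) (by omega) ∘ₗ (Y.brS (m := 2) rfl).flip δ) =
      (starTensor Y.F).compr₂ (mapS (TensorProduct.lift Y.inner2 ∘ₗ
        TensorProduct.map (br A L 𝔤) (br A L 𝔤) ∘ₗ
        (TensorProduct.assoc ℝ _ _ _).symm.toLinearMap ∘ₗ
        TensorProduct.map LinearMap.id (TensorProduct.assoc ℝ _ _ _).toLinearMap) ∘ₗ
        starTensor Y.F α ∘ₗ (starTensor Y.F).flip δ) :=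
    LinearMap.ext₂ fun γ β => hY.trS_brS_hodS_brS α γ β δ
  have h0 : Y.word4 α β γ δ = Y.word4Aux α δ γ β := rfl
  rw [h0, word4Aux]
  rw [h, sw_compr₂ _ _ ((isShift_mapS _).comp ((isShift_starTensor_right _ _).comp
    (isShift_starTensor_left _ _))), sw_R21_starTensor]
  change mapS _ (starTensor Y.F α (starTensor Y.F (mapS _ (starTensor Y.F β γ)) δ)) = _
  rw [← starTensor_assoc Y.F β γ δ, starTensor_mapS_left Y.F (IsInv.comm _ _),
    starTensor_mapS_right Y.F ((IsInv.comm _ _).rTensor _),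
    starTensor_mapS_right Y.F (IsInv.assoc _ _ _), ← mapS_comp, ← mapS_comp]
  congr 2
  exact tensor_ext_four' fun α β γ δ => rfl

theorem IsRegular.braidTerm_eq (hY : Y.IsRegular) (a : FPS (GForm A L 𝔤 1))
    (b : Obs (GForm A L 𝔤 0) (GForm A L 𝔤 2)) :
    Y.braidTerm a b = (Obs.mul Y.F (starTensor Y.F) (Y.field a)
      (Obs.mul Y.F (starTensor Y.F) b (Y.field a))).map Y.innerMid := by
  refine ArgString.Represents.apply_eq (.cons Y.F _ (isShift_mapS _) fun α =>
    .cons Y.F _ ((isShift_mapS _).comp (isShift_starTensor_right _ _)) fun β => ?_)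
  have h : Y.word3 α β = (mapS Y.innerMid ∘ₗ starTensor Y.F α) ∘ₗ starTensor Y.F β :=
    LinearMap.ext fun γ => hY.word3_eq α γ β
  rw [h]
  exact ArgString.represents_single _ _ _

theorem IsRegular.quarticTerm_eq (hY : Y.IsRegular) (a : FPS (GForm A L 𝔤 1)) :
    Y.quarticTerm a = (Y.field4 a).map Y.innerCross := by
  refine ArgString.Represents.apply_eq (.cons Y.F _ (isShift_mapS _) fun α =>
    .cons Y.F _ ((isShift_mapS _).comp (isShift_starTensor_right _ _)) fun β =>
    .cons Y.F _ (((isShift_mapS _).comp (isShift_starTensor_right _ _)).comp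
      (isShift_starTensor_right _ _)) fun γ => ?_)
  have h : Y.word4 α β γ = ((mapS Y.innerCross ∘ₗ starTensor Y.F α) ∘ₗ starTensor Y.F β) ∘ₗ
      starTensor Y.F γ := LinearMap.ext fun δ => hY.word4_eq α β γ δ
  rw [h]
  exact ArgString.represents_single _ _ _

theorem IsRegular.ymTerm_eq (hY : Y.IsRegular) (a : FPS (GForm A L 𝔤 1)) :
    Y.ymTerm a = ((Y.field2 a).map
        (TensorProduct.lift Y.inner2 ∘ₗ TensorProduct.map (d1 A L 𝔤) (d1 A L 𝔤)) +
      (1 / 2 : ℂ) • (Y.field3 a).map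
        (TensorProduct.lift Y.inner2 ∘ₗ TensorProduct.map (br A L 𝔤) (d1 A L 𝔤) ∘ₗ
          (TensorProduct.assoc ℝ _ _ _).symm.toLinearMap)) +
      (1 / 2 : ℂ) • ((Y.field3 a).map
        (TensorProduct.lift Y.inner2 ∘ₗ TensorProduct.map (d1 A L 𝔤) (br A L 𝔤)) +
      (1 / 2 : ℂ) • (Y.field4 a).map
        (TensorProduct.lift Y.inner2 ∘ₗ TensorProduct.map (br A L 𝔤) (br A L 𝔤) ∘ₗ
          (TensorProduct.assoc ℝ _ _ _).symm.toLinearMap)) := by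
  rw [ymTerm, hY.mul_trS_hod, curv_eq, Obs.mul_add, Obs.add_mul, Obs.mul_smul, Obs.add_mul,
    Obs.smul_mul, Obs.smul_mul, mul_d_d, mul_br_d, mul_d_br, mul_br_br]
  simp only [Obs.map_add, Obs.map_smul, Obs.map_comp]

theorem IsRegular.mul_curv_fieldSq (hY : Y.IsRegular) (a : FPS (GForm A L 𝔤 1)) :
    Obs.mul Y.F (Y.trS (show 2 + n = n + 2 by omega)) (Y.curv a)
        ((Y.fieldSq a).map (Y.hod (l := n) (by omega))) =
      (Y.field3 a).map
        (TensorProduct.lift Y.inner2 ∘ₗ TensorProduct.map (d1 A L 𝔤) (br A L 𝔤)) +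
      (1 / 2 : ℂ) • (Y.field4 a).map
        (TensorProduct.lift Y.inner2 ∘ₗ TensorProduct.map (br A L 𝔤) (br A L 𝔤) ∘ₗ
          (TensorProduct.assoc ℝ _ _ _).symm.toLinearMap) := by
  rw [hY.mul_trS_hod, curv_eq, fieldSq_eq, Obs.add_mul, Obs.smul_mul, mul_d_br, mul_br_br]
  simp only [Obs.map_add, Obs.map_smul, Obs.map_comp]

theorem IsRegular.mul_fieldSq_curv (hY : Y.IsRegular) (a : FPS (GForm A L 𝔤 1)) :
    Obs.mul Y.F (Y.trS (show n + 2 = n + 2 by omega))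
        ((Y.fieldSq a).map (Y.hod (l := n) (by omega))) (Y.curv a) =
      (Y.field3 a).map
        (TensorProduct.lift Y.inner2 ∘ₗ TensorProduct.map (br A L 𝔤) (d1 A L 𝔤) ∘ₗ
          (TensorProduct.assoc ℝ _ _ _).symm.toLinearMap) +
      (1 / 2 : ℂ) • (Y.field4 a).map
        (TensorProduct.lift Y.inner2 ∘ₗ TensorProduct.map (br A L 𝔤) (br A L 𝔤) ∘ₗ
          (TensorProduct.assoc ℝ _ _ _).symm.toLinearMap) := by
  rw [hY.mul_trS_hod_left, curv_eq, fieldSq_eq, Obs.mul_add, Obs.mul_smul, mul_br_d, mul_br_br]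
  simp only [Obs.map_add, Obs.map_smul, Obs.map_comp]

theorem mul_field_d_field (a : FPS (GForm A L 𝔤 1)) : Obs.mul Y.F (starTensor Y.F) (Y.field a)
    (Obs.mul Y.F (starTensor Y.F) ((Y.field a).map (d1 A L 𝔤)) (Y.field a)) =
      (Y.field3 a).map
        (TensorProduct.map LinearMap.id (TensorProduct.map (d1 A L 𝔤) LinearMap.id)) := by
  rw [Obs.map_mul _ isInv_d1, Obs.mul_map _ (isInv_d1.map IsInv.id)]
  rfl

theorem mul_field_br_field (a : FPS (GForm A L 𝔤 1)) : Obs.mul Y.F (starTensor Y.F) (Y.field a)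
    (Obs.mul Y.F (starTensor Y.F) ((Y.field2 a).map (br A L 𝔤)) (Y.field a)) =
      (Y.field4 a).map
        (TensorProduct.map LinearMap.id (TensorProduct.map (br A L 𝔤) LinearMap.id ∘ₗ
          (TensorProduct.assoc ℝ _ _ _).symm.toLinearMap)) := by
  rw [Obs.map_mul _ isInv_br, field2_mul_field, ← Obs.map_comp,
    Obs.mul_map _ ((isInv_br.map IsInv.id).comp IsInv.assoc_symm)]
  rfl

theorem IsRegular.braidTerm_fieldSq (hY : Y.IsRegular) (a : FPS (GForm A L 𝔤 1)) :
    Y.braidTerm a (Y.fieldSq a) = (Y.field4 a).map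
      (Y.innerMid ∘ₗ TensorProduct.map LinearMap.id (TensorProduct.map (br A L 𝔤) LinearMap.id ∘ₗ
        (TensorProduct.assoc ℝ _ _ _).symm.toLinearMap)) := by
  rw [hY.braidTerm_eq, fieldSq_eq, mul_field_br_field, ← Obs.map_comp]

theorem IsRegular.braidTerm_curv (hY : Y.IsRegular) (a : FPS (GForm A L 𝔤 1)) :
    Y.braidTerm a (Y.curv a) = (Y.field3 a).map
        (Y.innerMid ∘ₗ TensorProduct.map LinearMap.id
          (TensorProduct.map (d1 A L 𝔤) LinearMap.id)) +
      (1 / 2 : ℂ) • (Y.field4 a).map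
        (Y.innerMid ∘ₗ TensorProduct.map LinearMap.id (TensorProduct.map (br A L 𝔤) LinearMap.id ∘ₗ
          (TensorProduct.assoc ℝ _ _ _).symm.toLinearMap)) := by
  rw [hY.braidTerm_eq, curv_eq, Obs.add_mul, Obs.smul_mul, Obs.mul_add, Obs.mul_smul,
    mul_field_d_field, mul_field_br_field, Obs.map_add, Obs.map_smul, Obs.map_comp, Obs.map_comp]

/-- This explains the coefficients in the theorem. The two unbraided cubic terms get 1/4 - 1/12 =
1/6, matching the braided one. Of the quartic terms, the unbraided gets 1/8 - 1/12 = 1/24 and the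
braided 1/12 - 1/24 = 1/24, matching the crossed one. -/
theorem IsRegular.ymDensity_eq (hY : Y.IsRegular) (a : FPS (GForm A L 𝔤 1)) :
    Y.ymDensity a =
      (Y.field2 a).map Y.ym2 + (Y.field3 a).map Y.ym3 + (Y.field4 a).map Y.ym4 := by
  rw [ymDensity, hY.ymTerm_eq, hY.mul_curv_fieldSq, hY.mul_fieldSq_curv, hY.braidTerm_curv,
    hY.braidTerm_fieldSq, hY.quarticTerm_eq]
  refine Obs.ext' ?_ fun l => ?_ <;>
  · simp only [Obs.add_val, Obs.smul_val, Obs.map_val, Obs.add_var, Obs.smul_var, Obs.map_var,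
      ym2, ym3, ym4, mapS_add, mapS_smul]
    push_cast
    module

/-- Gauge invariance of the explicit Lagrangian density. -/
theorem IsRegular.ymDensity_var (hY : Y.IsRegular) (a : FPS (GForm A L 𝔤 1))
    (l : FPS (GForm A L 𝔤 0)) : (Y.ymDensity a).var l = 0 := by
  rw [hY.ymDensity_eq]
  exact hY.ym_var a l

end YMData

end YangMillsExpansion

/-! ### The Maurer-Cartan density up to exact forms -/

section MaurerCartan

variable {A L 𝔤 : Type*} [CommRing A] [LieRing L] [Module A L] [LieRingModule L A]
  [LieRinehartRing A L] [Algebra ℝ A] [LieAlgebra ℝ L] [LieRinehartAlgebra ℝ A L]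
  [LieRing 𝔤] [LieAlgebra ℝ 𝔤] {n : ℕ} {Y : YMData A L 𝔤 n}

namespace YMData

variable (Y) in
/-- The composite `∗ d` on `1`-forms. -/
noncomputable def hodD : GForm A L 𝔤 1 →ₗ[ℝ] GForm A L 𝔤 n :=
  Y.hod (k := 2) (l := n) (by omega) ∘ₗ d1 A L 𝔤

variable (Y) in
/-- The composite `∗ [-, -]` on pairs of `1`-forms. -/
noncomputable def hodBr : GForm A L 𝔤 1 ⊗[ℝ] GForm A L 𝔤 1 →ₗ[ℝ] GForm A L 𝔤 n :=
  Y.hod (k := 2) (l := n) (by omega) ∘ₗ br A L 𝔤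

theorem IsRegular.isInv_hodD (hY : Y.IsRegular) : IsInv Y.𝔨 Y.hodD := hY.isInv_hod.comp isInv_d1

theorem IsRegular.isInv_hodBr (hY : Y.IsRegular) : IsInv Y.𝔨 Y.hodBr := hY.isInv_hod.comp isInv_br

theorem IsRegular.isInv_ell1 (hY : Y.IsRegular) : IsInv Y.𝔨 Y.ell1 := isInv_gd.comp hY.isInv_hodD

theorem lift_ell2 : TensorProduct.lift Y.ell2 =
    -(gd rfl ∘ₗ Y.hodBr) -
      TensorProduct.lift (gbr (show 1 + n = n + 1 by omega)) ∘ₗ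
        TensorProduct.map LinearMap.id Y.hodD +
      (-1 : ℝ) ^ (n + 2) •
        (TensorProduct.lift (gbr rfl) ∘ₗ TensorProduct.map Y.hodD LinearMap.id) :=
  TensorProduct.ext' fun _ _ => rfl

theorem IsRegular.isInv_lift_ell2 (hY : Y.IsRegular) : IsInv Y.𝔨 (TensorProduct.lift Y.ell2) := by
  rw [lift_ell2]
  exact ((isInv_gd.comp hY.isInv_hodBr).neg.sub
    ((isInv_gbr _).comp (IsInv.id.map hY.isInv_hodD))).add
    (((isInv_gbr _).comp (hY.isInv_hodD.map IsInv.id)).smul _)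

theorem lift_ell3 : TensorProduct.lift (TensorProduct.lift Y.ell3) ∘ₗ
      (TensorProduct.assoc ℝ _ _ _).symm.toLinearMap =
    -(TensorProduct.lift (gbr (show 1 + n = n + 1 by omega)) ∘ₗ
        TensorProduct.map LinearMap.id Y.hodBr) -
      TensorProduct.lift (gbr (show 1 + n = n + 1 by omega)) ∘ₗ
        TensorProduct.map LinearMap.id Y.hodBr ∘ₗ (TensorProduct.leftComm ℝ _ _ _).toLinearMap +
      (-1 : ℝ) ^ (n + 2) •
        (TensorProduct.lift (gbr rfl) ∘ₗ TensorProduct.map Y.hodBr LinearMap.id ∘ₗ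
          (TensorProduct.assoc ℝ _ _ _).symm.toLinearMap) := by
  ext α β γ
  rfl

theorem IsRegular.isInv_lift_ell3 (hY : Y.IsRegular) :
    IsInv Y.𝔨 (TensorProduct.lift (TensorProduct.lift Y.ell3) ∘ₗ
      (TensorProduct.assoc ℝ _ _ _).symm.toLinearMap) := by
  rw [lift_ell3]
  exact (((isInv_gbr _).comp (IsInv.id.map hY.isInv_hodBr)).neg.sub
    ((isInv_gbr _).comp ((IsInv.id.map hY.isInv_hodBr).comp (IsInv.leftComm _ _ _)))).add
    (((isInv_gbr _).comp ((hY.isInv_hodBr.map IsInv.id).comp IsInv.assoc_symm)).smul _)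

/-- The pairing `Tr(A ∧ 𝒜)` of `1`-forms and `(n+1)`-forms. -/
noncomputable def pairing (Y : YMData A L 𝔤 n) :
    GForm A L 𝔤 1 ⊗[ℝ] GForm A L 𝔤 (n + 1) →ₗ[ℝ] (L [⋀^Fin (n + 2)]→ₗ[A] A) :=
  TensorProduct.lift (gtr Y.Tr (by omega))

/-- The boundary term `Tr(A ∧ ∗dB)`. -/
noncomputable def bdry2 (Y : YMData A L 𝔤 n) :
    GForm A L 𝔤 1 ⊗[ℝ] GForm A L 𝔤 1 →ₗ[ℝ] (L [⋀^Fin (n + 1)]→ₗ[A] A) :=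
  TensorProduct.lift (gtr Y.Tr (by omega)) ∘ₗ TensorProduct.map LinearMap.id Y.hodD

/-- The boundary term `Tr(A ∧ ∗[B, C])`. -/
noncomputable def bdry3 (Y : YMData A L 𝔤 n) :
    GForm A L 𝔤 1 ⊗[ℝ] (GForm A L 𝔤 1 ⊗[ℝ] GForm A L 𝔤 1) →ₗ[ℝ] (L [⋀^Fin (n + 1)]→ₗ[A] A) :=
  TensorProduct.lift (gtr Y.Tr (by omega)) ∘ₗ TensorProduct.map LinearMap.id Y.hodBr

/-- Integration by parts before integrating; this is the source of every boundary term. -/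
theorem pairing_d (α : GForm A L 𝔤 1) (β : GForm A L 𝔤 2) :
    gtr Y.Tr (show 1 + (n + 1) = n + 2 by omega) α
        (gd rfl (Y.hod (k := 2) (l := n) (by omega) β)) =
      Y.inner2 (d1 A L 𝔤 α) β - extDer (n + 1) (gtr Y.Tr (show 1 + n = n + 1 by omega) α
        (Y.hod (k := 2) (l := n) (by omega) β)) := by
  rw [extDer_gtr_one Y.Tr _ (by omega) (by omega)]
  simp only [inner2_apply, d1]
  abel

theorem IsRegular.pairing_br (hY : Y.IsRegular) (α β : GForm A L 𝔤 1) (γ : GForm A L 𝔤 2) :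
    gtr Y.Tr (show 1 + (n + 1) = n + 2 by omega) α
        (gbr (show 1 + n = n + 1 by omega) β (Y.hod (k := 2) (l := n) (by omega) γ)) =
      Y.inner2 (br A L 𝔤 (α ⊗ₜ β)) γ :=
  gtr_gbr_one hY.inv _ _ _ _ _ _

/-- The sign (-1)^d in the brackets ℓ₂ and ℓ₃ is chosen for this: reversing [∗γ, β] costs -(-1)^n,
and the two signs combine to -1 in every dimension. -/
theorem IsRegular.pairing_br_left (hY : Y.IsRegular) (α β : GForm A L 𝔤 1) (γ : GForm A L 𝔤 2) :
    (-1 : ℝ) ^ (n + 2) • gtr Y.Tr (show 1 + (n + 1) = n + 2 by omega) α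
        (gbr rfl (Y.hod (k := 2) (l := n) (by omega) γ) β) =
      -Y.inner2 (br A L 𝔤 (α ⊗ₜ β)) γ := by
  rw [gbr_comm (k := n) (l := 1) rfl (by omega), map_neg, map_zsmul, hY.pairing_br, mul_one,
    ← Int.cast_smul_eq_zsmul ℝ, smul_neg, smul_smul]
  push_cast
  rw [← pow_add, show n + 2 + n = 2 * (n + 1) by ring, pow_mul]
  simp

/-- The factor 2 here, and -6 and -24 in the next two identities, cancel the coefficients 1/2, -1/6,
-1/24 of the action. -/
theorem pairing_ell1 : Y.pairing ∘ₗ TensorProduct.map LinearMap.id Y.ell1 =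
    (2 : ℝ) • Y.ym2 - extDer (n + 1) ∘ₗ Y.bdry2 := by
  refine TensorProduct.ext' fun α β => ?_
  refine (pairing_d α (d1 A L 𝔤 β)).trans ?_
  rw [LinearMap.sub_apply, LinearMap.smul_apply, ym2_tmul, smul_smul]
  norm_num
  rfl

theorem IsRegular.pairing_ell2 (hY : Y.IsRegular) :
    Y.pairing ∘ₗ TensorProduct.map LinearMap.id (TensorProduct.lift Y.ell2) =
      (-6 : ℝ) • Y.ym3 + extDer (n + 1) ∘ₗ Y.bdry3 := by
  ext1
  refine LinearMap.ext fun α => TensorProduct.ext' fun β γ => ?_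
  have h1 := pairing_d (Y := Y) α (br A L 𝔤 (β ⊗ₜ γ))
  have h2 := hY.pairing_br α β (d1 A L 𝔤 γ)
  have h3 := hY.pairing_br_left α γ (d1 A L 𝔤 β)
  change gtr Y.Tr _ α (TensorProduct.lift Y.ell2 (β ⊗ₜ γ)) =
    (-6 : ℝ) • Y.ym3 (α ⊗ₜ (β ⊗ₜ γ)) + extDer (n + 1) (gtr Y.Tr _ α (Y.hod _ (br A L 𝔤 (β ⊗ₜ γ))))
  have h4 : TensorProduct.lift Y.ell2 (β ⊗ₜ γ) =
    -(gd rfl (Y.hod (k := 2) (l := n) (by omega) (br A L 𝔤 (β ⊗ₜ γ)))) -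
    gbr (show 1 + n = n + 1 by omega) β (Y.hod (k := 2) (l := n) (by omega) (d1 A L 𝔤 γ)) +
    (-1 : ℝ) ^ (n + 2) • gbr rfl (Y.hod (k := 2) (l := n) (by omega) (d1 A L 𝔤 β)) γ := rfl
  rw [h4, map_add, map_sub, map_neg, map_smul, h1, h2, h3, ym3_tmul]
  module

theorem IsRegular.pairing_ell3 (hY : Y.IsRegular) :
    Y.pairing ∘ₗ TensorProduct.map LinearMap.id (TensorProduct.lift (TensorProduct.lift Y.ell3) ∘ₗ
      (TensorProduct.assoc ℝ _ _ _).symm.toLinearMap) = (-24 : ℝ) • Y.ym4 := by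
  refine tensor_ext_four fun α β γ δ => ?_
  have h1 := hY.pairing_br α β (br A L 𝔤 (γ ⊗ₜ δ))
  have h2 := hY.pairing_br α γ (br A L 𝔤 (β ⊗ₜ δ))
  have h3 := hY.pairing_br_left α δ (br A L 𝔤 (β ⊗ₜ γ))
  change gtr Y.Tr _ α (Y.ell3 β γ δ) = (-24 : ℝ) • Y.ym4 (α ⊗ₜ (β ⊗ₜ (γ ⊗ₜ δ)))
  have h4 : Y.ell3 β γ δ =
    -(gbr (show 1 + n = n + 1 by omega) β
      (Y.hod (k := 2) (l := n) (by omega) (br A L 𝔤 (γ ⊗ₜ δ)))) -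
    gbr (show 1 + n = n + 1 by omega) γ
      (Y.hod (k := 2) (l := n) (by omega) (br A L 𝔤 (β ⊗ₜ δ))) +
    (-1 : ℝ) ^ (n + 2) • gbr rfl (Y.hod (k := 2) (l := n) (by omega) (br A L 𝔤 (β ⊗ₜ γ))) δ := rfl
  rw [h4, map_add, map_sub, map_neg, map_smul, h1, h2, h3, ym4_tmul]
  module

variable (a : FPS (GForm A L 𝔤 1))

theorem IsRegular.mc1_eq (hY : Y.IsRegular) : Y.mc1 a =
    (2 : ℂ) • (Y.field2 a).map Y.ym2 + (-1 : ℂ) • ((Y.field2 a).map Y.bdry2).map (extDer (n + 1)) := by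
  rw [mc1, trS, Obs.mul_starProd, Obs.mul_map _ hY.isInv_ell1, ← Obs.map_comp]
  change (Y.field2 a).map (Y.pairing ∘ₗ TensorProduct.map LinearMap.id Y.ell1) = _
  rw [pairing_ell1]
  refine Obs.ext' ?_ fun l => ?_ <;>
  · simp only [Obs.add_val, Obs.smul_val, Obs.map_val, Obs.add_var, Obs.smul_var, Obs.map_var,
      mapS_sub, mapS_smul, mapS_comp]
    push_cast
    module

theorem IsRegular.mc2_eq (hY : Y.IsRegular) : Y.mc2 a =
    (-6 : ℂ) • (Y.field3 a).map Y.ym3 + ((Y.field3 a).map Y.bdry3).map (extDer (n + 1)) := by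
  rw [mc2, trS, ell2S, Obs.mul_starProd, Obs.mul_starProd, Obs.mul_map _ hY.isInv_lift_ell2,
    ← Obs.map_comp]
  change (Y.field3 a).map
    (Y.pairing ∘ₗ TensorProduct.map LinearMap.id (TensorProduct.lift Y.ell2)) = _
  rw [hY.pairing_ell2]
  refine Obs.ext' ?_ fun l => ?_ <;>
  · simp only [Obs.add_val, Obs.smul_val, Obs.map_val, Obs.add_var, Obs.smul_var, Obs.map_var,
      mapS_add, mapS_smul, mapS_comp]
    push_cast
    module

theorem IsRegular.mc3_eq (hY : Y.IsRegular) : Y.mc3 a = (-24 : ℂ) • (Y.field4 a).map Y.ym4 := by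
  have h' : Obs.mul Y.F Y.ell3S (Y.field2 a) (Y.field a) =
      (Obs.mul Y.F (starTensor Y.F) (Y.field2 a) (Y.field a)).map
        (TensorProduct.lift (TensorProduct.lift Y.ell3)) :=
    Obs.mul_starProd Y.F (TensorProduct.lift Y.ell3) (Y.field2 a) (Y.field a)
  have h : Y.mc3 a = Obs.mul Y.F (Y.trS (show 1 + (n + 1) = n + 2 by omega)) (Y.field a)
      (Obs.mul Y.F Y.ell3S (Y.field2 a) (Y.field a)) := rfl
  rw [h, h', trS, Obs.mul_starProd, field2_mul_field, ← Obs.map_comp,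
    Obs.mul_map _ hY.isInv_lift_ell3, ← Obs.map_comp]
  change (Y.field4 a).map (Y.pairing ∘ₗ TensorProduct.map LinearMap.id _) = _
  rw [hY.pairing_ell3]
  refine Obs.ext' ?_ fun l => ?_ <;>
  · simp only [Obs.smul_val, Obs.map_val, Obs.smul_var, Obs.map_var, mapS_smul]
    push_cast
    rfl

end YMData

end MaurerCartan

/-! ### Series with coefficients in a subspace -/

section StarSupport

variable {V : Type*} [AddCommGroup V] [Module ℝ V]

theorem baseChange_eq_range_subtype (S : Submodule ℝ V) :
    S.baseChange ℂ = LinearMap.range (S.subtype.baseChange ℂ) := rfl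

/-- Series with all coefficients in a subspace. -/
def InS (S : Submodule ℝ V) (u : FPS V) : Prop := ∀ m, u m ∈ S.baseChange ℂ

theorem InS.add {S : Submodule ℝ V} {u w : FPS V} (hu : InS S u) (hw : InS S w) : InS S (u + w) :=
  fun m => add_mem (hu m) (hw m)

theorem InS.sub {S : Submodule ℝ V} {u w : FPS V} (hu : InS S u) (hw : InS S w) : InS S (u - w) :=
  fun m => sub_mem (hu m) (hw m)

theorem InS.smul {S : Submodule ℝ V} {u : FPS V} (t : ℂ) (hu : InS S u) : InS S (t • u) :=
  fun m => Submodule.smul_mem _ t (hu m)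

theorem InS.exists_mapS {S : Submodule ℝ V} {u : FPS V} (hu : InS S u) :
    ∃ u' : FPS S, mapS S.subtype u' = u := by
  have h : ∀ m, ∃ y, S.subtype.baseChange ℂ y = u m := fun m => by
    have := hu m
    rwa [baseChange_eq_range_subtype] at this
  choose u' hu' using h
  exact ⟨u', funext hu'⟩

theorem InS.mapS_of {X U : Type*} [AddCommGroup X] [Module ℝ X] [AddCommGroup U] [Module ℝ U]
    {S' : Submodule ℝ X} {i : U →ₗ[ℝ] V} {f : V →ₗ[ℝ] X} (h : ∀ y, f (i y) ∈ S') (u : FPS U) :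
    InS S' (mapS f (mapS i u)) := by
  intro m
  rw [baseChange_eq_range_subtype]
  have : f ∘ₗ i = S'.subtype ∘ₗ (f ∘ₗ i).codRestrict S' h := rfl
  rw [← mapS_comp, this, mapS_comp]
  exact ⟨_, rfl⟩

theorem InS.mapS_mem {X : Type*} [AddCommGroup X] [Module ℝ X] {S : Submodule ℝ V} {S' : Submodule ℝ X}
    {f : V →ₗ[ℝ] X} (h : ∀ y ∈ S, f y ∈ S') {u : FPS V} (hu : InS S u) : InS S' (mapS f u) := by
  obtain ⟨u', rfl⟩ := hu.exists_mapS
  exact InS.mapS_of (fun y : S => h y.1 y.2) u'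

variable {𝔨 W X Λ : Type*} [LieRing 𝔨] [LieAlgebra ℝ 𝔨] [LieRingModule 𝔨 V] [LieModule ℝ 𝔨 V]
  [AddCommGroup W] [Module ℝ W] [LieRingModule 𝔨 W] [LieModule ℝ 𝔨 W]
  [AddCommGroup X] [Module ℝ X]
  [AddCommGroup Λ] [Module ℝ Λ] [LieRingModule 𝔨 Λ] [LieModule ℝ 𝔨 Λ]
  (F : DrinfeldTwist 𝔨) {S' : Submodule ℝ X}

/-- The inclusion of an invariant subspace is an invariant map, so by naturality l ⊗⋆ a comes from Λ
⊗ S. Support conditions can then be tested on classical pure tensors, with no condition on l. -/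
theorem InS.starTensor_right {S : LieSubmodule ℝ 𝔨 V} {a : FPS V} (ha : InS S.toSubmodule a)
    {f : Λ ⊗[ℝ] V →ₗ[ℝ] X} (h : ∀ l, ∀ s ∈ S, f (l ⊗ₜ s) ∈ S') (l : FPS Λ) :
    InS S' (mapS f (starTensor F l a)) := by
  obtain ⟨a', rfl⟩ : ∃ a' : FPS S, mapS (S.incl : S →ₗ[ℝ] V) a' = a := ha.exists_mapS
  have hS : IsInv 𝔨 (S.incl : S →ₗ[ℝ] V) := fun ξ y => rfl
  have := starTensor_mapS_right F hS l a'
  rw [this]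
  refine InS.mapS_of (fun y => ?_) _
  induction y using TensorProduct.induction_on with
  | zero => simp
  | tmul l s => exact h l s s.2
  | add y z hy hz => rw [map_add, map_add]; exact add_mem hy hz

theorem InS.starTensor_left {S : LieSubmodule ℝ 𝔨 V} {a : FPS V} (ha : InS S.toSubmodule a)
    {f : V ⊗[ℝ] W →ₗ[ℝ] X} (h : ∀ s ∈ S, ∀ w, f (s ⊗ₜ w) ∈ S') (w : FPS W) :
    InS S' (mapS f (starTensor F a w)) := by
  obtain ⟨a', rfl⟩ : ∃ a' : FPS S, mapS (S.incl : S →ₗ[ℝ] V) a' = a := ha.exists_mapS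
  have hS : IsInv 𝔨 (S.incl : S →ₗ[ℝ] V) := fun ξ y => rfl
  have := starTensor_mapS_left F hS a' w
  rw [this]
  refine InS.mapS_of (fun y => ?_) _
  induction y using TensorProduct.induction_on with
  | zero => simp
  | tmul s w => exact h s s.2 w
  | add y z hy hz => rw [map_add, map_add]; exact add_mem hy hz

theorem InS.starTensor_middle {S : LieSubmodule ℝ 𝔨 V} {a : FPS V} (ha : InS S.toSubmodule a)
    {f : Λ ⊗[ℝ] (V ⊗[ℝ] W) →ₗ[ℝ] X} (h : ∀ l, ∀ s ∈ S, ∀ w, f (l ⊗ₜ (s ⊗ₜ w)) ∈ S')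
    (l : FPS Λ) (w : FPS W) : InS S' (mapS f (starTensor F l (starTensor F a w))) := by
  obtain ⟨a', rfl⟩ : ∃ a' : FPS S, mapS (S.incl : S →ₗ[ℝ] V) a' = a := ha.exists_mapS
  have hS : IsInv 𝔨 (S.incl : S →ₗ[ℝ] V) := fun ξ y => rfl
  have := starTensor_mapS_left F hS a' w
  rw [this, starTensor_mapS_right F (hS.rTensor W)]
  refine InS.mapS_of (fun y => ?_) _
  induction y using TensorProduct.induction_on with
  | zero => simp
  | add y z hy hz => rw [map_add, map_add]; exact add_mem hy hz
  | tmul l y =>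
    induction y using TensorProduct.induction_on with
    | zero => simp
    | add y z hy hz => rw [TensorProduct.tmul_add, map_add, map_add]; exact add_mem hy hz
    | tmul s w => exact h l s s.2 w

end StarSupport

/-! ### Supports of Lie algebra valued forms -/

section SupportedForms

variable {A L : Type*} (𝔤 : Type*) [CommRing A] [LieRing L] [Module A L] [LieRingModule L A]
  [LieRinehartRing A L] [Algebra ℝ A] [LieAlgebra ℝ L] [LieRinehartAlgebra ℝ A L]
  [LieRing 𝔤] [LieAlgebra ℝ 𝔤]

/-- `𝔤`-valued forms with coefficients in a subspace of forms. -/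
noncomputable def gForms {k : ℕ} (C : Submodule ℝ (L [⋀^Fin k]→ₗ[A] A)) : Submodule ℝ (GForm A L 𝔤 k) :=
  LinearMap.range (C.subtype.rTensor 𝔤)

variable {𝔤}

theorem gForms_induction_aux {k : ℕ} {C : Submodule ℝ (L [⋀^Fin k]→ₗ[A] A)}
    {p : GForm A L 𝔤 k → Prop} (h0 : p 0) (h1 : ∀ ψ ∈ C, ∀ x, p (GForm.of ψ x))
    (h2 : ∀ α β, p α → p β → p (α + β)) {α : GForm A L 𝔤 k} (hα : α ∈ gForms 𝔤 C) : p α := by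
  obtain ⟨y, hy⟩ := hα
  have hi : ∀ y : C ⊗[ℝ] 𝔤, p ((C.subtype.rTensor 𝔤 : C ⊗[ℝ] 𝔤 →ₗ[ℝ] GForm A L 𝔤 k) y) := ?_
  · exact hy ▸ hi y
  intro y
  induction y using TensorProduct.induction_on with
  | zero => exact h0
  | tmul ψ x => exact h1 ψ ψ.2 x
  | add y z hy hz => exact (map_add (C.subtype.rTensor 𝔤) y z) ▸ h2 _ _ hy hz

theorem of_mem_gForms {k : ℕ} {C : Submodule ℝ (L [⋀^Fin k]→ₗ[A] A)} {ψ : L [⋀^Fin k]→ₗ[A] A}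
    (hψ : ψ ∈ C) (x : 𝔤) : GForm.of ψ x ∈ gForms 𝔤 C := ⟨(⟨ψ, hψ⟩ : C) ⊗ₜ x, rfl⟩

@[elab_as_elim]
theorem gForms_induction {k : ℕ} {C : Submodule ℝ (L [⋀^Fin k]→ₗ[A] A)}
    {p : ∀ α : GForm A L 𝔤 k, α ∈ gForms 𝔤 C → Prop} (h0 : p 0 (zero_mem _))
    (h1 : ∀ ψ (hψ : ψ ∈ C) x, p (GForm.of ψ x) (of_mem_gForms hψ x))
    (h2 : ∀ α β hα hβ, p α hα → p β hβ → p (α + β) (add_mem hα hβ)) {α : GForm A L 𝔤 k}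
    (hα : α ∈ gForms 𝔤 C) : p α hα := by
  have h : ∃ h, p α h := gForms_induction_aux (p := fun α => ∃ h, p α h) ⟨_, h0⟩
    (fun ψ hψ x => ⟨_, h1 ψ hψ x⟩) (fun α β ⟨hα, h⟩ ⟨hβ, h'⟩ => ⟨_, h2 α β hα hβ h h'⟩) hα
  exact h.2

/-- A family of spaces of forms that behaves like the compactly supported forms. -/
structure IsSupport (C : ∀ k, Submodule ℝ (L [⋀^Fin k]→ₗ[A] A)) : Prop where
  lie_mem : ∀ {k} (ξ : L) {ψ : L [⋀^Fin k]→ₗ[A] A}, ψ ∈ C k → ⁅ξ, ψ⁆ ∈ C k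
  extDer_mem : ∀ {k} {ψ : L [⋀^Fin k]→ₗ[A] A}, ψ ∈ C k → extDer k ψ ∈ C (k + 1)
  wedge_left_mem : ∀ {k l m} (h : k + l = m) {ψ : L [⋀^Fin k]→ₗ[A] A} (η : L [⋀^Fin l]→ₗ[A] A),
    ψ ∈ C k → wedge h ψ η ∈ C m
  wedge_right_mem : ∀ {k l m} (h : k + l = m) (ψ : L [⋀^Fin k]→ₗ[A] A) {η : L [⋀^Fin l]→ₗ[A] A},
    η ∈ C l → wedge h ψ η ∈ C m

variable {C : ∀ k, Submodule ℝ (L [⋀^Fin k]→ₗ[A] A)}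

namespace IsSupport

theorem gLie_mem (hC : IsSupport C) {k : ℕ} (ξ : L) {α : GForm A L 𝔤 k} (hα : α ∈ gForms 𝔤 (C k)) :
    ⁅ξ, α⁆ ∈ gForms 𝔤 (C k) := by
  induction hα using gForms_induction with
  | h0 => simp
  | h1 ψ hψ x => exact of_mem_gForms (hC.lie_mem ξ hψ) x
  | h2 α β _ _ hα hβ => rw [lie_add]; exact add_mem hα hβ

theorem gd_mem (hC : IsSupport C) {k : ℕ} {α : GForm A L 𝔤 k} (hα : α ∈ gForms 𝔤 (C k)) :
    gd rfl α ∈ gForms 𝔤 (C (k + 1)) := by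
  induction hα using gForms_induction with
  | h0 => simp
  | h1 ψ hψ x => exact of_mem_gForms (hC.extDer_mem hψ) x
  | h2 α β _ _ hα hβ => rw [map_add]; exact add_mem hα hβ

theorem gbr_left_mem (hC : IsSupport C) {k l m : ℕ} (h : k + l = m) {α : GForm A L 𝔤 k}
    (hα : α ∈ gForms 𝔤 (C k)) (β : GForm A L 𝔤 l) : gbr h α β ∈ gForms 𝔤 (C m) := by
  induction hα using gForms_induction with
  | h0 => simp
  | h1 ψ hψ x =>
    induction β using GForm.induction with
    | h0 => simp
    | h1 η y => exact of_mem_gForms (hC.wedge_left_mem h η hψ) _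
    | h2 β γ hβ hγ => rw [map_add]; exact add_mem hβ hγ
  | h2 α β _ _ hα hβ => rw [map_add]; exact add_mem hα hβ

theorem gbr_right_mem (hC : IsSupport C) {k l m : ℕ} (h : k + l = m) (α : GForm A L 𝔤 k)
    {β : GForm A L 𝔤 l} (hβ : β ∈ gForms 𝔤 (C l)) : gbr h α β ∈ gForms 𝔤 (C m) := by
  rw [gbr_comm h (by omega)]
  exact neg_mem (Submodule.smul_of_tower_mem _ _ (hC.gbr_left_mem _ hβ α))

theorem gtr_left_mem (hC : IsSupport C) (Tr : 𝔤 →ₗ[ℝ] 𝔤 →ₗ[ℝ] ℝ) {k l m : ℕ} (h : k + l = m)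
    {α : GForm A L 𝔤 k} (hα : α ∈ gForms 𝔤 (C k)) (β : GForm A L 𝔤 l) : gtr Tr h α β ∈ C m := by
  induction hα using gForms_induction with
  | h0 => simp
  | h1 ψ hψ x =>
    induction β using GForm.induction with
    | h0 => simp
    | h1 η y => exact Submodule.smul_mem _ _ (hC.wedge_left_mem h η hψ)
    | h2 β γ hβ hγ => rw [map_add]; exact add_mem hβ hγ
  | h2 α β _ _ hα hβ => rw [map_add]; exact add_mem hα hβ

theorem gtr_right_mem (hC : IsSupport C) (Tr : 𝔤 →ₗ[ℝ] 𝔤 →ₗ[ℝ] ℝ) {k l m : ℕ} (h : k + l = m)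
    (α : GForm A L 𝔤 k) {β : GForm A L 𝔤 l} (hβ : β ∈ gForms 𝔤 (C l)) : gtr Tr h α β ∈ C m := by
  induction hβ using gForms_induction with
  | h0 => simp
  | h1 η hη y =>
    induction α using GForm.induction with
    | h0 => simp
    | h1 ψ x => exact Submodule.smul_mem _ _ (hC.wedge_right_mem h ψ hη)
    | h2 β γ hβ hγ => rw [map_add]; exact add_mem hβ hγ
  | h2 α β _ _ hα hβ => rw [map_add]; exact add_mem hα hβ

end IsSupport

theorem ghodge_mem {g : L →ₗ[A] L →ₗ[A] A} {k l d : ℕ} {c : (L [⋀^Fin d]→ₗ[A] A) →ₗ[A] A}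
    (h : k + l = d) (hg : ∀ ψ ∈ C k, hodge g c h ψ ∈ C l) {α : GForm A L 𝔤 k}
    (hα : α ∈ gForms 𝔤 (C k)) : ghodge g c h α ∈ gForms 𝔤 (C l) := by
  induction hα using gForms_induction with
  | h0 => simp
  | h1 ψ hψ x => exact of_mem_gForms (hg ψ hψ) x
  | h2 α β _ _ hα hβ => rw [map_add]; exact add_mem hα hβ

end SupportedForms

/-! ### Locality of values and variations -/

section Integration

variable {A L 𝔤 : Type*} [CommRing A] [LieRing L] [Module A L] [LieRingModule L A]
  [LieRinehartRing A L] [Algebra ℝ A] [LieAlgebra ℝ L] [LieRinehartAlgebra ℝ A L]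
  [LieRing 𝔤] [LieAlgebra ℝ 𝔤] {n : ℕ} {Y : YMData A L 𝔤 n}
  {C : ∀ k, Submodule ℝ (L [⋀^Fin k]→ₗ[A] A)}

/-- A functional on series of top degree forms that behaves like the integral. -/
structure IsIntegration (C : ∀ k, Submodule ℝ (L [⋀^Fin k]→ₗ[A] A))
    (I : FPS (L [⋀^Fin (n + 2)]→ₗ[A] A) → ℕ → ℂ) : Prop where
  add : ∀ {u w}, InS (C (n + 2)) u → InS (C (n + 2)) w → I (u + w) = I u + I w
  smul : ∀ (t : ℂ) u, I (t • u) = t • I u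
  stokes : ∀ {u}, InS (C (n + 1)) u → I (mapS (extDer (n + 1)) u) = 0

namespace YMData

theorem inner2_left_mem (hC : IsSupport C) {α : GForm A L 𝔤 2} (hα : α ∈ gForms 𝔤 (C 2))
    (β : GForm A L 𝔤 2) : Y.inner2 α β ∈ C (n + 2) := by
  rw [inner2_apply]
  exact hC.gtr_left_mem Y.Tr _ hα _

theorem IsRegular.inner2_right_mem (hY : Y.IsRegular) (hC : IsSupport C) (α : GForm A L 𝔤 2)
    {β : GForm A L 𝔤 2} (hβ : β ∈ gForms 𝔤 (C 2)) : Y.inner2 α β ∈ C (n + 2) := by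
  rw [hY.inner2_comm]
  exact inner2_left_mem hC hβ α

theorem br_left_mem (hC : IsSupport C) {α : GForm A L 𝔤 1} (hα : α ∈ gForms 𝔤 (C 1))
    (β : GForm A L 𝔤 1) : br A L 𝔤 (α ⊗ₜ β) ∈ gForms 𝔤 (C 2) := hC.gbr_left_mem _ hα _

theorem br_right_mem (hC : IsSupport C) (α : GForm A L 𝔤 1) {β : GForm A L 𝔤 1}
    (hβ : β ∈ gForms 𝔤 (C 1)) : br A L 𝔤 (α ⊗ₜ β) ∈ gForms 𝔤 (C 2) := hC.gbr_right_mem _ _ hβ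

theorem d1_mem (hC : IsSupport C) {α : GForm A L 𝔤 1} (hα : α ∈ gForms 𝔤 (C 1)) :
    d1 A L 𝔤 α ∈ gForms 𝔤 (C 2) := hC.gd_mem hα

theorem br0_mem (hC : IsSupport C) (l : GForm A L 𝔤 0) {α : GForm A L 𝔤 1}
    (hα : α ∈ gForms 𝔤 (C 1)) : br0 A L 𝔤 (l ⊗ₜ α) ∈ gForms 𝔤 (C 1) := hC.gbr_right_mem _ _ hα

/-- A linear map on pairs of `1`-forms with supported values if one entry is supported. -/
def IsLocal2 {X : Type*} [AddCommGroup X] [Module ℝ X] (C : ∀ k, Submodule ℝ (L [⋀^Fin k]→ₗ[A] A))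
    (f : GForm A L 𝔤 1 ⊗[ℝ] GForm A L 𝔤 1 →ₗ[ℝ] X) (S : Submodule ℝ X) : Prop :=
  (∀ α ∈ gForms 𝔤 (C 1), ∀ β, f (α ⊗ₜ β) ∈ S) ∧ ∀ α, ∀ β ∈ gForms 𝔤 (C 1), f (α ⊗ₜ β) ∈ S

/-- A linear map on triples of `1`-forms with supported values if one of the first two entries is
supported. -/
def IsLocal3 {X : Type*} [AddCommGroup X] [Module ℝ X] (C : ∀ k, Submodule ℝ (L [⋀^Fin k]→ₗ[A] A))
    (f : GForm A L 𝔤 1 ⊗[ℝ] (GForm A L 𝔤 1 ⊗[ℝ] GForm A L 𝔤 1) →ₗ[ℝ] X) (S : Submodule ℝ X) : Prop :=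
  (∀ α ∈ gForms 𝔤 (C 1), ∀ β γ, f (α ⊗ₜ (β ⊗ₜ γ)) ∈ S) ∧
    ∀ α, ∀ β ∈ gForms 𝔤 (C 1), ∀ γ, f (α ⊗ₜ (β ⊗ₜ γ)) ∈ S

/-- A linear map on quadruples of `1`-forms with supported values if one of the first two entries
is supported. -/
def IsLocal4 {X : Type*} [AddCommGroup X] [Module ℝ X] (C : ∀ k, Submodule ℝ (L [⋀^Fin k]→ₗ[A] A))
    (f : GForm A L 𝔤 1 ⊗[ℝ] (GForm A L 𝔤 1 ⊗[ℝ] (GForm A L 𝔤 1 ⊗[ℝ] GForm A L 𝔤 1)) →ₗ[ℝ] X)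
    (S : Submodule ℝ X) : Prop :=
  (∀ α ∈ gForms 𝔤 (C 1), ∀ β γ δ, f (α ⊗ₜ (β ⊗ₜ (γ ⊗ₜ δ))) ∈ S) ∧
    ∀ α, ∀ β ∈ gForms 𝔤 (C 1), ∀ γ δ, f (α ⊗ₜ (β ⊗ₜ (γ ⊗ₜ δ))) ∈ S

variable (Y) in
/-- The supported `1`-forms, as a submodule stable under the symmetries. -/
noncomputable def supported1 (hC : IsSupport C) : LieSubmodule ℝ Y.𝔨 (GForm A L 𝔤 1) where
  __ := gForms 𝔤 (C 1)
  lie_mem {ξ _} h := hC.gLie_mem (ξ : L) h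

theorem mem_of_tmul {M N X : Type*} [AddCommGroup M] [Module ℝ M] [AddCommGroup N] [Module ℝ N]
    [AddCommGroup X] [Module ℝ X] {S : Submodule ℝ X} {f : M ⊗[ℝ] N →ₗ[ℝ] X}
    (h : ∀ x y, f (x ⊗ₜ y) ∈ S) (w : M ⊗[ℝ] N) : f w ∈ S := by
  induction w using TensorProduct.induction_on with
  | zero => simp
  | tmul x y => exact h x y
  | add x y hx hy => rw [map_add]; exact add_mem hx hy

variable {a : FPS (GForm A L 𝔤 1)} {X : Type*} [AddCommGroup X] [Module ℝ X] {S : Submodule ℝ X}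

theorem IsLocal2.val (hC : IsSupport C) (ha : InS (gForms 𝔤 (C 1)) a)
    {f : GForm A L 𝔤 1 ⊗[ℝ] GForm A L 𝔤 1 →ₗ[ℝ] X} (hf : IsLocal2 C f S) :
    InS S ((Y.field2 a).map f).val :=
  InS.starTensor_left Y.F (S := Y.supported1 hC) ha (fun s hs w => hf.1 s hs w) a

theorem IsLocal3.val (hC : IsSupport C) (ha : InS (gForms 𝔤 (C 1)) a)
    {f : GForm A L 𝔤 1 ⊗[ℝ] (GForm A L 𝔤 1 ⊗[ℝ] GForm A L 𝔤 1) →ₗ[ℝ] X} (hf : IsLocal3 C f S) :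
    InS S ((Y.field3 a).map f).val :=
  InS.starTensor_left Y.F (S := Y.supported1 hC) ha (fun s hs w =>
    mem_of_tmul (f := f ∘ₗ TensorProduct.mk ℝ _ _ s) (fun β γ => hf.1 s hs β γ) w) _

theorem IsLocal4.val (hC : IsSupport C) (ha : InS (gForms 𝔤 (C 1)) a)
    {f : GForm A L 𝔤 1 ⊗[ℝ] (GForm A L 𝔤 1 ⊗[ℝ] (GForm A L 𝔤 1 ⊗[ℝ] GForm A L 𝔤 1)) →ₗ[ℝ] X}
    (hf : IsLocal4 C f S) : InS S ((Y.field4 a).map f).val :=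
  InS.starTensor_left Y.F (S := Y.supported1 hC) ha (fun s hs w =>
    mem_of_tmul (f := f ∘ₗ TensorProduct.mk ℝ _ _ s) (fun β w =>
      mem_of_tmul (f := f ∘ₗ TensorProduct.mk ℝ _ _ s ∘ₗ TensorProduct.mk ℝ _ _ β)
        (fun γ δ => hf.1 s hs β γ δ) w) w) _

/-- The parameter has no support condition, so where dλ replaces one factor the support comes from
the other. Hence locality is required in either slot. -/
theorem IsLocal2.var (hC : IsSupport C) (ha : InS (gForms 𝔤 (C 1)) a)
    {f : GForm A L 𝔤 1 ⊗[ℝ] GForm A L 𝔤 1 →ₗ[ℝ] X} (hf : IsLocal2 C f S)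
    (l : FPS (GForm A L 𝔤 0)) : InS S (((Y.field2 a).map f).var l) := by
  rw [Obs.map_var, field2_var, map_sub, ← mapS_comp, ← mapS_comp]
  refine InS.sub (InS.starTensor_right Y.F (S := Y.supported1 hC) ha (fun l s hs => ?_) l)
    (InS.starTensor_middle Y.F (S := Y.supported1 hC) ha (fun l s hs w => ?_) l a)
  · have : shiftVarOne (d0 A L 𝔤) (l ⊗ₜ s) = d0 A L 𝔤 l ⊗ₜ s + s ⊗ₜ d0 A L 𝔤 l := rfl
    rw [LinearMap.comp_apply, this, map_add]
    exact add_mem (hf.2 _ s hs) (hf.1 s hs _)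
  · have : rotVar (br0 A L 𝔤) (br0 A L 𝔤) (l ⊗ₜ (s ⊗ₜ w)) =
      br0 A L 𝔤 (l ⊗ₜ s) ⊗ₜ w + s ⊗ₜ br0 A L 𝔤 (l ⊗ₜ w) := rfl
    rw [LinearMap.comp_apply, this, map_add]
    exact add_mem (hf.1 _ (br0_mem hC l hs) _) (hf.1 s hs _)

/-- Only the leading factor a is followed: a variation leaves it in the first slot, rotates it
there, or pushes it to the second. This is why locality in two slots is enough. -/
theorem IsLocal3.var (hC : IsSupport C) (ha : InS (gForms 𝔤 (C 1)) a)
    {f : GForm A L 𝔤 1 ⊗[ℝ] (GForm A L 𝔤 1 ⊗[ℝ] GForm A L 𝔤 1) →ₗ[ℝ] X} (hf : IsLocal3 C f S)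
    (l : FPS (GForm A L 𝔤 0)) : InS S (((Y.field3 a).map f).var l) := by
  have h1 : ∀ s ∈ gForms 𝔤 (C 1), ∀ w, f (s ⊗ₜ w) ∈ S := fun s hs w =>
    mem_of_tmul (f := f ∘ₗ TensorProduct.mk ℝ _ _ s) (fun β γ => hf.1 s hs β γ) w
  rw [Obs.map_var, field3_var, map_sub, ← mapS_comp, ← mapS_comp]
  refine InS.sub (InS.starTensor_middle Y.F (S := Y.supported1 hC) ha (fun l s hs w => ?_) l a)
    (InS.starTensor_middle Y.F (S := Y.supported1 hC) ha (fun l s hs w => ?_) l _)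
  · have : shiftVar (d0 A L 𝔤) (shiftVarOne (d0 A L 𝔤)) (l ⊗ₜ (s ⊗ₜ w)) =
      d0 A L 𝔤 l ⊗ₜ (s ⊗ₜ w) + s ⊗ₜ shiftVarOne (d0 A L 𝔤) (l ⊗ₜ w) := rfl
    rw [LinearMap.comp_apply, this, map_add]
    exact add_mem (hf.2 _ s hs w) (h1 s hs _)
  · have : rotVar (br0 A L 𝔤) (rotVar (br0 A L 𝔤) (br0 A L 𝔤)) (l ⊗ₜ (s ⊗ₜ w)) =
      br0 A L 𝔤 (l ⊗ₜ s) ⊗ₜ w + s ⊗ₜ rotVar (br0 A L 𝔤) (br0 A L 𝔤) (l ⊗ₜ w) := rfl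
    rw [LinearMap.comp_apply, this, map_add]
    exact add_mem (h1 _ (br0_mem hC l hs) _) (h1 s hs _)

theorem IsLocal4.var (hC : IsSupport C) (ha : InS (gForms 𝔤 (C 1)) a)
    {f : GForm A L 𝔤 1 ⊗[ℝ] (GForm A L 𝔤 1 ⊗[ℝ] (GForm A L 𝔤 1 ⊗[ℝ] GForm A L 𝔤 1)) →ₗ[ℝ] X}
    (hf : IsLocal4 C f S) (l : FPS (GForm A L 𝔤 0)) : InS S (((Y.field4 a).map f).var l) := by
  have h1 : ∀ s ∈ gForms 𝔤 (C 1), ∀ w, f (s ⊗ₜ w) ∈ S := fun s hs w =>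
    mem_of_tmul (f := f ∘ₗ TensorProduct.mk ℝ _ _ s) (fun β w =>
      mem_of_tmul (f := f ∘ₗ TensorProduct.mk ℝ _ _ s ∘ₗ TensorProduct.mk ℝ _ _ β)
        (fun γ δ => hf.1 s hs β γ δ) w) w
  have h2 : ∀ α, ∀ s ∈ gForms 𝔤 (C 1), ∀ w, f (α ⊗ₜ (s ⊗ₜ w)) ∈ S := fun α s hs w =>
    mem_of_tmul (f := f ∘ₗ TensorProduct.mk ℝ _ _ α ∘ₗ TensorProduct.mk ℝ _ _ s)
      (fun γ δ => hf.2 α s hs γ δ) w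
  rw [Obs.map_var, field4_var, map_sub, ← mapS_comp, ← mapS_comp]
  refine InS.sub (InS.starTensor_middle Y.F (S := Y.supported1 hC) ha (fun l s hs w => ?_) l _)
    (InS.starTensor_middle Y.F (S := Y.supported1 hC) ha (fun l s hs w => ?_) l _)
  · have : shiftVar (d0 A L 𝔤) (shiftVar (d0 A L 𝔤) (shiftVarOne (d0 A L 𝔤))) (l ⊗ₜ (s ⊗ₜ w)) =
      d0 A L 𝔤 l ⊗ₜ (s ⊗ₜ w) +
        s ⊗ₜ shiftVar (d0 A L 𝔤) (shiftVarOne (d0 A L 𝔤)) (l ⊗ₜ w) := rfl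
    rw [LinearMap.comp_apply, this, map_add]
    exact add_mem (h2 _ s hs w) (h1 s hs _)
  · have : rotVar (br0 A L 𝔤) (rotVar (br0 A L 𝔤) (rotVar (br0 A L 𝔤) (br0 A L 𝔤)))
        (l ⊗ₜ (s ⊗ₜ w)) = br0 A L 𝔤 (l ⊗ₜ s) ⊗ₜ w +
          s ⊗ₜ rotVar (br0 A L 𝔤) (rotVar (br0 A L 𝔤) (br0 A L 𝔤)) (l ⊗ₜ w) := rfl
    rw [LinearMap.comp_apply, this, map_add]
    exact add_mem (h1 _ (br0_mem hC l hs) _) (h1 s hs _)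

end YMData

end Integration

/-! ### Integrating the densities: Maurer-Cartan form against explicit form -/

section Integration

variable {A L 𝔤 : Type*} [CommRing A] [LieRing L] [Module A L] [LieRingModule L A]
  [LieRinehartRing A L] [Algebra ℝ A] [LieAlgebra ℝ L] [LieRinehartAlgebra ℝ A L]
  [LieRing 𝔤] [LieAlgebra ℝ 𝔤] {n : ℕ} {Y : YMData A L 𝔤 n}
  {C : ∀ k, Submodule ℝ (L [⋀^Fin k]→ₗ[A] A)}
  {I : FPS (L [⋀^Fin (n + 2)]→ₗ[A] A) → ℕ → ℂ}

namespace YMData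

theorem IsRegular.isLocal_ym2 (hY : Y.IsRegular) (hC : IsSupport C) :
    IsLocal2 C Y.ym2 (C (n + 2)) := by
  constructor
  · intro α hα β
    exact Submodule.smul_mem _ _ (inner2_left_mem hC (d1_mem hC hα) _)
  · intro α β hβ
    exact Submodule.smul_mem _ _ (hY.inner2_right_mem hC _ (d1_mem hC hβ))

theorem IsRegular.isLocal_ym3 (hY : Y.IsRegular) (hC : IsSupport C) :
    IsLocal3 C Y.ym3 (C (n + 2)) := by
  constructor
  · intro α hα β γ
    exact Submodule.smul_mem _ _ (add_mem (add_mem (inner2_left_mem hC (d1_mem hC hα) _)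
      (inner2_left_mem hC (br_left_mem hC hα _) _)) (inner2_left_mem hC (br_left_mem hC hα _) _))
  · intro α β hβ γ
    exact Submodule.smul_mem _ _ (add_mem (add_mem
      (hY.inner2_right_mem hC _ (br_left_mem hC hβ _))
      (inner2_left_mem hC (br_right_mem hC _ hβ) _)) (hY.inner2_right_mem hC _ (d1_mem hC hβ)))

theorem IsRegular.isLocal_ym4 (hY : Y.IsRegular) (hC : IsSupport C) :
    IsLocal4 C Y.ym4 (C (n + 2)) := by
  constructor
  · intro α hα β γ δ
    rw [ym4_tmul]
    exact Submodule.smul_mem _ _ (add_mem (add_mem (inner2_left_mem hC (br_left_mem hC hα _) _)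
      (inner2_left_mem hC (br_left_mem hC hα _) _)) (inner2_left_mem hC (br_left_mem hC hα _) _))
  · intro α β hβ γ δ
    rw [ym4_tmul]
    exact Submodule.smul_mem _ _ (add_mem (add_mem
      (inner2_left_mem hC (br_right_mem hC _ hβ) _)
      (hY.inner2_right_mem hC _ (br_left_mem hC hβ _)))
      (hY.inner2_right_mem hC _ (br_left_mem hC hβ _)))

/-- The Hodge operator on `2`-forms preserves supports. -/
def HodgeLocal (Y : YMData A L 𝔤 n) (C : ∀ k, Submodule ℝ (L [⋀^Fin k]→ₗ[A] A)) : Prop :=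
  ∀ ψ ∈ C 2, hodge Y.metric Y.coeff (show 2 + n = n + 2 by omega) ψ ∈ C n

theorem HodgeLocal.hod_mem (hH : Y.HodgeLocal C) {α : GForm A L 𝔤 2}
    (hα : α ∈ gForms 𝔤 (C 2)) : Y.hod (k := 2) (l := n) (by omega) α ∈ gForms 𝔤 (C n) :=
  ghodge_mem _ hH hα

theorem HodgeLocal.isLocal_bdry2 (hH : Y.HodgeLocal C) (hC : IsSupport C) :
    IsLocal2 C Y.bdry2 (C (n + 1)) :=
  ⟨fun _ hα _ => hC.gtr_left_mem _ _ hα _,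
    fun _ _ hβ => hC.gtr_right_mem _ _ _ (hH.hod_mem (d1_mem hC hβ))⟩

theorem HodgeLocal.isLocal_bdry3 (hH : Y.HodgeLocal C) (hC : IsSupport C) :
    IsLocal3 C Y.bdry3 (C (n + 1)) :=
  ⟨fun _ hα _ _ => hC.gtr_left_mem _ _ hα _,
    fun _ _ hβ _ => hC.gtr_right_mem _ _ _ (hH.hod_mem (br_left_mem hC hβ _))⟩

/-- The Maurer-Cartan functional is the integral of the explicit density, up to exact terms. -/
theorem integral_mc (hC : IsSupport C) (hI : IsIntegration C I)
    {u2 u3 u4 : FPS (L [⋀^Fin (n + 2)]→ₗ[A] A)} {w2 w3 : FPS (L [⋀^Fin (n + 1)]→ₗ[A] A)}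
    (h2 : InS (C (n + 2)) u2) (h3 : InS (C (n + 2)) u3) (h4 : InS (C (n + 2)) u4)
    (k2 : InS (C (n + 1)) w2) (k3 : InS (C (n + 1)) w3) :
    (1 / 2 : ℂ) • I ((2 : ℂ) • u2 + (-1 : ℂ) • mapS (extDer (n + 1)) w2) -
      (1 / 6 : ℂ) • I ((-6 : ℂ) • u3 + mapS (extDer (n + 1)) w3) -
      (1 / 24 : ℂ) • I ((-24 : ℂ) • u4) = I (u2 + u3 + u4) := by
  have e2 : InS (C (n + 2)) (mapS (extDer (n + 1)) w2) :=
    InS.mapS_mem (fun _ h => hC.extDer_mem h) k2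
  have e3 : InS (C (n + 2)) (mapS (extDer (n + 1)) w3) :=
    InS.mapS_mem (fun _ h => hC.extDer_mem h) k3
  rw [hI.add (h2.smul _) (e2.smul _), hI.add (h3.smul _) e3, hI.add (h2.add h3) h4, hI.add h2 h3,
    hI.smul, hI.smul, hI.smul, hI.smul, hI.stokes k2, hI.stokes k3]
  module

variable {a : FPS (GForm A L 𝔤 1)}

theorem IsRegular.integral_mc_val (hY : Y.IsRegular) (hC : IsSupport C) (hH : Y.HodgeLocal C)
    (hI : IsIntegration C I) (ha : InS (gForms 𝔤 (C 1)) a) :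
    (1 / 2 : ℂ) • I (Y.mc1 a).val - (1 / 6 : ℂ) • I (Y.mc2 a).val
      - (1 / 24 : ℂ) • I (Y.mc3 a).val = I (Y.ymDensity a).val := by
  rw [hY.mc1_eq, hY.mc2_eq, hY.mc3_eq, hY.ymDensity_eq]
  exact integral_mc hC hI ((hY.isLocal_ym2 hC).val hC ha) ((hY.isLocal_ym3 hC).val hC ha)
    ((hY.isLocal_ym4 hC).val hC ha) ((hH.isLocal_bdry2 hC).val hC ha)
    ((hH.isLocal_bdry3 hC).val hC ha)

theorem IsRegular.integral_mc_var (hY : Y.IsRegular) (hC : IsSupport C) (hH : Y.HodgeLocal C)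
    (hI : IsIntegration C I) (ha : InS (gForms 𝔤 (C 1)) a) (l : FPS (GForm A L 𝔤 0)) :
    (1 / 2 : ℂ) • I ((Y.mc1 a).var l) - (1 / 6 : ℂ) • I ((Y.mc2 a).var l)
      - (1 / 24 : ℂ) • I ((Y.mc3 a).var l) = I ((Y.ymDensity a).var l) := by
  rw [hY.mc1_eq, hY.mc2_eq, hY.mc3_eq, hY.ymDensity_eq]
  exact integral_mc hC hI ((hY.isLocal_ym2 hC).var hC ha l) ((hY.isLocal_ym3 hC).var hC ha l)
    ((hY.isLocal_ym4 hC).var hC ha l) ((hH.isLocal_bdry2 hC).var hC ha l)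
    ((hH.isLocal_bdry3 hC).var hC ha l)

end YMData

end Integration

/-! ### Compatible twists -/

section CompatibleTwist

variable {A L 𝔤 : Type*} [CommRing A] [LieRing L] [Module A L] [LieRingModule L A]
  [LieRinehartRing A L] [Algebra ℝ A] [LieAlgebra ℝ L] [LieRinehartAlgebra ℝ A L]
  [LieRing 𝔤] [LieAlgebra ℝ 𝔤] {n : ℕ} {Y : YMData A L 𝔤 n}
  {C : ∀ k, Submodule ℝ (L [⋀^Fin k]→ₗ[A] A)}
  {I : FPS (L [⋀^Fin (n + 2)]→ₗ[A] A) → ℕ → ℂ}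

namespace YMData

/-- Symmetry of the star pairing of `1`-forms and `(n+1)`-forms. -/
def PairingSymm (Y : YMData A L 𝔤 n) (C : ∀ k, Submodule ℝ (L [⋀^Fin k]→ₗ[A] A))
    (I : FPS (L [⋀^Fin (n + 2)]→ₗ[A] A) → ℕ → ℂ) : Prop :=
  ∀ x y, InS (gForms 𝔤 (C 1)) x → InS (gForms 𝔤 (C (n + 1))) y →
    I (starProd Y.F (gtr Y.Tr (show 1 + (n + 1) = n + 2 by omega)) x y) =
      I (starProd Y.F (gtr Y.Tr (show 1 + (n + 1) = n + 2 by omega)).flip y x)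

/-- The map `(β, γ) ↦ [γ, ∗β]`. -/
noncomputable def twistBr (Y : YMData A L 𝔤 n) :
    GForm A L 𝔤 2 ⊗[ℝ] GForm A L 𝔤 1 →ₗ[ℝ] GForm A L 𝔤 (n + 1) :=
  TensorProduct.lift (gbr (show 1 + n = n + 1 by omega)) ∘ₗ
    TensorProduct.map LinearMap.id (Y.hod (k := 2) (l := n) (by omega)) ∘ₗ
      (TensorProduct.comm ℝ _ _).toLinearMap

theorem IsRegular.isInv_twistBr (hY : Y.IsRegular) : IsInv Y.𝔨 Y.twistBr :=
  (isInv_gbr _).comp ((IsInv.id.map hY.isInv_hod).comp (IsInv.comm _ _))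

theorem IsRegular.pairing_twistBr (hY : Y.IsRegular) :
    Y.pairing ∘ₗ TensorProduct.map LinearMap.id Y.twistBr = Y.innerMid := by
  ext1
  refine LinearMap.ext fun α => TensorProduct.ext' fun β γ => ?_
  exact hY.pairing_br α γ β

theorem IsRegular.pairing_flip_twistBr (hY : Y.IsRegular) :
    TensorProduct.lift (gtr Y.Tr (show 1 + (n + 1) = n + 2 by omega)).flip ∘ₗ
      TensorProduct.map Y.twistBr LinearMap.id =
    TensorProduct.lift Y.inner2 ∘ₗ TensorProduct.map LinearMap.id (br A L 𝔤) ∘ₗ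
      (TensorProduct.assoc ℝ _ _ _).toLinearMap := by
  refine TensorProduct.ext_threefold fun β γ δ => ?_
  refine (hY.pairing_br δ γ β).trans ?_
  rw [hY.inner2_comm, br_comm]
  rfl

/-- The braided term is unbraided by a compatible twist. -/
theorem IsRegular.integral_innerMid (hY : Y.IsRegular) (hS : Y.PairingSymm C I)
    {a : FPS (GForm A L 𝔤 1)} (ha : InS (gForms 𝔤 (C 1)) a) {b : FPS (GForm A L 𝔤 2)}
    (hb : InS (gForms 𝔤 (C (n + 1))) (mapS Y.twistBr (starTensor Y.F b a))) :
    I (mapS Y.innerMid (starTensor Y.F a (starTensor Y.F b a))) =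
      I (mapS (TensorProduct.lift Y.inner2 ∘ₗ TensorProduct.map LinearMap.id (br A L 𝔤))
        (starTensor Y.F b (starTensor Y.F a a))) := by
  -- Symmetry of the pairing for the 1-form a and the (n+1)-form [a, ∗b] in its braided order. One
  -- side contracts to the braided word, the other to Tr(b ∧ ∗[a, a]).
  have h := hS a _ ha hb
  rw [starProd_eq, starTensor_mapS_right Y.F hY.isInv_twistBr, starProd_eq,
    starTensor_mapS_left Y.F hY.isInv_twistBr, ← mapS_comp, ← mapS_comp] at h
  rw [← starTensor_assoc Y.F b a a, ← mapS_comp, ← hY.pairing_twistBr]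
  refine h.trans (congrArg I ?_)
  exact congrArg (fun f => mapS f _) hY.pairing_flip_twistBr

/-- The boundary term `Tr(C ∧ ∗[A, B])`. -/
noncomputable def bdry3Flip (Y : YMData A L 𝔤 n) :
    GForm A L 𝔤 1 ⊗[ℝ] (GForm A L 𝔤 1 ⊗[ℝ] GForm A L 𝔤 1) →ₗ[ℝ] (L [⋀^Fin (n + 1)]→ₗ[A] A) :=
  TensorProduct.lift (gtr Y.Tr (show 1 + n = n + 1 by omega)).flip ∘ₗ
    TensorProduct.map Y.hodBr LinearMap.id ∘ₗ (TensorProduct.assoc ℝ _ _ _).symm.toLinearMap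

theorem bdry3Flip_tmul (α β γ : GForm A L 𝔤 1) : Y.bdry3Flip (α ⊗ₜ (β ⊗ₜ γ)) =
    gtr Y.Tr (by omega) γ (Y.hod (k := 2) (l := n) (by omega) (br A L 𝔤 (α ⊗ₜ β))) := rfl

theorem IsRegular.pairing_flip_d (hY : Y.IsRegular) :
    (TensorProduct.lift (gtr Y.Tr (show 1 + (n + 1) = n + 2 by omega)).flip ∘ₗ
      (gd rfl ∘ₗ Y.hodBr).rTensor (GForm A L 𝔤 1)) ∘ₗ
        (TensorProduct.assoc ℝ _ _ _).symm.toLinearMap =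
    TensorProduct.lift Y.inner2 ∘ₗ TensorProduct.map (br A L 𝔤) (d1 A L 𝔤) ∘ₗ
      (TensorProduct.assoc ℝ _ _ _).symm.toLinearMap - extDer (n + 1) ∘ₗ Y.bdry3Flip := by
  ext1
  refine LinearMap.ext fun α => TensorProduct.ext' fun β γ => ?_
  refine (pairing_d γ (br A L 𝔤 (α ⊗ₜ β))).trans ?_
  rw [hY.inner2_comm]
  rfl

theorem pairing_id_d :
    Y.pairing ∘ₗ TensorProduct.map LinearMap.id (gd rfl ∘ₗ Y.hodBr) =
    TensorProduct.lift Y.inner2 ∘ₗ TensorProduct.map (d1 A L 𝔤) (br A L 𝔤) -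
      extDer (n + 1) ∘ₗ Y.bdry3 := by
  ext1
  refine LinearMap.ext fun α => TensorProduct.ext' fun β γ => ?_
  exact pairing_d α (br A L 𝔤 (β ⊗ₜ γ))

theorem integral_sub_exact (hC : IsSupport C) (hI : IsIntegration C I)
    {u : FPS (L [⋀^Fin (n + 2)]→ₗ[A] A)} {w : FPS (L [⋀^Fin (n + 1)]→ₗ[A] A)}
    (hu : InS (C (n + 2)) u) (hw : InS (C (n + 1)) w) : I (u - mapS (extDer (n + 1)) w) = I u := by
  have e : InS (C (n + 2)) (mapS (extDer (n + 1)) w) :=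
    InS.mapS_mem (fun _ h => hC.extDer_mem h) hw
  have h : u - mapS (extDer (n + 1)) w = u + (-1 : ℂ) • mapS (extDer (n + 1)) w := by module
  rw [h, hI.add hu (e.smul _), hI.smul, hI.stokes hw]
  simp

/-- The two mixed cubic terms have the same integral. -/
theorem IsRegular.integral_cubic_symm (hY : Y.IsRegular) (hC : IsSupport C) (hH : Y.HodgeLocal C)
    (hI : IsIntegration C I) (hS : Y.PairingSymm C I) {a : FPS (GForm A L 𝔤 1)}
    (ha : InS (gForms 𝔤 (C 1)) a) :
    I ((Y.field3 a).map
      (TensorProduct.lift Y.inner2 ∘ₗ TensorProduct.map (d1 A L 𝔤) (br A L 𝔤))).val =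
    I ((Y.field3 a).map
      (TensorProduct.lift Y.inner2 ∘ₗ TensorProduct.map (br A L 𝔤) (d1 A L 𝔤) ∘ₗ
        (TensorProduct.assoc ℝ _ _ _).symm.toLinearMap)).val := by
  have hinv : IsInv Y.𝔨 (gd rfl ∘ₗ Y.hodBr) := isInv_gd.comp hY.isInv_hodBr
  -- Symmetry of the pairing is applied to a and d∗[a, a]; integrating by parts on either side gives
  -- the two cubic terms.
  have hy : InS (gForms 𝔤 (C (n + 1))) (mapS (gd rfl ∘ₗ Y.hodBr) (starTensor Y.F a a)) :=
    InS.starTensor_left Y.F (S := Y.supported1 hC) ha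
      (fun s hs w => hC.gd_mem (hH.hod_mem (br_left_mem hC hs w))) a
  have h := hS a _ ha hy
  have hl : starProd Y.F (gtr Y.Tr (show 1 + (n + 1) = n + 2 by omega)) a
      (mapS (gd rfl ∘ₗ Y.hodBr) (starTensor Y.F a a)) =
      ((Y.field3 a).map
        (TensorProduct.lift Y.inner2 ∘ₗ TensorProduct.map (d1 A L 𝔤) (br A L 𝔤))).val -
      mapS (extDer (n + 1)) ((Y.field3 a).map Y.bdry3).val := by
    rw [starProd_eq, starTensor_mapS_right Y.F hinv, ← mapS_comp]
    refine (congrArg (fun f => mapS f (Y.field3 a).val) (pairing_id_d (Y := Y))).trans ?_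
    rw [mapS_sub, mapS_comp (extDer (n + 1)) Y.bdry3]
    rfl
  have hr : starProd Y.F (gtr Y.Tr (show 1 + (n + 1) = n + 2 by omega)).flip
      (mapS (gd rfl ∘ₗ Y.hodBr) (starTensor Y.F a a)) a =
      ((Y.field3 a).map
        (TensorProduct.lift Y.inner2 ∘ₗ TensorProduct.map (br A L 𝔤) (d1 A L 𝔤) ∘ₗ
          (TensorProduct.assoc ℝ _ _ _).symm.toLinearMap)).val -
      mapS (extDer (n + 1)) ((Y.field3 a).map Y.bdry3Flip).val := by
    rw [starProd_eq, starTensor_mapS_left Y.F hinv, ← mapS_comp, ← mapS_assoc_symm, ← mapS_comp,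
      hY.pairing_flip_d, mapS_sub, mapS_comp (extDer (n + 1)) Y.bdry3Flip]
    rfl
  rw [hl, hr, integral_sub_exact hC hI, integral_sub_exact hC hI] at h
  · exact h
  · refine IsLocal3.val hC ha ⟨fun α hα β γ => ?_, fun α β hβ γ => ?_⟩
    · exact inner2_left_mem hC (br_left_mem hC hα _) _
    · exact inner2_left_mem hC (br_right_mem hC _ hβ) _
  · refine IsLocal3.val hC ha ⟨fun α hα β γ => ?_, fun α β hβ γ => ?_⟩
    · rw [bdry3Flip_tmul]
      exact hC.gtr_right_mem _ _ _ (hH.hod_mem (br_left_mem hC hα _))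
    · rw [bdry3Flip_tmul]
      exact hC.gtr_right_mem _ _ _ (hH.hod_mem (br_right_mem hC _ hβ))
  · refine IsLocal3.val hC ha ⟨fun α hα β γ => ?_, fun α β hβ γ => ?_⟩
    · exact inner2_left_mem hC (d1_mem hC hα) _
    · exact hY.inner2_right_mem hC _ (br_left_mem hC hβ _)
  · exact (hH.isLocal_bdry3 hC).val hC ha

theorem IsRegular.integral_braidTerm_curv (hY : Y.IsRegular) (hC : IsSupport C)
    (hH : Y.HodgeLocal C) (hS : Y.PairingSymm C I) {a : FPS (GForm A L 𝔤 1)}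
    (ha : InS (gForms 𝔤 (C 1)) a) :
    I ((Y.field3 a).map (Y.innerMid ∘ₗ TensorProduct.map LinearMap.id
      (TensorProduct.map (d1 A L 𝔤) LinearMap.id))).val =
    I ((Y.field3 a).map
      (TensorProduct.lift Y.inner2 ∘ₗ TensorProduct.map (d1 A L 𝔤) (br A L 𝔤))).val := by
  have hb : InS (gForms 𝔤 (C (n + 1)))
      (mapS Y.twistBr (starTensor Y.F (mapS (d1 A L 𝔤) a) a)) := by
    rw [starTensor_mapS_left Y.F isInv_d1, ← mapS_comp]
    exact InS.starTensor_left Y.F (S := Y.supported1 hC) ha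
      (fun s hs w => hC.gbr_right_mem _ _ (hH.hod_mem (d1_mem hC hs))) a
  have h := hY.integral_innerMid hS ha hb
  rw [starTensor_mapS_left Y.F isInv_d1 a a, starTensor_mapS_right Y.F (isInv_d1.rTensor _),
    starTensor_mapS_left Y.F isInv_d1, ← mapS_comp, ← mapS_comp] at h
  refine h.trans (congrArg I ?_)
  refine congrArg (fun f => mapS f (Y.field3 a).val) ?_
  ext1
  exact LinearMap.ext fun α => TensorProduct.ext' fun β γ => rfl

theorem IsRegular.integral_braidTerm_fieldSq (hY : Y.IsRegular) (hC : IsSupport C)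
    (hH : Y.HodgeLocal C) (hS : Y.PairingSymm C I) {a : FPS (GForm A L 𝔤 1)}
    (ha : InS (gForms 𝔤 (C 1)) a) :
    I (Y.braidTerm a (Y.fieldSq a)).val =
    I ((Y.field4 a).map
        (TensorProduct.lift Y.inner2 ∘ₗ TensorProduct.map (br A L 𝔤) (br A L 𝔤) ∘ₗ
          (TensorProduct.assoc ℝ _ _ _).symm.toLinearMap)).val := by
  have hb : InS (gForms 𝔤 (C (n + 1)))
      (mapS Y.twistBr (starTensor Y.F (mapS (br A L 𝔤) (starTensor Y.F a a)) a)) := by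
    rw [starTensor_mapS_left Y.F isInv_br, ← mapS_assoc_symm, ← mapS_comp, ← mapS_comp]
    exact InS.starTensor_left Y.F (S := Y.supported1 hC) ha
      (fun s hs w => mem_of_tmul (f := ((Y.twistBr ∘ₗ (br A L 𝔤).rTensor _) ∘ₗ
        (TensorProduct.assoc ℝ _ _ _).symm.toLinearMap) ∘ₗ TensorProduct.mk ℝ _ _ s)
        (fun β γ => hC.gbr_right_mem _ _ (hH.hod_mem (br_left_mem hC hs β))) w) _
  have h := hY.integral_innerMid hS ha hb
  rw [hY.braidTerm_eq, fieldSq_eq]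
  refine h.trans (congrArg I ?_)
  rw [starTensor_mapS_left Y.F isInv_br, ← mapS_assoc_symm, ← mapS_comp, ← mapS_comp]
  refine congrArg (fun f => mapS f (Y.field4 a).val) ?_
  exact tensor_ext_four fun α β γ δ => rfl

/-- Once m, v, w and p, q have equal integrals, the cubic corrections sum to 1/6 - 1/12 - 1/12 = 0
and the quartic ones to 1/12 - 1/12 - 1/24 = -1/24. -/
theorem integral_combination (hI : IsIntegration C I)
    {u v w m q p x : FPS (L [⋀^Fin (n + 2)]→ₗ[A] A)} (hu : InS (C (n + 2)) u)
    (hv : InS (C (n + 2)) v) (hw : InS (C (n + 2)) w) (hm : InS (C (n + 2)) m)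
    (hq : InS (C (n + 2)) q) (hp : InS (C (n + 2)) p) (hx : InS (C (n + 2)) x)
    (h1 : I m = I v) (h2 : I p = I q) (h3 : I v = I w) :
    I ((1 / 2 : ℂ) • ((u + (1 / 2 : ℂ) • w) + (1 / 2 : ℂ) • (v + (1 / 2 : ℂ) • q)) +
      (1 / 6 : ℂ) • (m + (1 / 2 : ℂ) • p) +
      (-1 / 12 : ℂ) • ((v + (1 / 2 : ℂ) • q) + (w + (1 / 2 : ℂ) • q)) +
      (1 / 24 : ℂ) • (x + (-1 : ℂ) • p)) =
    (1 / 2 : ℂ) • I ((u + (1 / 2 : ℂ) • w) + (1 / 2 : ℂ) • (v + (1 / 2 : ℂ) • q)) +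
      (1 / 24 : ℂ) • I x - (1 / 24 : ℂ) • I q := by
  -- Additivity of I is available only on supported series, so I is made into a linear map on their
  -- span.
  let S : Submodule ℂ (FPS (L [⋀^Fin (n + 2)]→ₗ[A] A)) :=
    { carrier := {u | InS (C (n + 2)) u}
      add_mem' := fun h h' => h.add h'
      zero_mem' := fun m => zero_mem _
      smul_mem' := fun t u h => InS.smul t h }
  let J : S →ₗ[ℂ] (ℕ → ℂ) :=
    { toFun := fun u => I u
      map_add' := fun u w => hI.add u.2 w.2
      map_smul' := fun t u => hI.smul t u }
  lift u to S using hu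
  lift v to S using hv
  lift w to S using hw
  lift m to S using hm
  lift q to S using hq
  lift p to S using hp
  lift x to S using hx
  change J m = J v at h1
  change J p = J q at h2
  change J v = J w at h3
  change J ((1 / 2 : ℂ) • ((u + (1 / 2 : ℂ) • w) + (1 / 2 : ℂ) • (v + (1 / 2 : ℂ) • q)) +
      (1 / 6 : ℂ) • (m + (1 / 2 : ℂ) • p) +
      (-1 / 12 : ℂ) • ((v + (1 / 2 : ℂ) • q) + (w + (1 / 2 : ℂ) • q)) +
      (1 / 24 : ℂ) • (x + (-1 : ℂ) • p)) =
    (1 / 2 : ℂ) • J ((u + (1 / 2 : ℂ) • w) + (1 / 2 : ℂ) • (v + (1 / 2 : ℂ) • q)) +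
      (1 / 24 : ℂ) • J x - (1 / 24 : ℂ) • J q
  simp only [map_add, map_smul, h1, h2, h3]
  module

/-- The Yang-Mills density for a compatible twist. -/
theorem IsRegular.integral_ymDensity (hY : Y.IsRegular) (hC : IsSupport C)
    (hH : Y.HodgeLocal C) (hI : IsIntegration C I) (hS : Y.PairingSymm C I)
    {a : FPS (GForm A L 𝔤 1)} (ha : InS (gForms 𝔤 (C 1)) a) :
    I (Y.ymDensity a).val = (1 / 2 : ℂ) • I (Y.ymTerm a).val + (1 / 24 : ℂ) • I (Y.quarticTerm a).val
      - (1 / 24 : ℂ) • I (Y.trS (show 2 + n = n + 2 by omega)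
            (Y.brS rfl a a) (Y.hodS (show 2 + n = n + 2 by omega) (Y.brS rfl a a))) := by
  have hQ : Y.trS (show 2 + n = n + 2 by omega)
      (Y.brS rfl a a) (Y.hodS (show 2 + n = n + 2 by omega) (Y.brS rfl a a)) =
      ((Y.field4 a).map (TensorProduct.lift Y.inner2 ∘ₗ TensorProduct.map (br A L 𝔤) (br A L 𝔤) ∘ₗ
          (TensorProduct.assoc ℝ _ _ _).symm.toLinearMap)).val := by
    refine congrArg Obs.val ((hY.mul_trS_hod (Y.fieldSq a) (Y.fieldSq a)).trans ?_)
    rw [fieldSq_eq, mul_br_br, ← Obs.map_comp]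
  have h1 := hY.integral_braidTerm_curv hC hH hS ha
  have h2 := hY.integral_braidTerm_fieldSq hC hH hS ha
  have h3 := hY.integral_cubic_symm hC hH hI hS ha
  rw [hY.braidTerm_fieldSq] at h2
  rw [hQ, ymDensity, hY.ymTerm_eq, hY.mul_curv_fieldSq, hY.mul_fieldSq_curv, hY.braidTerm_curv,
    hY.braidTerm_fieldSq, hY.quarticTerm_eq]
  refine integral_combination hI ?_ ?_ ?_ ?_ ?_ ?_ ?_ h1 h2 h3
  · refine IsLocal2.val hC ha ⟨fun α hα β => ?_, fun α β hβ => ?_⟩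
    · exact inner2_left_mem hC (d1_mem hC hα) _
    · exact hY.inner2_right_mem hC _ (d1_mem hC hβ)
  · refine IsLocal3.val hC ha ⟨fun α hα β γ => ?_, fun α β hβ γ => ?_⟩
    · exact inner2_left_mem hC (d1_mem hC hα) _
    · exact hY.inner2_right_mem hC _ (br_left_mem hC hβ _)
  · refine IsLocal3.val hC ha ⟨fun α hα β γ => ?_, fun α β hβ γ => ?_⟩
    · exact inner2_left_mem hC (br_left_mem hC hα _) _
    · exact inner2_left_mem hC (br_right_mem hC _ hβ) _
  · refine IsLocal3.val hC ha ⟨fun α hα β γ => ?_, fun α β hβ γ => ?_⟩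
    · exact inner2_left_mem hC (br_left_mem hC hα _) _
    · exact hY.inner2_right_mem hC _ (d1_mem hC hβ)
  · refine IsLocal4.val hC ha ⟨fun α hα β γ δ => ?_, fun α β hβ γ δ => ?_⟩
    · exact inner2_left_mem hC (br_left_mem hC hα _) _
    · exact inner2_left_mem hC (br_right_mem hC _ hβ) _
  · refine IsLocal4.val hC ha ⟨fun α hα β γ δ => ?_, fun α β hβ γ δ => ?_⟩
    · exact inner2_left_mem hC (br_left_mem hC hα _) _
    · exact hY.inner2_right_mem hC _ (br_left_mem hC hβ _)
  · refine IsLocal4.val hC ha ⟨fun α hα β γ δ => ?_, fun α β hβ γ δ => ?_⟩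
    · exact inner2_left_mem hC (br_left_mem hC hα _) _
    · exact hY.inner2_right_mem hC _ (br_left_mem hC hβ _)

end YMData

end CompatibleTwist

/-! ### Coordinate vector fields of a chart -/

section ChartFields

open scoped Topology
open VectorField

variable {E M : Type*} [NormedAddCommGroup E] [NormedSpace ℝ E] [TopologicalSpace M]
  [ChartedSpace E M] [IsManifold 𝓘(ℝ, E) ∞ M]

/-- A vector in the model space, as a constant vector field. -/
def constField (w : E) (y : E) : TangentSpace 𝓘(ℝ, E) y := w

/-- A vector in the model space, as a constant vector field in the chart `e`. -/
noncomputable def chartField (e : OpenPartialHomeomorph M E) (w : E) (x : M) :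
    TangentSpace 𝓘(ℝ, E) x :=
  mpullback 𝓘(ℝ, E) 𝓘(ℝ, E) e (constField w) x

variable {e : OpenPartialHomeomorph M E}

theorem mdifferentiable_of_mem (he : e ∈ atlas E M) : e.MDifferentiable 𝓘(ℝ, E) 𝓘(ℝ, E) :=
  have : IsManifold 𝓘(ℝ, E) 1 M :=
    IsManifold.of_le (n := ∞) (by exact_mod_cast (le_top : (1 : ℕ∞) ≤ ⊤))
  mdifferentiable_of_mem_atlas he

theorem contMDiffOn_of_mem (he : e ∈ atlas E M) : ContMDiffOn 𝓘(ℝ, E) 𝓘(ℝ, E) ∞ e e.source :=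
  contMDiffOn_of_mem_maximalAtlas (IsManifold.subset_maximalAtlas he)

theorem contMDiffOn_symm_of_mem (he : e ∈ atlas E M) :
    ContMDiffOn 𝓘(ℝ, E) 𝓘(ℝ, E) ∞ e.symm e.target :=
  contMDiffOn_symm_of_mem_maximalAtlas (IsManifold.subset_maximalAtlas he)

theorem mfderiv_isInvertible (he : e ∈ atlas E M) {x : M} (hx : x ∈ e.source) :
    (mfderiv 𝓘(ℝ, E) 𝓘(ℝ, E) e x).IsInvertible :=
  ⟨(mdifferentiable_of_mem he).mfderiv hx, rfl⟩

theorem chartField_apply (he : e ∈ atlas E M) {x : M} (hx : x ∈ e.source) (w : E) :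
    chartField e w x = mfderiv 𝓘(ℝ, E) 𝓘(ℝ, E) e.symm (e x) (constField w (e x)) := by
  rw [chartField, mpullback_apply]
  have : mfderiv 𝓘(ℝ, E) 𝓘(ℝ, E) e x =
    (((mdifferentiable_of_mem he).mfderiv hx : TangentSpace 𝓘(ℝ, E) x ≃L[ℝ] _) :
      TangentSpace 𝓘(ℝ, E) x →L[ℝ] _) := rfl
  rw [this, ContinuousLinearMap.inverse_equiv]
  rfl

theorem mvfderiv_chartField (he : e ∈ atlas E M) {x : M} (hx : x ∈ e.source) (w : E) :
    mvfderiv 𝓘(ℝ, E) e x (chartField e w x) = w := by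
  rw [chartField_apply he hx]
  exact ((mdifferentiable_of_mem he).mfderiv hx).apply_symm_apply w

theorem chartField_mvfderiv (he : e ∈ atlas E M) {x : M} (hx : x ∈ e.source)
    (v : TangentSpace 𝓘(ℝ, E) x) :
    chartField e (mvfderiv 𝓘(ℝ, E) e x v) x = v := by
  rw [chartField_apply he hx]
  exact ((mdifferentiable_of_mem he).mfderiv hx).symm_apply_apply v

theorem chartField_sum {ι : Type*} [Fintype ι] (he : e ∈ atlas E M) {x : M}
    (hx : x ∈ e.source) (c : ι → ℝ) (v : ι → E) :
    chartField e (∑ i, c i • v i) x = ∑ i, c i • chartField e (v i) x := by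
  simp only [chartField_apply he hx]
  let D : E →ₗ[ℝ] TangentSpace 𝓘(ℝ, E) (e.symm (e x)) :=
    (mfderiv 𝓘(ℝ, E) 𝓘(ℝ, E) e.symm (e x)).toLinearMap
  change D (∑ i, c i • v i) = ∑ i, c i • D (v i)
  simp only [map_sum, map_smul]

variable (E) in
/-- Evaluation of smooth functions at a point. -/
noncomputable def evalAt (x : M) : Fn E M →ₐ[ℝ] ℝ where
  toFun f := f x
  map_one' := rfl
  map_mul' _ _ := rfl
  map_zero' := rfl
  map_add' _ _ := rfl
  commutes' _ := rfl

theorem evalAt_apply (x : M) (f : Fn E M) : evalAt E x f = f x := rfl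

theorem VF.sum_apply {ι : Type*} [Fintype ι] (X : ι → VF E M) (x : M) : (∑ i, X i) x = ∑ i, X i x := by
  have h := map_sum (ContMDiffSection.coeAddHom 𝓘(ℝ, E) E ∞ (TangentSpace 𝓘(ℝ, E) : M → Type _))
    X Finset.univ
  exact (congrFun h x).trans (Finset.sum_apply x _ _)

variable [CompleteSpace E]

theorem contMDiffOn_chartField (he : e ∈ atlas E M) (w : E) :
    CMDiff[e.source] ∞ (T% (chartField e w)) := by
  intro x hx
  have : IsManifold 𝓘(ℝ, E) ((∞ : WithTop ℕ∞) + 1) M := by simpa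
  refine ContMDiffAt.contMDiffWithinAt (ContMDiffAt.mpullback_vectorField_preimage (n := ∞) ?_
    ((contMDiffOn_of_mem he).contMDiffAt (e.open_source.mem_nhds hx))
    (mfderiv_isInvertible he hx) (by simp))
  exact contMDiffAt_vectorSpace_iff_contDiffAt.mpr (contDiffAt_const (c := w))

/-- Pullback along the chart commutes with brackets, and constant fields on the model space commute.
-/
theorem mlieBracket_chartField (he : e ∈ atlas E M) {x : M} (hx : x ∈ e.source) (v w : E) :
    mlieBracket 𝓘(ℝ, E) (chartField e v) (chartField e w) x = 0 := by
  have : IsManifold 𝓘(ℝ, E) (minSmoothness ℝ 2) M := isManifold_minSmoothness E M 2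
  have : IsManifold 𝓘(ℝ, E) (minSmoothness ℝ 3) M := isManifold_minSmoothness E M 3
  have hc : ∀ u : E, MDiffAt (T% (constField u)) (e x) := fun u =>
    ((contMDiffAt_vectorSpace_iff_contDiffAt (n := 1)).mpr
      (contDiffAt_const (c := u))).mdifferentiableAt one_ne_zero
  have h := mpullback_mlieBracket (n := ∞) (I := 𝓘(ℝ, E)) (I' := 𝓘(ℝ, E)) (hc v) (hc w)
    ((contMDiffOn_of_mem he).contMDiffAt (e.open_source.mem_nhds hx))
    (by
      rw [minSmoothness_of_isRCLikeNormedField]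
      exact WithTop.coe_le_coe.mpr (le_top : (2 : ℕ∞) ≤ ⊤))
  rw [show mlieBracket 𝓘(ℝ, E) (chartField e v) (chartField e w) x = _ from h.symm]
  rw [mpullback_apply, ← mlieBracketWithin_univ, mlieBracketWithin_eq_lieBracketWithin]
  have : lieBracketWithin ℝ (constField v) (constField w) Set.univ (e x) = (0 : E) := by
    change fderivWithin ℝ (fun _ : E => w) Set.univ (e x) v
      - fderivWithin ℝ (fun _ : E => v) Set.univ (e x) w = 0
    simp
  exact (congrArg (ContinuousLinearMap.inverse (mfderiv 𝓘(ℝ, E) 𝓘(ℝ, E) e x)) this).trans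
    (map_zero _)

/-- The field `chartField e w` cut off by a function supported in the chart. -/
noncomputable def cutField (he : e ∈ atlas E M) (χ : Fn E M) (hχ : tsupport χ ⊆ e.source) (w : E) :
    VF E M :=
  ⟨(χ : M → ℝ) • chartField e w, ContMDiffOn.smul_section_of_tsupport χ.contMDiff.contMDiffOn
    e.open_source hχ (contMDiffOn_chartField he w)⟩

theorem cutField_apply (he : e ∈ atlas E M) (χ : Fn E M) (hχ : tsupport χ ⊆ e.source) (w : E)
    (x : M) : cutField he χ hχ w x = χ x • chartField e w x := rfl

theorem lie_cutField (he : e ∈ atlas E M) (χ : Fn E M) (hχ : tsupport χ ⊆ e.source) {x : M}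
    (hx : x ∈ e.source) (h1 : ∀ᶠ y in 𝓝 x, χ y = 1) (v w : E) :
    ⁅cutField he χ hχ v, cutField he χ hχ w⁆ x = 0 := by
  have h : ∀ u, (cutField he χ hχ u : ∀ y : M, TangentSpace 𝓘(ℝ, E) y) =ᶠ[𝓝 x] chartField e u := by
    intro u
    filter_upwards [h1] with y hy
    rw [cutField_apply, hy, one_smul]
  rw [VF.lie_apply, (h v).mlieBracket_vectorField_eq (h w), mlieBracket_chartField he hx]

theorem lie_cutField_fn (he : e ∈ atlas E M) (χ : Fn E M) (hχ : tsupport χ ⊆ e.source) {x : M}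
    (hx : x ∈ e.source) (w : E) (f : Fn E M) :
    ⁅cutField he χ hχ w, f⁆ x = χ x * fderiv ℝ (f ∘ e.symm) (e x) w := by
  rw [VF.lie_fn_apply, cutField_apply, map_smul, smul_eq_mul, chartField_apply he hx]
  congr 1
  have hf := f.mdifferentiableAt' (e.symm (e x))
  have hs := (mdifferentiable_of_mem he).mdifferentiableAt_symm (e.map_source hx)
  have h := mvfderiv_comp_apply (e x) hf hs (constField w (e x))
  rw [e.left_inv hx] at h
  refine h.symm.trans ?_
  change mfderiv 𝓘(ℝ, E) 𝓘(ℝ, ℝ) (f ∘ e.symm) (e x) (constField w (e x)) = _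
  rw [mfderiv_eq_fderiv]
  rfl

theorem VF.lie_fn_of_eventually_const (X : VF E M) {f : Fn E M} {x : M} {c : ℝ}
    (h : ∀ᶠ y in 𝓝 x, f y = c) : ⁅X, f⁆ x = 0 := by
  have : (f : M → ℝ) =ᶠ[𝓝 x] fun _ => c := h
  rw [VF.lie_fn_apply, mvfderiv, this.mfderiv_eq]
  rw [mfderiv_const]
  rfl

end ChartFields

/-! ### Cutoffs and vector fields vanishing at a point -/

section Cutoff

open scoped Topology

variable {E M : Type*} [NormedAddCommGroup E] [NormedSpace ℝ E] [FiniteDimensional ℝ E]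
  [TopologicalSpace M] [T2Space M] [SecondCountableTopology M]
  [ChartedSpace E M] [IsManifold 𝓘(ℝ, E) ∞ M]

theorem exists_cutoff {K U : Set M} (hK : IsClosed K) (hU : IsOpen U) (h : K ⊆ U) :
    ∃ χ : Fn E M, (∀ x ∈ K, ∀ᶠ y in 𝓝 x, χ y = 1) ∧ tsupport χ ⊆ U := by
  have : LocallyCompactSpace M := ChartedSpace.locallyCompactSpace E M
  obtain ⟨χ, h0, h1, -⟩ := exists_contMDiffMap_zero_one_nhds_of_isClosed (n := ⊤) 𝓘(ℝ, E)
    hU.isClosed_compl hK (Set.disjoint_left.mpr fun x hx hx' => hx (h hx'))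
  refine ⟨χ, fun x hx => h1.filter_mono (nhds_le_nhdsSet hx), fun x hx => ?_⟩
  by_contra hxU
  have := h0.filter_mono (nhds_le_nhdsSet (s := Uᶜ) hxU)
  exact (notMem_tsupport_iff_eventuallyEq.mpr this) hx

theorem exists_cutoff_point {x : M} {U : Set M} (hU : U ∈ 𝓝 x) :
    ∃ χ : Fn E M, (∀ᶠ y in 𝓝 x, χ y = 1) ∧ tsupport χ ⊆ U := by
  obtain ⟨V, hVU, hV, hx⟩ := mem_nhds_iff.mp hU
  obtain ⟨χ, h1, h2⟩ := exists_cutoff (E := E) (isClosed_singleton (x := x)) hV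
    (Set.singleton_subset_iff.mpr hx)
  exact ⟨χ, h1 x rfl, h2.trans hVU⟩

/-- A coordinate function of the chart `e`, cut off by a function supported in the chart. -/
noncomputable def cutCoord {e : OpenPartialHomeomorph M E} (he : e ∈ atlas E M) (χ : Fn E M)
    (hχ : tsupport χ ⊆ e.source) (φ : E →L[ℝ] ℝ) : Fn E M :=
  ⟨fun x => χ x * φ (e x), contMDiff_of_tsupport fun x hx => by
    have hx' : x ∈ e.source := hχ (closure_mono (Function.support_mul_subset_left _ _) hx)
    exact (χ.contMDiff x).mul (φ.contMDiff.contMDiffAt.comp x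
      ((contMDiffOn_of_mem he).contMDiffAt (e.open_source.mem_nhds hx')))⟩

theorem lie_cutCoord {e : OpenPartialHomeomorph M E} (he : e ∈ atlas E M) (χ : Fn E M)
    (hχ : tsupport χ ⊆ e.source) (φ : E →L[ℝ] ℝ) {x : M} (hx : x ∈ e.source)
    (h1 : ∀ᶠ y in 𝓝 x, χ y = 1) (X : VF E M) :
    ⁅X, cutCoord he χ hχ φ⁆ x = φ (mvfderiv 𝓘(ℝ, E) e x (X x)) := by
  have h : (cutCoord he χ hχ φ : M → ℝ) =ᶠ[𝓝 x] φ ∘ e := by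
    filter_upwards [h1] with y hy
    change χ y * φ (e y) = φ (e y)
    rw [hy, one_mul]
  rw [VF.lie_fn_apply]
  have h2 := mvfderiv_comp_apply x (φ.mdifferentiableAt (x := e x))
    ((mdifferentiable_of_mem he).mdifferentiableAt hx) (X x)
  refine Eq.trans ?_ (h2.trans ?_)
  · rw [mvfderiv, mvfderiv, h.mfderiv_eq]
    rfl
  · change mfderiv 𝓘(ℝ, E) 𝓘(ℝ, ℝ) φ (e x) _ = _
    rw [mfderiv_eq_fderiv, φ.fderiv]
    rfl

variable {ι : Type*} [Fintype ι]

/-- A vector field vanishing at a point is a combination of vector fields with coefficients that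
vanish there. -/
theorem mem_ker_smul_top (b : Module.Basis ι ℝ E) {x : M} {X : VF E M} (hX : X x = 0) :
    X ∈ RingHom.ker (evalAt E x) • (⊤ : Submodule (Fn E M) (VF E M)) := by
  have hx := mem_chart_source E x
  have he := chart_mem_atlas E x
  obtain ⟨χ, h1, h2⟩ := exists_cutoff_point (E := E) ((chartAt E x).open_source.mem_nhds hx)
  -- Two nested cutoffs: on the support of ψ the function χ is locally 1, so the coefficients of X
  -- there are derivatives of globally defined coordinate functions.
  obtain ⟨ψ, h3, h4⟩ := exists_cutoff_point (E := E)
    (Filter.inter_mem (eventually_mem_nhds_iff.mpr h1) ((chartAt E x).open_source.mem_nhds hx))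
  have hψ : tsupport ψ ⊆ (chartAt E x).source := fun y hy => (h4 hy).2
  let f : ι → Fn E M := fun i => ⁅X, cutCoord he χ h2 (b.coord i).toContinuousLinearMap⁆
  -- Each coefficient vanishes at x: the first since ψ = 1 there, the others since X does.
  have hd : X = (1 - ψ) • X + ∑ i, f i • cutField he ψ hψ (b i) := by
    have : ψ • X = ∑ i, f i • cutField he ψ hψ (b i) := by
      ext y
      by_cases hy : y ∈ tsupport ψ
      · obtain ⟨hy1, hy2⟩ := h4 hy
        have hs : (∑ i, f i • cutField he ψ hψ (b i)) y
            = ∑ i, b.repr (mvfderiv 𝓘(ℝ, E) (chartAt E x) y (X y)) i •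
              ψ y • chartField (chartAt E x) (b i) y := by
          rw [VF.sum_apply]
          refine Finset.sum_congr rfl fun i _ => ?_
          rw [VF.smul_apply, cutField_apply]
          congr 1
          exact lie_cutCoord he χ h2 _ hy2 hy1 X
        rw [hs, VF.smul_apply]
        conv_lhs => rw [← chartField_mvfderiv he hy2 (X y)]
        conv_lhs => rw [← b.sum_repr (mvfderiv 𝓘(ℝ, E) (chartAt E x) y (X y))]
        rw [chartField_sum he hy2, Finset.smul_sum]
        exact Finset.sum_congr rfl fun i _ => smul_comm _ _ _
      · have h0 : ψ y = 0 := image_eq_zero_of_notMem_tsupport hy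
        rw [VF.sum_apply, VF.smul_apply, h0, zero_smul]
        symm
        refine Finset.sum_eq_zero fun i _ => ?_
        rw [VF.smul_apply, cutField_apply, h0, zero_smul, smul_zero]
    rw [← this, sub_smul, one_smul, sub_add_cancel]
  rw [hd]
  refine Submodule.add_mem _ (Submodule.smul_mem_smul ?_ trivial)
    (Submodule.sum_mem _ fun i _ => Submodule.smul_mem_smul ?_ trivial)
  · rw [RingHom.mem_ker]
    change 1 - ψ x = 0
    rw [h3.self_of_nhds, sub_self]
  · rw [RingHom.mem_ker]
    change mvfderiv 𝓘(ℝ, E) (cutCoord he χ h2 _) x (X x) = 0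
    rw [hX, map_zero]

end Cutoff

/-! ### Frames and the volume form of a Lorentzian metric -/

section LorentzFrames

open scoped Topology
open MeasureTheory

variable {n : ℕ} {M : Type*} [TopologicalSpace M] [ChartedSpace (Mdl n) M]
  [IsManifold 𝓘(ℝ, Mdl n) ∞ M] {g : LorentzMetric n M}
  {e : OpenPartialHomeomorph M (Mdl n)}

/-- The coordinate frame of a chart, cut off by a function supported in the chart. -/
noncomputable def cutFrame (he : e ∈ atlas (Mdl n) M) (χ : Fn (Mdl n) M)
    (hχ : tsupport χ ⊆ e.source) (i : Fin (n + 2)) : VF (Mdl n) M :=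
  cutField he χ hχ (EuclideanSpace.single i 1 : Mdl n)

theorem cutFrame_apply (he : e ∈ atlas (Mdl n) M) (χ : Fn (Mdl n) M)
    (hχ : tsupport χ ⊆ e.source) {x : M} (h1 : χ x = 1) (i : Fin (n + 2)) :
    cutFrame he χ hχ i x = chartField e (EuclideanSpace.single i 1 : Mdl n) x := by
  rw [cutFrame, cutField_apply, h1, one_smul]

theorem LorentzMetric.onFields_apply (X Y : VF (Mdl n) M) (x : M) :
    g.onFields X Y x = g.g x (X x) (Y x) := rfl

/-- Nondegeneracy from the signature: v is orthogonal to a timelike t, hence spacelike unless zero,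
yet also orthogonal to itself. -/
theorem LorentzMetric.eq_zero_of_forall (x : M) {v : TangentSpace 𝓘(ℝ, Mdl n) x}
    (h : ∀ w, g.g x w v = 0) : v = 0 := by
  by_contra hv
  obtain ⟨t, -, ht⟩ := g.lorentzian x
  exact (ht v (h t) hv).ne' (h v)

theorem evalAt_det (A : Matrix (Fin (n + 2)) (Fin (n + 2)) (Fn (Mdl n) M)) (x : M) :
    A.det x = (A.map fun f => f x).det :=
  (evalAt (Mdl n) x).map_det A

theorem gram_det_ne (he : e ∈ atlas (Mdl n) M) {x : M} (hx : x ∈ e.source) :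
    (Matrix.of fun i j : Fin (n + 2) => g.g x
      (chartField e (EuclideanSpace.single i 1 : Mdl n) x)
      (chartField e (EuclideanSpace.single j 1 : Mdl n) x)).det ≠ 0 := by
  intro h0
  obtain ⟨c, hc, h⟩ := Matrix.exists_mulVec_eq_zero_iff.mpr h0
  have hv : ∑ j, c j • chartField e (EuclideanSpace.single j 1 : Mdl n) x = 0 := by
    refine g.eq_zero_of_forall x fun w => ?_
    rw [← chartField_mvfderiv he hx w,
      ← (EuclideanSpace.basisFun (Fin (n + 2)) ℝ).toBasis.sum_repr (mvfderiv 𝓘(ℝ, Mdl n) e x w),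
      chartField_sum he hx, map_sum (g.g x), LinearMap.sum_apply]
    refine Finset.sum_eq_zero fun i _ => ?_
    have hi := congrFun h i
    simp only [Matrix.mulVec, dotProduct, Matrix.of_apply, Pi.zero_apply] at hi
    simp only [map_smul, LinearMap.smul_apply, map_sum, smul_eq_mul,
      OrthonormalBasis.coe_toBasis, EuclideanSpace.basisFun_apply]
    simp only [mul_comm (c _)]
    simp only [mul_assoc]
    rw [← Finset.mul_sum, hi, mul_zero]
  rw [← chartField_sum he hx] at hv
  have h3 := mvfderiv_chartField he hx (∑ j, c j • (EuclideanSpace.single j 1 : Mdl n))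
  rw [hv, map_zero] at h3
  refine hc (funext fun i => ?_)
  have h4 := congrArg (fun v : Mdl n => v i) h3
  simpa [Finset.sum_apply, Pi.single_apply] using h4.symm

variable [T2Space M] [SecondCountableTopology M]

theorem isFrameAt_cutFrame (g : LorentzMetric n M) (he : e ∈ atlas (Mdl n) M) (χ : Fn (Mdl n) M)
    (hχ : tsupport χ ⊆ e.source) {x : M} (hx : x ∈ e.source) (h1 : χ x = 1) :
    IsFrameAt g.onFields (evalAt (Mdl n) x) (cutFrame he χ hχ) where
  span X := by
    refine ⟨fun i => mvfderiv 𝓘(ℝ, Mdl n) e x (X x) i,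
      mem_ker_smul_top (EuclideanSpace.basisFun (Fin (n + 2)) ℝ).toBasis ?_⟩
    have h := chartField_mvfderiv he hx (X x)
    rw [← (EuclideanSpace.basisFun (Fin (n + 2)) ℝ).toBasis.sum_repr (mvfderiv 𝓘(ℝ, Mdl n) e x (X x)),
      chartField_sum he hx] at h
    change X x - (∑ i, mvfderiv 𝓘(ℝ, Mdl n) e x (X x) i • cutFrame he χ hχ i) x = 0
    rw [VF.sum_apply, sub_eq_zero]
    refine h.symm.trans (Finset.sum_congr rfl fun i _ => ?_)
    change _ = mvfderiv 𝓘(ℝ, Mdl n) e x (X x) i • cutFrame he χ hχ i x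
    rw [cutFrame_apply he χ hχ h1]
    simp
  det_ne := by
    rw [evalAt_apply, evalAt_det]
    convert gram_det_ne (g := g) he hx using 2
    ext i j
    simp only [Matrix.map_apply, Matrix.of_apply, LorentzMetric.onFields_apply,
      cutFrame_apply he χ hχ h1]

theorem exists_frame (g : LorentzMetric n M) (x : M) :
    ∃ E : Fin (n + 2) → VF (Mdl n) M, IsFrameAt g.onFields (evalAt (Mdl n) x) E := by
  obtain ⟨χ, h1, h2⟩ := exists_cutoff_point (E := Mdl n)
    ((chartAt (Mdl n) x).open_source.mem_nhds (mem_chart_source _ x))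
  exact ⟨_, isFrameAt_cutFrame g (chart_mem_atlas _ x) χ h2 (mem_chart_source _ x)
    h1.self_of_nhds⟩

theorem hasFrames (g : LorentzMetric n M) : HasFrames g.onFields (n + 2) := by
  intro a h
  ext x
  obtain ⟨E, hE⟩ := exists_frame g x
  exact h _ _ hE

theorem isVolume (v : g.VolumeForm) : IsVolume g.onFields v.coeff v.vol where
  symm X Y := by
    ext x
    exact g.symm x _ _
  coeff_smul f := by
    exact (LinearEquiv.ofBijective (LinearMap.toSpanSingleton (Fn (Mdl n) M) _ v.vol)
      v.generates).symm_apply_apply f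
  smul_coeff ψ := by
    exact (LinearEquiv.ofBijective (LinearMap.toSpanSingleton (Fn (Mdl n) M) _ v.vol)
      v.generates).apply_symm_apply ψ
  normalized := v.normalized

/-- The normalisation of vol identifies it with √|det g| up to sign; the sign depends on whether the
chart is oriented. -/
theorem abs_vol_cutFrame (v : g.VolumeForm) (he : e ∈ atlas (Mdl n) M) (χ : Fn (Mdl n) M)
    (hχ : tsupport χ ⊆ e.source) {x : M} (hx : x ∈ e.source) (h1 : χ x = 1) :
    |v.vol (cutFrame he χ hχ) x| = g.chartDensity e (e x) := by
  have h := congrArg (fun f : Fn (Mdl n) M => f x) (v.normalized (cutFrame he χ hχ))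
  change v.vol (cutFrame he χ hχ) x ^ 2 = - (Matrix.det (Matrix.of fun i j =>
    g.onFields (cutFrame he χ hχ i) (cutFrame he χ hχ j)) x) at h
  rw [evalAt_det] at h
  rw [LorentzMetric.chartDensity, ← Real.sqrt_sq_eq_abs, ← abs_sq, h, abs_neg]
  congr 4
  ext i j
  simp only [Matrix.map_apply, Matrix.of_apply, LorentzMetric.onFields_apply,
    cutFrame_apply he χ hχ h1, chartField_apply he hx]
  rw [e.left_inv hx]
  rfl

theorem vol_cutFrame_ne (v : g.VolumeForm) (he : e ∈ atlas (Mdl n) M) (χ : Fn (Mdl n) M)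
    (hχ : tsupport χ ⊆ e.source) {x : M} (hx : x ∈ e.source) (h1 : χ x = 1) :
    v.vol (cutFrame he χ hχ) x ≠ 0 :=
  (isVolume v).ev_vol_ne (isFrameAt_cutFrame g he χ hχ hx h1)

end LorentzFrames

/-! ### Locality of operators on forms -/

section Supports

open scoped Topology

variable {n : ℕ} {M : Type*} [TopologicalSpace M] [ChartedSpace (Mdl n) M]
  [IsManifold 𝓘(ℝ, Mdl n) ∞ M]

/-- The form `ψ` vanishes outside `K`. -/
def VanishesOff (K : Set M) {k : ℕ} (ψ : VF (Mdl n) M [⋀^Fin k]→ₗ[Fn (Mdl n) M] Fn (Mdl n) M) :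
    Prop :=
  ∀ X, ∀ x ∉ K, ψ X x = 0

theorem VF.lie_fn_eq_zero_of_notMem {K : Set M} (hK : IsClosed K) {f : Fn (Mdl n) M}
    (hf : ∀ x ∉ K, f x = 0) (X : VF (Mdl n) M) {x : M} (hx : x ∉ K) : ⁅X, f⁆ x = 0 :=
  X.lie_fn_of_eventually_const ((hK.isOpen_compl.eventually_mem hx).mono hf)

theorem VanishesOff.lie {K : Set M} (hK : IsClosed K) {k : ℕ}
    {ψ : VF (Mdl n) M [⋀^Fin k]→ₗ[Fn (Mdl n) M] Fn (Mdl n) M} (h : VanishesOff K ψ)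
    (ξ : VF (Mdl n) M) : VanishesOff K ⁅ξ, ψ⁆ := by
  intro X x hx
  rw [← evalAt_apply, form_lie_apply, map_sub, map_sum, evalAt_apply,
    VF.lie_fn_eq_zero_of_notMem hK (h X) ξ hx, zero_sub, neg_eq_zero]
  exact Finset.sum_eq_zero fun i _ => h _ x hx

theorem VanishesOff.extDer {K : Set M} (hK : IsClosed K) : ∀ {k : ℕ}
    {ψ : VF (Mdl n) M [⋀^Fin k]→ₗ[Fn (Mdl n) M] Fn (Mdl n) M} (_ : VanishesOff K ψ),
    VanishesOff K (extDer k ψ)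
  | 0, ψ, h => fun X x hx => by
    rw [extDer_zero_apply]
    exact VF.lie_fn_eq_zero_of_notMem hK (h _) _ hx
  | k + 1, ψ, h => fun X x hx => by
    have h1 : _root_.extDer (k + 1) ψ X =
        (_root_.extDer (k + 1) ψ).curryLeft (X 0) (Fin.tail X) := by
      rw [AlternatingMap.curryLeft_apply_apply]
      exact congrArg _ (Fin.cons_self_tail X).symm
    rw [h1, extDer_succ_curryLeft, AlternatingMap.sub_apply]
    have h2 : VanishesOff K (ψ.curryLeft (X 0)) := fun Y y hy => h _ y hy
    have h3 := h2.extDer hK (Fin.tail X) x hx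
    have h4 := h.lie hK (X 0) (Fin.tail X) x hx
    rw [← evalAt_apply, map_sub, evalAt_apply, evalAt_apply, h3, h4, sub_zero]

variable [T2Space M] [SecondCountableTopology M]

/-- A cutoff supported off K kills ψ while being 1 at x, so any map linear over functions sends ψ to
something vanishing at x. -/
theorem VanishesOff.exists_smul_eq_zero {K : Set M} (hK : IsClosed K) {k : ℕ}
    {ψ : VF (Mdl n) M [⋀^Fin k]→ₗ[Fn (Mdl n) M] Fn (Mdl n) M} (h : VanishesOff K ψ) {x : M}
    (hx : x ∉ K) : ∃ χ : Fn (Mdl n) M, χ x = 1 ∧ χ • ψ = 0 := by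
  obtain ⟨χ, h1, h2⟩ := exists_cutoff_point (E := Mdl n) (hK.isOpen_compl.mem_nhds hx)
  refine ⟨χ, h1.self_of_nhds, ?_⟩
  ext X y
  change χ y * ψ X y = 0
  by_cases hy : y ∈ K
  · rw [image_eq_zero_of_notMem_tsupport fun hy' => h2 hy' hy, zero_mul]
  · rw [h X y hy, mul_zero]

theorem VanishesOff.map {K : Set M} (hK : IsClosed K) {k l : ℕ}
    {ψ : VF (Mdl n) M [⋀^Fin k]→ₗ[Fn (Mdl n) M] Fn (Mdl n) M} (h : VanishesOff K ψ)
    (T : (VF (Mdl n) M [⋀^Fin k]→ₗ[Fn (Mdl n) M] Fn (Mdl n) M) →ₗ[Fn (Mdl n) M]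
      (VF (Mdl n) M [⋀^Fin l]→ₗ[Fn (Mdl n) M] Fn (Mdl n) M)) : VanishesOff K (T ψ) := by
  intro X x hx
  obtain ⟨χ, h1, h2⟩ := h.exists_smul_eq_zero hK hx
  have h3 : χ x * T ψ X x = 0 := by
    change (χ • T ψ) X x = 0
    rw [← map_smul, h2, map_zero]
    rfl
  rwa [h1, one_mul] at h3

theorem VanishesOff.map_fn {K : Set M} (hK : IsClosed K) {k : ℕ}
    {ψ : VF (Mdl n) M [⋀^Fin k]→ₗ[Fn (Mdl n) M] Fn (Mdl n) M} (h : VanishesOff K ψ)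
    (T : (VF (Mdl n) M [⋀^Fin k]→ₗ[Fn (Mdl n) M] Fn (Mdl n) M) →ₗ[Fn (Mdl n) M] Fn (Mdl n) M)
    {x : M} (hx : x ∉ K) : T ψ x = 0 := by
  obtain ⟨χ, h1, h2⟩ := h.exists_smul_eq_zero hK hx
  have h3 : χ x * T ψ x = 0 := by
    change (χ • T ψ) x = 0
    rw [← map_smul, h2, map_zero]
    rfl
  rwa [h1, one_mul] at h3

theorem isSupport_cptForms : IsSupport (cptForms n M) where
  lie_mem ξ _ := fun ⟨K, hK, h⟩ => ⟨K, hK, VanishesOff.lie hK.isClosed h ξ⟩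
  extDer_mem := fun ⟨K, hK, h⟩ => ⟨K, hK, VanishesOff.extDer hK.isClosed h⟩
  wedge_left_mem hkl _ η := fun ⟨K, hK, h⟩ =>
    ⟨K, hK, VanishesOff.map hK.isClosed h ((wedge hkl).flip η)⟩
  wedge_right_mem hkl ψ _ := fun ⟨K, hK, h⟩ => ⟨K, hK, VanishesOff.map hK.isClosed h (wedge hkl ψ)⟩

theorem hodgeLocal_cptForms {𝔤 : Type*} [LieRing 𝔤] [LieAlgebra ℝ 𝔤]
    (Y : YMData (Fn (Mdl n) M) (VF (Mdl n) M) 𝔤 n) : Y.HodgeLocal (cptForms n M) :=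
  fun _ ⟨K, hK, h⟩ => ⟨K, hK, VanishesOff.map hK.isClosed h
    { toFun := hodge Y.metric Y.coeff (show 2 + n = n + 2 by omega)
      map_add' := map_add _
      map_smul' := hodge_smul _ _ }⟩

end Supports

/-! ### Gluing the chart measures -/

section ChartMeasure

open scoped Topology
open MeasureTheory

variable {n : ℕ} {M : Type*} [TopologicalSpace M] [ChartedSpace (Mdl n) M]
  [IsManifold 𝓘(ℝ, Mdl n) ∞ M] {g : LorentzMetric n M}
  {e e' : OpenPartialHomeomorph M (Mdl n)}

theorem chartDensity_eq (g : LorentzMetric n M) (he : e ∈ atlas (Mdl n) M) {x : M}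
    (hx : x ∈ e.source) :
    g.chartDensity e (e x) = Real.sqrt |(Matrix.of fun i j : Fin (n + 2) => g.g x
      (chartField e (EuclideanSpace.single i 1 : Mdl n) x)
      (chartField e (EuclideanSpace.single j 1 : Mdl n) x)).det| := by
  rw [LorentzMetric.chartDensity]
  congr 4
  ext i j
  simp only [chartField_apply he hx]
  rw [e.left_inv hx]
  rfl

theorem mvfderiv_chartField_transition (he : e ∈ atlas (Mdl n) M) (he' : e' ∈ atlas (Mdl n) M)
    {x : M} (hx : x ∈ e.source) (hx' : x ∈ e'.source) (v : Mdl n) :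
    mvfderiv 𝓘(ℝ, Mdl n) e' x (chartField e v x) = fderiv ℝ (e' ∘ e.symm) (e x) v := by
  rw [chartField_apply he hx]
  have hs := (mdifferentiable_of_mem he).mdifferentiableAt_symm (e.map_source hx)
  have hx2 : e.symm (e x) ∈ e'.source := by rwa [e.left_inv hx]
  have h := mfderiv_comp_apply (e x) ((mdifferentiable_of_mem he').mdifferentiableAt hx2) hs
    (constField v (e x))
  rw [e.left_inv hx] at h
  refine h.symm.trans ?_
  change mfderiv 𝓘(ℝ, Mdl n) 𝓘(ℝ, Mdl n) (e' ∘ e.symm) (e x) (constField v (e x)) = _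
  rw [mfderiv_eq_fderiv]
  rfl

/-- The Gram matrices satisfy G = Jᵀ G' J for the Jacobian J of the transition map, and the square
root turns (det J)² into |det J|. -/
theorem chartDensity_transition (g : LorentzMetric n M) (he : e ∈ atlas (Mdl n) M)
    (he' : e' ∈ atlas (Mdl n) M) {x : M} (hx : x ∈ e.source) (hx' : x ∈ e'.source) :
    g.chartDensity e (e x) =
      |(fderiv ℝ (e' ∘ e.symm) (e x)).det| * g.chartDensity e' (e' x) := by
  set D := fderiv ℝ (e' ∘ e.symm) (e x) with hD
  let b := (EuclideanSpace.basisFun (Fin (n + 2)) ℝ).toBasis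
  have hb : ∀ i, b i = (EuclideanSpace.single i 1 : Mdl n) := fun i => by simp [b]
  let J := LinearMap.toMatrix b b D.toLinearMap
  have hJ : J.det = D.det := LinearMap.det_toMatrix b D.toLinearMap
  have hfield : ∀ i, chartField e (EuclideanSpace.single i 1 : Mdl n) x =
      ∑ k, J k i • chartField e' (EuclideanSpace.single k 1 : Mdl n) x := by
    intro i
    rw [← chartField_sum he' hx', ← chartField_mvfderiv he' hx' (chartField e _ x),
      mvfderiv_chartField_transition he he' hx hx', ← hD]
    congr 1
    rw [← hb, ← b.sum_repr (D (b i))]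
    refine Finset.sum_congr rfl fun k _ => ?_
    rw [hb k]
    congr 1
    exact (LinearMap.toMatrix_apply b b D.toLinearMap k i).symm
  have hG : (Matrix.of fun i j : Fin (n + 2) => g.g x
        (chartField e (EuclideanSpace.single i 1 : Mdl n) x)
        (chartField e (EuclideanSpace.single j 1 : Mdl n) x)) =
      J.transpose * (Matrix.of fun i j : Fin (n + 2) => g.g x
        (chartField e' (EuclideanSpace.single i 1 : Mdl n) x)
        (chartField e' (EuclideanSpace.single j 1 : Mdl n) x)) * J := by
    ext i j
    simp only [Matrix.of_apply, Matrix.mul_apply, Matrix.transpose_apply, hfield, map_sum,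
      LinearMap.sum_apply, map_smul, LinearMap.smul_apply, smul_eq_mul, Finset.sum_mul,
      Finset.mul_sum]
    refine Finset.sum_congr rfl fun k _ => Finset.sum_congr rfl fun l _ => by ring
  rw [chartDensity_eq g he hx, chartDensity_eq g he' hx', hG, Matrix.det_mul, Matrix.det_mul,
    Matrix.det_transpose, hJ, mul_right_comm, abs_mul, abs_mul_self, Real.sqrt_mul
    (mul_self_nonneg _), Real.sqrt_mul_self_eq_abs]

variable [MeasurableSpace M]

/-- The volume measure of the chart `e`. -/
noncomputable def chartMeasure (g : LorentzMetric n M) (e : OpenPartialHomeomorph M (Mdl n)) :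
    Measure M :=
  Measure.map e.symm
    ((volume.restrict e.target).withDensity fun y => ENNReal.ofReal (g.chartDensity e y))

theorem LorentzMetric.measure_eq (g : LorentzMetric n M) :
    g.measure = ⨆ e ∈ atlas (Mdl n) M, chartMeasure g e := rfl

variable [BorelSpace M]

theorem measurableSet_target_inter_preimage (e : OpenPartialHomeomorph M (Mdl n)) {S : Set M}
    (hS : MeasurableSet S) : MeasurableSet (e.target ∩ e.symm ⁻¹' S) := by
  have h1 : Measurable (e.target.domRestrict e.symm) :=
    (continuousOn_iff_continuous_domRestrict.mp e.continuousOn_symm).measurable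
  have h2 := e.open_target.measurableSet.subtype_image (h1 hS)
  rwa [Set.domRestrict_eq, Set.preimage_comp, Subtype.image_preimage_coe] at h2

theorem aemeasurable_symm (g : LorentzMetric n M) (e : OpenPartialHomeomorph M (Mdl n)) :
    AEMeasurable e.symm
      ((volume.restrict e.target).withDensity fun y => ENNReal.ofReal (g.chartDensity e y)) :=
  (e.continuousOn_symm.aemeasurable e.open_target.measurableSet).mono_ac
    (withDensity_absolutelyContinuous _ _)

theorem chartMeasure_apply (g : LorentzMetric n M) (e : OpenPartialHomeomorph M (Mdl n)) {S : Set M}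
    (hS : MeasurableSet S) : chartMeasure g e S =
      ∫⁻ y in e.target ∩ e.symm ⁻¹' S, ENNReal.ofReal (g.chartDensity e y) := by
  rw [chartMeasure, Measure.map_apply_of_aemeasurable (aemeasurable_symm g e) hS,
    ← restrict_withDensity e.open_target.measurableSet,
    Measure.restrict_apply' e.open_target.measurableSet, Set.inter_comm,
    withDensity_apply _ (measurableSet_target_inter_preimage e hS)]

theorem chartMeasure_compl_source (g : LorentzMetric n M) (e : OpenPartialHomeomorph M (Mdl n)) :
    chartMeasure g e e.sourceᶜ = 0 := by
  rw [chartMeasure_apply g e e.open_source.measurableSet.compl]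
  have : e.target ∩ e.symm ⁻¹' e.sourceᶜ = ∅ := by
    ext y
    simp only [Set.mem_inter_iff, Set.mem_preimage, Set.mem_compl_iff, Set.mem_empty_iff_false,
      iff_false, not_and, not_not]
    exact fun hy => e.map_target hy
  rw [this, Measure.restrict_empty, lintegral_zero_measure]

theorem chartMeasure_restrict_source (g : LorentzMetric n M)
    (e : OpenPartialHomeomorph M (Mdl n)) :
    (chartMeasure g e).restrict e.source = chartMeasure g e :=
  Measure.restrict_eq_self_of_ae_mem (chartMeasure_compl_source g e)

/-- Change of variables along the transition map; its Jacobian factor is the ratio of the two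
densities. -/
theorem chartMeasure_eq_of_subset (g : LorentzMetric n M) (he : e ∈ atlas (Mdl n) M)
    (he' : e' ∈ atlas (Mdl n) M) {S : Set M} (hS : MeasurableSet S) (h : S ⊆ e.source)
    (h' : S ⊆ e'.source) : chartMeasure g e S = chartMeasure g e' S := by
  rw [chartMeasure_apply g e hS, chartMeasure_apply g e' hS]
  have him : e'.target ∩ e'.symm ⁻¹' S = (e' ∘ e.symm) '' (e.target ∩ e.symm ⁻¹' S) := by
    ext y
    constructor
    · rintro ⟨hy, hy'⟩
      refine ⟨e (e'.symm y), ⟨e.map_source (h hy'), ?_⟩, ?_⟩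
      · rwa [Set.mem_preimage, e.left_inv (h hy')]
      · rw [Function.comp_apply, e.left_inv (h hy'), e'.right_inv hy]
    · rintro ⟨z, ⟨hz, hz'⟩, rfl⟩
      refine ⟨e'.map_source (h' hz'), ?_⟩
      rwa [Set.mem_preimage, Function.comp_apply, e'.left_inv (h' hz')]
  rw [him, lintegral_image_eq_lintegral_abs_det_fderiv_mul volume
    (measurableSet_target_inter_preimage e hS) (f' := fun y => fderiv ℝ (e' ∘ e.symm) y)]
  · refine setLIntegral_congr_fun (measurableSet_target_inter_preimage e hS) ?_
    rintro y ⟨hy, hy'⟩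
    have := chartDensity_transition g he he' (h hy') (h' hy')
    rw [e.right_inv hy] at this
    simp only [Function.comp_apply]
    rw [this, ENNReal.ofReal_mul (abs_nonneg _)]
  · rintro y ⟨hy, hy'⟩
    refine DifferentiableAt.hasFDerivAt ?_ |>.hasFDerivWithinAt
    rw [← mdifferentiableAt_iff_differentiableAt]
    exact MDifferentiableAt.comp y ((mdifferentiable_of_mem he').mdifferentiableAt (h' hy'))
      ((mdifferentiable_of_mem he).mdifferentiableAt_symm hy)
  · rintro y ⟨hy, hy'⟩ z ⟨hz, hz'⟩ hyz
    exact e.symm.injOn hy hz (e'.injOn (h' hy') (h' hz') hyz)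

theorem chartMeasure_restrict_comm (g : LorentzMetric n M) (he : e ∈ atlas (Mdl n) M)
    (he' : e' ∈ atlas (Mdl n) M) {D : Set M} (hD : MeasurableSet D) (h : D ⊆ e'.source) :
    (chartMeasure g e').restrict (D ∩ e.source) = (chartMeasure g e).restrict D := by
  rw [← chartMeasure_restrict_source g e, Measure.restrict_restrict hD]
  ext S hS
  rw [Measure.restrict_apply hS, Measure.restrict_apply hS]
  exact (chartMeasure_eq_of_subset g he he'
    (hS.inter (hD.inter e.open_source.measurableSet)) (fun x hx => hx.2.2)
    (fun x hx => h hx.2.1)).symm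

variable [SecondCountableTopology M]

/-- The volume measure is given by the chart density in every chart. -/
theorem LorentzMetric.measure_restrict_source (g : LorentzMetric n M)
    (he : e ∈ atlas (Mdl n) M) : g.measure.restrict e.source = chartMeasure g e := by
  rcases isEmpty_or_nonempty M with hM | hM
  · exact Subsingleton.elim _ _
  obtain ⟨s, hs, hcov⟩ := TopologicalSpace.countable_cover_nhds
    (fun x : M => (chartAt (Mdl n) x).open_source.mem_nhds (mem_chart_source (Mdl n) x))
  have hne : s.Nonempty := by
    by_contra h
    rw [Set.not_nonempty_iff_eq_empty.mp h, Set.biUnion_empty] at hcov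
    exact Set.empty_ne_univ hcov
  obtain ⟨f, rfl⟩ := hs.exists_eq_range hne
  rw [Set.biUnion_range] at hcov
  let U : ℕ → Set M := fun k => (chartAt (Mdl n) (f k)).source
  have hD : ∀ k, MeasurableSet (disjointed U k) := fun k =>
    MeasurableSet.disjointed (fun i => (chartAt (Mdl n) (f i)).open_source.measurableSet) k
  -- A measure glued from disjoint pieces of a countable chart cover. It restricts to every chart
  -- measure, hence dominates the supremum.
  let ν : Measure M :=
    Measure.sum fun k => (chartMeasure g (chartAt (Mdl n) (f k))).restrict (disjointed U k)
  have hν : ∀ e ∈ atlas (Mdl n) M, ν.restrict e.source = chartMeasure g e := by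
    intro e he
    rw [Measure.restrict_sum _ e.open_source.measurableSet]
    conv_rhs => rw [← Measure.restrict_univ (μ := chartMeasure g e), ← hcov,
      show (⋃ k, (chartAt (Mdl n) (f k)).source) = ⋃ k, disjointed U k from iUnion_disjointed.symm,
      Measure.restrict_iUnion (disjoint_disjointed U) hD]
    congr 1
    funext k
    rw [Measure.restrict_restrict e.open_source.measurableSet, Set.inter_comm,
      chartMeasure_restrict_comm g he (chart_mem_atlas _ _) (hD k) (disjointed_subset U k)]
  have hle : g.measure ≤ ν := by
    rw [g.measure_eq]
    exact iSup₂_le fun e he => (hν e he).symm.le.trans Measure.restrict_le_self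
  refine le_antisymm ((Measure.restrict_mono le_rfl hle).trans (hν e he).le) ?_
  -- The converse inequality: the measure of e is itself a member of the supremum.
  have h := Measure.restrict_mono (s := e.source) le_rfl
    (show chartMeasure g e ≤ g.measure from le_iSup₂ (f := fun e _ => chartMeasure g e) e he)
  rwa [chartMeasure_restrict_source] at h

end ChartMeasure

/-! ### Integration in a chart -/

section VolumeIntegral

open scoped Topology
open MeasureTheory

variable {n : ℕ} {M : Type*} [TopologicalSpace M] [T2Space M] [SecondCountableTopology M]
  [ChartedSpace (Mdl n) M] [IsManifold 𝓘(ℝ, Mdl n) ∞ M] {g : LorentzMetric n M}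
  {e : OpenPartialHomeomorph M (Mdl n)}

theorem continuousOn_chartDensity (v : g.VolumeForm) (he : e ∈ atlas (Mdl n) M) :
    ContinuousOn (fun x => g.chartDensity e (e x)) e.source := by
  intro x hx
  obtain ⟨χ, h1, h2⟩ := exists_cutoff_point (E := Mdl n) (e.open_source.mem_nhds hx)
  refine ContinuousAt.continuousWithinAt ?_
  refine ContinuousAt.congr (f := fun y => |v.vol (cutFrame he χ h2) y|)
    (v.vol (cutFrame he χ h2)).contMDiff.continuous.abs.continuousAt ?_
  filter_upwards [h1, e.open_source.mem_nhds hx] with y hy hy'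
  exact abs_vol_cutFrame v he χ h2 hy' hy

variable [MeasurableSpace M] [BorelSpace M]

/-- Near a point the measure has a continuous density in a chart, which is bounded on a compact
neighbourhood. -/
theorem isFiniteMeasureOnCompacts_measure (v : g.VolumeForm) :
    IsFiniteMeasureOnCompacts g.measure := by
  have : LocallyCompactSpace M := ChartedSpace.locallyCompactSpace (Mdl n) M
  suffices IsLocallyFiniteMeasure g.measure from inferInstance
  refine ⟨fun x => ?_⟩
  have he := chart_mem_atlas (Mdl n) x
  obtain ⟨K, hKx, hK, hKc⟩ := local_compact_nhds ((chartAt (Mdl n) x).open_source.mem_nhds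
    (mem_chart_source (Mdl n) x))
  set e := chartAt (Mdl n) x
  refine ⟨K, hKx, ?_⟩
  rw [← Measure.restrict_eq_self g.measure hK, g.measure_restrict_source he,
    chartMeasure_apply g e hKc.measurableSet]
  have him : e.target ∩ e.symm ⁻¹' K = e '' K := by
    rw [e.image_eq_target_inter_inv_preimage hK]
  rw [him]
  refine setLIntegral_lt_top_of_le_nnreal
    (hKc.image_of_continuousOn (e.continuousOn.mono hK)).measure_lt_top.ne ?_
  obtain ⟨C, hC⟩ := (hKc.image_of_continuousOn
    ((continuousOn_chartDensity v he).mono hK)).bddAbove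
  refine ⟨C.toNNReal, ?_⟩
  rintro _ ⟨y, hy, rfl⟩
  exact ENNReal.ofReal_le_ofReal (hC ⟨y, hy, rfl⟩)

theorem integral_eq_chart_integral (v : g.VolumeForm) (he : e ∈ atlas (Mdl n) M) (h : Fn (Mdl n) M)
    (h0 : ∀ x ∉ e.source, h x = 0) :
    ∫ x, h x ∂g.measure = ∫ y in e.target, g.chartDensity e y * h (e.symm y) := by
  rw [← setIntegral_eq_integral_of_forall_compl_eq_zero h0, g.measure_restrict_source he,
    chartMeasure, integral_map (aemeasurable_symm g e) h.contMDiff.continuous.aestronglyMeasurable,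
    integral_withDensity_eq_integral_toReal_smul₀]
  · refine setIntegral_congr_fun e.open_target.measurableSet fun y _ => ?_
    simp only [smul_eq_mul]
    rw [ENNReal.toReal_ofReal (show 0 ≤ g.chartDensity e y from Real.sqrt_nonneg _)]
  · refine AEMeasurable.ennreal_ofReal (ContinuousOn.aemeasurable ?_ e.open_target.measurableSet)
    refine ((continuousOn_chartDensity v he).comp e.continuousOn_symm
      fun y hy => e.map_target hy).congr fun y hy => ?_
    rw [Function.comp_apply, e.right_inv hy]
  · exact Filter.Eventually.of_forall fun _ => ENNReal.ofReal_lt_top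

/-- The integral of a partial derivative of a compactly supported function vanishes. -/
theorem integral_fderiv_eq_zero_of_hasCompactSupport {G : Mdl n → ℝ} (hG : ContDiff ℝ 1 G)
    (hc : HasCompactSupport G) (w : Mdl n) : ∫ y, fderiv ℝ G y w = 0 := by
  -- Integration by parts against the constant function 1.
  have h := integral_mul_fderiv_eq_neg_fderiv_mul_of_integrable (μ := (volume : Measure (Mdl n)))
    (f := fun _ => (1 : ℝ)) (g := G) (v := w) (by simp)
    (by
      simp only [one_mul]
      exact ((hG.continuous_fderiv one_ne_zero).clm_apply continuous_const).integrable_of_hasCompactSupport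
        (hc.fderiv_apply ℝ w))
    (by
      simp only [one_mul]
      exact hG.continuous.integrable_of_hasCompactSupport hc)
    (fun _ _ => differentiableAt_const _)
    (fun x _ => (hG.differentiable one_ne_zero) x)
  simpa using h

/-- Since K is compact inside the chart, the coordinate expression of F extends by zero to a C¹
function of compact support on the whole model space. -/
theorem integral_target_fderiv (he : e ∈ atlas (Mdl n) M) {K : Set M} (hK : IsCompact K)
    (hKe : K ⊆ e.source) {F : Fn (Mdl n) M} (hF : ∀ x ∉ K, F x = 0) (w : Mdl n) :
    IntegrableOn (fun y => fderiv ℝ (F ∘ e.symm) y w) e.target ∧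
      ∫ y in e.target, fderiv ℝ (F ∘ e.symm) y w = 0 := by
  classical
  let G : Mdl n → ℝ := e.target.indicator (F ∘ e.symm)
  have hK' : IsCompact (e '' K) := hK.image_of_continuousOn (e.continuousOn.mono hKe)
  have hG0 : ∀ y ∉ e '' K, G y = 0 := by
    intro y hy
    by_cases hyt : y ∈ e.target
    · rw [show G y = F (e.symm y) from Set.indicator_of_mem hyt _]
      exact hF _ fun h => hy ⟨_, h, e.right_inv hyt⟩
    · exact Set.indicator_of_notMem hyt _
  have hGt : ∀ y ∈ e.target, G =ᶠ[𝓝 y] F ∘ e.symm := fun y hy =>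
    (e.open_target.eventually_mem hy).mono fun z hz => Set.indicator_of_mem hz _
  have hGn : ∀ y ∉ e '' K, G =ᶠ[𝓝 y] fun _ => 0 := fun y hy =>
    (hK'.isClosed.isOpen_compl.eventually_mem hy).mono hG0
  have hsub : e '' K ⊆ e.target := fun y ⟨x, hx, hxy⟩ => hxy ▸ e.map_source (hKe hx)
  have hcd : ContDiff ℝ 1 G := by
    rw [contDiff_iff_contDiffAt]
    intro y
    by_cases hy : y ∈ e.target
    · refine ContDiffAt.congr_of_eventuallyEq ?_ (hGt y hy)
      rw [← contMDiffAt_iff_contDiffAt]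
      refine ((F.contMDiff (e.symm y)).comp y
        ((contMDiffOn_symm_of_mem he).contMDiffAt (e.open_target.mem_nhds hy))).of_le ?_
      exact WithTop.coe_le_coe.mpr (le_top : (1 : ℕ∞) ≤ ⊤)
    · exact contDiffAt_const.congr_of_eventuallyEq (hGn y fun h => hy (hsub h))
  have hGc : HasCompactSupport G := HasCompactSupport.intro hK' hG0
  refine ⟨IntegrableOn.congr_fun (f := fun y => fderiv ℝ G y w) ?_ (fun y hy => ?_)
    e.open_target.measurableSet, Eq.trans ?_ ((setIntegral_eq_integral_of_forall_compl_eq_zero (s := e.target) ?_).trans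
    (integral_fderiv_eq_zero_of_hasCompactSupport hcd hGc w))⟩
  · exact (((hcd.continuous_fderiv one_ne_zero).clm_apply
      continuous_const).integrable_of_hasCompactSupport (hGc.fderiv_apply ℝ w)).integrableOn
  · simp only [(hGt y hy).fderiv_eq]
  · refine setIntegral_congr_fun e.open_target.measurableSet fun y hy => ?_
    rw [(hGt y hy).fderiv_eq]
  · intro y hy
    rw [(hGn y fun h => hy (hsub h)).fderiv_eq]
    simp

end VolumeIntegral

/-! ### The exterior derivative on commuting fields -/

section ExtDerFrame

variable {A L : Type*} [CommRing A] [LieRing L] [Module A L] [LieRingModule L A]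
  [LieRinehartRing A L] [Algebra ℝ A] [LieAlgebra ℝ L] [LieRinehartAlgebra ℝ A L]

/-- The exterior derivative on a tuple of vector fields that commute at a point. -/
theorem ev_extDer (ev : A →ₐ[ℝ] ℝ) : ∀ {k : ℕ} (ψ : L [⋀^Fin k]→ₗ[A] A) (v : Fin (k + 1) → L)
    (_ : ∀ i j, ⁅v i, v j⁆ ∈ RingHom.ker ev • (⊤ : Submodule A L)),
    ev (extDer k ψ v) = ∑ i : Fin (k + 1), (-1) ^ (i : ℕ) * ev ⁅v i, ψ (i.removeNth v)⁆
  | 0, ψ, v, _ => by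
    rw [extDer_zero_apply, Fin.sum_univ_one, Subsingleton.elim (Fin.removeNth 0 v) ![]]
    simp
  | k + 1, ψ, v, h => by
    have h1 : extDer (k + 1) ψ v = (extDer (k + 1) ψ).curryLeft (v 0) (Fin.tail v) := by
      rw [AlternatingMap.curryLeft_apply_apply]
      exact congrArg _ (Fin.cons_self_tail v).symm
    have h2 := ev_extDer ev (ψ.curryLeft (v 0)) (Fin.tail v) fun i j => h i.succ j.succ
    have h3 : ∀ i : Fin (k + 1), ψ.curryLeft (v 0) (i.removeNth (Fin.tail v)) =
        ψ (i.succ.removeNth v) := by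
      intro i
      rw [AlternatingMap.curryLeft_apply_apply]
      congr 1
      ext j
      refine Fin.cases ?_ (fun j => ?_) j <;> simp [Fin.removeNth, Fin.tail]
    -- The bracket terms of the Lie derivative drop out, because forms are tensorial and the
    -- brackets vanish at the point.
    have h4 : ∑ i, ev (ψ (Function.update (Fin.tail v) i ⁅v 0, Fin.tail v i⁆)) = 0 :=
      Finset.sum_eq_zero fun i _ => ev_form_eq_zero_of_mem ev ψ _ i (by
        rw [Function.update_self]
        exact h 0 i.succ)
    rw [h1, extDer_succ_curryLeft, AlternatingMap.sub_apply, map_sub, h2, form_lie_apply, map_sub,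
      map_sum, h4,
      Fin.sum_univ_succ fun i : Fin (k + 1 + 1) => (-1 : ℝ) ^ (i : ℕ) * ev ⁅v i, ψ (i.removeNth v)⁆]
    simp only [h3, Fin.val_zero, pow_zero, one_mul, Fin.val_succ, pow_succ]
    have h5 : Fin.removeNth 0 v = Fin.tail v := rfl
    rw [h5, sub_zero, sub_eq_add_neg, ← Finset.sum_neg_distrib]
    congr 1
    refine Finset.sum_congr rfl fun i _ => ?_
    simp only [Fin.tail]
    ring

end ExtDerFrame

/-! ### Stokes' theorem in a chart -/

section Stokes

open scoped Topology
open MeasureTheory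

variable {n : ℕ} {M : Type*} [TopologicalSpace M] [T2Space M] [SecondCountableTopology M]
  [ChartedSpace (Mdl n) M] [IsManifold 𝓘(ℝ, Mdl n) ∞ M] {g : LorentzMetric n M}
  {e : OpenPartialHomeomorph M (Mdl n)}

/-- A smooth function that is locally constant near `K` and equal there to the sign of `f`. -/
theorem exists_smooth_sign {K U : Set M} (hK : IsClosed K) (hU : IsOpen U) (hKU : K ⊆ U)
    (f : Fn (Mdl n) M) (hf : ∀ x ∈ U, f x ≠ 0) :
    ∃ ε : Fn (Mdl n) M, ∀ x ∈ K, (∀ᶠ y in 𝓝 x, ε y = ε x) ∧ ε x * f x = |f x| := by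
  obtain ⟨χ, h1, h2⟩ := exists_cutoff (E := Mdl n) hK hU hKU
  -- The sign is locally constant where f has no zero, so multiplying it by a cutoff makes it
  -- globally smooth.
  have hs : ∀ x ∈ U, ∀ᶠ y in 𝓝 x, Real.sign (f y) = Real.sign (f x) := by
    intro x hx
    rcases lt_or_gt_of_ne (hf x hx) with h | h
    · filter_upwards [f.contMDiff.continuous.continuousAt.eventually_lt_const h] with y hy
      rw [Real.sign_of_neg hy, Real.sign_of_neg h]
    · filter_upwards [f.contMDiff.continuous.continuousAt.eventually_const_lt h] with y hy
      rw [Real.sign_of_pos hy, Real.sign_of_pos h]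
  refine ⟨⟨fun x => χ x * Real.sign (f x), contMDiff_of_tsupport fun x hx => ?_⟩, fun x hx => ?_⟩
  · have hx' := h2 (closure_mono (Function.support_mul_subset_left _ _) hx)
    refine ((χ.contMDiff x).mul (contMDiffAt_const (c := Real.sign (f x)))).congr_of_eventuallyEq ?_
    filter_upwards [hs x hx'] with y hy
    simp only [hy, Pi.mul_apply]
  · constructor
    · filter_upwards [h1 x hx, hs x (hKU hx)] with y hy hy'
      change χ y * Real.sign (f y) = χ x * Real.sign (f x)
      rw [hy, hy', (h1 x hx).self_of_nhds]
    · change χ x * Real.sign (f x) * f x = |f x|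
      rw [(h1 x hx).self_of_nhds, one_mul]
      rcases lt_or_gt_of_ne (hf x (hKU hx)) with h | h
      · rw [Real.sign_of_neg h, abs_of_neg h, neg_one_mul]
      · rw [Real.sign_of_pos h, abs_of_pos h, one_mul]

theorem VolumeForm.coeff_mul_vol (v : g.VolumeForm)
    (β : VF (Mdl n) M [⋀^Fin (n + 2)]→ₗ[Fn (Mdl n) M] Fn (Mdl n) M)
    (X : Fin (n + 2) → VF (Mdl n) M) (x : M) : v.coeff β x * v.vol X x = β X x := by
  have h := congrArg (fun γ => γ X x) ((isVolume v).smul_coeff β)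
  exact h

variable [MeasurableSpace M] [BorelSpace M]

/-- In the commuting coordinate frame dψ is a divergence, and the chart density turns its
coefficient into a sum of partial derivatives of compactly supported functions. No orientation of
the chart is assumed; the sign ε accounts for it. -/
theorem integral_extDer_of_chart (v : g.VolumeForm) (he : e ∈ atlas (Mdl n) M) {K : Set M}
    (hK : IsCompact K) (hKe : K ⊆ e.source)
    {ψ : VF (Mdl n) M [⋀^Fin (n + 1)]→ₗ[Fn (Mdl n) M] Fn (Mdl n) M} (h : VanishesOff K ψ) :
    ∫ x, v.coeff (extDer (n + 1) ψ) x ∂g.measure = 0 := by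
  obtain ⟨χ, h1, h2⟩ := exists_cutoff (E := Mdl n) hK.isClosed e.open_source hKe
  let X : Fin (n + 2) → VF (Mdl n) M := cutFrame he χ h2
  obtain ⟨ε, hε⟩ := exists_smooth_sign (K := K) (U := e.source ∩ {x | ∀ᶠ y in 𝓝 x, χ y = 1})
    hK.isClosed (e.open_source.inter isOpen_setOfPred_eventually_nhds)
    (fun x hx => ⟨hKe hx, h1 x hx⟩) (v.vol X)
    (fun x hx => vol_cutFrame_ne v he χ h2 hx.1 hx.2.self_of_nhds)
  let F : Fin (n + 2) → Fn (Mdl n) M := fun i => ψ (i.removeNth X)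
  have hF : ∀ i, ∀ x ∉ K, (ε * F i) x = 0 := by
    intro i x hx
    change ε x * F i x = 0
    rw [show F i x = 0 from h _ x hx, mul_zero]
  have hdv : VanishesOff K (extDer (n + 1) ψ) := h.extDer hK.isClosed
  have hc0 : ∀ x ∉ K, v.coeff (extDer (n + 1) ψ) x = 0 := fun x hx =>
    hdv.map_fn hK.isClosed v.coeff hx
  -- On K the density is ε vol(X) and coefficient times vol(X) is dψ(X); as ε is locally constant it
  -- moves inside the derivatives.
  have hkey : ∀ y ∈ e.target, g.chartDensity e y * v.coeff (extDer (n + 1) ψ) (e.symm y) =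
      ∑ i : Fin (n + 2), (-1) ^ (i : ℕ) *
        fderiv ℝ ((ε * F i : Fn (Mdl n) M) ∘ e.symm) y (EuclideanSpace.single i 1 : Mdl n) := by
    intro y hy
    obtain ⟨x, hx, rfl⟩ : ∃ x ∈ e.source, e x = y := ⟨e.symm y, e.map_target hy, e.right_inv hy⟩
    rw [e.left_inv hx]
    by_cases hxK : x ∈ K
    · have hχ1 := (h1 x hxK).self_of_nhds
      have hL : ∀ i, ⁅X i, ε * F i⁆ x =
          fderiv ℝ ((ε * F i : Fn (Mdl n) M) ∘ e.symm) (e x) (EuclideanSpace.single i 1 : Mdl n) := by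
        intro i
        have := lie_cutField_fn he χ h2 hx (EuclideanSpace.single i 1 : Mdl n) (ε * F i)
        rwa [hχ1, one_mul] at this
      have hL2 : ∀ i, ⁅X i, ε * F i⁆ x = ε x * ⁅X i, F i⁆ x := by
        intro i
        rw [LieRinehartRing.leibniz_mul_right]
        change ε x * ⁅X i, F i⁆ x + ⁅X i, ε⁆ x * F i x = _
        rw [(X i).lie_fn_of_eventually_const (hε x hxK).1, zero_mul, add_zero]
      have hd := ev_extDer (evalAt (Mdl n) x) ψ X fun i j => mem_ker_smul_top
        (EuclideanSpace.basisFun (Fin (n + 2)) ℝ).toBasis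
        (lie_cutField he χ h2 hx (h1 x hxK) _ _)
      rw [← abs_vol_cutFrame v he χ h2 hx hχ1, ← (hε x hxK).2, mul_assoc, mul_comm (v.vol X x),
        VolumeForm.coeff_mul_vol]
      rw [← evalAt_apply x (extDer (n + 1) ψ X), hd, Finset.mul_sum]
      refine Finset.sum_congr rfl fun i _ => ?_
      rw [← hL, hL2, evalAt_apply, mul_left_comm]
    · rw [hc0 x hxK, mul_zero]
      symm
      refine Finset.sum_eq_zero fun i _ => ?_
      -- Away from K the cutoff χ may vanish, so a second cutoff around x expresses the partial
      -- derivative as a vector field derivative, which is zero there.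
      obtain ⟨θ, h3, h4⟩ := exists_cutoff_point (E := Mdl n) (e.open_source.mem_nhds hx)
      have h5 := lie_cutField_fn he θ h4 hx (EuclideanSpace.single i 1 : Mdl n) (ε * F i)
      rw [h3.self_of_nhds, one_mul, VF.lie_fn_eq_zero_of_notMem hK.isClosed (hF i) _ hxK] at h5
      rw [← h5, mul_zero]
  rw [integral_eq_chart_integral v he _ fun x hx => hc0 x fun hxK => hx (hKe hxK),
    setIntegral_congr_fun e.open_target.measurableSet hkey, integral_finsetSum]
  · refine Finset.sum_eq_zero fun i _ => ?_
    rw [integral_const_mul, (integral_target_fderiv he hK hKe (hF i) _).2, mul_zero]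
  · exact fun i _ => (integral_target_fderiv he hK hKe (hF i) _).1.const_mul _

end Stokes

/-! ### Stokes' theorem on the manifold and the integral of series -/

section GlobalStokes

open scoped Topology
open MeasureTheory

variable {n : ℕ} {M : Type*} [TopologicalSpace M] [T2Space M] [SecondCountableTopology M]
  [ChartedSpace (Mdl n) M] [IsManifold 𝓘(ℝ, Mdl n) ∞ M] [MeasurableSpace M] [BorelSpace M]
  {g : LorentzMetric n M}

theorem smul_mem_cptForms (f : Fn (Mdl n) M) {k : ℕ}
    {ψ : VF (Mdl n) M [⋀^Fin k]→ₗ[Fn (Mdl n) M] Fn (Mdl n) M} (h : ψ ∈ cptForms n M k) :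
    f • ψ ∈ cptForms n M k := by
  obtain ⟨K, hK, h⟩ := h
  refine ⟨K, hK, fun X x hx => ?_⟩
  change f x * ψ X x = 0
  rw [h X x hx, mul_zero]

theorem integrable_coeff (v : g.VolumeForm)
    {β : VF (Mdl n) M [⋀^Fin (n + 2)]→ₗ[Fn (Mdl n) M] Fn (Mdl n) M} (h : β ∈ cptForms n M (n + 2)) :
    Integrable (fun x => v.coeff β x) g.measure := by
  obtain ⟨K, hK, h⟩ := h
  have := isFiniteMeasureOnCompacts_measure v
  exact (v.coeff β).contMDiff.continuous.integrable_of_hasCompactSupport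
    (HasCompactSupport.intro hK fun x hx => VanishesOff.map_fn hK.isClosed h v.coeff hx)

theorem integral_coeff_add (v : g.VolumeForm)
    {β γ : VF (Mdl n) M [⋀^Fin (n + 2)]→ₗ[Fn (Mdl n) M] Fn (Mdl n) M}
    (hβ : β ∈ cptForms n M (n + 2)) (hγ : γ ∈ cptForms n M (n + 2)) :
    ∫ x, v.coeff (β + γ) x ∂g.measure =
      ∫ x, v.coeff β x ∂g.measure + ∫ x, v.coeff γ x ∂g.measure := by
  rw [map_add]
  exact integral_add (integrable_coeff v hβ) (integrable_coeff v hγ)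

/-- **Stokes' theorem** for compactly supported forms. -/
theorem integral_extDer (v : g.VolumeForm)
    {ψ : VF (Mdl n) M [⋀^Fin (n + 1)]→ₗ[Fn (Mdl n) M] Fn (Mdl n) M}
    (h : ψ ∈ cptForms n M (n + 1)) : ∫ x, v.coeff (extDer (n + 1) ψ) x ∂g.measure = 0 := by
  -- Quantifying over all η lets good functions be combined, so compactness of K replaces a
  -- partition of unity.
  let good : Fn (Mdl n) M → Prop := fun f => ∀ η ∈ cptForms n M (n + 1),
    ∫ x, v.coeff (extDer (n + 1) (f • η)) x ∂g.measure = 0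
  have hS := isSupport_cptForms (n := n) (M := M)
  obtain ⟨K, hK, hψ⟩ := id h
  obtain ⟨f, hf1, hf⟩ : ∃ f : Fn (Mdl n) M, (∀ x ∈ K, f x = 1) ∧ good f := by
    refine hK.induction_on (p := fun S => ∃ f : Fn (Mdl n) M, (∀ x ∈ S, f x = 1) ∧ good f)
      ⟨0, fun _ hx => hx.elim, fun η _ => ?_⟩ (fun s t hst ⟨f, h1, h2⟩ =>
        ⟨f, fun x hx => h1 x (hst hx), h2⟩) ?_ ?_
    · rw [zero_smul, map_zero, map_zero]
      exact integral_zero _ _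
    · rintro s t ⟨f, hf1, hf⟩ ⟨f', hf1', hf'⟩
      -- This combination equals 1 wherever f or f' does, and is good because (1 - f)η is again an
      -- admissible form for f'.
      refine ⟨f + f' * (1 - f), fun x hx => ?_, fun η hη => ?_⟩
      · change f x + f' x * (1 - f x) = 1
        rcases hx with hx | hx
        · rw [hf1 x hx]
          ring
        · rw [hf1' x hx]
          ring
      · have h1 := smul_mem_cptForms (1 - f) hη
        rw [add_smul, mul_smul, map_add, integral_coeff_add v
          (hS.extDer_mem (smul_mem_cptForms f hη)) (hS.extDer_mem (smul_mem_cptForms f' h1)),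
          hf η hη, hf' _ h1, add_zero]
    · intro x _
      obtain ⟨f, h1, h2⟩ := exists_cutoff_point (E := Mdl n)
        ((chartAt (Mdl n) x).open_source.mem_nhds (mem_chart_source _ x))
      refine ⟨{y | f y = 1}, mem_nhdsWithin_of_mem_nhds h1, f, fun _ hy => hy, ?_⟩
      rintro η ⟨K', hK', hη⟩
      refine integral_extDer_of_chart v (chart_mem_atlas _ x) (hK'.inter_right (isClosed_tsupport f))
        (fun y hy => h2 hy.2) fun X y hy => ?_
      change f y * η X y = 0
      by_cases hyK : y ∈ K'
      · rw [image_eq_zero_of_notMem_tsupport fun hy' => hy ⟨hyK, hy'⟩, zero_mul]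
      · rw [hη X y hyK, mul_zero]
  have hfψ : f • ψ = ψ := by
    ext X x
    change f x * ψ X x = ψ X x
    by_cases hx : x ∈ K
    · rw [hf1 x hx, one_mul]
    · rw [hψ X x hx, mul_zero]
  rw [← hfψ]
  exact hf ψ h

/-- The complexified coefficient at a point. -/
noncomputable def coeffAt (v : g.VolumeForm) (x : M) :
    ℂ ⊗[ℝ] (VF (Mdl n) M [⋀^Fin (n + 2)]→ₗ[Fn (Mdl n) M] Fn (Mdl n) M) →ₗ[ℂ] ℂ :=
  LinearMap.liftBaseChange ℂ (N := ℂ)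
    { toFun := fun β => ((v.coeff β x : ℝ) : ℂ)
      map_add' := fun β γ => by rw [map_add]; exact Complex.ofReal_add _ _
      map_smul' := fun t β => by
        rw [LinearMap.map_smul_of_tower]
        exact Complex.ofReal_mul t _ }

theorem coeffAt_tmul (v : g.VolumeForm) (x : M) (z : ℂ)
    (β : VF (Mdl n) M [⋀^Fin (n + 2)]→ₗ[Fn (Mdl n) M] Fn (Mdl n) M) :
    coeffAt v x (z ⊗ₜ β) = z * (v.coeff β x : ℝ) := by
  rw [coeffAt, LinearMap.liftBaseChange_tmul]
  rfl

theorem integral_apply (v : g.VolumeForm)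
    (α : FPS (VF (Mdl n) M [⋀^Fin (n + 2)]→ₗ[Fn (Mdl n) M] Fn (Mdl n) M)) (m : ℕ) :
    v.integral α m = ∫ x, coeffAt v x (α m) ∂g.measure := rfl

theorem integrable_coeffAt (v : g.VolumeForm)
    {t : ℂ ⊗[ℝ] (VF (Mdl n) M [⋀^Fin (n + 2)]→ₗ[Fn (Mdl n) M] Fn (Mdl n) M)}
    (ht : t ∈ (cptForms n M (n + 2)).baseChange ℂ) :
    Integrable (fun x => coeffAt v x t) g.measure := by
  obtain ⟨t, rfl⟩ := ht
  induction t with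
  | zero =>
    simp only [map_zero]
    exact integrable_zero _ _ _
  | tmul z β =>
    refine (((integrable_coeff v β.2).ofReal (𝕜 := ℂ)).const_mul z).congr ?_
    exact Filter.Eventually.of_forall fun x => (coeffAt_tmul v x z β).symm
  | add t s ht hs =>
    simp only [map_add]
    exact ht.add hs

theorem integral_coeffAt_extDer (v : g.VolumeForm)
    {t : ℂ ⊗[ℝ] (VF (Mdl n) M [⋀^Fin (n + 1)]→ₗ[Fn (Mdl n) M] Fn (Mdl n) M)}
    (ht : t ∈ (cptForms n M (n + 1)).baseChange ℂ) :
    ∫ x, coeffAt v x ((extDer (n + 1)).baseChange ℂ t) ∂g.measure = 0 := by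
  obtain ⟨t, rfl⟩ := ht
  have hS := isSupport_cptForms (n := n) (M := M)
  have hmem : ∀ t, (extDer (n + 1)).baseChange ℂ ((cptForms n M (n + 1)).subtype.baseChange ℂ t) ∈
      (cptForms n M (n + 2)).baseChange ℂ := by
    intro t
    induction t with
    | zero =>
      simp only [map_zero]
      exact zero_mem _
    | tmul z β =>
      exact Submodule.tmul_mem_baseChange_of_mem z (hS.extDer_mem β.2)
    | add t s ht hs =>
      simp only [map_add]
      exact add_mem ht hs
  induction t with
  | zero =>
    simp only [map_zero]
    exact integral_zero _ _
  | tmul z β =>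
    simp only [LinearMap.baseChange_tmul, coeffAt_tmul]
    rw [integral_const_mul]
    refine mul_eq_zero_of_right z ((integral_ofReal (𝕜 := ℂ)).trans ?_)
    exact (congrArg _ (integral_extDer v β.2)).trans Complex.ofReal_zero
  | add t s ht hs =>
    simp only [map_add]
    rw [integral_add (integrable_coeffAt v (hmem t)) (integrable_coeffAt v (hmem s)), ht, hs,
      add_zero]

theorem isIntegration_integral (v : g.VolumeForm) :
    IsIntegration (cptForms n M) v.integral where
  add {u w} hu hw := by
    funext m
    rw [Pi.add_apply, integral_apply, integral_apply, integral_apply,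
      ← integral_add (integrable_coeffAt v (hu m)) (integrable_coeffAt v (hw m))]
    exact integral_congr_ae (Filter.Eventually.of_forall fun x => map_add (coeffAt v x) _ _)
  smul t u := by
    funext m
    rw [Pi.smul_apply, integral_apply, integral_apply, ← integral_smul]
    exact integral_congr_ae (Filter.Eventually.of_forall fun x => map_smul (coeffAt v x) _ _)
  stokes {u} hu := funext fun m => integral_coeffAt_extDer v (hu m)

end GlobalStokes

theorem mainTheorem5 {n : ℕ} {M : Type*} [TopologicalSpace M] [T2Space M]
    [SecondCountableTopology M] [ChartedSpace (Mdl n) M] [IsManifold 𝓘(ℝ, Mdl n) ∞ M]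
    [MeasurableSpace M] [BorelSpace M]
    (g : LorentzMetric n M) (v : g.VolumeForm)
    {𝔤 : Type*} [LieRing 𝔤] [LieAlgebra ℝ 𝔤]
    (T : BraidedYM v 𝔤)
    (hsymm : ∀ x y : 𝔤, T.Tr x y = T.Tr y x)
    (hnondeg : ∀ x : 𝔤, (∀ y, T.Tr x y = 0) → x = 0)
    (hinv : ∀ x y z : 𝔤, T.Tr ⁅x, z⁆ y + T.Tr z ⁅x, y⁆ = 0)
    (hkilling : ∀ ξ ∈ T.𝔨, g.IsKilling ξ)
    (a : FPS (GForm (Fn (Mdl n) M) (VF (Mdl n) M) 𝔤 1)) (ha : IsCpt a) :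
    T.action a = v.integral (T.data.ymDensity a).val ∧
    (∀ l : FPS (GForm (Fn (Mdl n) M) (VF (Mdl n) M) 𝔤 0),
      T.actionVar a l = 0 ∧ v.integral ((T.data.ymDensity a).var l) = 0) ∧
    (T.IsCompatible →
      T.action a = (1 / 2 : ℂ) • v.integral (T.data.ymTerm a).val
        + (1 / 24 : ℂ) • v.integral (T.data.quarticTerm a).val
        - (1 / 24 : ℂ) • v.integral (T.data.trS (show 2 + n = n + 2 by omega)
            (T.data.brS rfl a a) (T.data.hodS (show 2 + n = n + 2 by omega)
              (T.data.brS rfl a a)))) := by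
  have hF := hasFrames g
  have hv := isVolume v
  have hY : T.data.IsRegular :=
    { symm := hsymm
      inv := hinv
      hodge_lie := fun ξ hξ β => hv.lie_hodge hF (hkilling ξ hξ) _ β
      hodge_symm := fun α β => hv.wedge_hodge_symm hF _ α β }
  have hC := isSupport_cptForms (n := n) (M := M)
  have hH := hodgeLocal_cptForms T.data
  have hI := isIntegration_integral v
  have h1 : T.action a = v.integral (T.data.ymDensity a).val := hY.integral_mc_val hC hH hI ha
  have h2 : ∀ l, v.integral ((T.data.ymDensity a).var l) = 0 := fun l => by
    -- The density has zero variation before integration; homogeneity at t = 0 gives that the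
    -- integral of 0 is 0.
    have h0 := hI.smul 0 0
    rw [hY.ymDensity_var a l]
    rwa [zero_smul, zero_smul] at h0
  refine ⟨h1, fun l => ⟨(hY.integral_mc_var hC hH hI ha l).trans (h2 l), h2 l⟩, fun hT => ?_⟩
  rw [h1]
  exact hY.integral_ymDensity hC hH hI
    (fun x y hx hy => (hT.1 x y hx hy).1.trans (hT.1 x y hx hy).2) ha
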